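/- **Set-up.** Let $F_0$ be a nonarchimedean local field of characteristic $0$ with residue characteristic $\neq 2$, and let $F/F_0$ be a ramified quadratic extension with nontrivial automorphism $a\mapsto\bar a$ and uniformizers $\pi\in F$, $\pi_0\in F_0$ such that $\pi^2=\pi_0$; let $k$ be the residue field of $F$. Let $W^\flat$ be a nondegenerate $F/F_0$-hermitian space of dimension $n\ge 1$ with form $h$, let $W=W^\flat\oplus Fu$ (orthogonal sum), where $h(u,u)$ is a unit of $O_{F_0}$, and regard $\mathrm U(W^\flat)$ as the stabilizer of $u$ in $\mathrm U(W)$. The Hasse invariant of a hermitian space of dimension $m$ is $+1$ (the space is called split) if $(-1)^{m(m-1)/2}\det h$ is a norm from $F^\times$, and $-1$ otherwise; let $\varepsilon^\flat$ be the Hasse invariant of $W^\flat$. A vertex lattice of type $t$ in a hermitian space is an $O_F$-lattice $\Lambda$ with $\pi\Lambda^\vee\subseteq\Lambda\subseteq\Lambda^\vee$ and $\dim_k\Lambda^\vee/\Lambda=t$, where $\Lambda^\vee$ is the dual lattice; $\mathrm{Vert}^t$ denotes the set of these. Put $\mathbb N_n^{[t]}=\mathrm{Vert}^t(W^\flat)$,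 $\mathbb N_{n+1}^{[t]}=\mathrm{Vert}^t(W)$, and for $t\le s$ let $\mathbb N_m^{[s,t]}=\mathbb N_m^{[t,s]}$ $(m=n,n+1)$ be the set of pairs $(\Lambda_1,\Lambda_2)$ of vertex lattices of types $s$ and $t$ with $\Lambda_1\subseteq\Lambda_2$. The map $\Lambda^\flat\mapsto\Lambda^\flat\oplus\langle u\rangle$ sends $\mathbb N_n^{[t]}$ to $\mathbb N_{n+1}^{[t]}$. Stabilizers of vertex lattices of type $s$ in $W^\flat$ and in $W$ are denoted $K_n^{[s]}$ and $K_{n+1}^{[s]}$; the lattices are specified in each part, and $K_m^{[s,t]}=K_m^{[t,s]}=K_m^{[s]}\cap K_m^{[t]}$ unless specified otherwise. $K_n^{[s],\circ}$ is the kernel of $\det \bmod \pi$ on $K_n^{[s]}$. Fix Haar measures on $\mathrm U(W^\flat)$ and $\mathrm U(W)$ and put, with convolutions and volumes for these measures, $$\varphi_m^{[a,b]}=\mathrm{vol}(K_m^{[b]})^{-1}\,\mathbf 1_{K_m^{[a]}K_m^{[b]}}*\mathbf 1_{K_m^{[b]}K_m^{[a]}},$$ $$\varphi_{n+1}^{[a,b,c]}=\mathrm{vol}(K_{n+1}^{[c]})^{-1}\mathrm{vol}(K_{n+1}^{[b]})^{-2}\,\mathbf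 1_{K_{n+1}^{[a]}K_{n+1}^{[b]}}*\mathbf 1_{K_{n+1}^{[b]}K_{n+1}^{[c]}}*\mathbf 1_{K_{n+1}^{[c]}K_{n+1}^{[b]}}*\mathbf 1_{K_{n+1}^{[b]}K_{n+1}^{[a]}}.$$ An element $g=(g_1,g_2)\in G=\mathrm U(W^\flat)\times\mathrm U(W)$ is regular semisimple if the vectors $(g_1^{-1}g_2)^iu$, $0\le i\le n$, are linearly independent. For functions $f,f'$ on $G$ write $f\sim f'$ if for every regular semisimple $g$ the orbital integrals $\mathrm{Orb}(g,f)=\int_{\mathrm U(W^\flat)\times\mathrm U(W^\flat)}f(h_1^{-1}gh_2)\,dh_1dh_2$ and $\mathrm{Orb}(g,f')$ converge absolutely and are equal; here $\mathrm U(W^\flat)$ is embedded diagonally in $G$. **Claim.** All of the following hold. **(A)** Let $r=n$ if $n$ is even and $r=n-1$ if $n$ is odd, and let $0\le t\le r$ be even. (i) Let $\widehat{\mathbb N}_n^{[t]}$ be the fiber product of $\mathbb N_n^{[r]}\to\mathbb N_{n+1}^{[r]}\leftarrow\mathbb N_{n+1}^{[r,t]}$. As subsets of $\mathbb N_n^{[r]}\times\mathbb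 N_{n+1}^{[t]}$, via the injective maps $(\Lambda^\flat,\Lambda'\subseteq\Lambda)\mapsto(\Lambda^\flat,\Lambda)$ and $(\Lambda^\flat\subseteq\Lambda_1^\flat)\mapsto(\Lambda^\flat,\Lambda_1^\flat\oplus\langle u\rangle)$, one has $\widehat{\mathbb N}_n^{[t]}=\mathbb N_n^{[r,t]}$. Now let $\Lambda_0^\flat\in\mathrm{Vert}^r(W^\flat)$ and $\Lambda\in\mathrm{Vert}^t(W)$ with $\Lambda_0^\flat\oplus\langle u\rangle\subseteq\Lambda$, and let $K_n^{[r]},K_{n+1}^{[r]},K_{n+1}^{[t]},K_n^{[t]}$ be the stabilizers of $\Lambda_0^\flat$, $\Lambda_0^\flat\oplus\langle u\rangle$, $\Lambda$, $\Lambda\cap W^\flat$. (ii) $K_{n+1}^{[r]}K_{n+1}^{[t]}=K_n^{[r]}K_{n+1}^{[t]}$. (iii) $\mathrm{vol}(K_n^{[r,t]})^{-2}\mathbf 1_{K_n^{[r]}}\otimes\mathbf 1_{K_{n+1}^{[t]}}\sim\mathrm{vol}(K_n^{[t]})^{-2}\varphi_n^{[t,r]}\otimes\mathbf 1_{K_{n+1}^{[t]}}\sim\mathrm{vol}(K_n^{[r]})^{-2}\mathbf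 1_{K_n^{[r]}}\otimes\varphi_{n+1}^{[r,t]}$. **(B)** Let $n$ be odd and $W$ split. Let $\Lambda_0^\flat\in\mathrm{Vert}^{n-1}(W^\flat)$ and $\Lambda\in\mathrm{Vert}^{n+1}(W)$ with $\Lambda\subseteq\Lambda_0^\flat\oplus\langle u\rangle$, and let $K_n^{[n-1]},K_{n+1}^{[n-1]},K_{n+1}^{[n+1]}$ be the stabilizers of $\Lambda_0^\flat$, $\Lambda_0^\flat\oplus\langle u\rangle$, $\Lambda$. (i) $K_{n+1}^{[n-1,n+1]}$ is normal in $K_{n+1}^{[n-1]}$ with quotient isomorphic to $\mu_2(k)$, and the composition $K_n^{[n-1]}\to K_{n+1}^{[n-1]}\to\mu_2(k)$ is surjective with kernel $K_n^{[n-1],\circ}$. (ii) $K_n^{[n-1]}K_{n+1}^{[n+1]}=K_{n+1}^{[n-1]}K_{n+1}^{[n+1]}$. (iii) For every even $0\le t\le n+1$ and every $\Lambda^{[t]}\in\mathrm{Vert}^t(W)$ containing $\Lambda$, with stabilizer $K_{n+1}^{[t]}$: $\mathrm{vol}(K_n^{[n-1],\circ})^{-2}\mathbf 1_{K_n^{[n-1]}}\otimes\varphi_{n+1}^{[n+1,t]}\sim\mathrm{vol}(K_n^{[n-1]})^{-2}\mathbf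 1_{K_n^{[n-1]}}\otimes\varphi_{n+1}^{[n-1,n+1,t]}$. **(C)** Let $n$ be even and $0\le t\le n$ even. Let $\Lambda^\flat\in\mathrm{Vert}^t(W^\flat)$ and $\Lambda\in\mathrm{Vert}^n(W)$ with $\Lambda\subseteq\Lambda^\flat\oplus\langle u\rangle$, and let $K_n^{[t]},K_{n+1}^{[t]},K_{n+1}^{[n]}$ be the stabilizers of $\Lambda^\flat$, $\Lambda^\flat\oplus\langle u\rangle$, $\Lambda$. (i) If $t\le n-2$, then $\#\,K_n^{[t]}\backslash K_{n+1}^{[t]}/K_{n+1}^{[t,n]}$ is $2$ if $\varepsilon^\flat=+1$ and $1$ if $\varepsilon^\flat=-1$. (ii) If $\varepsilon^\flat=+1$ and $\Lambda=\Lambda_1^\flat\oplus\langle u\rangle$ with $\Lambda_1^\flat\in\mathrm{Vert}^n(W^\flat)$, $\Lambda_1^\flat\subseteq\Lambda^\flat$, and $K_n^{[n]}$ is the stabilizer of $\Lambda_1^\flat$, then $\mathrm{vol}(K_n^{[n]})^{-2}\varphi_n^{[n,t]}\otimes\mathbf 1_{K_{n+1}^{[n]}}\sim\mathrm{vol}(K_n^{[n,t]})^{-2}\mathbf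 1_{K_n^{[t]}\times K_{n+1}^{[n]}}$. If $\varepsilon^\flat=-1$, put $K_n^{[n,t]}=K_n^{[t]}\cap K_{n+1}^{[n]}$; then $\mathrm{vol}(K_n^{[t]})^{-2}\mathbf 1_{K_n^{[t]}}\otimes\varphi_{n+1}^{[t,n]}\sim\mathrm{vol}(K_n^{[n,t]})^{-2}\mathbf 1_{K_n^{[t]}\times K_{n+1}^{[n]}}$. **(D)** Let $n$ be odd, $W$ split and $0\le t\le n-1$ even. Define $\widehat{\mathbb N}_n^{[n-1,t]}=\{(\Lambda^\flat,\Lambda)\in\mathrm{Vert}^t(W^\flat)\times\mathrm{Vert}^{n+1}(W):\Lambda\subseteq\Lambda^\flat\oplus\langle u\rangle\}$ and $\mathbb N_n^{[n-1,t],\circ}=\{((\Lambda_1^\flat,\Lambda^\flat),\Lambda)\in\mathbb N_n^{[n-1,t]}\times\mathrm{Vert}^{n+1}(W):\Lambda\subseteq\Lambda_1^\flat\oplus\langle u\rangle\}$. (i) The map $((\Lambda_1^\flat,\Lambda^\flat),\Lambda)\mapsto(\Lambda^\flat,\Lambda)$ is a bijection $\mathbb N_n^{[n-1,t],\circ}\to\widehat{\mathbb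 N}_n^{[n-1,t]}$, and both sets are double coverings of $\mathbb N_n^{[n-1,t]}$: every fiber of $((\Lambda_1^\flat,\Lambda^\flat),\Lambda)\mapsto(\Lambda_1^\flat,\Lambda^\flat)$ on the first set, and every fiber on the second set of $(\Lambda^\flat,\Lambda)\mapsto(\Lambda_1^\flat,\Lambda^\flat)$ with $\Lambda+\langle u\rangle=\Lambda_1^\flat\oplus\langle u\rangle$, has exactly two elements. Now let $(\Lambda^\flat,\Lambda)\in\widehat{\mathbb N}_n^{[n-1,t]}$, and let $K_n^{[t]},K_{n+1}^{[t]},K_{n+1}^{[n+1]}$ be the stabilizers of $\Lambda^\flat$, $\Lambda^\flat\oplus\langle u\rangle$, $\Lambda$. (ii) $\#\,K_n^{[t]}\backslash K_{n+1}^{[t]}/K_{n+1}^{[t,n+1]}=1$ and $\#\,K_n^{[t],\circ}\backslash K_{n+1}^{[t]}/K_{n+1}^{[t,n+1]}=2$. (iii) If $\Lambda_1^\flat\in\mathrm{Vert}^{n-1}(W^\flat)$ with $\Lambda_1^\flat\subseteq\Lambda^\flat$ and $\Lambda\subseteq\Lambda_1^\flat\oplus\langle u\rangle$, and $K_n^{[n-1]},K_{n+1}^{[n-1]}$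 are the stabilizers of $\Lambda_1^\flat$, $\Lambda_1^\flat\oplus\langle u\rangle$, and $K_n^{[n-1,t],\circ}=K_n^{[n-1],\circ}\cap K_n^{[t]}$, then $$\mathrm{vol}(K_n^{[n-1,t],\circ})^{-2}\mathbf 1_{K_n^{[t]}}\otimes\mathbf 1_{K_{n+1}^{[n+1]}}\sim\mathrm{vol}(K_n^{[t]})^{-2}\mathbf 1_{K_n^{[t]}}\otimes\varphi_{n+1}^{[t,n+1]}\sim\mathrm{vol}(K_n^{[n-1]})^{-2}\varphi_n^{[n-1,t]}\otimes\varphi_{n+1}^{[n-1,n+1]}.$$ -/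

import Mathlib

open scoped Pointwise ValuativeRel
open MeasureTheory ValuativeRel

noncomputable section

namespace LatticeModel

/-! ### Hermitian spaces

`F` is a nonarchimedean local field, `σ` an involution of `F`, and a hermitian form on the
`F`-vector space `V` is a map `h : V →ₛₗ[σ] V →ₗ[F] F` with `h.IsSymm`. -/

section Hermitian

variable {F : Type*} [Field F] {σ : F →+* F} {V : Type*} [AddCommGroup V] [Module F V]

/-- The orthogonal sum `V ⊕ F u` of a hermitian space `(V, h)` and a line spanned by a vector
`u = (0, 1)` of length `h(u, u) = c`. -/
def extForm (h : V →ₛₗ[σ] V →ₗ[F] F) (c : F) : (V × F) →ₛₗ[σ] (V × F) →ₗ[F] F :=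
  LinearMap.mk₂'ₛₗ σ (RingHom.id F) (fun x y => h x.1 y.1 + c * σ x.2 * y.2)
    (fun x x' y => by simp; ring) (fun a x y => by simp; ring)
    (fun x y y' => by simp; ring) (fun a x y => by simp; ring)

/-- The special vector `u` of `V ⊕ F u`. -/
def specialVec (F V : Type*) [Field F] [AddCommGroup V] [Module F V] : V × F := (0, 1)

open Classical in
/-- The Hasse invariant of a hermitian space of dimension `n`: it is `1` if
`(-1) ^ (n (n - 1) / 2) * det (h (b i) (b j))` is a norm from `Fˣ` for a basis `b`
(the class modulo norms does not depend on `b`), and `-1` otherwise. -/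
def hasse (h : V →ₛₗ[σ] V →ₗ[F] F) : ℤ :=
  if ∃ (b : Module.Basis (Fin (Module.finrank F V)) F V) (x : F), x ≠ 0 ∧
      (-1) ^ (Module.finrank F V * (Module.finrank F V - 1) / 2) *
        (Matrix.of fun i j => h (b i) (b j)).det = x * σ x
  then 1 else -1

/-- The unitary group `U(V, h)`. -/
def unitaryGroup (h : V →ₛₗ[σ] V →ₗ[F] F) : Subgroup (V ≃ₗ[F] V) where
  carrier := {g | ∀ x y, h (g x) (g y) = h x y}
  mul_mem' := by
    intro a b ha hb x y
    simp only [Set.mem_ofPred_eq, LinearEquiv.mul_apply] at *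
    rw [ha, hb]
  one_mem' := fun _ _ => rfl
  inv_mem' := by
    intro a ha x y
    have := ha (a⁻¹ x) (a⁻¹ y)
    rw [← this, ← LinearEquiv.mul_apply, ← LinearEquiv.mul_apply, mul_inv_cancel]
    rfl

/-- The embedding `U(V) → U(V ⊕ F u)`, where `U(V)` acts trivially on `u`. -/
def embed (h : V →ₛₗ[σ] V →ₗ[F] F) (c : F) :
    unitaryGroup h →* unitaryGroup (extForm h c) where
  toFun g := ⟨(g : V ≃ₗ[F] V).prodCongr (LinearEquiv.refl F F), fun x y => by
    change h ((g : V ≃ₗ[F] V) x.1) ((g : V ≃ₗ[F] V) y.1) + c * σ x.2 * y.2 =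
      h x.1 y.1 + c * σ x.2 * y.2
    rw [g.2]⟩
  map_one' := rfl
  map_mul' _ _ := rfl

end Hermitian

/-! ### Topology and measurable structure of the unitary group -/

section Topology

variable {F : Type*} [Field F] [TopologicalSpace F] {σ : F →+* F}
  {V : Type*} [AddCommGroup V] [Module F V]

/-- The `F`-adic topology: the coarsest one for which all matrix coefficients `g ↦ ℓ (g v)`
are continuous. -/
instance (h : V →ₛₗ[σ] V →ₗ[F] F) : TopologicalSpace (unitaryGroup h) :=
  TopologicalSpace.induced
    (fun g (p : V × Module.Dual F V) => p.2 ((g : V ≃ₗ[F] V) p.1)) inferInstance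

instance (h : V →ₛₗ[σ] V →ₗ[F] F) : MeasurableSpace (unitaryGroup h) := borel _

instance (h : V →ₛₗ[σ] V →ₗ[F] F) : BorelSpace (unitaryGroup h) := ⟨rfl⟩

end Topology

/-! ### Vertex lattices and their stabilizers -/

section Lattices

variable {F : Type*} [Field F] [ValuativeRel F] {σ : F →+* F}
  {V : Type*} [AddCommGroup V] [Module F V]

/-- The dual lattice of all `v` such that `h(x, v)` is integral for all `x ∈ L`. -/
def dualLattice (h : V →ₛₗ[σ] V →ₗ[F] F) (L : Submodule 𝒪[F] V) : Submodule 𝒪[F] V where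
  carrier := {v | ∀ x ∈ L, h x v ∈ 𝒪[F]}
  add_mem' := by
    intro a b ha hb x hx
    rw [map_add]
    exact add_mem (ha x hx) (hb x hx)
  zero_mem' := by
    intro x _
    rw [map_zero]
    exact zero_mem _
  smul_mem' := by
    intro a v hv x hx
    have : h x (a • v) = (a : F) * h x v := by
      rw [show a • v = (a : F) • v from rfl, map_smul, smul_eq_mul]
    change h x (a • v) ∈ 𝒪[F]
    rw [this]
    exact mul_mem a.2 (hv x hx)

/-- `L` is a vertex lattice of type `t`: an `O_F`-lattice with `π L^∨ ⊆ L ⊆ L^∨` such that the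
dimension over the residue field of `L^∨ / L`, i.e. its length as an `O_F`-module, is `t`. -/
structure IsVertexLattice (h : V →ₛₗ[σ] V →ₗ[F] F) (t : ℕ) (L : Submodule 𝒪[F] V) : Prop where
  isLattice : L.IsLattice F
  maximalIdeal_smul_dual_le : 𝓂[F] • dualLattice h L ≤ L
  le_dual : L ≤ dualLattice h L
  length_eq : Module.length 𝒪[F] (dualLattice h L ⧸ L.submoduleOf (dualLattice h L)) = t

/-- The set `Vert^t(V)` of vertex lattices of type `t`. -/
def Vert (h : V →ₛₗ[σ] V →ₗ[F] F) (t : ℕ) : Set (Submodule 𝒪[F] V) :=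
  {L | IsVertexLattice h t L}

/-- For `t ≤ s`, the set `ℕ^{[s,t]}(V)` of pairs of vertex lattices of types `s` and `t`, the
first one included in the second one. -/
def VertPair (h : V →ₛₗ[σ] V →ₗ[F] F) (s t : ℕ) :
    Set (Submodule 𝒪[F] V × Submodule 𝒪[F] V) :=
  {p | p.1 ∈ Vert h s ∧ p.2 ∈ Vert h t ∧ p.1 ≤ p.2}

/-- The lattice `⟨u⟩ = O_F u` in `V ⊕ F u`. -/
def specialLine (F V : Type*) [Field F] [ValuativeRel F] [AddCommGroup V] [Module F V] :
    Submodule 𝒪[F] (V × F) :=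
  Submodule.span 𝒪[F] {specialVec F V}

/-- The lattice `L ⊕ ⟨u⟩` in `V ⊕ F u`. -/
def addLine (L : Submodule 𝒪[F] V) : Submodule 𝒪[F] (V × F) :=
  L.map (LinearMap.inl 𝒪[F] V F) ⊔ specialLine F V

/-- The intersection `Λ ∩ V` of a lattice `Λ` in `V ⊕ F u` with `V = u^⊥`. -/
def flatPart (L : Submodule 𝒪[F] (V × F)) : Submodule 𝒪[F] V :=
  L.comap (LinearMap.inl 𝒪[F] V F)

/-- The stabilizer in `U(V)` of a lattice `L`. -/
def stab (h : V →ₛₗ[σ] V →ₗ[F] F) (L : Submodule 𝒪[F] V) : Subgroup (unitaryGroup h) where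
  carrier := {g | ∀ v, (g : V ≃ₗ[F] V) v ∈ L ↔ v ∈ L}
  mul_mem' := by
    intro a b ha hb v
    exact (ha ((b : V ≃ₗ[F] V) v)).trans (hb v)
  one_mem' := fun _ => Iff.rfl
  inv_mem' := by
    intro a ha v
    have h1 := ha (((a⁻¹ : unitaryGroup h) : V ≃ₗ[F] V) v)
    have h2 : (a : V ≃ₗ[F] V) (((a⁻¹ : unitaryGroup h) : V ≃ₗ[F] V) v) = v := by
      rw [← LinearEquiv.mul_apply, ← Subgroup.coe_mul, mul_inv_cancel]
      rfl
    rw [h2] at h1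
    exact h1.symm

/-- The kernel of `det mod π` on the stabilizer of `L`. -/
def stabDet (h : V →ₛₗ[σ] V →ₗ[F] F) (L : Submodule 𝒪[F] V) : Subgroup (unitaryGroup h) where
  carrier := {g | g ∈ stab h L ∧
    valuation F ((LinearEquiv.det (g : V ≃ₗ[F] V) : F) - 1) < 1}
  mul_mem' := by
    rintro a b ⟨ha, ha'⟩ ⟨hb, hb'⟩
    refine ⟨mul_mem ha hb, ?_⟩
    rw [Subgroup.coe_mul, map_mul, Units.val_mul]
    set x : F := (LinearEquiv.det (a : V ≃ₗ[F] V) : F)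
    set y : F := (LinearEquiv.det (b : V ≃ₗ[F] V) : F)
    have hx : valuation F x = 1 := by
      have := (valuation F).map_one_add_of_lt ha'
      simpa using this
    have : x * y - 1 = x * (y - 1) + (x - 1) := by ring
    rw [this]
    refine (valuation F).map_add_lt ?_ ha'
    rw [map_mul, hx, one_mul]
    exact hb'
  one_mem' := ⟨one_mem _, by simp⟩
  inv_mem' := by
    rintro a ⟨ha, ha'⟩
    refine ⟨inv_mem ha, ?_⟩
    rw [Subgroup.coe_inv, map_inv]
    set x : Fˣ := LinearEquiv.det (a : V ≃ₗ[F] V)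
    have hx : valuation F (x : F) = 1 := by
      have := (valuation F).map_one_add_of_lt ha'
      simpa using this
    have : ((x⁻¹ : Fˣ) : F) - 1 = (x : F)⁻¹ * (-((x : F) - 1)) := by
      rw [Units.val_inv_eq_inv_val]
      field_simp
      ring
    rw [this, map_mul, map_inv₀, hx, Valuation.map_neg]
    simpa using ha'

theorem mem_addLine {L : Submodule 𝒪[F] V} {p : V × F} :
    p ∈ addLine L ↔ p.1 ∈ L ∧ p.2 ∈ 𝒪[F] := by
  constructor
  · intro hp
    obtain ⟨y, hy, z, hz, rfl⟩ := Submodule.mem_sup.1 hp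
    obtain ⟨v, hv, rfl⟩ := hy
    obtain ⟨a, rfl⟩ := Submodule.mem_span_singleton.1 hz
    refine ⟨?_, ?_⟩
    · simpa [specialVec] using hv
    · have : (a • (1 : F)) = (a : F) := by
        rw [show a • (1 : F) = (a : F) * 1 from rfl, mul_one]
      simp only [specialVec, LinearMap.inl_apply, Prod.smul_mk, Prod.mk_add_mk, zero_add, this]
      exact a.2
  · rintro ⟨h1, h2⟩
    refine Submodule.mem_sup.2 ⟨(p.1, 0), ⟨p.1, h1, rfl⟩, (0, p.2), ?_, by simp⟩
    refine Submodule.mem_span_singleton.2 ⟨⟨p.2, h2⟩, ?_⟩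
    ext
    · simp [specialVec]
    · change p.2 * 1 = p.2
      rw [mul_one]

/-- The inclusion of the stabilizer of `L` in `U(V)` into the stabilizer of `L ⊕ ⟨u⟩` in
`U(V ⊕ F u)`. -/
def stabEmbed (h : V →ₛₗ[σ] V →ₗ[F] F) (c : F) (L : Submodule 𝒪[F] V) :
    stab h L →* stab (extForm h c) (addLine L) :=
  ((embed h c).comp (stab h L).subtype).codRestrict _ (fun g v => by
    rw [mem_addLine, mem_addLine]
    exact and_congr (g.2 v.1) Iff.rfl)

end Lattices

/-! ### Hecke functions and orbital integrals -/

section Hecke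

variable {G : Type*} [Group G] [MeasurableSpace G]

/-- The volume of a subgroup. -/
def vol (μ : Measure G) (K : Subgroup G) : ℂ := (μ.real (K : Set G) : ℂ)

/-- The characteristic function of a set. -/
def ind (S : Set G) : G → ℂ := S.indicator 1

/-- The convolution `(f * f')(g) = ∫ f(x) f'(x⁻¹ g) dx`. -/
def conv (μ : Measure G) (f f' : G → ℂ) : G → ℂ := fun g => ∫ x, f x * f' (x⁻¹ * g) ∂μ

/-- The Hecke function `vol(B)⁻¹ • 1_{AB} * 1_{BA}`. -/
def hecke (μ : Measure G) (A B : Subgroup G) : G → ℂ :=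
  (vol μ B)⁻¹ • conv μ (ind ((A : Set G) * (B : Set G))) (ind ((B : Set G) * (A : Set G)))

/-- The Hecke function `vol(C)⁻¹ vol(B)⁻² • 1_{AB} * 1_{BC} * 1_{CB} * 1_{BA}`. -/
def hecke₃ (μ : Measure G) (A B C : Subgroup G) : G → ℂ :=
  ((vol μ C)⁻¹ * ((vol μ B) ^ 2)⁻¹) •
    conv μ (conv μ (conv μ (ind ((A : Set G) * (B : Set G))) (ind ((B : Set G) * (C : Set G))))
      (ind ((C : Set G) * (B : Set G)))) (ind ((B : Set G) * (A : Set G)))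

/-- The function `(f ⊗ f')(g₁, g₂) = f(g₁) f'(g₂)`. -/
def tensor {G' : Type*} (f : G → ℂ) (f' : G' → ℂ) : G × G' → ℂ := fun g => f g.1 * f' g.2

end Hecke

section Orbital

variable {F : Type*} [Field F] {σ : F →+* F} {V : Type*} [AddCommGroup V] [Module F V]

/-- `(g₁, g₂) ∈ U(V) × U(V ⊕ F u)` is regular semisimple for the two-sided action of `U(V)` if the
vectors `γ ^ i u`, `0 ≤ i ≤ dim V`, are linearly independent, where `γ = g₁⁻¹ g₂`. -/
def IsRegularSemisimple (h : V →ₛₗ[σ] V →ₗ[F] F) (c : F)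
    (g : unitaryGroup h × unitaryGroup (extForm h c)) : Prop :=
  LinearIndependent F (fun i : Fin (Module.finrank F V + 1) =>
    ((((embed h c g.1)⁻¹ * g.2) ^ (i : ℕ) : unitaryGroup (extForm h c)) :
      (V × F) ≃ₗ[F] (V × F)) (specialVec F V))

/-- The integrand `(h₁, h₂) ↦ f(h₁⁻¹ g h₂)` of the orbital integral. -/
def orbIntegrand (h : V →ₛₗ[σ] V →ₗ[F] F) (c : F)
    (g : unitaryGroup h × unitaryGroup (extForm h c))
    (f : unitaryGroup h × unitaryGroup (extForm h c) → ℂ) :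
    unitaryGroup h × unitaryGroup h → ℂ :=
  fun p => f (p.1⁻¹ * g.1 * p.2, (embed h c p.1)⁻¹ * g.2 * embed h c p.2)

variable [TopologicalSpace F]

/-- The orbital integral `∫_{H × H} f(h₁⁻¹ g h₂) dh₁ dh₂`, where `H = U(V)`. -/
def orb (h : V →ₛₗ[σ] V →ₗ[F] F) (c : F) (μ : Measure (unitaryGroup h))
    (g : unitaryGroup h × unitaryGroup (extForm h c))
    (f : unitaryGroup h × unitaryGroup (extForm h c) → ℂ) : ℂ :=
  ∫ p, orbIntegrand h c g f p ∂(μ.prod μ)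

/-- `f` and `f'` have identical regular semisimple orbital integrals: at every regular semisimple
element both orbital integrals converge and they have the same value. -/
def SameOrb (h : V →ₛₗ[σ] V →ₗ[F] F) (c : F) (μ : Measure (unitaryGroup h))
    (f f' : unitaryGroup h × unitaryGroup (extForm h c) → ℂ) : Prop :=
  ∀ g, IsRegularSemisimple h c g →
    Integrable (orbIntegrand h c g f) (μ.prod μ) ∧
    Integrable (orbIntegrand h c g f') (μ.prod μ) ∧
    orb h c μ g f = orb h c μ g f'

end Orbital

/-! ### Lattice models of the correspondences -/

section Models

variable {F : Type*} [Field F] [ValuativeRel F] {σ : F →+* F}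
  {V : Type*} [AddCommGroup V] [Module F V]

/-- The fiber product of `Vert^r(V) → Vert^r(V ⊕ F u)`, `Λ ↦ Λ ⊕ ⟨u⟩`, and the projection
`ℕ^{[r,t]}(V ⊕ F u) → Vert^r(V ⊕ F u)`. -/
def hatN (h : V →ₛₗ[σ] V →ₗ[F] F) (c : F) (r t : ℕ) :
    Set (Submodule 𝒪[F] V × (Submodule 𝒪[F] (V × F) × Submodule 𝒪[F] (V × F))) :=
  {x | x.1 ∈ Vert h r ∧ x.2 ∈ VertPair (extForm h c) r t ∧ addLine x.1 = x.2.1}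

/-- For `s ≥ t`, the big correspondence: pairs `(Λ♭, Λ)` in `Vert^t(V) × Vert^s(V ⊕ F u)`
with `Λ ⊆ Λ♭ ⊕ ⟨u⟩`. -/
def bigN (h : V →ₛₗ[σ] V →ₗ[F] F) (c : F) (t s : ℕ) :
    Set (Submodule 𝒪[F] V × Submodule 𝒪[F] (V × F)) :=
  {x | x.1 ∈ Vert h t ∧ x.2 ∈ Vert (extForm h c) s ∧ x.2 ≤ addLine x.1}

/-- For `t ≤ r ≤ s`, the small correspondence: the fiber product over `Vert^r(V ⊕ F u)` of
`ℕ^{[r,t]}(V)` and `ℕ^{[s,r]}(V ⊕ F u)`, that is, pairs `((Λ₁♭, Λ♭), Λ)` in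
`ℕ^{[r,t]}(V) × Vert^s(V ⊕ F u)` with `Λ ⊆ Λ₁♭ ⊕ ⟨u⟩`. -/
def circN (h : V →ₛₗ[σ] V →ₗ[F] F) (c : F) (r t s : ℕ) :
    Set ((Submodule 𝒪[F] V × Submodule 𝒪[F] V) × Submodule 𝒪[F] (V × F)) :=
  {x | x.1 ∈ VertPair h r t ∧ x.2 ∈ Vert (extForm h c) s ∧ x.2 ≤ addLine x.1.1}

/-- The number of double cosets `A \ B / C`, where `A` and `C` are subgroups of `B`. -/
def numDoubleCosets {G : Type*} [Group G] (A B C : Subgroup G) : ℕ :=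
  Nat.card (DoubleCoset.Quotient (A.subgroupOf B : Set B) (C.subgroupOf B : Set B))

end Models

end LatticeModel

end

open LatticeModel

/-! All the identities of orbital integrals come from one translation principle. The integrand of
the orbital integral of `1_K ⊗ φ` is right invariant under `D × D` for a compact open subgroup `D`.
If `D ≤ A`, replacing it by the sum of its translates over representatives of `A / D` in both
variables leaves the integral unchanged once it is divided by `vol(A)²` instead of `vol(D)²`
(`integral_sum_translates`, `IsRamified.sameOrb_of_translates`). A Hecke function `vol(B)⁻¹ 1_{AB} *
1_{BA}` is itself the sum of the two-sided translates of `1_B` over representatives of `AB / B`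
(`hecke_apply`, `hecke₃_apply`). When those representatives can be taken in `U(V)`, the sum of
translates is a tensor product with a Hecke function in one factor, provided the other factor is
invariant under the averaging group. Convergence is a finiteness statement: at a regular semisimple
element the vectors `γ^i u`, scaled by a fixed power of a uniformizer, span a lattice contained in
every lattice that contributes, and only finitely many images of a given lattice contain another one
(`IsRamified.finite_images`, `IsRamified.finite_support`).

What remains are factorizations `A' B = A B` with `A ≤ U(V)`, that is, transitivity of stabilizers
in `U(V)` on vertex lattices of `V ⊕ F u`. As `σ` is trivial on the residue field, the form reduces
to a nondegenerate symmetric form on `L / π L^∨`, and vertex lattices `N ≤ L` correspond to the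
totally isotropic subspaces `π N^∨ / π L^∨`. The residue characteristic is odd, so reflections give
a Witt theorem by integral isometries (`IsRamified.exists_stab_map_eq`). A vertex lattice containing
`u` splits off `⟨u⟩`. One not containing `u` is first enlarged by `u` and then recovered from a
vector `(w, 1)` with `h(w, w) = -c` modulo `π`, so all of them with the same type below a given `M ⊕
⟨u⟩` are conjugate under the stabilizer of `M` (`IsRamified.exists_embed_map_eq`).

In maximal type `π Λ^∨ = Λ`, and the form divided by `π` reduces to a symplectic form. Hence the
stabilizer has determinant `1` modulo `π` (`IsRamified.det_sub_one_lt`) and the discriminant is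
trivial (`IsRamified.hasse_eq_one_of_vert`). In a split space of even dimension, a vertex lattice of
type two less has a hyperbolic plane as reduction, so exactly two lattices of maximal type lie below
it (`IsRamified.exists_isotropic`, `IsRamified.exists_eq_pair`). Isometries of determinant `-1` swap
them, which explains the double coverings, the index two subgroups and the kernel of `det mod π`. -/

/-! ### Ramified involutions -/

section Ramified

/-- `σ` is the nontrivial automorphism of a tamely ramified quadratic extension with odd residue
characteristic and `π` is a uniformizer with `σ π = -π`. -/
structure IsRamified {F : Type*} [Field F] [ValuativeRel F] (σ : F →+* F) (π : F) : Prop where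
  invol : ∀ x, σ (σ x) = x
  val_map : ∀ x, valuation F (σ x) = valuation F x
  map_sub_lt : ∀ x, valuation F x ≤ 1 → valuation F (σ x - x) < 1
  map_unif : σ π = -π
  val_two : valuation F (2 : F) = 1
  unif_ne : π ≠ 0
  unif_lt : valuation F π < 1
  le_unif : ∀ x, valuation F x < 1 → valuation F x ≤ valuation F π

variable {F : Type*} [Field F] [ValuativeRel F]

theorem valuation_le_unif_of_irreducible [TopologicalSpace F] [IsNonarchimedeanLocalField F]
    {π : 𝒪[F]} (hπ : Irreducible π) {x : F} (hx : valuation F x < 1) :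
    ∃ y : 𝒪[F], x = π * y := by
  have hm : (⟨x, hx.le⟩ : 𝒪[F]) ∈ 𝓂[F] := by
    rw [IsLocalRing.mem_maximalIdeal, mem_nonunits_iff, Valuation.Integer.not_isUnit_iff_valuation_lt_one]
    exact hx
  rw [(IsDiscreteValuationRing.irreducible_iff_uniformizer π).1 hπ,
    Ideal.mem_span_singleton] at hm
  obtain ⟨y, hy⟩ := hm
  exact ⟨y, congrArg Subtype.val hy⟩

theorem valuation_lt_one_of_irreducible {π : 𝒪[F]} (hπ : Irreducible π) :
    valuation F (π : F) < 1 :=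
  Valuation.Integer.not_isUnit_iff_valuation_lt_one.1 hπ.not_isUnit

theorem valuation_unit (x : 𝒪[F]ˣ) : valuation F ((x : 𝒪[F]) : F) = 1 :=
  ((Valuation.integer.integers (valuation F)).isUnit_iff_valuation_eq_one).1 x.isUnit

variable {F₀ : Type*} [Field F₀] [ValuativeRel F₀] [Algebra F₀ F] [ValuativeExtension F₀ F]

theorem valuation_algebraMap_le_iff (a b : F₀) :
    valuation F (algebraMap F₀ F a) ≤ valuation F (algebraMap F₀ F b) ↔
      valuation F₀ a ≤ valuation F₀ b := by
  rw [← (valuation F).vle_iff_le, ← (valuation F₀).vle_iff_le, ValuativeExtension.vle_iff_vle]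

theorem valuation_algebraMap_eq_iff (a b : F₀) :
    valuation F (algebraMap F₀ F a) = valuation F (algebraMap F₀ F b) ↔
      valuation F₀ a = valuation F₀ b := by
  rw [le_antisymm_iff, le_antisymm_iff, valuation_algebraMap_le_iff, valuation_algebraMap_le_iff]

variable [TopologicalSpace F₀] [IsNonarchimedeanLocalField F₀]

/-- Ramification: elements of `F₀` have even valuation in `F`, whereas `π` has odd valuation.
Squaring an equality would give `a / b` in the maximal ideal of `F₀` whose square has the valuation
of `π₀`, although `π₀` divides `a / b`. -/
theorem valuation_algebraMap_ne_mul {π₀ : 𝒪[F₀]} (hπ₀ : Irreducible π₀) {π : F}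
    (hππ₀ : π ^ 2 = algebraMap F₀ F (π₀ : F₀)) {a b : F₀} (hb : b ≠ 0) :
    valuation F (algebraMap F₀ F a) ≠ valuation F (algebraMap F₀ F b * π) := by
  intro hab
  have h1 : valuation F₀ ((a / b) ^ 2) = valuation F₀ (π₀ : F₀) := by
    have h2 : valuation F (algebraMap F₀ F (a ^ 2)) =
        valuation F (algebraMap F₀ F (b ^ 2 * π₀)) := by
      rw [map_pow, map_pow, hab, map_mul (algebraMap F₀ F), map_pow (algebraMap F₀ F), ← hππ₀,
        ← mul_pow, map_pow]
    rw [valuation_algebraMap_eq_iff] at h2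
    have hb' : valuation F₀ b ≠ 0 := by simpa using hb
    rw [div_pow, map_div₀, h2, map_mul, map_pow]
    field_simp
  have hlt := valuation_lt_one_of_irreducible hπ₀
  have h3 : valuation F₀ (a / b) < 1 := by
    rw [← h1, map_pow] at hlt
    by_contra hcon
    exact absurd hlt (not_lt.2 (one_le_pow₀ (not_lt.1 hcon)))
  obtain ⟨y, hy⟩ := valuation_le_unif_of_irreducible hπ₀ h3
  have hne : valuation F₀ (π₀ : F₀) ≠ 0 := by
    simpa using fun h0 => hπ₀.ne_zero (Subtype.ext h0)
  rw [hy, mul_pow, pow_two, mul_assoc, map_mul, mul_eq_left₀ hne, map_mul, map_pow] at h1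
  have h4 : valuation F₀ (y : F₀) ^ 2 ≤ 1 := pow_le_one₀ zero_le y.2
  have h5 : valuation F₀ (π₀ : F₀) * valuation F₀ (y : F₀) ^ 2 < 1 :=
    (mul_le_of_le_one_right' h4).trans_lt hlt
  exact absurd h1 h5.ne

variable [TopologicalSpace F] [IsNonarchimedeanLocalField F]

theorem isRamified_of_quadratic (h2 : (2 : 𝓀[F₀]) ≠ 0) (hquad : Module.finrank F₀ F = 2)
    {π₀ : 𝒪[F₀]} (hπ₀ : Irreducible π₀) {π : 𝒪[F]} (hπ : Irreducible π)
    (hππ₀ : (π : F) ^ 2 = algebraMap F₀ F (π₀ : F₀))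
    {σ : F ≃ₐ[F₀] F} (hσ : σ ≠ AlgEquiv.refl) :
    IsRamified (σ : F →+* F) (π : F) := by
  have hπne : (π : F) ≠ 0 := fun h0 => hπ.ne_zero (Subtype.ext h0)
  have hval := fun (a b : F₀) (hb : b ≠ 0) => valuation_algebraMap_ne_mul (a := a) hπ₀ hππ₀ hb
  have hli : LinearIndependent F₀ ![(1 : F), (π : F)] := by
    rw [LinearIndependent.pair_iff]
    intro s t hst
    rw [Algebra.smul_def, Algebra.smul_def, mul_one] at hst
    have ht : t = 0 := by
      by_contra ht
      refine hval s t ht ?_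
      rw [eq_neg_of_add_eq_zero_left hst, Valuation.map_neg]
    refine ⟨?_, ht⟩
    simpa [ht] using hst
  have hdecomp : ∀ x : F, ∃ a b : F₀, x = algebraMap F₀ F a + algebraMap F₀ F b * π := by
    intro x
    have : FiniteDimensional F₀ F := Module.finite_of_finrank_eq_succ hquad
    have hspan := hli.span_eq_top_of_card_eq_finrank' (by simp [hquad])
    have hx : x ∈ Submodule.span F₀ (Set.range ![(1 : F), (π : F)]) := hspan ▸ Submodule.mem_top
    rw [Matrix.range_cons, Matrix.range_cons, Matrix.range_empty, Set.union_empty,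
      Set.singleton_union, Submodule.mem_span_pair] at hx
    obtain ⟨a, b, rfl⟩ := hx
    exact ⟨a, b, by rw [Algebra.smul_def, Algebra.smul_def, mul_one]⟩
  have hsπ : σ π = -(π : F) := by
    have h1 : σ π ^ 2 = (π : F) ^ 2 := by rw [← map_pow, hππ₀, AlgEquiv.commutes]
    rcases sq_eq_sq_iff_eq_or_eq_neg.1 h1 with h | h
    · refine absurd (AlgEquiv.ext fun x => ?_) hσ
      obtain ⟨a, b, rfl⟩ := hdecomp x
      simp [h]
    · exact h
  have hsx : ∀ a b : F₀, σ (algebraMap F₀ F a + algebraMap F₀ F b * π) =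
      algebraMap F₀ F a - algebraMap F₀ F b * π := by
    intro a b
    simp [hsπ, sub_eq_add_neg]
  -- The two terms never have the same nonzero valuation, so the valuation of `a + bπ` is read off
  -- from its coordinates.
  have hmax : ∀ a b : F₀, valuation F (algebraMap F₀ F a + algebraMap F₀ F b * π) =
      max (valuation F (algebraMap F₀ F a)) (valuation F (algebraMap F₀ F b * π)) := by
    intro a b
    by_cases hb : b = 0
    · simp [hb]
    · exact Valuation.map_add_of_distinct_val _ (hval a b hb)
  have h2' : valuation F (2 : F) = 1 := by
    have h3 : IsUnit (2 : 𝒪[F₀]) := by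
      rw [← IsLocalRing.residue_ne_zero_iff_isUnit, map_ofNat]
      exact h2
    have h4 := ((Valuation.integer.integers (valuation F₀)).isUnit_iff_valuation_eq_one).1 h3
    have h5 : valuation F₀ (2 : F₀) = valuation F₀ (1 : F₀) := by
      rw [map_one]; exact h4
    rw [← valuation_algebraMap_eq_iff (F := F)] at h5
    rwa [map_one, map_one, map_ofNat] at h5
  refine ⟨fun x => ?_, fun x => ?_, fun x hx => ?_, hsπ, h2', hπne,
    valuation_lt_one_of_irreducible hπ, fun x hx => ?_⟩
  · obtain ⟨a, b, rfl⟩ := hdecomp x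
    change σ (σ _) = _
    rw [hsx, map_sub, map_mul, hsπ]
    simp
  · obtain ⟨a, b, rfl⟩ := hdecomp x
    change valuation F (σ _) = _
    rw [hsx, hmax, sub_eq_add_neg]
    have := hmax a (-b)
    rw [map_neg, neg_mul, Valuation.map_neg] at this
    exact this
  -- Here `σ x - x = -2bπ`. The term `bπ` is integral, and its valuation differs from that of `1`,
  -- hence is smaller.
  · obtain ⟨a, b, rfl⟩ := hdecomp x
    change valuation F (σ _ - _) < 1
    rw [hsx, show algebraMap F₀ F a - algebraMap F₀ F b * π -
      (algebraMap F₀ F a + algebraMap F₀ F b * π) = -(2 * (algebraMap F₀ F b * π)) by ring,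
      Valuation.map_neg, map_mul, h2', one_mul]
    rw [hmax] at hx
    by_cases hb : b = 0
    · simp [hb]
    refine lt_of_le_of_ne ((le_max_right _ _).trans hx) fun h1 => hval 1 b hb ?_
    simp [h1]
  · obtain ⟨y, rfl⟩ := valuation_le_unif_of_irreducible hπ hx
    rw [map_mul]
    exact mul_le_of_le_one_right' y.2

end Ramified

/-! ### Square roots of principal units -/

section SquareRoot

variable {F : Type*} [Field F] [ValuativeRel F] [TopologicalSpace F] [IsNonarchimedeanLocalField F]

open Polynomial in
-- Hensel's lemma for `X² - x` at the approximate root `1`, where the derivative `2` is a unit.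
theorem exists_sq_eq_of_valuation_sub_one_lt (h2 : valuation F (2 : F) = 1) {x : F}
    (hx : valuation F (x - 1) < 1) : ∃ y : F, y ^ 2 = x ∧ valuation F (y - 1) < 1 := by
  let _ := IsTopologicalAddGroup.rightUniformSpace F
  have := isUniformAddGroup_of_addCommGroup (G := F)
  have : IsAdicComplete 𝓂[F] 𝒪[F] := inferInstance
  have hx1 : valuation F x ≤ 1 := by
    have := (valuation F).map_one_add_of_lt hx
    simpa using this.le
  have hmem : ∀ z : 𝒪[F], z ∈ 𝓂[F] ↔ valuation F (z : F) < 1 := fun z => by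
    rw [IsLocalRing.mem_maximalIdeal, mem_nonunits_iff,
      Valuation.Integer.not_isUnit_iff_valuation_lt_one]
  obtain ⟨y, hy, hy1⟩ := HenselianRing.is_henselian (I := 𝓂[F]) (X ^ 2 - C (⟨x, hx1⟩ : 𝒪[F]))
    (monic_X_pow_sub_C _ two_ne_zero) 1 (by
      rw [hmem]
      simp only [eval_sub, eval_pow, eval_X, one_pow, eval_C, AddSubgroupClass.coe_sub,
        OneMemClass.coe_one]
      rw [Valuation.map_sub_swap]
      exact hx) (by
      have : IsUnit (2 : 𝒪[F]) := by
        rw [(Valuation.integer.integers (valuation F)).isUnit_iff_valuation_eq_one]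
        exact h2
      refine IsUnit.map _ ?_
      simpa [one_add_one_eq_two] using this)
  refine ⟨y, ?_, ?_⟩
  · have := congrArg Subtype.val (IsRoot.def.1 hy)
    simpa [sub_eq_zero] using this
  · rw [hmem] at hy1
    exact hy1

/-- The square root `y` close to `1` satisfies `σ y = ± y`. The sign is `+`, because `σ y - y` is
small whereas `2y` is a unit, so `x = y²` is the norm of `y`. -/
theorem IsRamified.exists_norm_eq {σ : F →+* F} {π : F} (hR : IsRamified σ π) {x : F}
    (hσx : σ x = x) (hx : valuation F (x - 1) < 1) : ∃ y, y ≠ 0 ∧ x = y * σ y := by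
  obtain ⟨y, rfl, hy⟩ := exists_sq_eq_of_valuation_sub_one_lt hR.val_two hx
  have hy1 : valuation F y = 1 := by simpa using (valuation F).map_one_add_of_lt hy
  refine ⟨y, fun h0 => by simp [h0] at hy1, ?_⟩
  rw [map_pow] at hσx
  rcases sq_eq_sq_iff_eq_or_eq_neg.1 hσx with h | h
  · rw [h, sq]
  · have h1 := hR.map_sub_lt y hy1.le
    rw [h, show -y - y = -(2 * y) by ring, Valuation.map_neg, map_mul, hR.val_two, hy1] at h1
    simp at h1

end SquareRoot

/-! ### Alternating matrices -/

section Alternating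

variable {K : Type*} [Field K]

/-- An induction on the size replaces the Pfaffian: a nonzero entry yields an invertible alternating
2 × 2 block, whose determinant is the square of that entry, and its Schur complement is again
alternating. -/
theorem det_isSquare_of_alternating {ι : Type*} [Fintype ι] [DecidableEq ι] (S : Matrix ι ι K)
    (hS : S.transpose = -S) (hd : ∀ i, S i i = 0) : IsSquare S.det := by
  induction hn : Fintype.card ι using Nat.strong_induction_on generalizing ι with
  | _ n ih =>
    by_cases h0 : ∃ i j, S i j ≠ 0
    swap
    · push Not at h0
      obtain rfl : S = 0 := by ext i j; exact h0 i j
      rcases isEmpty_or_nonempty ι with h | h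
      · exact ⟨1, by simp⟩
      · exact ⟨0, by simp [Matrix.det_zero]⟩
    obtain ⟨i, j, hij⟩ := h0
    have hne : i ≠ j := by rintro rfl; exact hij (hd i)
    have hskew : ∀ a b, S b a = -S a b := fun a b => congrFun (congrFun hS a) b
    let f : Fin 2 → ι := ![i, j]
    have hf : Function.Injective f := by
      intro a b hab
      fin_cases a <;> fin_cases b
      · rfl
      · exact absurd hab hne
      · exact absurd hab.symm hne
      · rfl
    let e : Fin 2 ⊕ {x // x ∉ Set.range f} ≃ ι :=
      ((Equiv.ofInjective f hf).sumCongr (Equiv.refl _)).trans (Equiv.Set.sumCompl (Set.range f))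
    have hel : ∀ a, e (Sum.inl a) = f a := fun a => rfl
    let r := {x // x ∉ Set.range f}
    let A : Matrix (Fin 2) (Fin 2) K := Matrix.of fun a b => S (f a) (f b)
    let B : Matrix (Fin 2) r K := Matrix.of fun a b => S (f a) b
    let D : Matrix r r K := Matrix.of fun a b => S a b
    have hblock : S.submatrix e e = Matrix.fromBlocks A B (-B.transpose) D := by
      ext a b
      rcases a with a | a <;> rcases b with b | b
      · rfl
      · rfl
      · exact hskew _ _
      · rfl
    have hA : A.det = S i j * S i j := by
      rw [Matrix.det_fin_two]
      change S i i * S j j - S i j * S j i = _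
      rw [hd, hskew i j]
      ring
    have hAu : IsUnit A.det := by
      rw [hA]; exact (mul_ne_zero hij hij).isUnit
    let _ : Invertible A := A.invertibleOfIsUnitDet hAu
    have hAT : A.transpose = -A := by
      ext a b; exact hskew _ _
    have hAi : (A⁻¹).transpose = -A⁻¹ := by
      rw [Matrix.transpose_nonsing_inv, hAT]
      exact Matrix.inv_eq_left_inv (by
        rw [neg_mul_neg, Matrix.nonsing_inv_mul _ hAu])
    have hAd : ∀ a, A⁻¹ a a = 0 := by
      have hAA : ∀ a, A a a = 0 := fun a => hd _
      intro a
      rw [Matrix.inv_def, Matrix.adjugate_fin_two]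
      fin_cases a <;> simp [hAA]
    rw [← Matrix.det_submatrix_equiv_self e S, hblock, Matrix.det_fromBlocks₁₁, hA,
      Matrix.invOf_eq_nonsing_inv]
    refine IsSquare.mul ⟨_, rfl⟩ (ih (Fintype.card r) ?_ _ ?_ ?_ rfl)
    · rw [← hn]
      exact Fintype.card_subtype_lt (x := i) (by simp [f])
    · rw [Matrix.transpose_sub, Matrix.transpose_mul, Matrix.transpose_mul, Matrix.transpose_neg,
        Matrix.transpose_transpose, hAi]
      have hDT : D.transpose = -D := by ext a b; exact hskew _ _
      rw [hDT]
      simp only [Matrix.neg_mul, Matrix.mul_neg, Matrix.mul_assoc]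
      abel
    · intro a
      have hDD : D a a = 0 := hd _
      rw [Matrix.sub_apply, hDD, Matrix.neg_mul, Matrix.neg_mul, Matrix.neg_apply]
      have h10 : A⁻¹ 1 0 = -A⁻¹ 0 1 := congrFun (congrFun hAi 0) 1
      simp only [Matrix.mul_apply, Fin.sum_univ_two, Matrix.transpose_apply, hAd, h10]
      ring

/-- The invariance of `S` gives `(A + 1)ᵀ S A = S (A + 1)`; take determinants and cancel. -/
theorem det_eq_one_of_det_add_one_ne_zero {ι : Type*} [Fintype ι] [DecidableEq ι]
    {S A : Matrix ι ι K} (hS : S.det ≠ 0) (hA : A.transpose * S * A = S) (h1 : (A + 1).det ≠ 0) :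
    A.det = 1 := by
  have h : (A + 1).transpose * (S * A) = S * (A + 1) := by
    rw [Matrix.transpose_add, Matrix.transpose_one, add_mul, ← mul_assoc, hA, mul_add]
    simp [add_comm]
  have := congrArg Matrix.det h
  rw [Matrix.det_mul, Matrix.det_transpose, Matrix.det_mul, Matrix.det_mul] at this
  have h2 : (A + 1).det * S.det * A.det = (A + 1).det * S.det * 1 := by
    linear_combination this
  exact mul_left_cancel₀ (mul_ne_zero h1 hS) h2

open Matrix in
/-- Isometries of a nondegenerate alternating form have determinant one. -/
theorem det_eq_one_of_alternating {ι : Type*} [Fintype ι] [DecidableEq ι]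
    {S : Matrix ι ι K} (hS : S.det ≠ 0) (hST : S.transpose = -S)
    (hSd : ∀ x : ι → K, x ⬝ᵥ (S *ᵥ x) = 0) (A : Matrix ι ι K)
    (hA : A.transpose * S * A = S) : A.det = 1 := by
  -- Induction on the dimension of the kernel of `A + 1`. If it is nonzero, `A` is multiplied by a
  -- symplectic transvection, of determinant one, chosen so that the kernel shrinks.
  induction hk : Module.finrank K (LinearMap.ker (A + 1).mulVecLin)
    using Nat.strong_induction_on generalizing A with
  | _ k ih =>
    by_cases h1 : (A + 1).det ≠ 0
    · exact det_eq_one_of_det_add_one_ne_zero hS hA h1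
    have hx : ∃ x, x ∉ LinearMap.range (A + 1).mulVecLin := by
      by_contra! hcon
      refine h1 ?_
      have : IsUnit (A + 1) := by
        rw [← Matrix.mulVec_surjective_iff_isUnit]
        exact hcon
      exact ((Matrix.isUnit_iff_isUnit_det _).1 this).ne_zero
    obtain ⟨x, hx⟩ := hx
    have hAd : A.det ≠ 0 := by
      intro h0
      apply hS
      rw [← hA, Matrix.det_mul, h0, mul_zero]
    set u : ι → K := x ᵥ* S with hu
    have hSx : S *ᵥ x = -u := by
      rw [hu, ← Matrix.mulVec_transpose, hST, Matrix.neg_mulVec, neg_neg]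
    have hux : u ⬝ᵥ x = 0 := by
      rw [hu, ← Matrix.dotProduct_mulVec]
      exact hSd x
    -- The transvection along a vector `x` outside the range of `A + 1`. Then `(TA + 1)v = (A + 1)v
    -- + (u ⬝ Av) x` vanishes only if both terms do.
    let T : Matrix ι ι K := 1 + vecMulVec x u
    have hT : T.transpose * S * T = S := by
      have e1 : vecMulVec u x * S = vecMulVec u u := by
        rw [Matrix.vecMulVec_mul]
      have e2 : S * vecMulVec x u = -vecMulVec u u := by
        rw [Matrix.mul_vecMulVec, hSx, Matrix.neg_vecMulVec]
      have e3 : vecMulVec u u * vecMulVec x u = 0 := by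
        rw [Matrix.vecMulVec_mul_vecMulVec, hux, zero_smul, Matrix.vecMulVec_zero]
      simp only [T, Matrix.transpose_add, Matrix.transpose_one, Matrix.transpose_vecMulVec,
        add_mul, mul_add, one_mul, mul_one, e1, e2, e3]
      abel
    have hTd : T.det = 1 := by
      have : T = 1 + Matrix.replicateCol Unit x * Matrix.replicateRow Unit u := by
        rw [← Matrix.vecMulVec_eq]
      rw [this, Matrix.det_one_add_replicateCol_mul_replicateRow, hux, add_zero]
    have hTA : (T * A).transpose * S * (T * A) = S := by
      calc (T * A).transpose * S * (T * A) = A.transpose * (T.transpose * S * T) * A := by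
            rw [Matrix.transpose_mul]; simp only [Matrix.mul_assoc]
        _ = S := by rw [hT, hA]
    have hTAv : ∀ v, (T * A + 1) *ᵥ v = (A + 1) *ᵥ v + (u ⬝ᵥ (A *ᵥ v)) • x := by
      intro v
      rw [Matrix.add_mulVec, Matrix.add_mulVec, ← Matrix.mulVec_mulVec]
      simp only [T, Matrix.add_mulVec, Matrix.one_mulVec, Matrix.vecMulVec_mulVec]
      simp only [op_smul_eq_smul]
      abel
    have hle : LinearMap.ker (T * A + 1).mulVecLin ≤ LinearMap.ker (A + 1).mulVecLin := by
      intro v hv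
      rw [LinearMap.mem_ker, Matrix.mulVecLin_apply] at hv ⊢
      rw [hTAv] at hv
      by_cases h0 : u ⬝ᵥ (A *ᵥ v) = 0
      · simpa [h0] using hv
      · refine absurd ⟨-(u ⬝ᵥ (A *ᵥ v))⁻¹ • v, ?_⟩ hx
        rw [Matrix.mulVecLin_apply, Matrix.mulVec_smul, eq_neg_of_add_eq_zero_left hv, smul_neg,
          neg_smul, neg_neg, smul_smul, inv_mul_cancel₀ h0, one_smul]
    have hlt : LinearMap.ker (T * A + 1).mulVecLin < LinearMap.ker (A + 1).mulVecLin := by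
      refine lt_of_le_of_ne hle fun heq => ?_
      -- A functional `f` that kills the range of `A + 1` but not `x` is the pairing with `S A v`
      -- for some `v` in the kernel of `A + 1`. That `v` leaves the kernel when `A` is replaced by
      -- `TA`, since `u ⬝ Av` equals `f x` up to sign.
      obtain ⟨f, hfx, hf⟩ := Submodule.exists_le_ker_of_notMem hx
      let w : ι → K := fun i => f (Pi.single i 1)
      have hw : ∀ y, f y = w ⬝ᵥ y := by
        intro y
        conv_lhs => rw [← Finset.univ_sum_single y]
        rw [map_sum, dotProduct]
        refine Finset.sum_congr rfl fun i _ => ?_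
        rw [show (Pi.single i (y i) : ι → K) = y i • Pi.single i 1 by
          rw [← Pi.single_smul, smul_eq_mul, mul_one], map_smul, smul_eq_mul, mul_comm]
      have hwA : (A + 1).transpose *ᵥ w = 0 := by
        rw [Matrix.mulVec_transpose]
        refine dotProduct_eq_zero _ fun y => ?_
        rw [← Matrix.dotProduct_mulVec, ← hw]
        exact hf ⟨y, rfl⟩
      have hSA : IsUnit (S * A).det := by
        rw [Matrix.det_mul]; exact (mul_ne_zero hS hAd).isUnit
      obtain ⟨v, hv⟩ : ∃ v, (S * A) *ᵥ v = w :=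
        ⟨(S * A)⁻¹ *ᵥ w, by rw [Matrix.mulVec_mulVec, Matrix.mul_nonsing_inv _ hSA,
          Matrix.one_mulVec]⟩
      have hker : (A + 1) *ᵥ v = 0 := by
        have h : (A + 1).transpose * (S * A) = S * (A + 1) := by
          rw [Matrix.transpose_add, Matrix.transpose_one, add_mul, ← mul_assoc, hA, mul_add]
          simp [add_comm]
        rw [← hv, Matrix.mulVec_mulVec, h, ← Matrix.mulVec_mulVec] at hwA
        exact Matrix.eq_zero_of_mulVec_eq_zero hS hwA
      have hAv : A *ᵥ v = -v := by
        rw [Matrix.add_mulVec, Matrix.one_mulVec] at hker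
        exact eq_neg_of_add_eq_zero_left hker
      have hmem : v ∈ LinearMap.ker (T * A + 1).mulVecLin := by
        rw [heq]; exact hker
      rw [LinearMap.mem_ker, Matrix.mulVecLin_apply, hTAv, hker, zero_add, hAv] at hmem
      have hwx : w ⬝ᵥ x = -(u ⬝ᵥ v) := by
        rw [← hv, ← Matrix.mulVec_mulVec, hAv, Matrix.mulVec_neg, neg_dotProduct, dotProduct_comm,
          Matrix.dotProduct_mulVec, ← hu]

      rw [hw] at hfx
      rcases smul_eq_zero.1 hmem with h | h
      · rw [dotProduct_neg, neg_eq_zero] at h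
        exact hfx (by rw [hwx, h, neg_zero])
      · simp [h] at hfx
    have := ih _ (hk ▸ Submodule.finrank_lt_finrank_of_lt hlt) (T * A) hTA rfl
    rwa [Matrix.det_mul, hTd, one_mul] at this

end Alternating

/-! ### Relative lengths of submodules -/

section RelLength

variable {R M : Type*} [Ring R] [AddCommGroup M] [Module R M]

/-- The length of `B / A`, for `A ≤ B`. -/
noncomputable def relLength (A B : Submodule R M) : ℕ∞ := Module.length R (B ⧸ A.submoduleOf B)

theorem relLength_add {A B C : Submodule R M} (hAB : A ≤ B) (hBC : B ≤ C) :
    relLength A C = relLength A B + relLength B C := by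
  have hle : A.submoduleOf B ≤ (A.submoduleOf C).comap (Submodule.inclusion hBC) :=
    fun x hx => hx
  refine Module.length_eq_add_of_exact
    (Submodule.mapQ _ _ (Submodule.inclusion hBC) hle)
    (Submodule.factor (show A.submoduleOf C ≤ B.submoduleOf C from fun x hx => hAB hx)) ?_ ?_ ?_
  · rw [injective_iff_map_eq_zero]
    intro x hx
    obtain ⟨x, rfl⟩ := Submodule.Quotient.mk_surjective _ x
    rw [Submodule.mapQ_apply, Submodule.Quotient.mk_eq_zero] at hx
    exact (Submodule.Quotient.mk_eq_zero _).2 hx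
  · exact Submodule.factor_surjective _
  · intro x
    obtain ⟨x, rfl⟩ := Submodule.Quotient.mk_surjective _ x
    constructor
    · intro hx
      have hx' : x.1 ∈ B := (Submodule.Quotient.mk_eq_zero (B.submoduleOf C)).1 hx
      exact ⟨Submodule.Quotient.mk ⟨x.1, hx'⟩, rfl⟩
    · rintro ⟨y, hy⟩
      obtain ⟨y, rfl⟩ := Submodule.Quotient.mk_surjective _ y
      rw [← hy]
      exact (Submodule.Quotient.mk_eq_zero (B.submoduleOf C)).2 y.2

theorem relLength_eq_zero {A B : Submodule R M} (hAB : A ≤ B) (h : relLength A B = 0) : A = B := by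
  rw [relLength, Module.length_eq_zero_iff, Submodule.Quotient.subsingleton_iff,
    Submodule.submoduleOf_eq_top] at h
  exact le_antisymm hAB h

theorem relLength_pos {A B : Submodule R M} (hAB : A < B) : 1 ≤ relLength A B := by
  rw [Order.one_le_iff_pos, pos_iff_ne_zero]
  exact fun h => hAB.ne (relLength_eq_zero hAB.le h)

theorem relLength_map {M' : Type*} [AddCommGroup M'] [Module R M'] (e : M →ₗ[R] M')
    (he : Function.Injective e) (A B : Submodule R M) :
    relLength (A.map e) (B.map e) = relLength A B := by
  refine (LinearEquiv.length_eq (Submodule.Quotient.equiv _ _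
    (Submodule.equivMapOfInjective e he B) ?_)).symm
  ext ⟨y, x, hx, rfl⟩
  constructor
  · rintro ⟨z, hz, hzx⟩
    have : e z = e x := congrArg Subtype.val hzx
    exact ⟨z, hz, this⟩
  · rintro ⟨z, hz, hzx⟩
    refine ⟨⟨z, he hzx ▸ hx⟩, hz, ?_⟩
    exact Subtype.ext hzx

/-- The lengths of `B / A` and `D / C` add up to zero, the finite length `n` being cancellable in
`ℕ∞`. This is how inclusions of vertex lattices become equalities. -/
theorem eq_of_chain {A B C D : Submodule R M} (hAB : A ≤ B) (hBC : B ≤ C) (hCD : C ≤ D) {n : ℕ}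
    (h1 : relLength A D = n) (h2 : relLength B C = n) : A = B := by
  rw [relLength_add hAB (hBC.trans hCD), relLength_add hBC hCD, h2] at h1
  refine relLength_eq_zero hAB ?_
  have h3 : (relLength A B + relLength C D) + (n : ℕ∞) = 0 + n := by
    rw [zero_add]
    refine Eq.trans ?_ h1
    rw [add_assoc, add_comm (relLength C D)]
  exact (add_eq_zero.1 ((ENat.add_left_injective_of_ne_top (ENat.natCast_ne_top n)) h3)).1

end RelLength

/-! ### Lattices and duality -/

section Lattices

variable {F : Type*} [Field F] [ValuativeRel F]
  {V : Type*} [AddCommGroup V] [Module F V] {V' : Type*} [AddCommGroup V'] [Module F V']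

theorem int_smul_mem {L : Submodule 𝒪[F] V} {a : F} (ha : valuation F a ≤ 1) {x : V} (hx : x ∈ L) :
    a • x ∈ L :=
  L.smul_mem (⟨a, ha⟩ : 𝒪[F]) hx

/-- The quotient is cyclic, generated by `x`, and the annihilator of the generator is exactly the
maximal ideal. -/
theorem relLength_sup_span {L : Submodule 𝒪[F] V} {x : V} (hx : x ∉ L)
    (hm : ∀ a : F, valuation F a < 1 → a • x ∈ L) :
    relLength L (L ⊔ Submodule.span 𝒪[F] {x}) = 1 := by
  have hxm : x ∈ L ⊔ Submodule.span 𝒪[F] {x} :=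
    le_sup_right (a := L) (Submodule.mem_span_singleton_self x)
  let f : 𝒪[F] →ₗ[𝒪[F]] (↥(L ⊔ Submodule.span 𝒪[F] {x}) ⧸
      L.submoduleOf (L ⊔ Submodule.span 𝒪[F] {x})) :=
    LinearMap.toSpanSingleton _ _ (Submodule.Quotient.mk ⟨x, hxm⟩)
  have hf : Function.Surjective f := by
    intro y
    obtain ⟨⟨y, hy⟩, rfl⟩ := Submodule.Quotient.mk_surjective _ y
    obtain ⟨l, hl, z, hz, rfl⟩ := Submodule.mem_sup.1 hy
    obtain ⟨a, rfl⟩ := Submodule.mem_span_singleton.1 hz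
    refine ⟨a, ?_⟩
    rw [LinearMap.toSpanSingleton_apply, ← Submodule.Quotient.mk_smul, Submodule.Quotient.eq]
    change a • x - (l + a • x) ∈ L
    simpa using hl
  have hk : ∀ a : 𝒪[F], a ∈ LinearMap.ker f ↔ a • x ∈ L := by
    intro a
    rw [LinearMap.mem_ker, LinearMap.toSpanSingleton_apply, ← Submodule.Quotient.mk_smul,
      Submodule.Quotient.mk_eq_zero]
    rfl
  have hker : LinearMap.ker f = 𝓂[F] := by
    refine ((IsLocalRing.maximalIdeal.isMaximal 𝒪[F]).eq_of_le ?_ ?_).symm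
    · intro h1
      have : (1 : 𝒪[F]) ∈ LinearMap.ker f := h1 ▸ Submodule.mem_top
      rw [hk, one_smul] at this
      exact hx this
    · intro a ha
      rw [IsLocalRing.mem_maximalIdeal, mem_nonunits_iff,
        Valuation.Integer.not_isUnit_iff_valuation_lt_one] at ha
      exact (hk a).2 (hm _ ha)
  rw [relLength, ← (f.quotKerEquivOfSurjective hf).length_eq, hker, Module.length_eq_one_iff,
    isSimpleModule_iff_quot_maximal]
  exact ⟨𝓂[F], inferInstance, ⟨LinearEquiv.refl _ _⟩⟩

/-- The image of a lattice. -/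
noncomputable def mapLattice (φ : V ≃ₗ[F] V') (L : Submodule 𝒪[F] V) : Submodule 𝒪[F] V' :=
  L.map (φ.toLinearMap.restrictScalars 𝒪[F])

theorem mem_mapLattice {φ : V ≃ₗ[F] V'} {L : Submodule 𝒪[F] V} {x : V'} :
    x ∈ mapLattice φ L ↔ φ.symm x ∈ L := by
  constructor
  · rintro ⟨y, hy, rfl⟩
    simpa using hy
  · intro hx
    exact ⟨_, hx, by simp⟩

theorem apply_mem_mapLattice {φ : V ≃ₗ[F] V'} {L : Submodule 𝒪[F] V} {x : V} :
    φ x ∈ mapLattice φ L ↔ x ∈ L := by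
  rw [mem_mapLattice, φ.symm_apply_apply]

theorem mapLattice_mono {φ : V ≃ₗ[F] V'} {L M : Submodule 𝒪[F] V} (hLM : L ≤ M) :
    mapLattice φ L ≤ mapLattice φ M := Submodule.map_mono hLM

theorem mapLattice_isLattice (φ : V ≃ₗ[F] V') {L : Submodule 𝒪[F] V} (hL : L.IsLattice F) :
    (mapLattice φ L).IsLattice F where
  fg := hL.fg.map _
  span_eq_top := by
    rw [eq_top_iff]
    have h1 : (mapLattice φ L : Set V') = φ '' L := rfl
    rw [h1, ← LinearEquiv.coe_toLinearMap, ← Submodule.map_span, hL.span_eq_top, Submodule.map_top,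
      LinearMap.range_eq_top.2 φ.surjective]

variable [TopologicalSpace F] [IsNonarchimedeanLocalField F]

theorem Submodule.IsLattice.exists_basis [FiniteDimensional F V] {L : Submodule 𝒪[F] V}
    (hL : L.IsLattice F) :
    ∃ b : Module.Basis (Fin (Module.finrank F V)) F V,
      ∀ z, z ∈ L ↔ ∀ i, valuation F (b.repr z i) ≤ 1 := by
  have : Module.IsTorsionFree 𝒪[F] F := inferInstance
  have : Module.Free 𝒪[F] L := Submodule.IsLattice.free F L
  have : Module.Finite 𝒪[F] L := Submodule.IsLattice.finite F L
  have hr : Module.finrank 𝒪[F] L = Module.finrank F V := by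
    rw [Module.finrank, Submodule.IsLattice.rank' F L, Module.finrank]
  let b := (Module.finBasis 𝒪[F] L).reindex (finCongr hr)
  let b' := b.extendOfIsLattice F
  have hb' : ∀ i, b' i = b i := fun i => Module.Basis.extendOfIsLattice_apply F b i
  refine ⟨b', fun z => ⟨fun hz i => ?_, fun hz => ?_⟩⟩
  · have h1 := congrArg Subtype.val (b.sum_repr ⟨z, hz⟩)
    have h2 : z = ∑ i, ((b.repr ⟨z, hz⟩ i : 𝒪[F]) : F) • b' i := by
      refine h1.symm.trans ?_
      simp only [hb', AddSubmonoidClass.coe_finsetSum]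
      rfl
    rw [h2, map_sum, Finsupp.finsetSum_apply]
    simp only [map_smul, Module.Basis.repr_self, Finsupp.smul_apply, smul_eq_mul]
    rw [Finset.sum_eq_single i (fun j _ hj => by simp [hj]) (by simp)]
    rw [Finsupp.single_eq_same, mul_one]
    exact (b.repr ⟨z, hz⟩ i).2
  · rw [← b'.sum_repr z]
    refine Submodule.sum_mem _ fun i _ => int_smul_mem (hz i) ?_
    rw [hb']
    exact (b i).2

omit [TopologicalSpace F] [IsNonarchimedeanLocalField F] in
theorem isLattice_of_basis {ι : Type*} [Finite ι] (b : Module.Basis ι F V) {L : Submodule 𝒪[F] V}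
    (hL : ∀ z, z ∈ L ↔ ∀ i, valuation F (b.repr z i) ≤ 1) : L.IsLattice F := by
  have := Fintype.ofFinite ι
  have hb : ∀ i, b i ∈ L := fun i => by
    classical
    rw [hL]
    intro j
    rw [b.repr_self, Finsupp.single_apply]
    split_ifs <;> simp
  have hspan : Submodule.span 𝒪[F] (Set.range b) = L := by
    refine le_antisymm (Submodule.span_le.2 ?_) fun z hz => ?_
    · rintro _ ⟨i, rfl⟩
      exact hb i
    · rw [← b.sum_repr z]
      exact Submodule.sum_mem _ fun i _ =>
        int_smul_mem ((hL z).1 hz i) (Submodule.subset_span ⟨i, rfl⟩)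
  classical
  refine ⟨⟨Finset.univ.image b, ?_⟩, ?_⟩
  · rw [Finset.coe_image, Finset.coe_univ, Set.image_univ, hspan]
  · rw [eq_top_iff, ← b.span_eq]
    refine Submodule.span_mono ?_
    rintro _ ⟨i, rfl⟩
    exact hb i

end Lattices

/-! ### Dual lattices with respect to a hermitian form -/

section Duality

variable {F : Type*} [Field F] [ValuativeRel F] {σ : F →+* F} {π : F}
  {V : Type*} [AddCommGroup V] [Module F V] {h : V →ₛₗ[σ] V →ₗ[F] F}
  {V' : Type*} [AddCommGroup V'] [Module F V'] {h' : V' →ₛₗ[σ] V' →ₗ[F] F}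

theorem mem_dualLattice {L : Submodule 𝒪[F] V} {z : V} :
    z ∈ dualLattice h L ↔ ∀ x ∈ L, valuation F (h x z) ≤ 1 := Iff.rfl

/-- The sublattice `π L^∨` of the dual lattice, of all `z` such that `h(x, z)` is not a unit for
all `x ∈ L`. -/
def subDual (h : V →ₛₗ[σ] V →ₗ[F] F) (L : Submodule 𝒪[F] V) : Submodule 𝒪[F] V where
  carrier := {z | ∀ x ∈ L, valuation F (h x z) < 1}
  add_mem' := by
    intro a b ha hb x hx
    rw [map_add]
    exact Valuation.map_add_lt _ (ha x hx) (hb x hx)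
  zero_mem' := by
    intro x _
    simp
  smul_mem' := by
    intro a z hz x hx
    change valuation F (h x ((a : F) • z)) < 1
    rw [map_smul, smul_eq_mul, map_mul]
    exact (mul_le_of_le_one_left' a.2).trans_lt (hz x hx)

theorem mem_subDual {L : Submodule 𝒪[F] V} {z : V} :
    z ∈ subDual h L ↔ ∀ x ∈ L, valuation F (h x z) < 1 := Iff.rfl

theorem dual_anti {L M : Submodule 𝒪[F] V} (hLM : L ≤ M) : dualLattice h M ≤ dualLattice h L :=
  fun _ hz x hx => hz x (hLM hx)

theorem subDual_anti {L M : Submodule 𝒪[F] V} (hLM : L ≤ M) : subDual h M ≤ subDual h L :=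
  fun _ hz x hx => hz x (hLM hx)

theorem IsRamified.valuation_comm (hR : IsRamified σ π) (hs : h.IsSymm) (x y : V) :
    valuation F (h x y) = valuation F (h y x) := by
  rw [← hs.eq y x, hR.val_map]

theorem IsRamified.unif_inv (hR : IsRamified σ π) {x : F} (hx : valuation F x < 1) :
    valuation F (π⁻¹ * x) ≤ 1 := by
  have h0 : valuation F π ≠ 0 := by simpa using hR.unif_ne
  rw [map_mul, map_inv₀, inv_mul_le_iff₀ (zero_lt_iff.2 h0), mul_one]
  exact hR.le_unif x hx

theorem IsRamified.unif_mul (hR : IsRamified σ π) {x : F} (hx : valuation F x ≤ 1) :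
    valuation F (π * x) < 1 := by
  rw [map_mul]
  exact (mul_le_of_le_one_right' hx).trans_lt hR.unif_lt

theorem IsRamified.mem_subDual_iff (hR : IsRamified σ π) {L : Submodule 𝒪[F] V} {z : V} :
    z ∈ subDual h L ↔ π⁻¹ • z ∈ dualLattice h L := by
  rw [mem_subDual, mem_dualLattice]
  refine forall₂_congr fun x _ => ?_
  rw [map_smul, smul_eq_mul]
  refine ⟨fun hz => hR.unif_inv hz, fun hz => ?_⟩
  have := hR.unif_mul hz
  rwa [mul_inv_cancel_left₀ hR.unif_ne] at this

theorem IsRamified.unif_smul_mem_subDual (hR : IsRamified σ π) {L : Submodule 𝒪[F] V} {z : V}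
    (hz : z ∈ dualLattice h L) : π • z ∈ subDual h L := by
  rw [hR.mem_subDual_iff, inv_smul_smul₀ hR.unif_ne]
  exact hz

theorem IsRamified.maximalIdeal_smul_dual_le_iff (hR : IsRamified σ π)
    {L M : Submodule 𝒪[F] V} : 𝓂[F] • dualLattice h L ≤ M ↔ subDual h L ≤ M := by
  rw [Submodule.smul_le]
  constructor
  · intro H z hz
    have h1 : (⟨π, hR.unif_lt.le⟩ : 𝒪[F]) ∈ 𝓂[F] := by
      rw [IsLocalRing.mem_maximalIdeal, mem_nonunits_iff,
        Valuation.Integer.not_isUnit_iff_valuation_lt_one]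
      exact hR.unif_lt
    have h2 : π • (π⁻¹ • z) ∈ M := H _ h1 _ (hR.mem_subDual_iff.1 hz)
    rwa [smul_inv_smul₀ hR.unif_ne] at h2
  · intro H a ha z hz
    rw [IsLocalRing.mem_maximalIdeal, mem_nonunits_iff,
      Valuation.Integer.not_isUnit_iff_valuation_lt_one] at ha
    refine H fun x hx => ?_
    change valuation F (h x ((a : F) • z)) < 1
    rw [map_smul, smul_eq_mul, map_mul]
    exact (mul_le_of_le_one_right' (hz x hx)).trans_lt ha

/-- The form of the definition used throughout: `subDual h L` is the radical of the reduced form on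
`L`, and membership in it is a condition on pairings rather than on products with the maximal ideal.
-/
theorem IsRamified.isVertexLattice_iff (hR : IsRamified σ π) {t : ℕ} {L : Submodule 𝒪[F] V} :
    IsVertexLattice h t L ↔ L.IsLattice F ∧ subDual h L ≤ L ∧ L ≤ dualLattice h L ∧
      relLength L (dualLattice h L) = t :=
  ⟨fun H => ⟨H.1, hR.maximalIdeal_smul_dual_le_iff.1 H.2, H.3, H.4⟩,
    fun H => ⟨H.1, hR.maximalIdeal_smul_dual_le_iff.2 H.2.1, H.2.2.1, H.2.2.2⟩⟩

/-- An isometry of hermitian spaces. -/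
def IsIsometry (h : V →ₛₗ[σ] V →ₗ[F] F) (h' : V' →ₛₗ[σ] V' →ₗ[F] F) (φ : V ≃ₗ[F] V') : Prop :=
  ∀ x y, h' (φ x) (φ y) = h x y

omit [ValuativeRel F] in
theorem IsIsometry.symm {φ : V ≃ₗ[F] V'} (hφ : IsIsometry h h' φ) : IsIsometry h' h φ.symm := by
  intro x y
  rw [← hφ, φ.apply_symm_apply, φ.apply_symm_apply]

theorem IsIsometry.dualLattice {φ : V ≃ₗ[F] V'} (hφ : IsIsometry h h' φ) (L : Submodule 𝒪[F] V) :
    dualLattice h' (mapLattice φ L) = mapLattice φ (dualLattice h L) := by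
  ext z
  rw [mem_mapLattice, mem_dualLattice, mem_dualLattice]
  constructor
  · intro H x hx
    rw [← hφ, φ.apply_symm_apply]
    exact H _ (apply_mem_mapLattice.2 hx)
  · intro H x hx
    rw [← hφ.symm]
    exact H _ (mem_mapLattice.1 hx)

theorem IsIsometry.subDual {φ : V ≃ₗ[F] V'} (hφ : IsIsometry h h' φ) (L : Submodule 𝒪[F] V) :
    subDual h' (mapLattice φ L) = mapLattice φ (subDual h L) := by
  ext z
  rw [mem_mapLattice, mem_subDual, mem_subDual]
  constructor
  · intro H x hx
    rw [← hφ, φ.apply_symm_apply]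
    exact H _ (apply_mem_mapLattice.2 hx)
  · intro H x hx
    rw [← hφ.symm]
    exact H _ (mem_mapLattice.1 hx)

theorem IsIsometry.mapLattice_mem_vert (hR : IsRamified σ π) {φ : V ≃ₗ[F] V'}
    (hφ : IsIsometry h h' φ) {L : Submodule 𝒪[F] V} {t : ℕ} (hL : L ∈ Vert h t) :
    mapLattice φ L ∈ Vert h' t := by
  obtain ⟨h1, h2, h3, h4⟩ := hR.isVertexLattice_iff.1 hL
  refine hR.isVertexLattice_iff.2 ⟨mapLattice_isLattice φ h1, ?_, ?_, ?_⟩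
  · rw [hφ.subDual]
    exact mapLattice_mono h2
  · rw [hφ.dualLattice]
    exact mapLattice_mono h3
  · rw [hφ.dualLattice, mapLattice, mapLattice, relLength_map]
    · exact h4
    · exact φ.injective

variable [FiniteDimensional F V] [TopologicalSpace F] [IsNonarchimedeanLocalField F]

omit [ValuativeRel F] [TopologicalSpace F] [IsNonarchimedeanLocalField F] in
theorem exists_form_eq (hnd : h.Nondegenerate) {ι : Type*} [Finite ι] (b : Module.Basis ι F V)
    (c : ι → F) : ∃ z, ∀ i, h (b i) z = c i := by
  have := Fintype.ofFinite ι
  let f : V →ₗ[F] (ι → F) := LinearMap.pi fun i => h (b i)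
  have hinj : Function.Injective f := by
    rw [injective_iff_map_eq_zero]
    intro z hz
    refine hnd.2 z fun y => ?_
    rw [← b.sum_repr y, map_sum, LinearMap.sum_apply]
    refine Finset.sum_eq_zero fun i _ => ?_
    rw [LinearMap.map_smulₛₗ, LinearMap.smul_apply, show h (b i) z = 0 from congrFun hz i,
      smul_zero]
  have hsurj := (LinearMap.injective_iff_surjective_of_finrank_eq_finrank (f := f) (by
    rw [Module.finrank_fintype_fun_eq_card, Module.finrank_eq_card_basis b])).1 hinj
  obtain ⟨z, hz⟩ := hsurj c
  exact ⟨z, fun i => congrFun hz i⟩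

omit [ValuativeRel F] [TopologicalSpace F] [IsNonarchimedeanLocalField F] [FiniteDimensional F V] in
theorem form_sum_left {ι : Type*} [Fintype ι] (b : Module.Basis ι F V) (x z : V) :
    h x z = ∑ i, σ (b.repr x i) * h (b i) z := by
  conv_lhs => rw [← b.sum_repr x]
  rw [map_sum, LinearMap.sum_apply]
  exact Finset.sum_congr rfl fun i _ => by
    rw [LinearMap.map_smulₛₗ, LinearMap.smul_apply, smul_eq_mul]

/-- Bases of a lattice and its dual which are dual to each other. -/
theorem IsRamified.exists_dual_basis (hR : IsRamified σ π) (hs : h.IsSymm) (hnd : h.Nondegenerate)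
    {L : Submodule 𝒪[F] V} (hL : L.IsLattice F) :
    ∃ b b' : Module.Basis (Fin (Module.finrank F V)) F V,
      (∀ z, z ∈ L ↔ ∀ i, valuation F (b.repr z i) ≤ 1) ∧
      (∀ z, z ∈ dualLattice h L ↔ ∀ i, valuation F (b'.repr z i) ≤ 1) ∧
      (∀ z i, h (b i) z = b'.repr z i) ∧ ∀ z i, h (b' i) z = b.repr z i := by
  classical
  obtain ⟨b, hb⟩ := hL.exists_basis
  choose w hw using fun j => exists_form_eq hnd b (Pi.single j 1)
  have hli : LinearIndependent F w := by
    rw [Fintype.linearIndependent_iff]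
    intro g hg i
    have := congrArg (h (b i)) hg
    rw [map_sum, map_zero, Finset.sum_eq_single i (fun j _ hj => by
      rw [map_smul, hw, Pi.single_apply, if_neg hj.symm, smul_zero]) (by simp), map_smul, hw,
      Pi.single_eq_same, smul_eq_mul, mul_one] at this
    exact this
  let b' : Module.Basis (Fin (Module.finrank F V)) F V :=
    basisOfLinearIndependentOfCardEqFinrank' w hli (by simp)
  have hb'w : ∀ i, b' i = w i := fun i => by simp [b']
  have h1 : ∀ z i, h (b i) z = b'.repr z i := by
    intro z i
    conv_lhs => rw [← b'.sum_repr z]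
    rw [map_sum, Finset.sum_eq_single i (fun j _ hj => by
      rw [map_smul, hb'w, hw, Pi.single_apply, if_neg hj.symm, smul_zero]) (by simp), map_smul,
      hb'w, hw, Pi.single_eq_same, smul_eq_mul, mul_one]
  refine ⟨b, b', hb, fun z => ?_, h1, fun z i => ?_⟩
  · rw [mem_dualLattice]
    constructor
    · intro H i
      rw [← h1]
      refine H _ ((hb _).2 fun j => ?_)
      rw [b.repr_self, Finsupp.single_apply]
      split_ifs <;> simp
    · intro H x hx
      rw [form_sum_left b x z]
      refine Valuation.map_sum_le _ fun i _ => ?_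
      rw [map_mul, hR.val_map, h1]
      exact mul_le_one' ((hb x).1 hx i) (H i)
  · rw [← hs.eq, form_sum_left b z, map_sum, Finset.sum_eq_single i (fun j _ hj => by
      rw [h1, b'.repr_self, Finsupp.single_apply, if_neg hj.symm, mul_zero, map_zero]) (by simp),
      h1, b'.repr_self, Finsupp.single_eq_same, mul_one, hR.invol]

theorem IsRamified.dual_isLattice (hR : IsRamified σ π) (hs : h.IsSymm) (hnd : h.Nondegenerate)
    {L : Submodule 𝒪[F] V} (hL : L.IsLattice F) : (dualLattice h L).IsLattice F := by
  obtain ⟨b, b', -, hb', -⟩ := hR.exists_dual_basis hs hnd hL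
  exact isLattice_of_basis b' hb'

theorem IsRamified.dual_dual (hR : IsRamified σ π) (hs : h.IsSymm) (hnd : h.Nondegenerate)
    {L : Submodule 𝒪[F] V} (hL : L.IsLattice F) : dualLattice h (dualLattice h L) = L := by
  obtain ⟨b, b', hb, hb', -, h2⟩ := hR.exists_dual_basis hs hnd hL
  refine le_antisymm (fun z hz => ?_) fun z hz x hx => ?_
  · rw [hb]
    intro i
    rw [← h2]
    refine hz _ ((hb' _).2 fun j => ?_)
    rw [b'.repr_self, Finsupp.single_apply]
    split_ifs <;> simp
  · change valuation F _ ≤ 1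
    rw [hR.valuation_comm hs]
    exact hx z hz

/-- Reducing the coordinates in the dual basis identifies `L^∨ / π L^∨` with a power of the residue
field, of exponent `dim V`. -/
theorem IsRamified.relLength_subDual_dual (hR : IsRamified σ π) (hs : h.IsSymm)
    (hnd : h.Nondegenerate) {L : Submodule 𝒪[F] V} (hL : L.IsLattice F) :
    relLength (subDual h L) (dualLattice h L) = Module.finrank F V := by
  obtain ⟨b, b', hb, hb', h1, h2⟩ := hR.exists_dual_basis hs hnd hL
  let f : ↥(dualLattice h L) →ₗ[𝒪[F]] (Fin (Module.finrank F V) → 𝓀[F]) :=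
    { toFun := fun z i => IsLocalRing.residue _ (⟨b'.repr z.1 i, (hb' _).1 z.2 i⟩ : 𝒪[F])
      map_add' := by
        intro x y
        ext i
        rw [Pi.add_apply, ← map_add]
        congr 1
        ext
        simp
      map_smul' := by
        intro a x
        ext i
        rw [Pi.smul_apply, Algebra.smul_def]
        change _ = IsLocalRing.residue _ a * _
        rw [← map_mul]
        congr 1
        ext
        change b'.repr ((a : F) • x.1) i = _
        simp }
  have hf : Function.Surjective f := by
    intro c
    choose d hd using fun i => IsLocalRing.residue_surjective (R := 𝒪[F]) (c i)
    have hm : ∀ i, b'.repr (∑ i, (d i : F) • b' i) i = d i := fun i => by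
      rw [b'.repr_sum_self]
    refine ⟨⟨∑ i, (d i : F) • b' i, (hb' _).2 fun i => ?_⟩, ?_⟩
    · rw [hm]; exact (d i).2
    · ext i
      rw [← hd]
      change IsLocalRing.residue _ _ = _
      congr 1
      ext
      exact hm i
  have hker : LinearMap.ker f = (subDual h L).submoduleOf (dualLattice h L) := by
    ext z
    rw [LinearMap.mem_ker, funext_iff]
    change (∀ i, IsLocalRing.residue _ _ = 0) ↔ z.1 ∈ subDual h L
    simp only [IsLocalRing.residue_eq_zero_iff, IsLocalRing.mem_maximalIdeal, mem_nonunits_iff,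
        Valuation.Integer.not_isUnit_iff_valuation_lt_one]
    rw [mem_subDual]
    constructor
    · intro H x hx
      rw [form_sum_left b x]
      refine Valuation.map_sum_lt _ one_ne_zero fun i _ => ?_
      rw [map_mul, hR.val_map, h1]
      exact (mul_le_of_le_one_left' ((hb x).1 hx i)).trans_lt (H i)
    · intro H i
      rw [← h1]
      refine H _ ((hb _).2 fun j => ?_)
      rw [b.repr_self, Finsupp.single_apply]
      split_ifs <;> simp
  have hsimple : IsSimpleModule 𝒪[F] 𝓀[F] := by
    rw [isSimpleModule_iff_quot_maximal]
    exact ⟨𝓂[F], inferInstance, ⟨LinearEquiv.refl _ _⟩⟩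
  rw [relLength, ← hker, (f.quotKerEquivOfSurjective hf).length_eq, Module.length_pi,
    Module.length_eq_one]
  simp

end Duality

/-! ### Residues -/

section Residue

variable {F : Type*} [Field F] [ValuativeRel F]

open Classical in
/-- The residue class of an integral element of `F` (and `0` for nonintegral elements). -/
noncomputable def resid (x : F) : 𝓀[F] :=
  if hx : valuation F x ≤ 1 then IsLocalRing.residue 𝒪[F] ⟨x, hx⟩ else 0

theorem resid_of_le {x : F} (hx : valuation F x ≤ 1) :
    resid x = IsLocalRing.residue 𝒪[F] ⟨x, hx⟩ := dif_pos hx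

theorem resid_eq_zero_iff {x : F} (hx : valuation F x ≤ 1) : resid x = 0 ↔ valuation F x < 1 := by
  rw [resid_of_le hx, IsLocalRing.residue_eq_zero_iff, IsLocalRing.mem_maximalIdeal,
    mem_nonunits_iff, Valuation.Integer.not_isUnit_iff_valuation_lt_one]

theorem resid_eq_zero {x : F} (hx : valuation F x < 1) : resid x = 0 :=
  (resid_eq_zero_iff hx.le).2 hx

theorem resid_ne_zero_iff {x : F} (hx : valuation F x ≤ 1) :
    resid x ≠ 0 ↔ valuation F x = 1 := by
  rw [Ne, resid_eq_zero_iff hx, not_lt]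
  exact ⟨fun h => le_antisymm hx h, fun h => h.ge⟩

theorem resid_ne_zero {x : F} (hx : valuation F x = 1) : resid x ≠ 0 :=
  (resid_ne_zero_iff hx.le).2 hx

theorem resid_add {x y : F} (hx : valuation F x ≤ 1) (hy : valuation F y ≤ 1) :
    resid (x + y) = resid x + resid y := by
  rw [resid_of_le hx, resid_of_le hy, resid_of_le (Valuation.map_add_le _ hx hy), ← map_add]
  rfl

theorem resid_mul {x y : F} (hx : valuation F x ≤ 1) (hy : valuation F y ≤ 1) :
    resid (x * y) = resid x * resid y := by
  have hxy : valuation F (x * y) ≤ 1 := by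
    rw [map_mul]; exact mul_le_one' hx hy
  rw [resid_of_le hx, resid_of_le hy, resid_of_le hxy, ← map_mul]
  rfl

theorem resid_one : resid (1 : F) = 1 := by
  rw [resid_of_le (by simp), ← map_one (IsLocalRing.residue 𝒪[F])]
  rfl

theorem resid_neg {x : F} (hx : valuation F x ≤ 1) : resid (-x) = -resid x := by
  rw [eq_neg_iff_add_eq_zero, ← resid_add (by rwa [Valuation.map_neg]) hx, neg_add_cancel]
  exact resid_eq_zero (by simp)

theorem resid_sub {x y : F} (hx : valuation F x ≤ 1) (hy : valuation F y ≤ 1) :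
    resid (x - y) = resid x - resid y := by
  rw [sub_eq_add_neg, resid_add hx (by rwa [Valuation.map_neg]), resid_neg hy, sub_eq_add_neg]

theorem resid_two : resid (2 : F) = 2 := by
  rw [← one_add_one_eq_two, resid_add (by simp) (by simp), resid_one, one_add_one_eq_two]

theorem exists_resid_eq (a : 𝓀[F]) : ∃ x : F, valuation F x ≤ 1 ∧ resid x = a := by
  obtain ⟨x, rfl⟩ := IsLocalRing.residue_surjective a
  exact ⟨x, x.2, resid_of_le x.2⟩

theorem resid_sub_eq_zero_iff {x y : F} (hx : valuation F x ≤ 1) (hy : valuation F y ≤ 1) :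
    resid x = resid y ↔ valuation F (x - y) < 1 := by
  rw [← sub_eq_zero, ← resid_sub hx hy, resid_eq_zero_iff ((valuation F).map_sub_le hx hy)]

variable {σ : F →+* F} {π : F}

/-- The involution acts trivially on the residue field because the extension is ramified. This turns
hermitian forms into symmetric ones modulo `π`. -/
theorem IsRamified.resid_map (hR : IsRamified σ π) (x : F) : resid (σ x) = resid x := by
  by_cases hx : valuation F x ≤ 1
  · rw [resid_sub_eq_zero_iff (by rwa [hR.val_map]) hx]
    exact hR.map_sub_lt x hx
  · rw [resid, dif_neg (by rwa [hR.val_map]), resid, dif_neg hx]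

theorem IsRamified.two_ne_zero (hR : IsRamified σ π) : (2 : 𝓀[F]) ≠ 0 := by
  rw [← resid_two]
  exact resid_ne_zero hR.val_two

end Residue

/-! ### Vertex lattices -/

section Vertex

variable {F : Type*} [Field F] [ValuativeRel F] {σ : F →+* F} {π : F}
  {V : Type*} [AddCommGroup V] [Module F V] {h : V →ₛₗ[σ] V →ₗ[F] F}

/-- The residue of the value of a hermitian form. -/
noncomputable def resForm (h : V →ₛₗ[σ] V →ₗ[F] F) (x y : V) : 𝓀[F] := resid (h x y)

section

variable {M : Submodule 𝒪[F] V}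

theorem resForm_add_left (hM : M ≤ dualLattice h M) {x y z : V} (hx : x ∈ M) (hy : y ∈ M)
    (hz : z ∈ M) : resForm h (x + y) z = resForm h x z + resForm h y z := by
  rw [resForm, map_add, LinearMap.add_apply, resid_add (hM hz x hx) (hM hz y hy)]
  rfl

theorem resForm_sub_left (hM : M ≤ dualLattice h M) {x y z : V} (hx : x ∈ M) (hy : y ∈ M)
    (hz : z ∈ M) : resForm h (x - y) z = resForm h x z - resForm h y z := by
  rw [resForm, map_sub, LinearMap.sub_apply, resid_sub (hM hz x hx) (hM hz y hy)]
  rfl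

theorem resForm_smul_right (hM : M ≤ dualLattice h M) {a : F} (ha : valuation F a ≤ 1) {x z : V}
    (hx : x ∈ M) (hz : z ∈ M) : resForm h x (a • z) = resid a * resForm h x z := by
  rw [resForm, map_smul, smul_eq_mul, resid_mul ha (hM hz x hx)]
  rfl

theorem resForm_add_right (hM : M ≤ dualLattice h M) {x y z : V} (hx : x ∈ M) (hy : y ∈ M)
    (hz : z ∈ M) : resForm h z (x + y) = resForm h z x + resForm h z y := by
  rw [resForm, map_add, resid_add (hM hx z hz) (hM hy z hz)]
  rfl

theorem resForm_sub_right (hM : M ≤ dualLattice h M) {x y z : V} (hx : x ∈ M) (hy : y ∈ M)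
    (hz : z ∈ M) : resForm h z (x - y) = resForm h z x - resForm h z y := by
  rw [resForm, map_sub, resid_sub (hM hx z hz) (hM hy z hz)]
  rfl

theorem IsRamified.resForm_comm (hR : IsRamified σ π) (hs : h.IsSymm) (x y : V) :
    resForm h x y = resForm h y x := by
  rw [resForm, ← hs.eq y x, hR.resid_map]
  rfl

theorem IsRamified.resForm_smul_left (hR : IsRamified σ π) (hM : M ≤ dualLattice h M) {a : F}
    (ha : valuation F a ≤ 1) {x z : V}
    (hx : x ∈ M) (hz : z ∈ M) : resForm h (a • x) z = resid a * resForm h x z := by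
  rw [resForm, LinearMap.map_smulₛₗ, LinearMap.smul_apply, smul_eq_mul,
    resid_mul (by rwa [hR.val_map]) (hM hz x hx), hR.resid_map]
  rfl

theorem resForm_eq_zero_iff (hM : M ≤ dualLattice h M) {x y : V} (hx : x ∈ M) (hy : y ∈ M) :
    resForm h x y = 0 ↔ valuation F (h x y) < 1 := resid_eq_zero_iff (hM hy x hx)

theorem resForm_ne_zero_iff (hM : M ≤ dualLattice h M) {x y : V} (hx : x ∈ M) (hy : y ∈ M) :
    resForm h x y ≠ 0 ↔ valuation F (h x y) = 1 := resid_ne_zero_iff (hM hy x hx)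

theorem small_smul_mem_subDual {L : Submodule 𝒪[F] V} (hM : M ≤ dualLattice h M) (hL : L ≤ M)
    {a : F} (ha : valuation F a < 1) {x : V} (hx : x ∈ M) : a • x ∈ subDual h L := by
  intro y hy
  rw [map_smul, smul_eq_mul, map_mul]
  exact (mul_le_of_le_one_right' (hM hx y (hL hy))).trans_lt ha

end

section

variable {t : ℕ} {L : Submodule 𝒪[F] V}

theorem LatticeModel.IsVertexLattice.relLength_eq (hL : IsVertexLattice h t L) :
    relLength L (dualLattice h L) = t := hL.4

theorem IsRamified.subDual_le (hR : IsRamified σ π) (hL : L ∈ Vert h t) : subDual h L ≤ L :=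
  (hR.isVertexLattice_iff.1 hL).2.1

variable [FiniteDimensional F V] [TopologicalSpace F] [IsNonarchimedeanLocalField F]

omit [FiniteDimensional F V] [TopologicalSpace F] [IsNonarchimedeanLocalField F] in
-- In the chain `L ≤ M ≤ M^∨ ≤ L^∨` the inner and the outer quotient both have length `t`.
theorem vert_eq_of_le {L M : Submodule 𝒪[F] V} (hL : L ∈ Vert h t) (hM : M ∈ Vert h t)
    (hLM : L ≤ M) : L = M :=
  eq_of_chain hLM hM.le_dual (dual_anti hLM) hL.4 hM.4

/-- Computes the dimension of the reduced quadratic space `L / π L^∨`, by splitting `L^∨ / π L^∨` at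
`L`. -/
theorem IsRamified.relLength_subDual (hR : IsRamified σ π) (hs : h.IsSymm) (hnd : h.Nondegenerate)
    (hL : L ∈ Vert h t) : relLength (subDual h L) L + t = Module.finrank F V := by
  rw [← hR.relLength_subDual_dual hs hnd hL.1, ← hL.relLength_eq]
  exact (relLength_add (hR.subDual_le hL) hL.le_dual).symm

/-- In maximal type `L^∨ / L` is as long as `L^∨ / π L^∨`. -/
theorem IsRamified.subDual_eq (hR : IsRamified σ π) (hs : h.IsSymm) (hnd : h.Nondegenerate)
    (hL : L ∈ Vert h (Module.finrank F V)) : subDual h L = L :=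
  eq_of_chain (hR.subDual_le hL) hL.le_dual le_rfl
    (hR.relLength_subDual_dual hs hnd hL.1) hL.4

theorem IsRamified.le_finrank (hR : IsRamified σ π) (hs : h.IsSymm) (hnd : h.Nondegenerate)
    (hL : L ∈ Vert h t) : t ≤ Module.finrank F V := by
  have h1 := hR.relLength_subDual hs hnd hL
  rw [← Nat.cast_le (α := ℕ∞), ← h1]
  exact le_add_self

/-- Otherwise the reduced symmetric form vanishes on the diagonal, hence everywhere by polarization,
as `2` is invertible. Then `L = π L^∨`, which forces the maximal type. -/
theorem IsRamified.exists_unit_vector (hR : IsRamified σ π) (hs : h.IsSymm) (hnd : h.Nondegenerate)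
    (hL : L ∈ Vert h t) (ht : t < Module.finrank F V) : ∃ e ∈ L, valuation F (h e e) = 1 := by
  by_contra! hcon
  have h0 : ∀ x ∈ L, resForm h x x = 0 := fun x hx => by
    by_contra h1
    exact hcon x hx ((resForm_ne_zero_iff hL.le_dual hx hx).1 h1)
  have h1 : L ≤ subDual h L := by
    intro y hy x hx
    rw [← resForm_eq_zero_iff hL.le_dual hx hy]
    have h2 := h0 _ (add_mem hx hy)
    rw [resForm_add_left hL.le_dual hx hy (add_mem hx hy), resForm_add_right hL.le_dual hx hy hx,
      resForm_add_right hL.le_dual hx hy hy, h0 x hx, h0 y hy, hR.resForm_comm hs y x] at h2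
    have h3 : 2 * resForm h x y = 0 := by linear_combination h2
    exact (mul_eq_zero.1 h3).resolve_left hR.two_ne_zero
  have h2 := hR.relLength_subDual_dual hs hnd hL.1
  rw [le_antisymm (hR.subDual_le hL) h1, hL.relLength_eq] at h2
  exact ht.ne (by exact_mod_cast h2)

/-- If no pairing with `π L^∨` were a unit, all of them would be divisible by `π`, so `x` would pair
integrally with `L^∨` and lie in the bidual `L`. -/
theorem IsRamified.exists_unit_pairing (hR : IsRamified σ π) (hs : h.IsSymm)
    (hnd : h.Nondegenerate) (hL : L.IsLattice F) {x : V} (hx : x ∉ L)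
    (hx' : ∀ z ∈ subDual h L, valuation F (h z x) ≤ 1) :
    ∃ i ∈ subDual h L, valuation F (h i x) = 1 := by
  by_contra! hcon
  refine hx ?_
  rw [← hR.dual_dual hs hnd hL]
  intro z hz
  have h1 := hR.unif_smul_mem_subDual hz
  have h2 := lt_of_le_of_ne (hx' _ h1) (hcon _ h1)
  have h3 := hR.unif_inv h2
  rw [LinearMap.map_smulₛₗ, LinearMap.smul_apply, smul_eq_mul, hR.map_unif, ← mul_assoc, mul_neg,
    inv_mul_cancel₀ hR.unif_ne, neg_one_mul, Valuation.map_neg] at h3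
  exact h3

/-- Adjoining a vector to a vertex lattice lowers its type by two. -/
theorem IsRamified.vert_sup_span (hR : IsRamified σ π) (hs : h.IsSymm) (hnd : h.Nondegenerate)
    {s : ℕ} (hL : L ∈ Vert h s) {x : V} (hx : x ∉ L) (hxx : valuation F (h x x) ≤ 1)
    (hxL' : x ∈ dualLattice h L) :
    ∃ t, t + 2 = s ∧ L ⊔ Submodule.span 𝒪[F] {x} ∈ Vert h t := by
  set N := L ⊔ Submodule.span 𝒪[F] {x} with hN
  have hLN : L ≤ N := le_sup_left
  have hxN : x ∈ N := le_sup_right (a := L) (Submodule.mem_span_singleton_self x)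
  have hdual : ∀ z, z ∈ dualLattice h N ↔ z ∈ dualLattice h L ∧ valuation F (h x z) ≤ 1 := by
    intro z
    refine ⟨fun hz => ⟨dual_anti hLN hz, hz x hxN⟩, fun hz y hy => ?_⟩
    obtain ⟨l, hl, w, hw, rfl⟩ := Submodule.mem_sup.1 hy
    obtain ⟨a, rfl⟩ := Submodule.mem_span_singleton.1 hw
    rw [map_add, LinearMap.add_apply, show a • x = (a : F) • x from rfl, LinearMap.map_smulₛₗ,
      LinearMap.smul_apply, smul_eq_mul]
    refine Valuation.map_add_le (valuation F) (mem_dualLattice.1 hz.1 l hl) ?_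
    rw [map_mul, hR.val_map]
    exact mul_le_one' a.2 hz.2
  have hsmall : ∀ a : F, valuation F a < 1 → a • x ∈ L := by
    intro a ha
    refine hR.subDual_le hL fun y hy => ?_
    rw [map_smul, smul_eq_mul, map_mul]
    exact (mul_le_of_le_one_right' (hxL' y hy)).trans_lt ha
  have hNd : N ≤ dualLattice h N := by
    intro y hy
    obtain ⟨l, hl, w, hw, rfl⟩ := Submodule.mem_sup.1 hy
    obtain ⟨a, rfl⟩ := Submodule.mem_span_singleton.1 hw
    refine add_mem ((hdual l).2 ⟨hL.le_dual hl, ?_⟩)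
      (Submodule.smul_mem _ _ ((hdual x).2 ⟨hxL', hxx⟩))
    rw [hR.valuation_comm hs]
    exact hxL' l hl
  have hlen1 : relLength L N = 1 := relLength_sup_span hx hsmall
  have hxL : ∀ z ∈ subDual h L, valuation F (h z x) ≤ 1 := fun z hz => hxL' z (hR.subDual_le hL hz)
  -- A vector of `π L^∨` pairing to a unit with `x`; `π⁻¹ i` will generate the dual of `L` over the
  -- dual of `N`.
  obtain ⟨i, hi, hix⟩ := hR.exists_unit_pairing hs hnd hL.1 hx hxL
  have hxi : valuation F (h x i) = 1 := by rw [hR.valuation_comm hs]; exact hix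
  have hxi0 : h x i ≠ 0 := fun h0 => by simp [h0] at hxi
  have hi' : π⁻¹ • i ∈ dualLattice h L := hR.mem_subDual_iff.1 hi
  -- Subtracting the multiple of `π⁻¹ i` that makes a vector of `L^∨` orthogonal to `x` brings it
  -- into `N^∨`.
  have hidual : dualLattice h L = dualLattice h N ⊔ Submodule.span 𝒪[F] {π⁻¹ • i} := by
    refine le_antisymm (fun z hz => ?_) (sup_le (dual_anti hLN)
      ((Submodule.span_singleton_le_iff_mem _ _).2 hi'))
    have h1 : valuation F (π * h x z) ≤ 1 := by
      rw [← smul_eq_mul, ← map_smul, hR.valuation_comm hs]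
      exact hxL _ (hR.unif_smul_mem_subDual hz)
    have ha : valuation F (π * h x z / h x i) ≤ 1 := by
      rw [map_div₀, hxi, div_one]
      exact h1
    have hz' : z = (z - (π * h x z / h x i) • π⁻¹ • i) + (π * h x z / h x i) • π⁻¹ • i := by
      rw [sub_add_cancel]
    rw [hz']
    refine Submodule.add_mem_sup ((hdual _).2 ⟨sub_mem hz (int_smul_mem ha hi'), ?_⟩)
      (int_smul_mem ha (Submodule.mem_span_singleton_self _))
    have : h x (z - (π * h x z / h x i) • π⁻¹ • i) = 0 := by
      rw [map_sub, map_smul, map_smul, smul_eq_mul, smul_eq_mul]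
      have := hR.unif_ne
      field_simp
      ring
    rw [this]
    simp
  have hlen2 : relLength (dualLattice h N) (dualLattice h L) = 1 := by
    rw [hidual]
    refine relLength_sup_span (fun hmem => ?_) fun a ha => ?_
    · have h1 := ((hdual _).1 hmem).2
      rw [map_smul, smul_eq_mul, map_mul, hxi, mul_one, map_inv₀,
        inv_le_one₀ (zero_lt_iff.2 (by simpa using hR.unif_ne))] at h1
      exact absurd hR.unif_lt (not_lt.2 h1)
    · rw [smul_smul, mul_comm]
      refine int_smul_mem (hR.unif_inv ha) (hNd (hLN (hR.subDual_le hL hi)))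
  have hlen : (s : ℕ∞) = 1 + (relLength N (dualLattice h N) + 1) := by
    rw [← hL.relLength_eq, relLength_add hLN (hNd.trans (dual_anti hLN)),
      relLength_add hNd (dual_anti hLN), hlen1, hlen2]
  have hfin : relLength N (dualLattice h N) ≠ ⊤ := by
    intro htop
    rw [htop] at hlen
    simp at hlen
  obtain ⟨t, ht⟩ := ENat.ne_top_iff_exists.1 hfin
  refine ⟨t, ?_, hR.isVertexLattice_iff.2 ⟨⟨?_, ?_⟩, ?_, hNd, ht.symm⟩⟩
  · rw [← ht] at hlen
    have : s = 1 + (t + 1) := by exact_mod_cast hlen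
    omega
  · exact hL.1.fg.sup (Submodule.fg_span_singleton x)
  · rw [eq_top_iff, ← hL.1.span_eq_top]
    exact Submodule.span_mono hLN
  · exact (subDual_anti hLN).trans ((hR.subDual_le hL).trans hLN)

/-- The sublattice of vectors whose pairing with `i` is not a unit. -/
noncomputable def pairingKernel (h : V →ₛₗ[σ] V →ₗ[F] F) (i : V) (M : Submodule 𝒪[F] V) : Submodule 𝒪[F] V :=
  M ⊓ subDual h (Submodule.span 𝒪[F] {i})

omit [FiniteDimensional F V] [TopologicalSpace F] [IsNonarchimedeanLocalField F] in
theorem IsRamified.mem_pairingKernel (hR : IsRamified σ π) {i : V} {M : Submodule 𝒪[F] V} {v : V} :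
    v ∈ pairingKernel h i M ↔ v ∈ M ∧ valuation F (h i v) < 1 := by
  refine and_congr_right fun _ => ⟨fun H => H i (Submodule.mem_span_singleton_self i),
    fun H x hx => ?_⟩
  obtain ⟨a, rfl⟩ := Submodule.mem_span_singleton.1 hx
  rw [show a • i = (a : F) • i from rfl, LinearMap.map_smulₛₗ, LinearMap.smul_apply, smul_eq_mul,
    map_mul, hR.val_map]
  exact (mul_le_of_le_one_left' a.2).trans_lt H

omit [FiniteDimensional F V] in
/-- An isotropic line modulo `π` determines a vertex sublattice of larger type. -/
theorem IsRamified.vert_pairingKernel (hR : IsRamified σ π) (hs : h.IsSymm)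
    (hL : L ∈ Vert h t) {i : V} (hi : i ∈ L)
    (hi' : i ∉ subDual h L) (hii : resForm h i i = 0) :
    pairingKernel h i L ∈ Vert h (t + 2) := by
  set N := pairingKernel h i L with hN
  have hmem : ∀ v, v ∈ N ↔ v ∈ L ∧ valuation F (h i v) < 1 := fun v => hR.mem_pairingKernel
  have hNL : N ≤ L := inf_le_left
  have hiN : i ∈ N := (hmem i).2 ⟨hi, (resForm_eq_zero_iff hL.le_dual hi hi).1 hii⟩
  -- As `i` is not in the radical, some `w` pairs with it to a unit, and then `L` is generated by
  -- `N` and `w`.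
  obtain ⟨w, hw, hiw⟩ : ∃ w ∈ L, valuation F (h i w) = 1 := by
    by_contra! hcon
    refine hi' fun x hx => ?_
    rw [hR.valuation_comm hs]
    exact lt_of_le_of_ne (hL.le_dual hx i hi) (hcon x hx)
  have hiw0 : h i w ≠ 0 := fun h0 => by simp [h0] at hiw
  have hwi0 : h w i ≠ 0 := fun h0 => by rw [hR.valuation_comm hs] at hiw; simp [h0] at hiw
  have hLN : L = N ⊔ Submodule.span 𝒪[F] {w} := by
    refine le_antisymm (fun z hz => ?_)
      (sup_le hNL ((Submodule.span_singleton_le_iff_mem _ _).2 hw))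
    have ha : valuation F (h i z / h i w) ≤ 1 := by
      rw [map_div₀, hiw, div_one]
      exact hL.le_dual hz i hi
    rw [← sub_add_cancel z ((h i z / h i w) • w)]
    refine Submodule.add_mem_sup ((hmem _).2 ⟨sub_mem hz (int_smul_mem ha hw), ?_⟩)
      (int_smul_mem ha (Submodule.mem_span_singleton_self _))
    have : h i (z - (h i z / h i w) • w) = 0 := by
      rw [map_sub, map_smul, smul_eq_mul]
      field_simp
      ring
    rw [this]
    simp
  have hsmall : ∀ a : F, valuation F a < 1 → ∀ z ∈ L, a • z ∈ N := by
    intro a ha z hz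
    refine (hmem _).2 ⟨int_smul_mem ha.le hz, ?_⟩
    rw [map_smul, smul_eq_mul, map_mul]
    exact (mul_le_of_le_one_right' (hL.le_dual hz i hi)).trans_lt ha
  have hlen1 : relLength N L = 1 := by
    rw [hLN]
    refine relLength_sup_span (fun hwN => ?_) fun a ha => hsmall a ha w hw
    exact ((hmem w).1 hwN).2.ne hiw
  have hπi : π⁻¹ • i ∈ dualLattice h N := by
    intro x hx
    rw [map_smul, smul_eq_mul]
    refine hR.unif_inv ?_
    rw [hR.valuation_comm hs]
    exact ((hmem x).1 hx).2
  -- A vector of `N^∨` can be corrected by a multiple of `π⁻¹ i` to become orthogonal to `w`, after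
  -- which it pairs integrally with all of `L`.
  have hdual : dualLattice h N = dualLattice h L ⊔ Submodule.span 𝒪[F] {π⁻¹ • i} := by
    refine le_antisymm (fun z hz => ?_)
      (sup_le (dual_anti hNL) ((Submodule.span_singleton_le_iff_mem _ _).2 hπi))
    have h1 : valuation F (π * h w z) ≤ 1 := by
      rw [← Valuation.map_neg, ← neg_mul, ← hR.map_unif, ← smul_eq_mul, ← LinearMap.smul_apply,
        ← LinearMap.map_smulₛₗ]
      exact hz _ (hsmall _ hR.unif_lt w hw)
    have ha : valuation F (π * h w z / h w i) ≤ 1 := by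
      rw [map_div₀, hR.valuation_comm hs w i, hiw, div_one]
      exact h1
    rw [← sub_add_cancel z ((π * h w z / h w i) • π⁻¹ • i)]
    refine Submodule.add_mem_sup ?_ (int_smul_mem ha (Submodule.mem_span_singleton_self _))
    have hz' : z - (π * h w z / h w i) • π⁻¹ • i ∈ dualLattice h N :=
      sub_mem hz (int_smul_mem ha hπi)
    have h0 : h w (z - (π * h w z / h w i) • π⁻¹ • i) = 0 := by
      rw [map_sub, map_smul, map_smul, smul_eq_mul, smul_eq_mul]
      have := hR.unif_ne
      field_simp
      ring
    intro y hy
    rw [hLN] at hy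
    obtain ⟨l, hl, v, hv, rfl⟩ := Submodule.mem_sup.1 hy
    obtain ⟨a, rfl⟩ := Submodule.mem_span_singleton.1 hv
    rw [map_add, LinearMap.add_apply, show a • w = (a : F) • w from rfl, LinearMap.map_smulₛₗ,
      LinearMap.smul_apply, h0, smul_zero, add_zero]
    exact hz' l hl
  have hlen2 : relLength (dualLattice h L) (dualLattice h N) = 1 := by
    rw [hdual]
    refine relLength_sup_span (fun H => hi' (hR.mem_subDual_iff.2 H)) fun a ha => ?_
    rw [smul_smul, mul_comm]
    exact int_smul_mem (hR.unif_inv ha) (hL.le_dual hi)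
  refine hR.isVertexLattice_iff.2 ⟨⟨?_, ?_⟩, ?_, ?_, ?_⟩
  · exact Submodule.FG.of_le hL.1.fg hNL
  · rw [eq_top_iff, ← hL.1.span_eq_top, Submodule.span_le]
    intro z hz
    have := Submodule.smul_mem (Submodule.span F (N : Set V)) π⁻¹
      (Submodule.subset_span (hsmall _ hR.unif_lt z hz))
    rwa [inv_smul_smul₀ hR.unif_ne] at this
  · intro z hz
    have h1 := hR.mem_subDual_iff.1 hz
    rw [hdual] at h1
    obtain ⟨l, hl, v, hv, hlv⟩ := Submodule.mem_sup.1 h1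
    obtain ⟨a, rfl⟩ := Submodule.mem_span_singleton.1 hv
    have h2 : z = π • l + (a : F) • i := by
      have h3 := congrArg (π • ·) hlv
      simp only [smul_inv_smul₀ hR.unif_ne, smul_add] at h3
      rw [← h3, show a • π⁻¹ • i = (a : F) • π⁻¹ • i from rfl, smul_comm π, smul_inv_smul₀ hR.unif_ne]
    rw [h2]
    have h4 := hR.unif_smul_mem_subDual hl
    exact add_mem ((hmem _).2 ⟨hR.subDual_le hL h4, h4 i hi⟩) (int_smul_mem a.2 hiN)
  · exact hNL.trans (hL.le_dual.trans (dual_anti hNL))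
  · rw [relLength_add hNL (hL.le_dual.trans (dual_anti hNL)), relLength_add hL.le_dual
      (dual_anti hNL), hlen1, hlen2, hL.relLength_eq]
    push_cast
    ring

omit [FiniteDimensional F V] in
-- Since `i` lies in `N` and pairs trivially with `N` modulo `π`, it is isotropic modulo `π` and `N`
-- lies in its pairing kernel, a vertex lattice of the same type.
theorem IsRamified.eq_pairingKernel (hR : IsRamified σ π) (hs : h.IsSymm)
    (hL : L ∈ Vert h t) {N : Submodule 𝒪[F] V} (hN : N ∈ Vert h (t + 2)) (hNL : N ≤ L) {i : V}
    (hi : i ∈ subDual h N) (hi' : i ∉ subDual h L) : N = pairingKernel h i L := by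
  have hiN := hR.subDual_le hN hi
  refine vert_eq_of_le hN (hR.vert_pairingKernel hs hL (hNL hiN) hi' ?_) fun v hv => ?_
  · rw [resForm_eq_zero_iff hL.le_dual (hNL hiN) (hNL hiN)]
    exact hi i hiN
  · rw [hR.mem_pairingKernel]
    refine ⟨hNL hv, ?_⟩
    rw [hR.valuation_comm hs]
    exact hi v hv

theorem IsRamified.dual_le_dual_iff (hR : IsRamified σ π) (hs : h.IsSymm) (hnd : h.Nondegenerate)
    {L M : Submodule 𝒪[F] V} (hL : L.IsLattice F) (hM : M.IsLattice F) :
    dualLattice h M ≤ dualLattice h L ↔ L ≤ M := by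
  refine ⟨fun H => ?_, dual_anti⟩
  rw [← hR.dual_dual hs hnd hL, ← hR.dual_dual hs hnd hM]
  exact dual_anti H

theorem IsRamified.subDual_le_subDual_iff (hR : IsRamified σ π) (hs : h.IsSymm)
    (hnd : h.Nondegenerate) {L M : Submodule 𝒪[F] V} (hL : L.IsLattice F) (hM : M.IsLattice F) :
    subDual h M ≤ subDual h L ↔ L ≤ M := by
  rw [← hR.dual_le_dual_iff hs hnd hL hM]
  constructor
  · intro H z hz
    have := hR.mem_subDual_iff.1 (H (hR.unif_smul_mem_subDual hz))
    rwa [inv_smul_smul₀ hR.unif_ne] at this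
  · intro H z hz
    exact hR.mem_subDual_iff.2 (H (hR.mem_subDual_iff.1 hz))

/-- Duality reverses inclusions: if `π N^∨` were contained in `π L^∨`, then `L ≤ N`, and the types
would agree. -/
theorem IsRamified.exists_mem_subDual (hR : IsRamified σ π) (hs : h.IsSymm)
    (hnd : h.Nondegenerate) (hL : L ∈ Vert h t) {N : Submodule 𝒪[F] V} (hN : N ∈ Vert h (t + 2))
    (hNL : N ≤ L) : ∃ i ∈ subDual h N, i ∉ subDual h L := by
  by_contra! hcon
  have h1 : N = L := le_antisymm hNL ((hR.subDual_le_subDual_iff hs hnd hL.1 hN.1).1 hcon)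
  have h2 := hN.relLength_eq
  rw [h1, hL.relLength_eq] at h2
  have : t = t + 2 := by exact_mod_cast h2
  omega

end

end Vertex

/-! ### Orthogonal sums with a line -/

section Ext

variable {F : Type*} [Field F] {σ : F →+* F} {π : F}
  {V : Type*} [AddCommGroup V] [Module F V] {h : V →ₛₗ[σ] V →ₗ[F] F} {c : F}

theorem extForm_apply (x y : V × F) : extForm h c x y = h x.1 y.1 + c * σ x.2 * y.2 := rfl

theorem extForm_isSymm (hs : h.IsSymm) (hσ : ∀ x, σ (σ x) = x) (hc : σ c = c) :
    (extForm h c).IsSymm := by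
  refine ⟨fun x y => ?_⟩
  rw [extForm_apply, extForm_apply, map_add, hs.eq, map_mul, map_mul, hσ, hc]
  ring

theorem extForm_nondegenerate (hs : h.IsSymm) (hnd : h.Nondegenerate) (hσ : ∀ x, σ (σ x) = x)
    (hc : σ c = c) (hc0 : c ≠ 0) : (extForm h c).Nondegenerate := by
  have hr : ∀ y, (∀ x, extForm h c x y = 0) → y = 0 := by
    intro y hy
    refine Prod.ext (hnd.2 _ fun x => ?_) ?_
    · simpa [extForm_apply] using hy (x, 0)
    · simpa [extForm_apply, hc0] using hy (0, 1)
  refine ⟨fun x hx => hr x fun y => ?_, hr⟩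
  rw [← (extForm_isSymm hs hσ hc).eq, hx, map_zero]

variable [ValuativeRel F]

theorem specialVec_mem_addLine (L : Submodule 𝒪[F] V) : specialVec F V ∈ addLine L :=
  mem_addLine.2 ⟨zero_mem L, by simp [specialVec]⟩

theorem mem_flatPart {L : Submodule 𝒪[F] (V × F)} {x : V} : x ∈ flatPart L ↔ (x, 0) ∈ L := Iff.rfl

theorem flatPart_addLine (L : Submodule 𝒪[F] V) : flatPart (addLine L) = L := by
  ext x
  rw [mem_flatPart, mem_addLine]
  simp

theorem addLine_le_iff {L M : Submodule 𝒪[F] V} : addLine L ≤ addLine M ↔ L ≤ M := by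
  refine ⟨fun H x hx => ?_, fun H x hx => ?_⟩
  · rw [← flatPart_addLine M]
    refine H (mem_addLine.2 ⟨hx, by simp⟩)
  · rw [mem_addLine] at hx ⊢
    exact ⟨H hx.1, hx.2⟩

theorem addLine_injective : Function.Injective (addLine : Submodule 𝒪[F] V → _) := fun _ _ H =>
  le_antisymm (addLine_le_iff.1 H.le) (addLine_le_iff.1 H.ge)

theorem IsRamified.dual_addLine (hR : IsRamified σ π) (hc : valuation F c = 1)
    (L : Submodule 𝒪[F] V) :
    dualLattice (extForm h c) (addLine L) = addLine (dualLattice h L) := by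
  ext y
  rw [mem_addLine, mem_dualLattice, mem_dualLattice]
  constructor
  · intro H
    refine ⟨fun x hx => ?_, ?_⟩
    · simpa [extForm_apply] using H (x, 0) (mem_addLine.2 ⟨hx, by simp⟩)
    · have := H _ (specialVec_mem_addLine L)
      change valuation F y.2 ≤ 1
      simpa [extForm_apply, specialVec, hc] using this
  · rintro ⟨h1, h2⟩ x hx
    rw [mem_addLine] at hx
    rw [extForm_apply]
    refine Valuation.map_add_le _ (h1 _ hx.1) ?_
    rw [map_mul, map_mul, hc, one_mul, hR.val_map]
    exact mul_le_one' hx.2 h2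

theorem relLength_addLine (A B : Submodule 𝒪[F] V) :
    relLength (addLine A) (addLine B) = relLength A B := by
  let f : ↥(addLine B) →ₗ[𝒪[F]] (B ⧸ A.submoduleOf B) :=
    (Submodule.mkQ _).comp (LinearMap.codRestrict B
      ((LinearMap.fst 𝒪[F] V F).comp (addLine B).subtype) fun x => (mem_addLine.1 x.2).1)
  have hf : Function.Surjective f := by
    intro y
    obtain ⟨y, rfl⟩ := Submodule.Quotient.mk_surjective _ y
    exact ⟨⟨(y.1, 0), mem_addLine.2 ⟨y.2, by simp⟩⟩, rfl⟩
  have hk : LinearMap.ker f = (addLine A).submoduleOf (addLine B) := by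
    ext x
    rw [LinearMap.mem_ker]
    refine (Submodule.Quotient.mk_eq_zero _).trans ?_
    change x.1.1 ∈ A ↔ x.1 ∈ addLine A
    rw [mem_addLine]
    exact ⟨fun H => ⟨H, (mem_addLine.1 x.2).2⟩, fun H => H.1⟩
  rw [relLength, relLength, ← hk, (f.quotKerEquivOfSurjective hf).length_eq]

theorem addLine_mono {L M : Submodule 𝒪[F] V} (H : L ≤ M) : addLine L ≤ addLine M :=
  addLine_le_iff.2 H

theorem subDual_le_of_addLine {L : Submodule 𝒪[F] V} :
    subDual (extForm h c) (addLine L) ≤ addLine L → subDual h L ≤ L := by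
  intro H x hx
  have : ((x, 0) : V × F) ∈ addLine L := by
    refine H fun y hy => ?_
    simpa [extForm_apply] using hx _ (mem_addLine.1 hy).1
  exact (mem_addLine.1 this).1

theorem addLine_isLattice_iff {L : Submodule 𝒪[F] V} :
    (addLine L).IsLattice F ↔ L.IsLattice F := by
  have hmapfst : (addLine L).map (LinearMap.fst 𝒪[F] V F) = L := by
    ext x
    constructor
    · rintro ⟨y, hy, rfl⟩
      exact (mem_addLine.1 hy).1
    · intro hx
      exact ⟨(x, 0), mem_addLine.2 ⟨hx, by simp⟩, rfl⟩
  refine ⟨fun H => ⟨?_, ?_⟩, fun H => ⟨?_, ?_⟩⟩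
  · rw [← hmapfst]
    exact H.fg.map _
  · have h1 := congrArg (Submodule.map (LinearMap.fst F V F)) H.span_eq_top
    rw [Submodule.map_span, Submodule.map_top, LinearMap.range_eq_top.2 LinearMap.fst_surjective]
      at h1
    rw [← h1]
    congr 1
    ext x
    constructor
    · intro hx
      exact ⟨(x, 0), mem_addLine.2 ⟨hx, by simp⟩, rfl⟩
    · rintro ⟨y, hy, rfl⟩
      exact (mem_addLine.1 hy).1
  · exact (H.fg.map _).sup (Submodule.fg_span_singleton _)
  · rw [eq_top_iff]
    rintro ⟨x, a⟩ -
    have h1 : ((x, 0) : V × F) ∈ Submodule.span F (addLine L : Set (V × F)) := by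
      have h2 : x ∈ Submodule.span F (L : Set V) := H.span_eq_top ▸ Submodule.mem_top
      have h3 : LinearMap.inl F V F x ∈ (Submodule.span F (L : Set V)).map (LinearMap.inl F V F) :=
        ⟨x, h2, rfl⟩
      rw [Submodule.map_span] at h3
      refine Submodule.span_mono ?_ h3
      rintro _ ⟨y, hy, rfl⟩
      exact mem_addLine.2 ⟨hy, by simp⟩
    have h2 : a • specialVec F V ∈ Submodule.span F (addLine L : Set (V × F)) :=
      Submodule.smul_mem _ _ (Submodule.subset_span (specialVec_mem_addLine L))
    convert! add_mem h1 h2 using 1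
    simp [specialVec]

/-- The line `⟨u⟩` is self-dual because `c` is a unit, so it contributes nothing to the quotient of
the dual by the lattice. -/
theorem IsRamified.addLine_mem_vert_iff (hR : IsRamified σ π) (hc : valuation F c = 1) {t : ℕ}
    {L : Submodule 𝒪[F] V} : addLine L ∈ Vert (extForm h c) t ↔ L ∈ Vert h t := by
  have hc0 : c ≠ 0 := fun h0 => by simp [h0] at hc
  change IsVertexLattice _ _ _ ↔ IsVertexLattice _ _ _
  rw [hR.isVertexLattice_iff, hR.isVertexLattice_iff, hR.dual_addLine hc, relLength_addLine,
    addLine_le_iff]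
  refine and_congr addLine_isLattice_iff (and_congr ⟨subDual_le_of_addLine, fun H x hx => ?_⟩ Iff.rfl)
  · rw [mem_addLine]
    refine ⟨H fun y hy => ?_, ?_⟩
    · simpa [extForm_apply] using hx (y, 0) (mem_addLine.2 ⟨hy, by simp⟩)
    · have := hx _ (specialVec_mem_addLine L)
      simp only [extForm_apply, specialVec, map_zero, LinearMap.zero_apply, map_one, mul_one,
        zero_add, map_mul, hc, one_mul] at this
      exact this.le

/-- Integrality against `u`, of unit length, bounds the last coordinate, so subtracting the
projection onto `⟨u⟩` does not leave `L`. -/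
theorem addLine_flatPart (hc : valuation F c = 1) {L : Submodule 𝒪[F] (V × F)}
    (hL : L ≤ dualLattice (extForm h c) L) (hu : specialVec F V ∈ L) :
    addLine (flatPart L) = L := by
  have h2 : ∀ x ∈ L, valuation F x.2 ≤ 1 := fun x hx => by
    simpa [extForm_apply, specialVec, hc] using mem_dualLattice.1 (hL hx) _ hu
  ext x
  rw [mem_addLine, mem_flatPart]
  constructor
  · rintro ⟨h1, h2⟩
    have := add_mem h1 (int_smul_mem h2 hu)
    simpa [specialVec] using this
  · intro hx
    refine ⟨?_, h2 x hx⟩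
    have := sub_mem hx (int_smul_mem (h2 x hx) hu)
    have e : x - x.2 • specialVec F V = (x.1, 0) := by
      ext <;> simp [specialVec]
    rwa [e] at this

theorem IsRamified.flatPart_mem_vert (hR : IsRamified σ π) (hc : valuation F c = 1) {t : ℕ}
    {L : Submodule 𝒪[F] (V × F)} (hL : L ∈ Vert (extForm h c) t) (hu : specialVec F V ∈ L) :
    flatPart L ∈ Vert h t := by
  rw [← hR.addLine_mem_vert_iff hc, addLine_flatPart hc hL.le_dual hu]
  exact hL

theorem specialLine_le_iff {L : Submodule 𝒪[F] (V × F)} :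
    specialLine F V ≤ L ↔ specialVec F V ∈ L :=
  Submodule.span_singleton_le_iff_mem _ _

end Ext

/-! ### Unitary groups acting on lattices -/

section Unitary

variable {F : Type*} [Field F] [ValuativeRel F] {σ : F →+* F} {π : F}
  {V : Type*} [AddCommGroup V] [Module F V] {h : V →ₛₗ[σ] V →ₗ[F] F} {c : F}

omit [ValuativeRel F] in
theorem unitary_isIsometry (g : unitaryGroup h) : IsIsometry h h (g : V ≃ₗ[F] V) := g.2

omit [ValuativeRel F] in
theorem unitary_mul_apply (a b : unitaryGroup h) (x : V) :
    ((a * b : unitaryGroup h) : V ≃ₗ[F] V) x = (a : V ≃ₗ[F] V) ((b : V ≃ₗ[F] V) x) := rfl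

omit [ValuativeRel F] in
theorem unitary_inv_apply (a : unitaryGroup h) (x : V) :
    ((a⁻¹ : unitaryGroup h) : V ≃ₗ[F] V) x = (a : V ≃ₗ[F] V).symm x := rfl

theorem mapLattice_mul (a b : unitaryGroup h) (L : Submodule 𝒪[F] V) :
    mapLattice ((a * b : unitaryGroup h) : V ≃ₗ[F] V) L =
      mapLattice (a : V ≃ₗ[F] V) (mapLattice (b : V ≃ₗ[F] V) L) := by
  ext x
  simp only [mem_mapLattice]
  rfl

theorem mapLattice_one (L : Submodule 𝒪[F] V) :
    mapLattice ((1 : unitaryGroup h) : V ≃ₗ[F] V) L = L := by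
  ext x
  rw [mem_mapLattice]
  rfl

theorem mem_stab_iff {g : unitaryGroup h} {L : Submodule 𝒪[F] V} :
    g ∈ stab h L ↔ mapLattice (g : V ≃ₗ[F] V) L = L := by
  constructor
  · intro hg
    ext x
    rw [mem_mapLattice]
    have := hg ((g : V ≃ₗ[F] V).symm x)
    rw [LinearEquiv.apply_symm_apply] at this
    exact this.symm
  · intro hg x
    conv_lhs => rw [← hg]
    exact apply_mem_mapLattice

theorem mapLattice_inv_eq_iff {g : unitaryGroup h} {L M : Submodule 𝒪[F] V} :
    mapLattice ((g⁻¹ : unitaryGroup h) : V ≃ₗ[F] V) L = M ↔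
      L = mapLattice (g : V ≃ₗ[F] V) M := by
  constructor
  · rintro rfl
    rw [← mapLattice_mul, mul_inv_cancel, mapLattice_one]
  · rintro rfl
    rw [← mapLattice_mul, inv_mul_cancel, mapLattice_one]

theorem inv_mul_mem_stab_iff {a b : unitaryGroup h} {L : Submodule 𝒪[F] V} :
    a⁻¹ * b ∈ stab h L ↔ mapLattice (b : V ≃ₗ[F] V) L = mapLattice (a : V ≃ₗ[F] V) L := by
  rw [mem_stab_iff, mapLattice_mul, mapLattice_inv_eq_iff]

omit [ValuativeRel F] in
theorem embed_apply (a : unitaryGroup h) (x : V × F) :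
    ((embed h c a : unitaryGroup (extForm h c)) : (V × F) ≃ₗ[F] (V × F)) x =
      ((a : V ≃ₗ[F] V) x.1, x.2) := rfl

omit [ValuativeRel F] in
theorem embed_specialVec (a : unitaryGroup h) :
    ((embed h c a : unitaryGroup (extForm h c)) : (V × F) ≃ₗ[F] (V × F)) (specialVec F V) =
      specialVec F V := by
  rw [embed_apply]
  simp [specialVec]

theorem mapLattice_embed_addLine (a : unitaryGroup h) (L : Submodule 𝒪[F] V) :
    mapLattice ((embed h c a : unitaryGroup (extForm h c)) : (V × F) ≃ₗ[F] (V × F)) (addLine L) =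
      addLine (mapLattice (a : V ≃ₗ[F] V) L) := by
  ext x
  rw [mem_mapLattice, mem_addLine, mem_addLine, mem_mapLattice]
  rfl

theorem embed_mem_stab_addLine {a : unitaryGroup h} {L : Submodule 𝒪[F] V} :
    embed h c a ∈ stab (extForm h c) (addLine L) ↔ a ∈ stab h L := by
  rw [mem_stab_iff, mem_stab_iff, mapLattice_embed_addLine, addLine_injective.eq_iff]

omit [ValuativeRel F] in
theorem embed_injective : Function.Injective (embed h c) := by
  intro a b hab
  ext x
  have := congrArg (fun g : unitaryGroup (extForm h c) => ((g : (V × F) ≃ₗ[F] (V × F)) (x, 0)).1) hab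
  exact this

omit [ValuativeRel F] in
/-- A unitary transformation fixing the special vector comes from the orthogonal complement. -/
theorem exists_embed_eq (hc0 : c ≠ 0) {g : unitaryGroup (extForm h c)}
    (hg : (g : (V × F) ≃ₗ[F] (V × F)) (specialVec F V) = specialVec F V) :
    ∃ a, embed h c a = g := by
  have key : ∀ g : unitaryGroup (extForm h c),
      (g : (V × F) ≃ₗ[F] (V × F)) (specialVec F V) = specialVec F V →
      ∀ x : V, ((g : (V × F) ≃ₗ[F] (V × F)) (x, 0)).2 = 0 := by
    intro g hg x
    have h1 := g.2 (specialVec F V) (x, 0)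
    rw [hg, extForm_apply, extForm_apply] at h1
    simpa [specialVec, hc0] using h1
  have hg' : ((g⁻¹ : unitaryGroup (extForm h c)) : (V × F) ≃ₗ[F] (V × F)) (specialVec F V) =
      specialVec F V := by
    rw [unitary_inv_apply, LinearEquiv.symm_apply_eq, hg]
  have e1 : ∀ x : V, (g : (V × F) ≃ₗ[F] (V × F)) (((g : (V × F) ≃ₗ[F] (V × F)) (x, 0)).1, 0) =
      (g : (V × F) ≃ₗ[F] (V × F)) ((g : (V × F) ≃ₗ[F] (V × F)) (x, 0)) := fun x => by
    congr 1
    exact Prod.ext rfl (key g hg x).symm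
  let a : V ≃ₗ[F] V := LinearEquiv.ofLinearMap
    ((LinearMap.fst F V F).comp ((g : (V × F) ≃ₗ[F] (V × F)).toLinearMap.comp (LinearMap.inl F V F)))
    ((LinearMap.fst F V F).comp
      ((g : (V × F) ≃ₗ[F] (V × F)).symm.toLinearMap.comp (LinearMap.inl F V F)))
    (by
      ext x
      change ((g : (V × F) ≃ₗ[F] (V × F)) (((g : (V × F) ≃ₗ[F] (V × F)).symm (x, 0)).1, 0)).1 = x
      have : ((((g : (V × F) ≃ₗ[F] (V × F)).symm (x, 0)).1, 0) : V × F) =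
          (g : (V × F) ≃ₗ[F] (V × F)).symm (x, 0) := Prod.ext rfl (key _ hg' x).symm
      rw [this, LinearEquiv.apply_symm_apply])
    (by
      ext x
      change ((g : (V × F) ≃ₗ[F] (V × F)).symm (((g : (V × F) ≃ₗ[F] (V × F)) (x, 0)).1, 0)).1 = x
      have : ((((g : (V × F) ≃ₗ[F] (V × F)) (x, 0)).1, 0) : V × F) =
          (g : (V × F) ≃ₗ[F] (V × F)) (x, 0) := Prod.ext rfl (key _ hg x).symm
      rw [this, LinearEquiv.symm_apply_apply])
  have ha : ∀ x, ((a x, 0) : V × F) = (g : (V × F) ≃ₗ[F] (V × F)) (x, 0) := fun x =>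
    Prod.ext rfl (key _ hg x).symm
  refine ⟨⟨a, fun x y => ?_⟩, ?_⟩
  · have h1 := g.2 (x, 0) (y, 0)
    rw [← ha, ← ha, extForm_apply, extForm_apply] at h1
    simpa using h1
  · ext1
    refine LinearEquiv.ext fun x => ?_
    have hx : x = (x.1, 0) + x.2 • specialVec F V := by
      ext <;> simp [specialVec]
    conv_rhs => rw [hx, map_add, map_smul, hg, ← ha]
    rw [embed_apply]
    ext <;> simp [specialVec]

omit [ValuativeRel F] in
-- The condition on `α` is exactly what makes the transvection along `x` with coefficient `α`
-- unitary; the one with coefficient `σ α` is its inverse. Besides reflections, this provides maps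
-- sending one vector to another one of the same length.
theorem exists_quasiReflection [FiniteDimensional F V] (hs : h.IsSymm) (hσ : ∀ x, σ (σ x) = x)
    (x : V) {α : F} (hα : α + σ α + α * σ α * h x x = 0) :
    ∃ s : unitaryGroup h, (∀ v, (s : V ≃ₗ[F] V) v = v + (α * h x v) • x) ∧
      (LinearEquiv.det (s : V ≃ₗ[F] V) : F) = 1 + α * h x x := by
  have hcomp : ∀ α, α + σ α + α * σ α * h x x = 0 →
      (LinearMap.transvection (σ α • h x) x).comp (LinearMap.transvection (α • h x) x) =
        LinearMap.id := by
    intro α hα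
    ext v
    rw [LinearMap.comp_apply, LinearMap.transvection.apply, LinearMap.transvection.apply]
    simp only [LinearMap.smul_apply, smul_eq_mul, map_add, map_smul, LinearMap.id_apply]
    have e : ∀ k : F, α * k + (σ α * k + α * k * (σ α * h x x)) = 0 := fun k => by
      linear_combination k * hα
    rw [add_assoc, ← add_smul, e, zero_smul, add_zero]
  have hα' : σ α + σ (σ α) + σ α * σ (σ α) * h x x = 0 := by
    rw [hσ]; linear_combination hα
  have h2 := hcomp (σ α) hα'
  rw [hσ] at h2
  let s : V ≃ₗ[F] V := LinearEquiv.ofLinearMap (LinearMap.transvection (α • h x) x)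
    (LinearMap.transvection (σ α • h x) x) h2 (hcomp α hα)
  have hsv : ∀ v, s v = v + (α * h x v) • x := fun v => rfl
  refine ⟨⟨s, fun v w => ?_⟩, hsv, ?_⟩
  · simp only [hsv, map_add, LinearMap.add_apply, map_smul, LinearMap.map_smulₛₗ,
      LinearMap.smul_apply, smul_eq_mul, map_mul, hs.eq x v]
    linear_combination (h v x) * (h x w) * hα
  · rw [LinearEquiv.coe_det]
    change LinearMap.det (LinearMap.transvection (α • h x) x) = _
    rw [LinearMap.transvection.det]
    rfl

/-- Pairing with `x` is multiplied by `1 + α h(x, x)`. This factor has norm `1`, hence is a unit, so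
integrality against `x` can be carried back from `s v` to `v`. -/
theorem IsRamified.quasiReflection_mem_stab (hR : IsRamified σ π) {x : V} {α : F}
    (hs : h.IsSymm) (hα : α + σ α + α * σ α * h x x = 0) (hα1 : valuation F α ≤ 1)
    {s : unitaryGroup h}
    (hsv : ∀ v, (s : V ≃ₗ[F] V) v = v + (α * h x v) • x) {L : Submodule 𝒪[F] V} (hx : x ∈ L)
    (hxL : ∀ z ∈ L, valuation F (h x z) ≤ 1) : s ∈ stab h L := by
  have hfwd : ∀ v, valuation F (h x v) ≤ 1 → (α * h x v) • x ∈ L := fun v hv =>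
    int_smul_mem (by rw [map_mul]; exact mul_le_one' hα1 hv) hx
  have hδ : valuation F (1 + α * h x x) = 1 := by
    have h1 : (1 + α * h x x) * σ (1 + α * h x x) = 1 := by
      rw [map_add, map_one, map_mul, hs.eq]
      linear_combination (h x x) * hα
    have h2 := congrArg (valuation F) h1
    rw [map_mul, hR.val_map, map_one, ← sq] at h2
    exact (pow_eq_one_iff.1 h2).resolve_right _root_.two_ne_zero
  intro v
  rw [hsv]
  constructor
  · intro hv
    have h1 := hxL _ hv
    rw [map_add, map_smul, smul_eq_mul, show h x v + α * h x v * h x x =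
      (1 + α * h x x) * h x v by ring, map_mul, hδ, one_mul] at h1
    have := sub_mem hv (hfwd v h1)
    rwa [add_sub_cancel_right] at this
  · intro hv
    exact add_mem hv (hfwd v (hxL v hv))

variable [FiniteDimensional F V]

/-- Reflections in vectors of unit length. -/
theorem IsRamified.exists_reflection (hR : IsRamified σ π) (hs : h.IsSymm)
    {x : V} (hxx : valuation F (h x x) = 1) :
    ∃ s : unitaryGroup h, (LinearEquiv.det (s : V ≃ₗ[F] V) : F) = -1 ∧
      (∀ L : Submodule 𝒪[F] V, x ∈ L → (∀ z ∈ L, valuation F (h x z) ≤ 1) → s ∈ stab h L) ∧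
      (∀ v, valuation F (h x v) ≤ 1 → ∃ a, valuation F a ≤ 1 ∧
        (s : V ≃ₗ[F] V) v = v - a • x ∧ resid a * resForm h x x = 2 * resForm h x v) ∧
      ∀ v, h x v = 0 → (s : V ≃ₗ[F] V) v = v := by
  have h0 : h x x ≠ 0 := fun h0 => by simp [h0] at hxx
  -- The coefficient of the reflection that negates `x`.
  have hα : -2 / h x x + σ (-2 / h x x) + -2 / h x x * σ (-2 / h x x) * h x x = 0 := by
    rw [map_div₀, map_neg, map_ofNat, hs.eq]
    field_simp
    ring
  obtain ⟨s, hsv, hdet⟩ := exists_quasiReflection hs hR.invol x hα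
  have hα1 : valuation F (-2 / h x x) ≤ 1 := by
    rw [map_div₀, hxx, div_one, Valuation.map_neg, hR.val_two]
  refine ⟨s, ?_, fun L hx hxL => hR.quasiReflection_mem_stab hs hα hα1 hsv hx hxL,
    fun v hv => ⟨2 / h x x * h x v, ?_, ?_, ?_⟩, fun v hv => ?_⟩
  · rw [hdet]
    field_simp
    ring
  · rw [map_mul, map_div₀, hxx, div_one, hR.val_two, one_mul]
    exact hv
  · rw [hsv, sub_eq_add_neg, ← neg_smul]
    congr 2
    ring
  · rw [resForm, resForm, ← resid_mul _ hxx.le, ← resid_two, ← resid_mul hR.val_two.le hv]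
    · congr 1
      field_simp
    · rw [map_mul, map_div₀, hxx, div_one, hR.val_two, one_mul]
      exact hv
  · rw [hsv, hv]
    simp

/-- Two vectors of the same unit length are conjugate up to sign. -/
theorem IsRamified.exists_map_eq (hR : IsRamified σ π) (hs : h.IsSymm) {L : Submodule 𝒪[F] V}
    (hL : L ≤ dualLattice h L) {x y : V} (hx : x ∈ L) (hy : y ∈ L) (hxy : h x x = h y y)
    (hyy : valuation F (h y y) = 1) :
    ∃ s : unitaryGroup h, (s : V ≃ₗ[F] V) x = y ∧
      ∀ M, L ≤ M → M ≤ dualLattice h L → s ∈ stab h M := by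
  -- The quasi-reflection along `x - y` with coefficient `-1 / h(x - y, x)` sends `x` to `y`. The
  -- denominator is a unit: its trace is the unit `h(x - y, x - y)`, and `σ` is trivial modulo `π`.
  have key : ∀ x y : V, x ∈ L → y ∈ L → h x x = h y y → valuation F (h (x - y) (x - y)) = 1 →
      ∃ s : unitaryGroup h, (s : V ≃ₗ[F] V) x = y ∧
      ∀ M, L ≤ M → M ≤ dualLattice h L → s ∈ stab h M := by
    intro x y hx hy hxy hu
    have hz : x - y ∈ L := sub_mem hx hy
    have hsum : h (x - y) x + σ (h (x - y) x) = h (x - y) (x - y) := by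
      rw [hs.eq]
      simp only [map_sub, LinearMap.sub_apply]
      rw [hxy]
      ring
    have hβ1 : valuation F (h (x - y) x) = 1 := by
      rw [← resid_ne_zero_iff (hL hx _ hz)]
      intro h0
      have h1 := congrArg resid hsum
      rw [resid_add (hL hx _ hz) (by rw [hR.val_map]; exact hL hx _ hz), hR.resid_map, h0,
        add_zero] at h1
      exact resid_ne_zero hu h1.symm
    have hβ0 : h (x - y) x ≠ 0 := fun h0 => by rw [h0] at hβ1; simp at hβ1
    have hσβ0 : σ (h (x - y) x) ≠ 0 := (map_ne_zero σ).2 hβ0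
    have hα : -1 / h (x - y) x + σ (-1 / h (x - y) x) +
        -1 / h (x - y) x * σ (-1 / h (x - y) x) * h (x - y) (x - y) = 0 := by
      rw [← hsum, map_div₀, map_neg, map_one]
      field_simp
      ring
    obtain ⟨s, hsv, -⟩ := exists_quasiReflection hs hR.invol (x - y) hα
    refine ⟨s, ?_, fun M hLM hML => hR.quasiReflection_mem_stab hs hα ?_ hsv (hLM hz)
      fun z hz' => hML hz' _ hz⟩
    · rw [hsv, div_mul_cancel₀ _ hβ0]
      simp
    · rw [map_div₀, hβ1, div_one, Valuation.map_neg, map_one]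
  by_cases hu : valuation F (h (x - y) (x - y)) = 1
  · exact key x y hx hy hxy hu
  have hny : -y ∈ L := neg_mem hy
  -- The lengths of `x - y` and `x + y` add up to the unit `4 h(y, y)`. If the first is not a unit,
  -- `x` is sent to `-y` and then to `y` by the reflection in `y`.
  have hu' : valuation F (h (x - -y) (x - -y)) = 1 := by
    have hxm := sub_mem hx hy
    have hxp := sub_mem hx hny
    by_contra hcon
    have h1 := not_not.1 (mt (resForm_ne_zero_iff hL hxm hxm).1 hu)
    have h2 := not_not.1 (mt (resForm_ne_zero_iff hL hxp hxp).1 hcon)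
    have h3 : h (x - y) (x - y) + h (x - -y) (x - -y) = 2 * (2 * h y y) := by
      simp only [map_sub, map_neg, LinearMap.sub_apply, LinearMap.neg_apply, hxy]
      ring
    have h4 := congrArg resid h3
    rw [resid_add (hL hxm _ hxm) (hL hxp _ hxp)] at h4
    change resForm h _ _ + resForm h _ _ = _ at h4
    rw [h1, h2, add_zero, eq_comm] at h4
    refine resid_ne_zero ?_ h4
    rw [map_mul, map_mul, hR.val_two, hyy, one_mul, one_mul]
  obtain ⟨s, hsx, hs1⟩ := key x (-y) hx hny (by simp [hxy]) hu'
  have h0 : h y y ≠ 0 := fun h0 => by simp [h0] at hyy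
  have hα : -2 / h y y + σ (-2 / h y y) + -2 / h y y * σ (-2 / h y y) * h y y = 0 := by
    rw [map_div₀, map_neg, map_ofNat, hs.eq]
    field_simp
    ring
  obtain ⟨r, hrv, -⟩ := exists_quasiReflection hs hR.invol y hα
  refine ⟨r * s, ?_, fun M hLM hML => mul_mem ?_ (hs1 M hLM hML)⟩
  · rw [unitary_mul_apply, hsx, hrv, map_neg, mul_neg, div_mul_cancel₀ _ h0]
    module
  · refine hR.quasiReflection_mem_stab hs hα ?_ hrv (hLM hy) fun z hz => hML hz _ hy
    rw [map_div₀, hyy, div_one, Valuation.map_neg, hR.val_two]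

end Unitary

/-! ### Transitivity on vertex sublattices -/

section Witt

variable {F : Type*} [Field F] [ValuativeRel F] {σ : F →+* F} {π : F}
  {V : Type*} [AddCommGroup V] [Module F V] {h : V →ₛₗ[σ] V →ₗ[F] F} {c : F}

theorem subDual_mapLattice (a : unitaryGroup h) (L : Submodule 𝒪[F] V) :
    subDual h (mapLattice (a : V ≃ₗ[F] V) L) = mapLattice (a : V ≃ₗ[F] V) (subDual h L) :=
  (unitary_isIsometry a).subDual L

theorem mapLattice_le_of_mem_stab {a : unitaryGroup h} {L M : Submodule 𝒪[F] V}
    (ha : a ∈ stab h M) (hLM : L ≤ M) : mapLattice (a : V ≃ₗ[F] V) L ≤ M := by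
  rw [← mem_stab_iff.1 ha]
  exact mapLattice_mono hLM

theorem IsRamified.mapLattice_mem_vert (hR : IsRamified σ π) {t : ℕ} {L : Submodule 𝒪[F] V}
    (hL : L ∈ Vert h t) (a : unitaryGroup h) : mapLattice (a : V ≃ₗ[F] V) L ∈ Vert h t :=
  (unitary_isIsometry a).mapLattice_mem_vert hR hL

variable [FiniteDimensional F V]

/-- A reflection that moves `v` to `w` modulo `π`, and fixes modulo `π` everything orthogonal to
`v - w`. -/
theorem IsRamified.exists_reflection_sub (hR : IsRamified σ π) (hs : h.IsSymm)
    {M : Submodule 𝒪[F] V} (hM : M ≤ dualLattice h M) {x : V} (hx : x ∈ M)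
    (hxx : resForm h x x ≠ 0) :
    ∃ s : unitaryGroup h, (LinearEquiv.det (s : V ≃ₗ[F] V) : F) = -1 ∧
      (∀ L : Submodule 𝒪[F] V, M ≤ L → L ≤ dualLattice h M → s ∈ stab h L) ∧
      (∀ v ∈ M, ∃ a, valuation F a ≤ 1 ∧
        (s : V ≃ₗ[F] V) v = v - a • x ∧ resid a * resForm h x x = 2 * resForm h x v) ∧
      (∀ v ∈ M, resForm h x v = 0 → ∃ a, valuation F a < 1 ∧ (s : V ≃ₗ[F] V) v = v - a • x) := by
  obtain ⟨s, h1, h2, h3, -⟩ := hR.exists_reflection hs ((resForm_ne_zero_iff hM hx hx).1 hxx)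
  refine ⟨s, h1, fun L hML hLM => h2 L (hML hx) fun z hz => hLM hz x hx,
    fun v hv => h3 v (hM hv x hx), fun v hv hxv => ?_⟩
  obtain ⟨a, ha, hsv, hax⟩ := h3 v (hM hv x hx)
  refine ⟨a, ?_, hsv⟩
  rw [hxv, mul_zero] at hax
  exact (resid_eq_zero_iff ha).1 ((mul_eq_zero.1 hax).resolve_right hxx)

variable [TopologicalSpace F] [IsNonarchimedeanLocalField F]

/-- Vertex sublattices of the same type of an integral lattice are conjugate. -/
theorem IsRamified.exists_stab_map_eq (hR : IsRamified σ π) (hs : h.IsSymm) (hnd : h.Nondegenerate)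
    {M : Submodule 𝒪[F] V} (hfg : M.FG) (hM : M ≤ dualLattice h M) {s : ℕ}
    {L₂ L₃ : Submodule 𝒪[F] V} (h2 : L₂ ∈ Vert h s) (h3 : L₃ ∈ Vert h s) (h2M : L₂ ≤ M)
    (h3M : L₃ ≤ M) :
    ∃ a : unitaryGroup h, (∀ L, M ≤ L → L ≤ dualLattice h M → a ∈ stab h L) ∧
      mapLattice (a : V ≃ₗ[F] V) L₂ = L₃ := by
  have hnoeth : IsNoetherian 𝒪[F] M := isNoetherian_of_fg_of_noetherian M hfg
  -- As in Witt's theorem, the common part of the totally isotropic subspaces attached to `L₂` and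
  -- `L₃` is enlarged step by step. The process stops because `M` is Noetherian.
  induction hN : (subDual h L₂ ⊓ subDual h L₃).submoduleOf M using WellFoundedGT.induction
    generalizing L₂ with
  | _ N ih =>
  subst hN
  have hI3 : subDual h L₃ ≤ M := (hR.subDual_le h3).trans h3M
  have hI2 : subDual h L₂ ≤ M := (hR.subDual_le h2).trans h2M
  have two : (2 : 𝓀[F]) ≠ 0 := hR.two_ne_zero
  -- the dual lattice pairs trivially
  have zero : ∀ L ≤ M, ∀ x ∈ L, ∀ d ∈ subDual h L, d ∈ M → resForm h x d = 0 :=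
    fun L hL x hx d hd hdM => (resForm_eq_zero_iff hM (hL hx) hdM).2 (mem_subDual.1 hd x hx)
  -- it suffices to enlarge the intersection
  have step : ∀ a : unitaryGroup h, (∀ L, M ≤ L → L ≤ dualLattice h M → a ∈ stab h L) →
      subDual h L₂ ⊓ subDual h L₃ <
      subDual h (mapLattice (a : V ≃ₗ[F] V) L₂) ⊓ subDual h L₃ →
      ∃ a : unitaryGroup h, (∀ L, M ≤ L → L ≤ dualLattice h M → a ∈ stab h L) ∧
        mapLattice (a : V ≃ₗ[F] V) L₂ = L₃ := by
    intro a ha hlt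
    obtain ⟨b, hb, hbe⟩ := ih ((subDual h (mapLattice (a : V ≃ₗ[F] V) L₂) ⊓
      subDual h L₃).submoduleOf M) (by
        refine lt_of_le_of_ne (fun x hx => hlt.le hx) fun heq => hlt.not_ge fun x hx => ?_
        have hx' : (⟨x, hI3 hx.2⟩ : M) ∈ (subDual h (mapLattice (a : V ≃ₗ[F] V) L₂) ⊓
          subDual h L₃).submoduleOf M := hx
        rw [← heq] at hx'
        exact hx') (hR.mapLattice_mem_vert h2 a)
        (mapLattice_le_of_mem_stab (ha M le_rfl hM) h2M) rfl
    exact ⟨b * a, fun L h1 h2 => mul_mem (hb L h1 h2) (ha L h1 h2), by rw [mapLattice_mul, hbe]⟩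
  -- effect of reflections on the intersection
  have refl : ∀ L ∈ Vert h s, L ≤ M → ∀ x ∈ M, resForm h x x ≠ 0 →
      (∀ d ∈ subDual h L ⊓ subDual h L₃, resForm h x d = 0) →
      ∃ r : unitaryGroup h, (∀ L, M ≤ L → L ≤ dualLattice h M → r ∈ stab h L) ∧
        subDual h L ⊓ subDual h L₃ ≤
        subDual h (mapLattice (r : V ≃ₗ[F] V) L) ⊓ subDual h L₃ ∧
        ∀ v ∈ M, ∃ a, valuation F a ≤ 1 ∧
          (r : V ≃ₗ[F] V) v = v - a • x ∧ resid a * resForm h x x = 2 * resForm h x v := by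
    intro L hL hLM x hx hxx hd
    obtain ⟨r, -, hr1, hr2, hr3⟩ := hR.exists_reflection_sub hs hM hx hxx
    refine ⟨r, hr1, fun d hdd => ⟨?_, hdd.2⟩, hr2⟩
    obtain ⟨a, ha, hrd⟩ := hr3 d (((hR.subDual_le hL).trans hLM) hdd.1) (hd d hdd)
    have h4 := small_smul_mem_subDual hM (mapLattice_le_of_mem_stab (hr1 M le_rfl hM) hLM) ha hx
    have h5 : (r : V ≃ₗ[F] V) d ∈ subDual h (mapLattice (r : V ≃ₗ[F] V) L) := by
      rw [subDual_mapLattice, apply_mem_mapLattice]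
      exact hdd.1
    have h6 := add_mem h5 h4
    rwa [hrd, sub_add_cancel] at h6
  -- the case of non-orthogonal vectors
  have move : ∀ L ∈ Vert h s, L ≤ M → ∀ j ∈ subDual h L, ∀ j' ∈ subDual h L₃,
      resForm h j j' ≠ 0 →
      ∃ r : unitaryGroup h, (∀ L, M ≤ L → L ≤ dualLattice h M → r ∈ stab h L) ∧
        subDual h L ⊓ subDual h L₃ < subDual h (mapLattice (r : V ≃ₗ[F] V) L) ⊓ subDual h L₃ := by
    intro L hL hLM j hj j' hj' hjj
    have hjL := hR.subDual_le hL hj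
    have hjL' := hR.subDual_le h3 hj'
    have hjM := hLM hjL
    have hjM' := hI3 hj'
    have hxM := sub_mem hjM hjM'
    have e1 : resForm h (j - j') j = - resForm h j j' := by
      rw [resForm_sub_left hM hjM hjM' hjM, zero L hLM j hjL j hj hjM, zero_sub,
        hR.resForm_comm hs]
    have e2 : resForm h (j - j') j' = resForm h j j' := by
      rw [resForm_sub_left hM hjM hjM' hjM', zero L₃ h3M j' hjL' j' hj' hjM', sub_zero]
    -- Both vectors are isotropic modulo `π`, so `j - j'` is anisotropic exactly because they are
    -- not orthogonal. The reflection in it sends `j` to `j'` modulo `π`.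
    have e3 : resForm h (j - j') (j - j') = - 2 * resForm h j j' := by
      rw [resForm_sub_right hM hjM hjM' hxM, e1, e2]
      ring
    obtain ⟨r, hr1, hr2, hr3⟩ := refl L hL hLM (j - j') hxM
      (by rw [e3]; exact mul_ne_zero (neg_ne_zero.2 two) hjj) (fun d hd => by
        have hdM := hI3 hd.2
        rw [resForm_sub_left hM hjM hjM' hdM, zero L hLM j hjL d hd.1 hdM,
          zero L₃ h3M j' hjL' d hd.2 hdM, sub_zero])
    obtain ⟨a, ha, hrj, hra⟩ := hr3 j hjM
    have ha1 : resid a = 1 := by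
      rw [e3, e1] at hra
      have h5 : (resid a - 1) * (-2 * resForm h j j') = 0 := by linear_combination hra
      exact sub_eq_zero.1 ((mul_eq_zero.1 h5).resolve_right
        (mul_ne_zero (neg_ne_zero.2 two) hjj))
    have ha2 : valuation F (1 - a) < 1 := by
      rw [← resid_eq_zero_iff ((valuation F).map_sub_le (map_one _).le ha),
        resid_sub (map_one _).le ha, ha1, resid_one, sub_self]
    have hrj' : (r : V ≃ₗ[F] V) j = j' + (1 - a) • (j - j') := by
      rw [hrj]; module
    have hsm := fun {N} (hN : N ≤ M) => small_smul_mem_subDual hM hN ha2 hxM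
    refine ⟨r, hr1, lt_of_le_not_ge hr2 fun hge => ?_⟩
    have h5 : (r : V ≃ₗ[F] V) j ∈
        subDual h (mapLattice (r : V ≃ₗ[F] V) L) ⊓ subDual h L₃ := by
      refine ⟨?_, ?_⟩
      · change _ ∈ subDual h (mapLattice (r : V ≃ₗ[F] V) L)
        rw [subDual_mapLattice, apply_mem_mapLattice]
        exact hj
      · rw [hrj']
        exact add_mem hj' (hsm h3M)
    have h6 := (hge h5).1
    rw [hrj'] at h6
    have h7 := (Submodule.add_mem_iff_left _ (hsm hLM)).1 h6
    exact hjj (zero L hLM j hjL j' h7 hjM')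
  by_cases hle : subDual h L₂ ≤ subDual h L₃
  · refine ⟨1, fun _ _ _ => one_mem _, ?_⟩
    rw [mapLattice_one]
    exact (vert_eq_of_le h3 h2
      ((hR.subDual_le_subDual_iff hs hnd h3.isLattice h2.isLattice).1 hle)).symm
  by_cases hge : subDual h L₃ ≤ subDual h L₂
  · refine ⟨1, fun _ _ _ => one_mem _, ?_⟩
    rw [mapLattice_one]
    exact vert_eq_of_le h2 h3
      ((hR.subDual_le_subDual_iff hs hnd h2.isLattice h3.isLattice).1 hge)
  obtain ⟨j, hj, hj3⟩ := Set.not_subset.1 hle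
  obtain ⟨j', hj', hj2⟩ := Set.not_subset.1 hge
  -- One reflection is enough if the two isotropic subspaces are not orthogonal to each other.
  -- Otherwise a preliminary reflection destroys the orthogonality.
  by_cases hcase : ∃ j ∈ subDual h L₂, ∃ j' ∈ subDual h L₃, resForm h j j' ≠ 0
  · obtain ⟨j, hj, j', hj', hjj⟩ := hcase
    obtain ⟨r, hr, hlt⟩ := move L₂ h2 h2M j hj j' hj' hjj
    exact step r hr hlt
  push Not at hcase
  have hjM := hI2 hj
  have hjM' := hI3 hj'
  have hunit : ∀ L ≤ M, ∀ j ∈ M, j ∉ subDual h L → ∃ l ∈ L, resForm h l j ≠ 0 := by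
    intro L hL j hj hjL
    contrapose! hjL
    exact mem_subDual.2 fun l hl => (resForm_eq_zero_iff hM (hL hl) hj).1 (hjL l hl)
  obtain ⟨l3, hl3, hlj⟩ := hunit L₃ h3M j hjM hj3
  obtain ⟨l2, hl2, hlj'⟩ := hunit L₂ h2M j' hjM' hj2
  have hl3M := h3M hl3
  have hl2M := h2M hl2
  have hjL := hR.subDual_le h2 hj
  -- A mirror for the preliminary reflection: anisotropic, orthogonal to the common part, but
  -- orthogonal to neither `j` nor `j'`. The sum `l3 + l2` works unless it is isotropic, in which
  -- case `j` is added to it.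
  have y0 : ∃ y ∈ M, resForm h y y ≠ 0 ∧ resForm h y j ≠ 0 ∧ resForm h y j' ≠ 0 ∧
      ∀ d ∈ subDual h L₂ ⊓ subDual h L₃, resForm h y d = 0 := by
    have hyM := add_mem hl3M hl2M
    have e1 : resForm h (l3 + l2) j = resForm h l3 j := by
      rw [resForm_add_left hM hl3M hl2M hjM, zero L₂ h2M l2 hl2 j hj hjM, add_zero]
    have e2 : resForm h (l3 + l2) j' = resForm h l2 j' := by
      rw [resForm_add_left hM hl3M hl2M hjM', zero L₃ h3M l3 hl3 j' hj' hjM', zero_add]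
    have e3 : ∀ d ∈ subDual h L₂ ⊓ subDual h L₃, resForm h (l3 + l2) d = 0 := fun d hd => by
      have hdM := hI3 hd.2
      rw [resForm_add_left hM hl3M hl2M hdM, zero L₂ h2M l2 hl2 d hd.1 hdM,
        zero L₃ h3M l3 hl3 d hd.2 hdM, add_zero]
    by_cases hyy : resForm h (l3 + l2) (l3 + l2) = 0
    · refine ⟨l3 + l2 + j, add_mem hyM hjM, ?_, ?_, ?_, fun d hd => ?_⟩
      · rw [resForm_add_left hM hyM hjM (add_mem hyM hjM), resForm_add_right hM hyM hjM hyM,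
          resForm_add_right hM hyM hjM hjM, hyy, hR.resForm_comm hs j,
          zero L₂ h2M j hjL j hj hjM, e1, zero_add, add_zero, ← two_mul]
        exact mul_ne_zero two hlj
      · rwa [resForm_add_left hM hyM hjM hjM, e1, zero L₂ h2M j hjL j hj hjM, add_zero]
      · rwa [resForm_add_left hM hyM hjM hjM', e2, hcase j hj j' hj', add_zero]
      · have hdM := hI3 hd.2
        rw [resForm_add_left hM hyM hjM hdM, e3 d hd, zero L₂ h2M j hjL d hd.1 hdM, add_zero]
    · exact ⟨_, hyM, hyy, by rwa [e1], by rwa [e2], e3⟩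
  obtain ⟨y, hyM, hyy, hyj, hyj', hyd⟩ := y0
  -- The reflected vector `j - a y` pairs nontrivially with `j'`, so the first case applies to the
  -- reflected lattice.
  obtain ⟨r, hr1, hr2, hr3⟩ := refl L₂ h2 h2M y hyM hyy hyd
  obtain ⟨a, ha, hrj, hra⟩ := hr3 j hjM
  have ha0 : resid a ≠ 0 := fun h0 => by
    rw [h0, zero_mul] at hra
    exact mul_ne_zero two hyj hra.symm
  have h5 : (r : V ≃ₗ[F] V) j ∈ subDual h (mapLattice (r : V ≃ₗ[F] V) L₂) := by
    rw [subDual_mapLattice, apply_mem_mapLattice]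
    exact hj
  obtain ⟨b, hb1, hb2⟩ := move _ (hR.mapLattice_mem_vert h2 r)
    (mapLattice_le_of_mem_stab (hr1 M le_rfl hM) h2M) _ h5 j' hj' (by
      have hay := int_smul_mem ha hyM
      rw [hrj, resForm_sub_left hM hjM hay hjM', hcase j hj j' hj', zero_sub,
        hR.resForm_comm hs, resForm_smul_right hM ha hjM' hyM, hR.resForm_comm hs j']
      exact neg_ne_zero.2 (mul_ne_zero ha0 hyj'))
  refine step (b * r) (fun L h1 h2 => mul_mem (hb1 L h1 h2) (hr1 L h1 h2)) ?_
  rw [mapLattice_mul]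
  exact lt_of_le_of_lt hr2 hb2

end Witt

/-! ### Transitivity of the small unitary group on vertex lattices of the orthogonal sum -/

section ExtTransitive

variable {F : Type*} [Field F] [ValuativeRel F] {σ : F →+* F} {π : F}
  {V : Type*} [AddCommGroup V] [Module F V] {h : V →ₛₗ[σ] V →ₗ[F] F} {c : F}

omit [ValuativeRel F] in
theorem exists_neg (h : V →ₛₗ[σ] V →ₗ[F] F) :
    ∃ s : unitaryGroup h, ∀ v, (s : V ≃ₗ[F] V) v = -v :=
  ⟨⟨LinearEquiv.neg F, fun x y => by simp⟩, fun _ => rfl⟩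

variable [FiniteDimensional F V]

/-- Two vectors of the same nonzero length modulo `π` are conjugate modulo `π`. -/
theorem IsRamified.exists_map_eq_mod (hR : IsRamified σ π) (hs : h.IsSymm)
    {M : Submodule 𝒪[F] V} (hM : M ≤ dualLattice h M) {v w : V} (hv : v ∈ M) (hw : w ∈ M)
    (hvw : resForm h v v = resForm h w w) (hww : resForm h w w ≠ 0) :
    ∃ a : unitaryGroup h, (∀ L, M ≤ L → L ≤ dualLattice h M → a ∈ stab h L) ∧
      ∃ b, valuation F b < 1 ∧ ∃ x ∈ M, (a : V ≃ₗ[F] V) v = w + b • x := by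
  have key : ∀ w ∈ M, resForm h v v = resForm h w w → resForm h (v - w) (v - w) ≠ 0 →
      ∃ a : unitaryGroup h, (∀ L, M ≤ L → L ≤ dualLattice h M → a ∈ stab h L) ∧
      ∃ b, valuation F b < 1 ∧ ∃ x ∈ M, (a : V ≃ₗ[F] V) v = w + b • x := by
    intro w hw hvw hx
    have hxM := sub_mem hv hw
    obtain ⟨s, -, hs1, hs2, -⟩ := hR.exists_reflection_sub hs hM hxM hx
    obtain ⟨a, ha, hsv, hax⟩ := hs2 v hv
    refine ⟨s, hs1, 1 - a, ?_, v - w, hxM, by rw [hsv]; module⟩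
    -- Equality of the lengths of `v` and `w` makes the coefficient `a` of the reflection congruent
    -- to `1`, so `v` goes to `w` modulo `π`.
    have e1 : resForm h (v - w) (v - w) = 2 * resForm h (v - w) v := by
      rw [resForm_sub_right hM hv hw hxM, resForm_sub_left hM hv hw hv,
        resForm_sub_left hM hv hw hw, hR.resForm_comm hs v w, ← hvw]
      ring
    rw [← resid_eq_zero_iff ((valuation F).map_sub_le (map_one _).le ha),
      resid_sub (map_one _).le ha, resid_one, sub_eq_zero]
    rw [← e1] at hax
    exact (mul_eq_right₀ hx).1 hax |>.symm
  -- If `v - w` is isotropic modulo `π`, then `v + w` is not, by the parallelogram identity. One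
  -- sends `v` to `-w` and composes with `-1`.
  by_cases hx : resForm h (v - w) (v - w) = 0
  · have hw' := neg_mem hw
    have hvw' : resForm h v v = resForm h (-w) (-w) := by
      rw [hvw]
      simp [resForm]
    obtain ⟨a, ha, b, hb, x, hx, hav⟩ := key (-w) hw' hvw' (by
      intro h0
      have e : h (v - w) (v - w) + h (v - -w) (v - -w) = 2 * (h v v + h w w) := by
        simp only [map_sub, map_neg, LinearMap.sub_apply, LinearMap.neg_apply]
        ring
      have hxm := sub_mem hv hw
      have hxp := sub_mem hv hw'
      have h4 := congrArg resid e
      rw [resid_add (hM hxm _ hxm) (hM hxp _ hxp), resid_mul hR.val_two.le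
        ((valuation F).map_add_le (hM hv _ hv) (hM hw _ hw)),
        resid_add (hM hv _ hv) (hM hw _ hw)] at h4
      change resForm h _ _ + resForm h _ _ = _ * (resForm h _ _ + resForm h _ _) at h4
      rw [hx, h0, hvw, resid_two, zero_add, ← two_mul] at h4
      exact mul_ne_zero hR.two_ne_zero (mul_ne_zero hR.two_ne_zero hww) h4.symm)
    obtain ⟨s, hs'⟩ := exists_neg h
    refine ⟨s * a, fun L h1 h2 => mul_mem (fun v => ?_) (ha L h1 h2), b, hb, -x, neg_mem hx, ?_⟩
    · rw [hs', neg_mem_iff]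
    · rw [unitary_mul_apply, hav, hs']
      module
  · exact key w hw hvw hx

variable [TopologicalSpace F] [IsNonarchimedeanLocalField F]

/-- A vertex sublattice of colength one in `M ⊕ ⟨u⟩` that does not contain `u` is cut out by a
vector `(w, 1)`. -/
theorem IsRamified.exists_pairingKernel_addLine (hR : IsRamified σ π) (hs : h.IsSymm)
    (hnd : h.Nondegenerate) (hσc : σ c = c) (hc : valuation F c = 1) {t : ℕ}
    {M : Submodule 𝒪[F] V} (hM : M ∈ Vert h t) {Λ : Submodule 𝒪[F] (V × F)}
    (hΛ : Λ ∈ Vert (extForm h c) (t + 2)) (hle : Λ ≤ addLine M) (hu : specialVec F V ∉ Λ) :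
    ∃ w ∈ M, (w, 1) ∈ subDual (extForm h c) Λ ∧
      (w, 1) ∉ subDual (extForm h c) (addLine M) ∧ resForm h w w = - resid c := by
  have hc0 : c ≠ 0 := fun h0 => by simp [h0] at hc
  have hse := extForm_isSymm hs hR.invol hσc
  have hnde := extForm_nondegenerate hs hnd hR.invol hσc hc0
  have hE := (hR.addLine_mem_vert_iff hc).2 hM
  have huE := specialVec_mem_addLine M
  obtain ⟨i, hi, hiu⟩ := hR.exists_unit_pairing hse hnde hΛ.isLattice hu
    fun z hz => hE.le_dual huE z (hle (hR.subDual_le hΛ hz))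
  have h1 : valuation F i.2 = 1 := by
    simpa [extForm_apply, specialVec, hc, hR.val_map] using hiu
  have h20 : i.2 ≠ 0 := fun h0 => by simp [h0] at h1
  -- The last coordinate of `i` is a unit since `i` pairs to a unit with `u`, so it can be
  -- normalized to `1`. The relation `h(w, w) + c = 0` modulo `π` then says that the vector is
  -- isotropic.
  have hj : ((i.2⁻¹ • i.1, 1) : V × F) ∈ subDual (extForm h c) Λ := by
    have := int_smul_mem (a := i.2⁻¹) (by rw [map_inv₀, h1, inv_one]) hi
    convert! this using 1
    ext <;> simp [h20]
  have hjΛ := hR.subDual_le hΛ hj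
  have hw := (mem_addLine.1 (hle hjΛ)).1
  refine ⟨_, hw, hj, fun hj' => ?_, ?_⟩
  · have := (hR.valuation_comm hse _ _).symm.trans_lt (mem_subDual.1 hj' _ huE)
    simp [extForm_apply, specialVec, hc] at this
  · have := hj _ hjΛ
    rw [extForm_apply] at this
    simp only [map_one, mul_one] at this
    rw [← resid_eq_zero_iff ((valuation F).map_add_le (hM.le_dual hw _ hw) hc.le),
      resid_add (hM.le_dual hw _ hw) hc.le] at this
    exact eq_neg_of_add_eq_zero_left this

/-- The two lattices are cut out by vectors `(v, 1)` and `(w, 1)`, where `v` and `w` have the same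
length `-c`, nonzero modulo `π`. An isometry of `V` moving `v` to `w` modulo `π` makes both lattices
the pairing kernel of `(w, 1)`. -/
theorem IsRamified.exists_embed_map_eq_of_colength_one (hR : IsRamified σ π) (hs : h.IsSymm)
    (hnd : h.Nondegenerate) (hσc : σ c = c) (hc : valuation F c = 1) {t : ℕ}
    {M : Submodule 𝒪[F] V} (hM : M ∈ Vert h t) {Λ₂ Λ₃ : Submodule 𝒪[F] (V × F)}
    (h2 : Λ₂ ∈ Vert (extForm h c) (t + 2)) (h3 : Λ₃ ∈ Vert (extForm h c) (t + 2))
    (h2M : Λ₂ ≤ addLine M) (h3M : Λ₃ ≤ addLine M) (hu2 : specialVec F V ∉ Λ₂)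
    (hu3 : specialVec F V ∉ Λ₃) :
    ∃ a : unitaryGroup h, (∀ L, M ≤ L → L ≤ dualLattice h M → a ∈ stab h L) ∧
      mapLattice ((embed h c a : unitaryGroup (extForm h c)) : (V × F) ≃ₗ[F] (V × F)) Λ₂ = Λ₃ := by
  have hc0 : c ≠ 0 := fun h0 => by simp [h0] at hc
  have hse := extForm_isSymm hs hR.invol hσc
  have hE := (hR.addLine_mem_vert_iff hc).2 hM
  obtain ⟨v, hv, hv2, -, hvv⟩ := hR.exists_pairingKernel_addLine hs hnd hσc hc hM h2 h2M hu2
  obtain ⟨w, hw, hw3, hwE, hww⟩ := hR.exists_pairingKernel_addLine hs hnd hσc hc hM h3 h3M hu3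
  obtain ⟨a, ha, b, hb, x, hx, hav⟩ := hR.exists_map_eq_mod hs hM.le_dual hv hw
    (hvv.trans hww.symm) (by rw [hww]; exact neg_ne_zero.2 (resid_ne_zero hc))
  refine ⟨a, ha, ?_⟩
  have h2' := hR.mapLattice_mem_vert h2 (embed h c a)
  have h2M' : mapLattice ((embed h c a : unitaryGroup (extForm h c)) : (V × F) ≃ₗ[F] (V × F)) Λ₂ ≤
      addLine M :=
    mapLattice_le_of_mem_stab (embed_mem_stab_addLine.2 (ha M le_rfl hM.le_dual)) h2M
  have hw2 : ((w, 1) : V × F) ∈ subDual (extForm h c)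
      (mapLattice ((embed h c a : unitaryGroup (extForm h c)) : (V × F) ≃ₗ[F] (V × F)) Λ₂) := by
    have h4 : ((embed h c a : unitaryGroup (extForm h c)) : (V × F) ≃ₗ[F] (V × F)) (v, 1) ∈
        subDual (extForm h c)
        (mapLattice ((embed h c a : unitaryGroup (extForm h c)) : (V × F) ≃ₗ[F] (V × F)) Λ₂) := by
      rw [subDual_mapLattice, apply_mem_mapLattice]
      exact hv2
    have h5 := small_smul_mem_subDual hE.le_dual h2M' hb
      (mem_addLine.2 ⟨hx, zero_mem _⟩ : ((x, 0) : V × F) ∈ addLine M)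
    have h6 := sub_mem h4 h5
    rw [embed_apply, hav] at h6
    convert! h6 using 1
    ext <;> simp
  rw [hR.eq_pairingKernel hse hE h2' h2M' hw2 hwE, hR.eq_pairingKernel hse hE h3 h3M hw3 hwE]

/-- Adjoining the special vector to a vertex lattice. -/
theorem IsRamified.exists_addLine_eq_sup (hR : IsRamified σ π) (hs : h.IsSymm)
    (hnd : h.Nondegenerate) (hσc : σ c = c) (hc : valuation F c = 1) {s t : ℕ}
    {M : Submodule 𝒪[F] V} (hM : M ∈ Vert h t) {Λ : Submodule 𝒪[F] (V × F)}
    (hΛ : Λ ∈ Vert (extForm h c) s) (hle : Λ ≤ addLine M) (hu : specialVec F V ∉ Λ) :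
    ∃ t', t' + 2 = s ∧ ∃ N ∈ Vert h t', N ≤ M ∧ Λ ⊔ specialLine F V = addLine N := by
  have hc0 : c ≠ 0 := fun h0 => by simp [h0] at hc
  have hse := extForm_isSymm hs hR.invol hσc
  have hnde := extForm_nondegenerate hs hnd hR.invol hσc hc0
  have hE := (hR.addLine_mem_vert_iff hc).2 hM
  have huE := specialVec_mem_addLine M
  obtain ⟨t', ht', hN⟩ := hR.vert_sup_span hse hnde hΛ hu (hE.le_dual huE _ huE)
    (dual_anti hle (hE.le_dual huE))
  have huN : specialVec F V ∈ Λ ⊔ Submodule.span 𝒪[F] {specialVec F V} :=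
    Submodule.mem_sup_right (Submodule.mem_span_singleton_self _)
  have h1 := addLine_flatPart hc hN.le_dual huN
  refine ⟨t', ht', _, hR.flatPart_mem_vert hc hN huN, ?_, h1.symm⟩
  rw [← addLine_le_iff, h1]
  exact sup_le hle (specialLine_le_iff.2 huE)

/-- Adjoining `u` produces lattices `N₂ ⊕ ⟨u⟩` and `N₃ ⊕ ⟨u⟩`. Witt's theorem in `M` moves `N₂` to
`N₃`, and the colength one case inside `N₃ ⊕ ⟨u⟩` does the rest. The second isometry still
stabilizes `M` because `N₃ ≤ M ≤ N₃^∨`. -/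
theorem IsRamified.exists_embed_map_eq (hR : IsRamified σ π) (hs : h.IsSymm)
    (hnd : h.Nondegenerate) (hσc : σ c = c) (hc : valuation F c = 1) {s t : ℕ}
    {M : Submodule 𝒪[F] V} (hM : M ∈ Vert h t) {Λ₂ Λ₃ : Submodule 𝒪[F] (V × F)}
    (h2 : Λ₂ ∈ Vert (extForm h c) s) (h3 : Λ₃ ∈ Vert (extForm h c) s)
    (h2M : Λ₂ ≤ addLine M) (h3M : Λ₃ ≤ addLine M) (hu2 : specialVec F V ∉ Λ₂)
    (hu3 : specialVec F V ∉ Λ₃) :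
    ∃ a ∈ stab h M,
      mapLattice ((embed h c a : unitaryGroup (extForm h c)) : (V × F) ≃ₗ[F] (V × F)) Λ₂ = Λ₃ := by
  obtain ⟨t', rfl, N₂, hN₂, hNM₂, e2⟩ := hR.exists_addLine_eq_sup hs hnd hσc hc hM h2 h2M hu2
  obtain ⟨t'', ht, N₃, hN₃, hNM₃, e3⟩ := hR.exists_addLine_eq_sup hs hnd hσc hc hM h3 h3M hu3
  obtain rfl : t'' = t' := by omega
  obtain ⟨a, ha, hae⟩ := hR.exists_stab_map_eq hs hnd hM.isLattice.fg hM.le_dual hN₂ hN₃ hNM₂ hNM₃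
  have h2' := hR.mapLattice_mem_vert h2 (embed h c a)
  obtain ⟨b, hb, hbe⟩ := hR.exists_embed_map_eq_of_colength_one hs hnd hσc hc hN₃ h2' h3 (by
      rw [← hae, ← mapLattice_embed_addLine, ← e2]
      exact mapLattice_mono le_sup_left) (e3 ▸ le_sup_left) (by
      rw [← embed_specialVec a, apply_mem_mapLattice]
      exact hu2) hu3
  refine ⟨b * a, mul_mem (hb M hNM₃ (hM.le_dual.trans (dual_anti hNM₃))) (ha M le_rfl hM.le_dual),
    ?_⟩
  rw [map_mul, mapLattice_mul, hbe]

/-- There are two vertex sublattices of colength one in a vertex lattice whose reduction is a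
hyperbolic plane. -/
theorem IsRamified.exists_eq_pair (hR : IsRamified σ π) (hs : h.IsSymm) (hnd : h.Nondegenerate)
    {s : ℕ} {L : Submodule 𝒪[F] V} (hL : L ∈ Vert h s) (hdim : s + 2 = Module.finrank F V)
    {i : V} (hi : i ∈ L) (hi' : i ∉ subDual h L) (hii : resForm h i i = 0) :
    ∃ N₁ N₂, N₁ ≠ N₂ ∧ {N | N ∈ Vert h (s + 2) ∧ N ≤ L} = {N₁, N₂} := by
  have hM := hL.le_dual
  have two : (2 : 𝓀[F]) ≠ 0 := hR.two_ne_zero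
  -- The second isotropic line of the hyperbolic plane: a vector not orthogonal to `i`, corrected by
  -- a multiple of `i` so that it becomes isotropic modulo `π`.
  obtain ⟨j, hj, hij, hjj⟩ : ∃ j ∈ L, resForm h i j ≠ 0 ∧ resForm h j j = 0 := by
    have : ∃ j ∈ L, resForm h i j ≠ 0 := by
      contrapose! hi'
      refine mem_subDual.2 fun x hx => (resForm_eq_zero_iff hM hx hi).1 ?_
      rw [hR.resForm_comm hs, hi' x hx]
    obtain ⟨j, hj, hij⟩ := this
    obtain ⟨a, ha, hae⟩ := exists_resid_eq (F := F) (resForm h j j / (2 * resForm h i j))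
    have hai := int_smul_mem ha hi
    have hjai := sub_mem hj hai
    refine ⟨j - a • i, hjai, ?_, ?_⟩
    · rwa [resForm_sub_right hM hj hai hi, resForm_smul_right hM ha hi hi, hii, mul_zero, sub_zero]
    · rw [resForm_sub_right hM hj hai hjai, resForm_sub_left hM hj hai hj,
        resForm_sub_left hM hj hai hai, hR.resForm_comm hs (a • i) j,
        resForm_smul_right hM ha hj hi, hR.resForm_smul_left hM ha hi hai,
        resForm_smul_right hM ha hi hi,
        hii, hae, hR.resForm_comm hs j i]
      field_simp
      ring
  have hj' : j ∉ subDual h L := fun H => hij ((resForm_eq_zero_iff hM hi hj).2 (H i hi))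
  -- The quotient `L / π L^∨` has length two, and adjoining `i` and then `j` to `π L^∨` are two
  -- strict steps.
  have hdec : ∀ k ∈ L, ∃ a b : F, ∃ m ∈ subDual h L, valuation F a ≤ 1 ∧ valuation F b ≤ 1 ∧
      k = a • i + b • j + m := by
    have h0 := hR.relLength_subDual hs hnd hL
    set A₁ := subDual h L ⊔ Submodule.span 𝒪[F] {i}
    set A₂ := A₁ ⊔ Submodule.span 𝒪[F] {j}
    have hA₁ : A₁ ≤ L := sup_le (hR.subDual_le hL) ((Submodule.span_singleton_le_iff_mem _ _).2 hi)
    have hA₂ : A₂ ≤ L := sup_le hA₁ ((Submodule.span_singleton_le_iff_mem _ _).2 hj)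
    have h1 : subDual h L < A₁ := lt_of_le_not_ge le_sup_left fun H =>
      hi' (H (Submodule.mem_sup_right (Submodule.mem_span_singleton_self _)))
    have h2 : A₁ < A₂ := lt_of_le_not_ge le_sup_left fun H => by
      obtain ⟨m, hm, x, hx, hmx⟩ := Submodule.mem_sup.1
        (H (Submodule.mem_sup_right (Submodule.mem_span_singleton_self j)))
      obtain ⟨a, rfl⟩ := Submodule.mem_span_singleton.1 hx
      refine hij ?_
      rw [← hmx, resForm_add_right hM (hR.subDual_le hL hm) (L.smul_mem a hi) hi,
        (resForm_eq_zero_iff hM hi (hR.subDual_le hL hm)).2 (hm i hi),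
        show a • i = (a : F) • i from rfl, resForm_smul_right hM a.2 hi hi, hii, mul_zero, add_zero]
    have h3 := relLength_pos h1
    have h4 := relLength_pos h2
    have h5 := relLength_add (h1.le.trans h2.le) hA₂
    have h6 := relLength_add h1.le h2.le
    have h7 : A₂ = L := by
      refine relLength_eq_zero hA₂ ?_
      rw [h5, h6, ← hdim] at h0
      generalize relLength (subDual h L) A₁ = p at *
      generalize relLength A₁ A₂ = q at *
      generalize relLength A₂ L = r at *
      induction p with
      | top => 
          rw [top_add, top_add, top_add] at h0
          exact absurd h0.symm (ENat.natCast_ne_top _)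
      | coe p =>
        induction q with
        | top => 
          rw [add_top, top_add, top_add] at h0
          exact absurd h0.symm (ENat.natCast_ne_top _)
        | coe q =>
          induction r with
          | top => 
          rw [add_top, top_add] at h0
          exact absurd h0.symm (ENat.natCast_ne_top _)
          | coe r =>
            norm_cast at *
            omega
    intro k hk
    rw [← h7] at hk
    obtain ⟨y, hy, z, hz, rfl⟩ := Submodule.mem_sup.1 hk
    obtain ⟨b, rfl⟩ := Submodule.mem_span_singleton.1 hz
    obtain ⟨m, hm, x, hx, rfl⟩ := Submodule.mem_sup.1 hy
    obtain ⟨a, rfl⟩ := Submodule.mem_span_singleton.1 hx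
    exact ⟨a, b, m, hm, a.2, b.2, by
      change m + (a : F) • i + (b : F) • j = _
      module⟩
  refine ⟨pairingKernel h i L, pairingKernel h j L, fun heq => ?_, Set.ext fun N => ⟨fun hN => ?_,
    ?_⟩⟩
  · have h1 : i ∈ pairingKernel h i L :=
      hR.mem_pairingKernel.2 ⟨hi, (resForm_eq_zero_iff hM hi hi).1 hii⟩
    rw [heq, hR.mem_pairingKernel] at h1
    refine hij ?_
    rw [hR.resForm_comm hs]
    exact (resForm_eq_zero_iff hM hj hi).2 h1.2
  · obtain ⟨hN, hNL⟩ := hN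
    obtain ⟨k, hk, hk'⟩ := hR.exists_mem_subDual hs hnd hL hN hNL
    have hkN := hR.subDual_le hN hk
    have hkk := (resForm_eq_zero_iff hM (hNL hkN) (hNL hkN)).2 (hk k hkN)
    obtain ⟨a, b, m, hm, ha, hb, hkab⟩ := hdec k (hNL hkN)
    have hmN := subDual_anti (h := h) hNL hm
    have hmL := hR.subDual_le hL hm
    have hai := int_smul_mem ha hi
    have hbj := int_smul_mem hb hj
    have hab := add_mem hai hbj
    have hm0 : ∀ x ∈ L, resForm h x m = 0 := fun x hx =>
      (resForm_eq_zero_iff hM hx hmL).2 (hm x hx)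
    have hsm := fun {a : F} (ha : valuation F a < 1) {x : V} (hx : x ∈ L) =>
      small_smul_mem_subDual (h := h) hM le_rfl ha hx
    -- In hyperbolic coordinates the form is `2ab (i, j)`, so an isotropic vector is proportional to
    -- `i` or to `j` modulo `π`.
    have e : resForm h k k = 2 * (resid a * resid b * resForm h i j) := by
      rw [hkab, resForm_add_right hM hab hmL (add_mem hab hmL), hm0 _ (add_mem hab hmL),
        resForm_add_left hM hab hmL hab, hR.resForm_comm hs m, hm0 _ hab,
        resForm_add_right hM hai hbj hab, resForm_smul_right hM ha hab hi,
        resForm_smul_right hM hb hab hj, resForm_add_left hM hai hbj hi,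
        resForm_add_left hM hai hbj hj, hR.resForm_smul_left hM ha hi hi,
        hR.resForm_smul_left hM ha hi hj, hR.resForm_smul_left hM hb hj hi,
        hR.resForm_smul_left hM hb hj hj, hii, hjj, hR.resForm_comm hs j i]
      ring
    rw [hkk] at e
    have hunit : ∀ {a : F} {x : V}, valuation F a ≤ 1 → x ∈ L → a • x ∈ subDual h N →
        a • x ∉ subDual h L → x ∈ subDual h N := by
      intro a x ha hx hax hax'
      have h1 : valuation F a = 1 := le_antisymm ha (not_lt.1 fun h1 => hax' (hsm h1 hx))
      have h0 : a ≠ 0 := fun h0 => by simp [h0] at h1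
      have := int_smul_mem (a := a⁻¹) (by rw [map_inv₀, h1, inv_one]) hax
      rwa [inv_smul_smul₀ h0] at this
    have hcase : resid a = 0 ∨ resid b = 0 := by
      have := mul_eq_zero.1 ((mul_eq_zero.1 e.symm).resolve_left two)
      exact mul_eq_zero.1 (this.resolve_right hij)
    rcases hcase with h0 | h0
    · right
      have hai' := hsm ((resid_eq_zero_iff ha).1 h0) hi
      have h1 : b • j = k - (a • i + m) := by rw [hkab]; module
      refine hR.eq_pairingKernel hs hL hN hNL (hunit hb hj ?_ ?_) hj'
      · rw [h1]
        exact sub_mem hk (add_mem (subDual_anti hNL hai') hmN)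
      · rw [h1]
        exact fun H => hk' ((Submodule.sub_mem_iff_left _ (add_mem hai' hm)).1 H)
    · left
      have hbj' := hsm ((resid_eq_zero_iff hb).1 h0) hj
      have h1 : a • i = k - (b • j + m) := by rw [hkab]; module
      refine hR.eq_pairingKernel hs hL hN hNL (hunit ha hi ?_ ?_) hi'
      · rw [h1]
        exact sub_mem hk (add_mem (subDual_anti hNL hbj') hmN)
      · rw [h1]
        exact fun H => hk' ((Submodule.sub_mem_iff_left _ (add_mem hbj' hm)).1 H)
  · rintro (rfl | rfl)
    · exact ⟨hR.vert_pairingKernel hs hL hi hi' hii, inf_le_left⟩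
    · exact ⟨hR.vert_pairingKernel hs hL hj hj' hjj, inf_le_left⟩

end ExtTransitive

/-! ### Reduction of integral matrices modulo `π` -/

section ResidMatrix

variable {F : Type*} [Field F] [ValuativeRel F] {ι : Type*}

theorem exists_integral_matrix [Fintype ι] [DecidableEq ι] {A : Matrix ι ι F} (hA : ∀ i j, valuation F (A i j) ≤ 1) :
    ∃ A' : Matrix ι ι 𝒪[F], A = A'.map Subtype.val ∧
      A.map resid = (IsLocalRing.residue 𝒪[F]).mapMatrix A' :=
  ⟨Matrix.of fun i j => ⟨A i j, hA i j⟩, rfl, by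
    ext i j
    exact resid_of_le (hA i j)⟩

variable [Fintype ι] [DecidableEq ι]

theorem resid_matrix_mul {A B : Matrix ι ι F} (hA : ∀ i j, valuation F (A i j) ≤ 1)
    (hB : ∀ i j, valuation F (B i j) ≤ 1) : (A * B).map resid = A.map resid * B.map resid := by
  obtain ⟨A', rfl, eA⟩ := exists_integral_matrix hA
  obtain ⟨B', rfl, eB⟩ := exists_integral_matrix hB
  rw [eA, eB, ← map_mul]
  have : A'.map Subtype.val * B'.map Subtype.val = (A' * B').map (Subtype.val : 𝒪[F] → F) :=
    (Matrix.map_mul (f := Subring.subtype _)).symm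
  rw [this]
  ext i j
  exact resid_of_le ((A' * B') i j).2

theorem valuation_det_le {A : Matrix ι ι F} (hA : ∀ i j, valuation F (A i j) ≤ 1) :
    valuation F A.det ≤ 1 := by
  obtain ⟨A', rfl, -⟩ := exists_integral_matrix hA
  have : (A'.map Subtype.val).det = (A'.det : F) := (RingHom.map_det 𝒪[F].subtype A').symm
  rw [this]
  exact A'.det.2

omit [Fintype ι] [DecidableEq ι] in
theorem resid_sum {s : Finset ι} {f : ι → F} (hf : ∀ i, valuation F (f i) ≤ 1) :
    resid (∑ i ∈ s, f i) = ∑ i ∈ s, resid (f i) := by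
  classical
  induction s using Finset.induction_on with
  | empty => simpa using resid_eq_zero (F := F) (x := 0) (by simp)
  | insert a s ha ih =>
    rw [Finset.sum_insert ha, Finset.sum_insert ha, resid_add (hf a)
      ((valuation F).map_sum_le fun i _ => hf i), ih]

theorem resid_det {A : Matrix ι ι F} (hA : ∀ i j, valuation F (A i j) ≤ 1) :
    resid A.det = (A.map resid).det := by
  obtain ⟨A', rfl, eA⟩ := exists_integral_matrix hA
  rw [eA, ← RingHom.map_det]
  have : (A'.map Subtype.val).det = (A'.det : F) := (RingHom.map_det 𝒪[F].subtype A').symm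
  rw [this]
  exact resid_of_le A'.det.2

end ResidMatrix

/-! ### Gram matrices and independence of the Hasse invariant from the basis -/

section Gram

variable {F : Type*} [Field F] {σ : F →+* F} {π : F}
  {V : Type*} [AddCommGroup V] [Module F V] {h : V →ₛₗ[σ] V →ₗ[F] F} {c : F}
  {V' : Type*} [AddCommGroup V'] [Module F V'] {h' : V' →ₛₗ[σ] V' →ₗ[F] F}
  {ι ι' : Type*} [Fintype ι] [DecidableEq ι]

/-- The Gram matrix of a family of vectors. -/
def gram (h : V →ₛₗ[σ] V →ₗ[F] F) (b : ι → V) : Matrix ι ι F := Matrix.of fun i j => h (b i) (b j)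

omit [DecidableEq ι] in
theorem gram_eq_mul (b : Module.Basis ι F V) (b' : ι' → V) :
    gram h b' = ((b.toMatrix b').map σ).transpose * gram h b * b.toMatrix b' := by
  ext i j
  have e : ∀ i, b' i = ∑ k, b.toMatrix b' k i • b k := fun i => by
    simp [Module.Basis.toMatrix_apply, b.sum_repr]
  rw [Matrix.mul_apply]
  simp only [Matrix.mul_apply, Matrix.transpose_apply, Matrix.map_apply]
  change h (b' i) (b' j) = _
  conv_lhs => rw [e j, map_sum]
  refine Finset.sum_congr rfl fun l _ => ?_
  conv_lhs => rw [e i, map_smul, map_sum, LinearMap.sum_apply]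
  rw [smul_eq_mul, mul_comm]
  congr 1
  refine Finset.sum_congr rfl fun k _ => ?_
  rw [LinearMap.map_smulₛₗ, LinearMap.smul_apply, smul_eq_mul]
  rfl

theorem exists_det_gram_eq (b : Module.Basis ι F V) (b' : Module.Basis ι F V) :
    ∃ x : F, x ≠ 0 ∧ (gram h b').det = x * σ x * (gram h b).det := by
  refine ⟨(b.toMatrix b').det, ?_, ?_⟩
  · have := b.toMatrix_mul_toMatrix_flip b'
    have h1 := congrArg Matrix.det this
    rw [Matrix.det_mul, Matrix.det_one] at h1
    exact left_ne_zero_of_mul_eq_one h1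
  · rw [gram_eq_mul b b', Matrix.det_mul, Matrix.det_mul, Matrix.det_transpose]
    have : ((b.toMatrix b').map σ).det = σ (b.toMatrix b').det := (RingHom.map_det _ _).symm
    rw [this]
    ring

/-- A change of basis multiplies the determinant of the Gram matrix by a norm. An arbitrary finite
index type is allowed so that bases adapted to orthogonal sums can be used directly. -/
theorem hasse_eq_one_iff [FiniteDimensional F V] (b : Module.Basis ι F V) :
    hasse h = 1 ↔ ∃ x : F, x ≠ 0 ∧
      (-1) ^ (Fintype.card ι * (Fintype.card ι - 1) / 2) * (gram h b).det = x * σ x := by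
  have hcard := Module.finrank_eq_card_basis b
  let e : ι ≃ Fin (Module.finrank F V) := Fintype.equivFinOfCardEq hcard.symm
  have hre : ∀ b : Module.Basis (Fin (Module.finrank F V)) F V,
      (gram h (b.reindex e.symm)).det = (gram h b).det := fun b => by
    rw [← Matrix.det_submatrix_equiv_self e (gram h b)]
    congr 1
    ext i j
    simp [gram]
  have hmain : (∃ (b : Module.Basis (Fin (Module.finrank F V)) F V) (x : F), x ≠ 0 ∧
      (-1) ^ (Module.finrank F V * (Module.finrank F V - 1) / 2) *
        (Matrix.of fun i j => h (b i) (b j)).det = x * σ x) ↔ ∃ x : F, x ≠ 0 ∧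
      (-1) ^ (Fintype.card ι * (Fintype.card ι - 1) / 2) * (gram h b).det = x * σ x := by
    rw [← hcard]
    constructor
    · rintro ⟨b', x, hx, hxe⟩
      obtain ⟨y, hy, hye⟩ := exists_det_gram_eq (h := h) (b'.reindex e.symm) b
      rw [hre] at hye
      refine ⟨y * x, mul_ne_zero hy hx, ?_⟩
      change _ * (gram h b').det = _ at hxe
      rw [hye, map_mul]
      linear_combination y * σ y * hxe
    · rintro ⟨x, hx, hxe⟩
      refine ⟨b.reindex e, x, hx, ?_⟩
      rw [← hxe]
      congr 1
      change (gram h (b.reindex e)).det = _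
      rw [← hre]
      congr 1
      ext i j
      simp [gram]
  rw [← hmain, hasse]
  split_ifs with H
  · simp [H]
  · simp [H]

theorem det_gram_prod (b : Module.Basis ι F V) :
    (gram (extForm h c) (b.prod (Module.Basis.singleton Unit F))).det = c * (gram h b).det := by
  have : gram (extForm h c) (b.prod (Module.Basis.singleton Unit F)) =
      Matrix.fromBlocks (gram h b) 0 0 (Matrix.of fun _ _ => c) := by
    ext i j
    rcases i with i | i <;> rcases j with j | j <;> simp [gram, extForm_apply]
  rw [this, Matrix.det_fromBlocks_zero₂₁, Matrix.det_unique (n := Unit), mul_comm]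
  rfl

omit [Fintype ι] [DecidableEq ι] in
theorem gram_map {φ : V ≃ₗ[F] V'} (hφ : ∀ x y, h' (φ x) (φ y) = h x y) (b : Module.Basis ι F V) :
    gram h' (b.map φ) = gram h b := by
  ext i j
  simp [gram, hφ]

end Gram

/-! ### Lattices of maximal type: symplectic reduction and discriminants -/

section Hasse

variable {F : Type*} [Field F] [ValuativeRel F] {σ : F →+* F} {π : F}
  {V : Type*} [AddCommGroup V] [Module F V] {h : V →ₛₗ[σ] V →ₗ[F] F} {c : F}
  [FiniteDimensional F V] [TopologicalSpace F] [IsNonarchimedeanLocalField F]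

/-- The Gram matrix of a vertex lattice of maximal type. -/
theorem IsRamified.exists_gram_eq (hR : IsRamified σ π) (hs : h.IsSymm) (hnd : h.Nondegenerate)
    {Λ : Submodule 𝒪[F] V} (hΛ : Λ ∈ Vert h (Module.finrank F V)) :
    ∃ b : Module.Basis (Fin (Module.finrank F V)) F V,
      (∀ z, z ∈ Λ ↔ ∀ i, valuation F (b.repr z i) ≤ 1) ∧
      ∃ S : Matrix _ _ F, gram h b = π • S ∧ (∀ i j, valuation F (S i j) ≤ 1) ∧
      (∀ i j, S j i = - σ (S i j)) ∧ (S.map resid).det ≠ 0 := by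
  have hsub := hR.subDual_eq hs hnd hΛ
  obtain ⟨b, hb⟩ := hΛ.isLattice.exists_basis
  have hbΛ : ∀ i, b i ∈ Λ := fun i => (hb _).2 fun j => by
    rw [b.repr_self, Finsupp.single_apply]
    split_ifs <;> simp
  have hlt : ∀ i j, valuation F (h (b i) (b j)) < 1 := fun i j =>
    (hsub.symm.le (hbΛ j) : b j ∈ subDual h Λ) _ (hbΛ i)
  have hS1 : ∀ i j, valuation F ((π⁻¹ • gram h b) i j) ≤ 1 := fun i j => by
    rw [Matrix.smul_apply, smul_eq_mul]
    exact hR.unif_inv (hlt i j)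
  refine ⟨b, hb, π⁻¹ • gram h b, ?_, hS1, fun i j => ?_, fun h0 => ?_⟩
  · rw [smul_inv_smul₀ hR.unif_ne]
  -- Division by `π` turns hermitian into skew-hermitian, as `σ π = -π`.
  · simp only [Matrix.smul_apply, smul_eq_mul, map_mul, map_inv₀, hR.map_unif, gram,
      Matrix.of_apply, hs.eq]
    rw [inv_neg]
    ring
  -- A vector in the kernel of the reduction lifts to `z` with `π⁻¹ z` in `π Λ^∨ = Λ`. Hence all
  -- coordinates of `z` are divisible by `π`, so the vector was zero.
  · obtain ⟨v, hv, hSv⟩ := Matrix.exists_mulVec_eq_zero_iff.2 h0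
    choose x hx hxv using fun i => exists_resid_eq (F := F) (v i)
    set z := ∑ j, x j • b j with hz
    have hzr : ∀ i, b.repr z i = x i := fun i => by
      rw [hz, b.repr_sum_self]
    have hzz : π⁻¹ • z ∈ Λ := by
      rw [← hsub]
      intro y hy
      rw [form_sum_left b]
      refine (valuation F).map_sum_lt one_ne_zero fun i _ => ?_
      rw [map_mul, hR.val_map]
      refine (mul_le_of_le_one_left' ((hb y).1 hy i)).trans_lt ?_
      have e : h (b i) (π⁻¹ • z) = ∑ j, (π⁻¹ • gram h b) i j * x j := by
        rw [hz, map_smul, map_sum, Finset.smul_sum]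
        refine Finset.sum_congr rfl fun j _ => ?_
        simp only [gram, Matrix.smul_apply, Matrix.of_apply, map_smul, smul_eq_mul]
        ring
      have hle : ∀ j, valuation F ((π⁻¹ • gram h b) i j * x j) ≤ 1 := fun j => by
        rw [map_mul]
        exact mul_le_one' (hS1 i j) (hx j)
      rw [e, ← resid_eq_zero_iff ((valuation F).map_sum_le fun j _ => hle j), resid_sum hle]
      refine Eq.trans ?_ (congrFun hSv i)
      refine Finset.sum_congr rfl fun j _ => ?_
      rw [resid_mul (hS1 i j) (hx j), hxv]
      rfl
    refine hv (funext fun i => ?_)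
    rw [Pi.zero_apply, ← hxv, resid_eq_zero_iff (hx i)]
    have h1 := (hb _).1 hzz i
    rw [map_smul, Finsupp.smul_apply, hzr, smul_eq_mul] at h1
    have h2 : x i = π * (π⁻¹ * x i) := by rw [mul_inv_cancel_left₀ hR.unif_ne]
    rw [h2, map_mul]
    exact (mul_le_of_le_one_right' h1).trans_lt hR.unif_lt

/-- The reduction of an element of the stabilizer preserves the nondegenerate alternating form
obtained from `π⁻¹ h`, and symplectic matrices have determinant one. -/
theorem IsRamified.det_sub_one_lt (hR : IsRamified σ π) (hs : h.IsSymm) (hnd : h.Nondegenerate)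
    {Λ : Submodule 𝒪[F] V} (hΛ : Λ ∈ Vert h (Module.finrank F V)) {a : unitaryGroup h}
    (ha : a ∈ stab h Λ) :
    valuation F ((LinearEquiv.det (a : V ≃ₗ[F] V) : F) - 1) < 1 := by
  obtain ⟨b, hb, S, hbS, hS1, hS2, hS0⟩ := hR.exists_gram_eq hs hnd hΛ
  have hbΛ : ∀ i, b i ∈ Λ := fun i => (hb _).2 fun j => by
    rw [b.repr_self, Finsupp.single_apply]
    split_ifs <;> simp
  set A := b.toMatrix fun i => (a : V ≃ₗ[F] V) (b i) with hA
  have hA1 : ∀ i j, valuation F (A i j) ≤ 1 := fun i j =>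
    (hb _).1 ((ha _).2 (hbΛ j)) i
  have hdet : (LinearEquiv.det (a : V ≃ₗ[F] V) : F) = A.det := by
    rw [LinearEquiv.coe_det, ← LinearMap.det_toMatrix b]
    congr 1
    ext i j
    rw [LinearMap.toMatrix_apply]
    rfl
  have hAS : (A.map σ).transpose * S * A = S := by
    have h1 := gram_eq_mul (h := h) b fun i => (a : V ≃ₗ[F] V) (b i)
    have h2 : gram h (fun i => (a : V ≃ₗ[F] V) (b i)) = gram h b := by
      ext i j
      exact a.2 _ _
    rw [h2, hbS, Matrix.mul_smul, Matrix.smul_mul] at h1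
    exact (smul_right_injective _ hR.unif_ne h1).symm
  have hAσ1 : ∀ i j, valuation F ((A.map σ).transpose i j) ≤ 1 := fun i j => by
    rw [Matrix.transpose_apply, Matrix.map_apply, hR.val_map]
    exact hA1 j i
  have hAS1 : ∀ i j, valuation F (((A.map σ).transpose * S) i j) ≤ 1 := fun i j => by
    rw [Matrix.mul_apply]
    refine (valuation F).map_sum_le fun k _ => ?_
    rw [map_mul]
    exact mul_le_one' (hAσ1 i k) (hS1 k j)
  have h3 : (A.map resid).transpose * S.map resid * A.map resid = S.map resid := by
    conv_rhs => rw [← hAS]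
    rw [resid_matrix_mul hAS1 hA1, resid_matrix_mul hAσ1 hS1]
    congr 2
    ext i j
    exact (hR.resid_map _).symm
  have hST : (S.map resid).transpose = - S.map resid := by
    ext i j
    rw [Matrix.transpose_apply, Matrix.map_apply, Matrix.neg_apply, Matrix.map_apply, hS2 i j,
      resid_neg (by rw [hR.val_map]; exact hS1 i j), hR.resid_map]
  have h4 := det_eq_one_of_alternating hS0 hST (fun x => by
    have h5 : x ⬝ᵥ (S.map resid).mulVec x = - (x ⬝ᵥ (S.map resid).mulVec x) := by
      conv_lhs => rw [Matrix.dotProduct_mulVec, ← Matrix.mulVec_transpose, hST,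
        Matrix.neg_mulVec, neg_dotProduct, dotProduct_comm]
    have h6 : (2 : 𝓀[F]) * (x ⬝ᵥ (S.map resid).mulVec x) = 0 := by linear_combination h5
    exact (mul_eq_zero.1 h6).resolve_left hR.two_ne_zero) _ h3
  rw [hdet, ← resid_eq_zero_iff ((valuation F).map_sub_le (valuation_det_le hA1) (map_one _).le),
    resid_sub (valuation_det_le hA1) (map_one _).le, resid_det hA1, h4, resid_one, sub_self]

/-- The discriminant of a space with a vertex lattice of maximal type is trivial. -/
theorem IsRamified.exists_norm_of_vert (hR : IsRamified σ π) (hs : h.IsSymm) (hnd : h.Nondegenerate)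
    {Λ : Submodule 𝒪[F] V} (hΛ : Λ ∈ Vert h (Module.finrank F V)) {k : ℕ}
    (hk : Module.finrank F V = 2 * k) :
    ∃ b : Module.Basis (Fin (Module.finrank F V)) F V, ∃ x : F, x ≠ 0 ∧
      (-1) ^ k * (gram h b).det = x * σ x := by
  obtain ⟨b, hb, S, hbS, hS1, hS2, hS0⟩ := hR.exists_gram_eq hs hnd hΛ
  have hST : (S.map resid).transpose = - S.map resid := by
    ext i j
    rw [Matrix.transpose_apply, Matrix.map_apply, Matrix.neg_apply, Matrix.map_apply, hS2 i j,
      resid_neg (by rw [hR.val_map]; exact hS1 i j), hR.resid_map]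
  have hd : ∀ i, (S.map resid) i i = 0 := fun i => by
    have h5 : (S.map resid) i i = - (S.map resid) i i := congrFun (congrFun hST i) i
    have h6 : (2 : 𝓀[F]) * (S.map resid) i i = 0 := by linear_combination h5
    exact (mul_eq_zero.1 h6).resolve_left hR.two_ne_zero
  -- Modulo `π`, the determinant of `S` is the square of the residue of some unit `y`, that is, the
  -- residue of the norm of `y`.
  obtain ⟨d, hd⟩ := det_isSquare_of_alternating _ hST hd
  have hd0 : d ≠ 0 := fun h0 => hS0 (by rw [hd, h0, zero_mul])
  obtain ⟨y, hy, rfl⟩ := exists_resid_eq d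
  have hy1 : valuation F y = 1 := (resid_ne_zero_iff hy).1 hd0
  have hy0 : y ≠ 0 := fun h0 => by simp [h0] at hy1
  have hσy0 : σ y ≠ 0 := (map_ne_zero σ).2 hy0
  have hσS : σ S.det = S.det := by
    have h1 : S.map σ = (-1 : F) • S.transpose := by
      ext i j
      rw [Matrix.smul_apply, Matrix.transpose_apply, hS2 i j]
      simp
    have h2 : (S.map σ).det = σ S.det := (RingHom.map_det _ _).symm
    have h3 : (-1 : F) ^ Module.finrank F V = 1 := by
      rw [hk, pow_mul]
      simp
    rw [← h2, h1, Matrix.det_smul, Matrix.det_transpose, Fintype.card_fin, h3, one_mul]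
  have hzz : valuation F (S.det * (y * σ y)⁻¹) ≤ 1 := by
    rw [map_mul, map_inv₀, map_mul, hR.val_map, hy1, one_mul, inv_one, mul_one]
    exact valuation_det_le hS1
  -- The quotient of `det S` by the norm of `y` is a principal unit fixed by `σ`, hence a norm. The
  -- factor `π^(2k)` contributes the norm of `π^k` times `(-1)^k`, which is the sign in the
  -- statement.
  obtain ⟨w, hw0, hw⟩ := hR.exists_norm_eq (x := S.det * (y * σ y)⁻¹) (by
    rw [map_mul, map_inv₀, map_mul, hR.invol, hσS, mul_comm y]) (by
    rw [← resid_eq_zero_iff ((valuation F).map_sub_le hzz (map_one _).le),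
      resid_sub hzz (map_one _).le, resid_mul (valuation_det_le hS1) (by simp [hy1, hR.val_map]),
      resid_det hS1, hd, sub_eq_zero, resid_one]
    have h1 : resid (y * σ y) = resid y * resid y := by
      rw [resid_mul hy (by rwa [hR.val_map]), hR.resid_map]
    rw [← h1, ← resid_mul (by simp [hy1, hR.val_map]) (by simp [hy1, hR.val_map]),
      mul_inv_cancel₀ (mul_ne_zero hy0 hσy0), resid_one])
  refine ⟨b, π ^ k * y * w, mul_ne_zero (mul_ne_zero (pow_ne_zero _ hR.unif_ne) hy0) hw0, ?_⟩
  have hS : S.det = w * σ w * (y * σ y) := by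
    rw [← hw, inv_mul_cancel_right₀ (mul_ne_zero hy0 hσy0)]
  have h3 : π ^ Module.finrank F V = π ^ k * π ^ k := by rw [hk, two_mul, pow_add]
  rw [hbS, Matrix.det_smul, hS, Fintype.card_fin, h3, map_mul, map_mul, map_pow, hR.map_unif,
    neg_pow π]
  ring

omit [ValuativeRel F] [TopologicalSpace F] [IsNonarchimedeanLocalField F] in
-- The exponent is `k (2k - 1)`, which has the parity of `k`.
theorem neg_one_pow_hasse (k : ℕ) : (-1 : F) ^ (2 * k * (2 * k - 1) / 2) = (-1) ^ k := by
  rw [mul_assoc, Nat.mul_div_cancel_left _ two_pos]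
  rcases Nat.eq_zero_or_pos k with rfl | hk
  · rfl
  · obtain ⟨k, rfl⟩ := Nat.exists_eq_add_of_lt hk
    rw [show 2 * (0 + k + 1) - 1 = 2 * k + 1 by omega, mul_comm, pow_mul, pow_succ (-1 : F) (2 * k),
      pow_mul]
    simp

theorem IsRamified.hasse_eq_one_of_vert (hR : IsRamified σ π) (hs : h.IsSymm)
    (hnd : h.Nondegenerate) {Λ : Submodule 𝒪[F] V} (hΛ : Λ ∈ Vert h (Module.finrank F V))
    (heven : Even (Module.finrank F V)) : hasse h = 1 := by
  obtain ⟨k, hk⟩ := heven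
  rw [← two_mul] at hk
  obtain ⟨b, x, hx, hxe⟩ := hR.exists_norm_of_vert hs hnd hΛ hk
  refine (hasse_eq_one_iff b).2 ⟨x, hx, ?_⟩
  have h3 := neg_one_pow_hasse (F := F) k
  rw [← hk] at h3
  rw [Fintype.card_fin, h3, hxe]

/-- Splitting off a line spanned by a vector of unit length. -/
theorem IsRamified.exists_isometry_extForm (hR : IsRamified σ π) (hs : h.IsSymm)
    (hnd : h.Nondegenerate) {t : ℕ} {L : Submodule 𝒪[F] V} (hL : L ∈ Vert h t)
    (ht : t < Module.finrank F V) :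
    ∃ (W : Submodule F V) (h' : W →ₛₗ[σ] W →ₗ[F] F) (q : F) (φ : V ≃ₗ[F] W × F),
      h'.IsSymm ∧ h'.Nondegenerate ∧ σ q = q ∧ valuation F q = 1 ∧
      IsIsometry h (extForm h' q) φ ∧ Module.finrank F W + 1 = Module.finrank F V ∧
      ∃ M ∈ Vert h' t, mapLattice φ L = addLine M := by
  obtain ⟨e, he, hee⟩ := hR.exists_unit_vector hs hnd hL ht
  have hee0 : h e e ≠ 0 := fun h0 => by simp [h0] at hee
  let W : Submodule F V := LinearMap.ker (h e)
  let h' : W →ₛₗ[σ] W →ₗ[F] F := LinearMap.mk₂'ₛₗ σ (RingHom.id F) (fun x y => h x y)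
    (fun x x' y => by simp) (fun a x y => by simp) (fun x y y' => by simp) (fun a x y => by simp)
  have hW : ∀ x : V, x - (h e x / h e e) • e ∈ W := fun x => by
    change h e _ = 0
    rw [map_sub, map_smul, smul_eq_mul, div_mul_cancel₀ _ hee0, sub_self]
  have hW' : ∀ w : W, h e w = 0 := fun w => w.2
  have hW'' : ∀ w : W, h w e = 0 := fun w => by rw [← hs.eq, hW', map_zero]
  let φ : V ≃ₗ[F] W × F := LinearEquiv.ofLinearMap
    (LinearMap.prod (LinearMap.codRestrict W (LinearMap.id - (LinearMap.toSpanSingleton F V e).comp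
      ((h e e)⁻¹ • h e)) (fun x => by
        convert! hW x using 1
        simp [div_eq_inv_mul])) ((h e e)⁻¹ • h e))
    (W.subtype.coprod (LinearMap.toSpanSingleton F V e))
    (by
      refine LinearMap.ext fun x => Prod.ext (Subtype.ext ?_) ?_
      · simp [hW', hee0]
      · change (h e e)⁻¹ * h e (x.1 + x.2 • e) = x.2
        rw [map_add, hW', map_smul, smul_eq_mul, zero_add]
        field_simp)
    (by
      ext x
      simp)
  have hφs : ∀ x : W × F, φ.symm x = x.1 + x.2 • e := fun x => rfl
  have hiso : IsIsometry (extForm h' (h e e)) h φ.symm := fun x y => by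
    rw [hφs, hφs, extForm_apply]
    simp only [map_add, LinearMap.add_apply, map_smul, LinearMap.map_smulₛₗ, LinearMap.smul_apply,
      hW', hW'', smul_eq_mul]
    change _ = h x.1 y.1 + _
    ring
  have hσq : σ (h e e) = h e e := hs.eq e e
  have hnd' : h'.Nondegenerate := by
    have hr : ∀ w, (∀ x, h' x w = 0) → w = 0 := fun w hw => by
      refine Subtype.ext (hnd.2 _ fun x => ?_)
      have h1 : x = (φ x).1 + (φ x).2 • e := by rw [← hφs, φ.symm_apply_apply]
      rw [h1, map_add, LinearMap.add_apply, LinearMap.map_smulₛₗ, LinearMap.smul_apply, hW',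
        smul_zero, add_zero]
      exact hw _
    have hs' : ∀ x y, σ (h' x y) = h' y x := fun x y => hs.eq x y
    exact ⟨fun w hw => hr w fun x => by rw [← hs', hw, map_zero], hr⟩
  have hvert : mapLattice φ L ∈ Vert (extForm h' (h e e)) t :=
    (show IsIsometry h (extForm h' (h e e)) φ from hiso.symm).mapLattice_mem_vert hR hL
  have hue : specialVec F W ∈ mapLattice φ L := by
    rw [mem_mapLattice, hφs]
    simpa [specialVec] using he
  refine ⟨W, h', h e e, φ, ⟨fun x y => hs.eq x y⟩, hnd', hσq, hee, hiso.symm, ?_, _,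
    hR.flatPart_mem_vert hee hvert hue, (addLine_flatPart hee hvert.le_dual hue).symm⟩
  rw [φ.finrank_eq, Module.finrank_prod, Module.finrank_self]

/-- In a split space of even dimension `N`, the reduction of a vertex lattice of type `N - 2` is
a hyperbolic plane. -/
theorem IsRamified.exists_isotropic (hR : IsRamified σ π) (hs : h.IsSymm)
    (hnd : h.Nondegenerate) {t : ℕ} {L : Submodule 𝒪[F] V} (hL : L ∈ Vert h t)
    (ht : t + 2 = Module.finrank F V) (heven : Even t) (hh : hasse h = 1) :
    ∃ i ∈ L, i ∉ subDual h L ∧ resForm h i i = 0 := by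
  obtain ⟨W, h₁, q₁, φ, hs₁, hnd₁, hσq₁, hq₁, hφ, hW, L₁, hL₁, hφL⟩ :=
    hR.exists_isometry_extForm hs hnd hL (by omega)
  obtain ⟨W', h₂, q₂, ψ, hs₂, hnd₂, hσq₂, hq₂, hψ, hW', L₂, hL₂, hψL⟩ :=
    hR.exists_isometry_extForm hs₁ hnd₁ hL₁ (by omega)
  obtain rfl : t = Module.finrank F W' := by omega
  obtain ⟨k, hk⟩ := heven
  rw [← two_mul] at hk
  -- Once two lines of unit lengths `q₁` and `q₂` are split off, the remaining lattice has maximal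
  -- type and trivial discriminant. Splitness of the whole space thus makes `-q₁ q₂` the norm of an
  -- element `r`.
  obtain ⟨b, x, hx, hxe⟩ := hR.exists_norm_of_vert hs₂ hnd₂ hL₂ hk
  obtain ⟨y, hy, hye⟩ := (hasse_eq_one_iff
    ((((b.prod (Module.Basis.singleton Unit F)).map ψ.symm).prod
      (Module.Basis.singleton Unit F)).map φ.symm)).1 hh
  rw [gram_map hφ.symm, det_gram_prod, gram_map hψ.symm, det_gram_prod] at hye
  have hcard : Fintype.card ((Fin (Module.finrank F W') ⊕ Unit) ⊕ Unit) = 2 * (k + 1) := by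
    simp only [Fintype.card_sum, Fintype.card_fin, Fintype.card_unit, hk]
    ring
  rw [hcard, neg_one_pow_hasse] at hye
  have hq1 : q₁ ≠ 0 := fun h0 => by simp [h0] at hq₁
  have hσx : σ x ≠ 0 := (map_ne_zero σ).2 hx
  have hr : - (q₁ * q₂) = y / x * σ (y / x) := by
    rw [map_div₀, div_mul_div_comm, ← hxe, ← hye, eq_div_iff (by
      rw [hxe]; exact mul_ne_zero hx hσx)]
    ring
  set r := y / x
  have hr1 : valuation F r = 1 := by
    have h1 := congrArg (valuation F) hr
    rw [Valuation.map_neg, map_mul, map_mul, hq₁, hq₂, hR.val_map, one_mul, ← sq] at h1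
    exact (pow_eq_one_iff.1 h1.symm).resolve_right _root_.two_ne_zero
  set e₁ : V := φ.symm (specialVec F W) with he₁
  set e₂ : V := φ.symm (ψ.symm (specialVec F W'), 0) with he₂
  have he₁L : e₁ ∈ L := by
    rw [← mem_mapLattice, hφL]
    exact specialVec_mem_addLine _
  have he₂L : e₂ ∈ L := by
    rw [← mem_mapLattice, hφL, mem_addLine]
    refine ⟨?_, zero_mem _⟩
    rw [← mem_mapLattice, hψL]
    exact specialVec_mem_addLine _
  have h11 : h e₁ e₁ = q₁ := by
    rw [he₁, hφ.symm, extForm_apply]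
    simp [specialVec]
  have h12 : h e₁ e₂ = 0 := by
    rw [he₁, he₂, hφ.symm, extForm_apply]
    simp [specialVec]
  have h21 : h e₂ e₁ = 0 := by rw [← hs.eq, h12, map_zero]
  have h22 : h e₂ e₂ = q₂ := by
    rw [he₂, hφ.symm, extForm_apply, hψ.symm, extForm_apply]
    simp [specialVec]
  have hre := int_smul_mem hr1.le he₁L
  have hqe := int_smul_mem hq₁.le he₂L
  have hiL := add_mem hre hqe
  have hM := hL.le_dual
  -- This vector has length `q₁ (r σ(r) + q₁ q₂) = 0`. It is not in the radical because its pairing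
  -- with `e₁` is a unit.
  refine ⟨r • e₁ + q₁ • e₂, hiL, fun H => ?_, ?_⟩
  · have h1 := H _ he₁L
    rw [map_add, map_smul, map_smul, h11, h12, smul_zero, add_zero, smul_eq_mul, map_mul, hr1,
      hq₁, one_mul] at h1
    exact lt_irrefl _ h1
  · have e : h (r • e₁ + q₁ • e₂) (r • e₁ + q₁ • e₂) = q₁ * (r * σ r + q₁ * q₂) := by
      simp only [map_add, LinearMap.add_apply, map_smul, LinearMap.map_smulₛₗ,
        LinearMap.smul_apply, h11, h12, h21, h22, smul_eq_mul, hσq₁]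
      ring
    rw [resForm, e, ← hr, neg_add_cancel, mul_zero]
    exact resid_eq_zero (by simp)

end Hasse

/-! ### Finiteness of sets of lattices -/

/-- There are finitely many submodules between `A` and `B` if `B` is finitely generated and
`ϖ ^ k B ⊆ A`. -/
theorem finite_between {R M : Type*} [CommRing R] [IsDomain R] [IsDiscreteValuationRing R]
    [Finite (IsLocalRing.ResidueField R)] [AddCommGroup M] [Module R M] {ϖ : R}
    (hϖ : Irreducible ϖ) {A B : Submodule R M} (hB : B.FG) {k : ℕ} (hk : ∀ x ∈ B, ϖ ^ k • x ∈ A) :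
    {X : Submodule R M | A ≤ X ∧ X ≤ B}.Finite := by
  have hfin : Finite (R ⧸ IsLocalRing.maximalIdeal R) :=
    inferInstanceAs (Finite (IsLocalRing.ResidueField R))
  have hfin' := Ideal.finite_quotient_pow (I := IsLocalRing.maximalIdeal R)
    (IsNoetherian.noetherian _) k
  rw [hϖ.maximalIdeal_eq, Ideal.span_singleton_pow] at hfin'
  set I := Ideal.span {ϖ ^ k}
  have hB' : (⊤ : Submodule R B).FG := (Submodule.fg_top B).2 hB
  have : Finite (B ⧸ (I • ⊤ : Submodule R B)) := Submodule.finite_quotient_smul _ hB'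
  have hle : ∀ x : B, x ∈ (I • ⊤ : Submodule R B) → (x : M) ∈ A := by
    intro x hx
    refine Submodule.smul_induction_on hx (fun r hr n _ => ?_) fun x y hx hy => add_mem hx hy
    obtain ⟨s, rfl⟩ := Ideal.mem_span_singleton'.1 hr
    rw [mul_smul]
    exact A.smul_mem s (hk n n.2)
  refine (Set.finite_range fun Y : Submodule R (B ⧸ (I • ⊤ : Submodule R B)) =>
    (Y.comap (Submodule.mkQ _)).map B.subtype).subset ?_
  rintro X ⟨hAX, hXB⟩
  refine ⟨(X.submoduleOf B).map (Submodule.mkQ _), ?_⟩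
  ext x
  constructor
  · rintro ⟨y, ⟨z, hz, hzy⟩, rfl⟩
    have h1 := hAX (hle _ ((Submodule.Quotient.eq _).1 hzy))
    have h2 := X.sub_mem hz h1
    simpa using h2
  · intro hx
    exact ⟨⟨x, hXB hx⟩, ⟨⟨x, hXB hx⟩, hx, rfl⟩, rfl⟩

section FiniteLattices

variable {F : Type*} [Field F] [ValuativeRel F] [TopologicalSpace F] [IsNonarchimedeanLocalField F]
  {σ : F →+* F} {π : F}
  {V : Type*} [AddCommGroup V] [Module F V] {h : V →ₛₗ[σ] V →ₗ[F] F} {c : F}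

theorem exists_pow_mul_mem {ϖ : 𝒪[F]} (hϖ : Irreducible ϖ) (a : F) :
    ∃ k : ℕ, valuation F ((ϖ : F) ^ k * a) ≤ 1 := by
  by_cases ha : valuation F a ≤ 1
  · exact ⟨0, by simpa using ha⟩
  have ha0 : a ≠ 0 := fun h0 => ha (by simp [h0])
  have ha' : valuation F a⁻¹ ≤ 1 := by
    rw [map_inv₀]
    exact inv_le_one_of_one_le₀ (not_le.1 ha).le
  obtain ⟨k, u, hu⟩ := IsDiscreteValuationRing.eq_unit_mul_pow_irreducible
    (x := (⟨a⁻¹, ha'⟩ : 𝒪[F])) (fun h0 => inv_ne_zero ha0 (congrArg Subtype.val h0)) hϖ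
  refine ⟨k, ?_⟩
  have h1 : a⁻¹ = (u : 𝒪[F]) * (ϖ : F) ^ k := congrArg Subtype.val hu
  have h2 : (ϖ : F) ^ k * a * (u : 𝒪[F]) = 1 := by
    rw [show (ϖ : F) ^ k * a * ((u : 𝒪[F]) : F) = ((u : 𝒪[F]) * (ϖ : F) ^ k) * a by ring, ← h1,
      inv_mul_cancel₀ ha0]
  have h3 := congrArg (valuation F) h2
  rw [map_mul, valuation_unit, mul_one, map_one] at h3
  exact h3.le

theorem exists_pow_smul_mem {ϖ : 𝒪[F]} (hϖ : Irreducible ϖ) {A B : Submodule 𝒪[F] V}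
    (hA : A.FG) (hB : B.IsLattice F) : ∃ k : ℕ, ∀ x ∈ A, ϖ ^ k • x ∈ B := by
  induction A, hA using Submodule.fg_induction with
  | singleton x =>
    have hx : x ∈ Submodule.span F (B : Set V) := hB.span_eq_top ▸ Submodule.mem_top
    have h1 : ∃ k : ℕ, ϖ ^ k • x ∈ B := by
      induction hx using Submodule.span_induction with
      | mem x hx => exact ⟨0, by simpa using hx⟩
      | zero => exact ⟨0, by simp⟩
      | add x y _ _ hx hy =>
        obtain ⟨k, hk⟩ := hx
        obtain ⟨l, hl⟩ := hy
        refine ⟨k + l, ?_⟩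
        rw [smul_add]
        refine add_mem ?_ ?_
        · rw [pow_add, mul_comm, mul_smul]
          exact B.smul_mem _ hk
        · rw [pow_add, mul_smul]
          exact B.smul_mem _ hl
      | smul a x _ hx =>
        obtain ⟨k, hk⟩ := hx
        obtain ⟨l, hl⟩ := exists_pow_mul_mem hϖ a
        refine ⟨l + k, ?_⟩
        have := int_smul_mem hl hk
        convert! this using 1
        change ((ϖ ^ (l + k) : 𝒪[F]) : F) • a • x = _ • ((ϖ ^ k : 𝒪[F]) : F) • x
        rw [smul_smul, smul_smul]
        congr 1
        push_cast
        ring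
    obtain ⟨k, hk⟩ := h1
    refine ⟨k, fun y hy => ?_⟩
    obtain ⟨a, rfl⟩ := Submodule.mem_span_singleton.1 hy
    rw [smul_comm]
    exact B.smul_mem _ hk
  | sup N₁ N₂ _ _ h1 h2 =>
    obtain ⟨k, hk⟩ := h1
    obtain ⟨l, hl⟩ := h2
    refine ⟨k + l, fun x hx => ?_⟩
    obtain ⟨y, hy, z, hz, rfl⟩ := Submodule.mem_sup.1 hx
    rw [smul_add]
    refine add_mem ?_ ?_
    · rw [pow_add, mul_comm, mul_smul]
      exact B.smul_mem _ (hk y hy)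
    · rw [pow_add, mul_smul]
      exact B.smul_mem _ (hl z hz)

omit [TopologicalSpace F] [IsNonarchimedeanLocalField F] in
theorem smul_pow_isLattice {ϖ : 𝒪[F]} (hϖ : Irreducible ϖ) (k : ℕ) {A : Submodule 𝒪[F] V}
    (hA : A.IsLattice F) : ∃ B : Submodule 𝒪[F] V, B.IsLattice F ∧ ∀ x, x ∈ B ↔ ϖ ^ k • x ∈ A := by
  have h0 : (ϖ : F) ^ k ≠ 0 := pow_ne_zero _ fun h0 => hϖ.ne_zero (Subtype.ext h0)
  refine ⟨mapLattice (LinearEquiv.smulOfNeZero F V _ (inv_ne_zero h0)) A,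
    mapLattice_isLattice _ hA, fun x => ?_⟩
  rw [mem_mapLattice]
  have : (LinearEquiv.smulOfNeZero F V _ (inv_ne_zero h0)).symm x = ϖ ^ k • x := by
    rw [LinearEquiv.symm_apply_eq]
    change x = ((ϖ : F) ^ k)⁻¹ • ((ϖ : F) ^ k) • x
    rw [inv_smul_smul₀ h0]
  rw [this]

variable [FiniteDimensional F V]

/-- Finitely many images of a lattice under isometries contain a given lattice. -/
theorem IsRamified.finite_images (hR : IsRamified σ π) (hs : h.IsSymm) (hnd : h.Nondegenerate)
    {N M : Submodule 𝒪[F] V} (hN : N.IsLattice F) (hM : M.IsLattice F) :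
    {X : Submodule 𝒪[F] V | N ≤ X ∧ ∃ g : unitaryGroup h, mapLattice (g : V ≃ₗ[F] V) M = X}.Finite := by
  obtain ⟨ϖ, hϖ⟩ := IsDiscreteValuationRing.exists_irreducible 𝒪[F]
  -- If `ϖ^k M ≤ M^∨`, every image `X` of `M` satisfies `ϖ^k X ≤ X^∨ ≤ N^∨`. So `X` is bounded above
  -- by the lattice `B = ϖ^(-k) N^∨`.
  obtain ⟨k, hk⟩ := exists_pow_smul_mem hϖ hM.fg (hR.dual_isLattice hs hnd hM)
  obtain ⟨B, hB, hBe⟩ := smul_pow_isLattice hϖ k (hR.dual_isLattice hs hnd hN)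
  obtain ⟨l, hl⟩ := exists_pow_smul_mem hϖ hB.fg hN
  refine (finite_between hϖ hB.fg hl).subset ?_
  rintro _ ⟨hNX, g, rfl⟩
  refine ⟨hNX, fun x hx => (hBe x).2 (dual_anti hNX ?_)⟩
  rw [mem_mapLattice] at hx
  rw [(unitary_isIsometry g).dualLattice, mem_mapLattice]
  have e : (g : V ≃ₗ[F] V).symm (ϖ ^ k • x) = ϖ ^ k • (g : V ≃ₗ[F] V).symm x :=
    map_smul (g : V ≃ₗ[F] V).symm ((ϖ : F) ^ k) x
  rw [e]
  exact hk _ hx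

/-- The set of images of a lattice under isometries is countable. -/
theorem IsRamified.countable_images (hR : IsRamified σ π) (hs : h.IsSymm) (hnd : h.Nondegenerate)
    {M : Submodule 𝒪[F] V} (hM : M.IsLattice F) :
    {X : Submodule 𝒪[F] V | ∃ g : unitaryGroup h, mapLattice (g : V ≃ₗ[F] V) M = X}.Countable := by
  obtain ⟨ϖ, hϖ⟩ := IsDiscreteValuationRing.exists_irreducible 𝒪[F]
  have h0 : ∀ k, (ϖ : F) ^ k ≠ 0 := fun k => pow_ne_zero _ fun h0 => hϖ.ne_zero (Subtype.ext h0)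
  -- Every image contains `ϖ^k M` for some `k`, and for each `k` there are finitely many.
  refine (Set.countable_iUnion fun k => (hR.finite_images hs hnd
    (mapLattice_isLattice (LinearEquiv.smulOfNeZero F V _ (h0 k)) hM) hM).countable).mono ?_
  rintro X ⟨g, rfl⟩
  obtain ⟨k, hk⟩ := exists_pow_smul_mem hϖ hM.fg (mapLattice_isLattice (g : V ≃ₗ[F] V) hM)
  refine Set.mem_iUnion.2 ⟨k, fun x hx => ?_, g, rfl⟩
  rw [mem_mapLattice] at hx
  have := hk _ hx
  have e : ϖ ^ k • (LinearEquiv.smulOfNeZero F V _ (h0 k)).symm x = x :=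
    (LinearEquiv.smulOfNeZero F V _ (h0 k)).apply_symm_apply x
  rwa [e] at this

end FiniteLattices

/-! ### Topology of unitary groups -/

section UnitaryTopology

variable {F : Type*} [Field F] [ValuativeRel F] [TopologicalSpace F] [IsNonarchimedeanLocalField F]
  {σ : F →+* F} {π : F}
  {V : Type*} [AddCommGroup V] [Module F V] {h : V →ₛₗ[σ] V →ₗ[F] F} {c : F}

theorem isOpen_integers : IsOpen {x : F | valuation F x ≤ 1} := by
  rw [isOpen_iff_mem_nhds]
  intro x hx
  rw [IsValuativeTopology.mem_nhds_iff']
  refine ⟨1, fun z hz => ?_⟩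
  have := (valuation F).map_add_le (le_of_lt (show valuation F (z - x) < 1 from hz)) hx
  rwa [sub_add_cancel] at this

instance IsNonarchimedeanLocalField.t2Space : T2Space F := by
  refine IsTopologicalAddGroup.t2Space_of_zero_sep fun x hx => ⟨{z | valuation F z < valuation F x},
    ?_, fun h => lt_irrefl (valuation F x) h⟩
  exact (IsValuativeTopology.hasBasis_nhds_zero' F).mem_of_mem ((valuation F).ne_zero_iff.2 hx)

theorem isClosed_integers : IsClosed {x : F | valuation F x ≤ 1} :=
  (IsNonarchimedeanLocalField.isCompact_closedBall F 1).isClosed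

theorem IsRamified.continuous (hR : IsRamified σ π) : Continuous σ := by
  refine continuous_of_continuousAt_zero σ ?_
  rw [ContinuousAt, map_zero, (IsValuativeTopology.hasBasis_nhds_zero F).tendsto_iff
    (IsValuativeTopology.hasBasis_nhds_zero F)]
  exact fun γ _ => ⟨γ, trivial, fun x hx => by
    change valuation F (σ x) < γ
    rw [hR.val_map]
    exact hx⟩

omit [ValuativeRel F] [IsNonarchimedeanLocalField F] in
theorem continuous_coeff (v : V) (l : Module.Dual F V) :
    Continuous fun g : unitaryGroup h => l ((g : V ≃ₗ[F] V) v) :=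
  (continuous_apply (v, l)).comp (continuous_induced_dom
    (f := fun (g : unitaryGroup h) (p : V × Module.Dual F V) => p.2 ((g : V ≃ₗ[F] V) p.1)))

omit [ValuativeRel F] [IsNonarchimedeanLocalField F] in
theorem continuous_unitary_mul_left (a : unitaryGroup h) : Continuous fun g => a * g := by
  refine continuous_induced_rng.2 (continuous_pi fun p => ?_)
  exact continuous_coeff p.1 (p.2.comp (a : V ≃ₗ[F] V).toLinearMap)

variable [FiniteDimensional F V]

omit [TopologicalSpace F] [IsNonarchimedeanLocalField F] [FiniteDimensional F V] in
theorem forall_map_mem_iff {ι : Type*} [Finite ι] (b : Module.Basis ι F V)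
    {L : Submodule 𝒪[F] V} (hb : ∀ z, z ∈ L ↔ ∀ i, valuation F (b.repr z i) ≤ 1)
    {g : unitaryGroup h} : (∀ z ∈ L, (g : V ≃ₗ[F] V) z ∈ L) ↔
      ∀ j i, valuation F (b.repr ((g : V ≃ₗ[F] V) (b j)) i) ≤ 1 := by
  classical
  have := Fintype.ofFinite ι
  constructor
  · intro H j
    rw [← hb]
    refine H _ ((hb _).2 fun i => ?_)
    rw [b.repr_self, Finsupp.single_apply]
    split_ifs <;> simp
  · intro H z hz
    rw [← b.sum_repr z, map_sum]
    refine sum_mem fun j _ => ?_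
    rw [map_smul]
    exact int_smul_mem ((hb z).1 hz j) ((hb _).2 (H j))

/-- By adjunction, preserving `L^∨` amounts to the inverse preserving `L`. The stabilizer is thus
described by finitely many matrix coefficients of `g` alone, which makes it open and closed. -/
theorem IsRamified.mem_stab_iff_repr (hR : IsRamified σ π) (hs : h.IsSymm) (hnd : h.Nondegenerate)
    {L : Submodule 𝒪[F] V} (hL : L.IsLattice F) {ι ι' : Type*} [Finite ι] [Finite ι'] (b : Module.Basis ι F V)
    (b' : Module.Basis ι' F V)
    (hb : ∀ z, z ∈ L ↔ ∀ i, valuation F (b.repr z i) ≤ 1)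
    (hb' : ∀ z, z ∈ dualLattice h L ↔ ∀ i, valuation F (b'.repr z i) ≤ 1) {g : unitaryGroup h} :
    g ∈ stab h L ↔ (∀ j i, valuation F (b.repr ((g : V ≃ₗ[F] V) (b j)) i) ≤ 1) ∧
      ∀ j i, valuation F (b'.repr ((g : V ≃ₗ[F] V) (b' j)) i) ≤ 1 := by
  have hdual : ∀ g : unitaryGroup h, (∀ z ∈ L, (g : V ≃ₗ[F] V) z ∈ L) →
      ∀ z ∈ dualLattice h L, (g : V ≃ₗ[F] V).symm z ∈ dualLattice h L := by
    intro g hg z hz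
    refine mem_dualLattice.2 fun x hx => ?_
    have := mem_dualLattice.1 hz _ (hg x hx)
    rwa [← g.2, LinearEquiv.apply_symm_apply]
  rw [← forall_map_mem_iff b hb, ← forall_map_mem_iff b' hb']
  constructor
  · intro hg
    refine ⟨fun z hz => (hg z).2 hz, fun z hz => ?_⟩
    have := hdual g⁻¹ (fun z hz => ((inv_mem hg : g⁻¹ ∈ stab h L) z).2 hz) z hz
    exact this
  · rintro ⟨h1, h2⟩ v
    refine ⟨fun hv => ?_, h1 v⟩
    rw [← hR.dual_dual hs hnd hL] at hv ⊢
    refine mem_dualLattice.2 fun x hx => ?_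
    rw [← g.2 x v]
    exact mem_dualLattice.1 hv _ (h2 x hx)

theorem IsRamified.isOpen_stab (hR : IsRamified σ π) (hs : h.IsSymm) (hnd : h.Nondegenerate)
    {L : Submodule 𝒪[F] V} (hL : L.IsLattice F) : IsOpen (stab h L : Set (unitaryGroup h)) := by
  obtain ⟨b, hb⟩ := hL.exists_basis
  obtain ⟨b', hb'⟩ := (hR.dual_isLattice hs hnd hL).exists_basis
  have : (stab h L : Set (unitaryGroup h)) =
      (⋂ j, ⋂ i, {g : unitaryGroup h | valuation F (b.coord i ((g : V ≃ₗ[F] V) (b j))) ≤ 1}) ∩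
      ⋂ j, ⋂ i, {g : unitaryGroup h | valuation F (b'.coord i ((g : V ≃ₗ[F] V) (b' j))) ≤ 1} := by
    ext g
    simp only [Set.mem_inter_iff, Set.mem_iInter]
    exact hR.mem_stab_iff_repr hs hnd hL b b' hb hb'
  rw [this]
  exact (isOpen_iInter_of_finite fun j => isOpen_iInter_of_finite fun i =>
    isOpen_integers.preimage (continuous_coeff _ _)).inter
    (isOpen_iInter_of_finite fun j => isOpen_iInter_of_finite fun i =>
    isOpen_integers.preimage (continuous_coeff _ _))

theorem IsRamified.isClosed_stab (hR : IsRamified σ π) (hs : h.IsSymm) (hnd : h.Nondegenerate)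
    {L : Submodule 𝒪[F] V} (hL : L.IsLattice F) : IsClosed (stab h L : Set (unitaryGroup h)) := by
  obtain ⟨b, hb⟩ := hL.exists_basis
  obtain ⟨b', hb'⟩ := (hR.dual_isLattice hs hnd hL).exists_basis
  have : (stab h L : Set (unitaryGroup h)) =
      (⋂ j, ⋂ i, {g : unitaryGroup h | valuation F (b.coord i ((g : V ≃ₗ[F] V) (b j))) ≤ 1}) ∩
      ⋂ j, ⋂ i, {g : unitaryGroup h | valuation F (b'.coord i ((g : V ≃ₗ[F] V) (b' j))) ≤ 1} := by
    ext g
    simp only [Set.mem_inter_iff, Set.mem_iInter]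
    exact hR.mem_stab_iff_repr hs hnd hL b b' hb hb'
  rw [this]
  exact (isClosed_iInter fun j => isClosed_iInter fun i =>
    isClosed_integers.preimage (continuous_coeff _ _)).inter
    (isClosed_iInter fun j => isClosed_iInter fun i =>
    isClosed_integers.preimage (continuous_coeff _ _))

omit [ValuativeRel F] [TopologicalSpace F] [IsNonarchimedeanLocalField F] in
/-- A matrix preserving the Gram matrix comes from a unitary transformation. -/
theorem exists_unitary_of_matrix (hnd : h.Nondegenerate) {ι : Type*} [Fintype ι] [DecidableEq ι]
    (b : Module.Basis ι F V) {A : Matrix ι ι F}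
    (hA : (A.map σ).transpose * gram h b * A = gram h b) :
    ∃ g : unitaryGroup h, ∀ j i, b.repr ((g : V ≃ₗ[F] V) (b j)) i = A i j := by
  let φ := Matrix.toLin b b A
  have hφ : ∀ j i, b.repr (φ (b j)) i = A i j := fun j i => by
    have := congrFun (congrFun (LinearMap.toMatrix_toLin b b A) i) j
    rwa [LinearMap.toMatrix_apply] at this
  have h1 : ∀ i j, h (φ (b i)) (φ (b j)) = h (b i) (b j) := by
    intro i j
    have h2 := gram_eq_mul (h := h) b fun i => φ (b i)
    have h3 : b.toMatrix (fun i => φ (b i)) = A := by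
      ext i j
      exact hφ j i
    rw [h3, hA] at h2
    exact congrFun (congrFun h2 i) j
  have h2 : ∀ i y, h (φ (b i)) (φ y) = h (b i) y := by
    intro i y
    have : (h (φ (b i))).comp φ = h (b i) := b.ext fun j => h1 i j
    exact LinearMap.congr_fun this y
  have h3 : ∀ x y, h (φ x) (φ y) = h x y := by
    intro x y
    conv_lhs => rw [← b.sum_repr x]
    rw [form_sum_left b x y, map_sum, map_sum, LinearMap.sum_apply]
    refine Finset.sum_congr rfl fun i _ => ?_
    rw [map_smul, LinearMap.map_smulₛₗ, LinearMap.smul_apply, h2, smul_eq_mul]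
  have hinj : Function.Injective φ := by
    rw [injective_iff_map_eq_zero]
    intro x hx
    refine hnd.1 x fun y => ?_
    rw [← h3, hx, map_zero, LinearMap.zero_apply]
  exact ⟨⟨LinearEquiv.ofInjectiveEndo φ hinj, h3⟩, hφ⟩

omit [FiniteDimensional F V] in
-- Every coefficient `l (g v)` is a linear combination of the finitely many matrix entries, so these
-- already define the topology.
theorem isInducing_matrix {ι : Type*} [Fintype ι] (b : Module.Basis ι F V) :
    Topology.IsInducing fun (g : unitaryGroup h) (i j : ι) => b.repr ((g : V ≃ₗ[F] V) (b j)) i := by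
  refine ⟨le_antisymm (continuous_iff_le_induced.1 (continuous_pi fun i => continuous_pi fun j =>
    continuous_coeff (b j) (b.coord i))) ?_⟩
  let Ψ : (ι → ι → F) → (V × Module.Dual F V → F) := fun A p =>
    ∑ j, ∑ i, b.repr p.1 j * A i j * p.2 (b i)
  have hΨ : Continuous Ψ := by
    refine continuous_pi fun p => ?_
    fun_prop
  have hcomp : (fun (g : unitaryGroup h) (p : V × Module.Dual F V) => p.2 ((g : V ≃ₗ[F] V) p.1)) =
      Ψ ∘ fun (g : unitaryGroup h) (i j : ι) => b.repr ((g : V ≃ₗ[F] V) (b j)) i := by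
    ext g p
    change _ = ∑ j, ∑ i, _
    conv_lhs => rw [← b.sum_repr p.1, map_sum, map_sum]
    refine Finset.sum_congr rfl fun j _ => ?_
    conv_lhs => rw [map_smul, ← b.sum_repr ((g : V ≃ₗ[F] V) (b j)), map_smul, map_sum, Finset.smul_sum]
    refine Finset.sum_congr rfl fun i _ => ?_
    rw [map_smul, smul_eq_mul, smul_eq_mul, mul_assoc]
  change _ ≤ TopologicalSpace.induced _ _
  rw [hcomp, ← induced_compose]
  exact induced_mono (continuous_iff_le_induced.1 hΨ)

/-- In matrix terms, the isometries with integral entries are a closed subset, given by the Gram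
equation, of a product of copies of the compact ring of integers. -/
theorem IsRamified.isCompact_stab (hR : IsRamified σ π) (hs : h.IsSymm) (hnd : h.Nondegenerate)
    {L : Submodule 𝒪[F] V} (hL : L.IsLattice F) : IsCompact (stab h L : Set (unitaryGroup h)) := by
  obtain ⟨b, hb⟩ := hL.exists_basis
  obtain ⟨b', hb'⟩ := (hR.dual_isLattice hs hnd hL).exists_basis
  have hind := isInducing_matrix (h := h) b
  have hK : IsCompact {g : unitaryGroup h |
      ∀ i j, valuation F (b.repr ((g : V ≃ₗ[F] V) (b j)) i) ≤ 1} := by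
    rw [hind.isCompact_iff]
    have himg : (fun (g : unitaryGroup h) i j => b.repr ((g : V ≃ₗ[F] V) (b j)) i) ''
        {g : unitaryGroup h | ∀ i j, valuation F (b.repr ((g : V ≃ₗ[F] V) (b j)) i) ≤ 1} =
        (Set.univ.pi fun _ => Set.univ.pi fun _ => {x : F | valuation F x ≤ 1}) ∩
        {A | ((Matrix.of A).map σ).transpose * gram h b * Matrix.of A = gram h b} := by
      ext A
      constructor
      · rintro ⟨g, hg, rfl⟩
        refine ⟨fun i _ j _ => hg i j, ?_⟩
        have := gram_eq_mul (h := h) b fun i => (g : V ≃ₗ[F] V) (b i)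
        refine this.symm.trans ?_
        ext i j
        exact g.2 _ _
      · rintro ⟨hA1, hA2⟩
        obtain ⟨g, hg⟩ := exists_unitary_of_matrix hnd b hA2
        have : (fun i j => b.repr ((g : V ≃ₗ[F] V) (b j)) i) = A := by
          ext i j
          exact hg j i
        refine ⟨g, fun i j => ?_, this⟩
        rw [hg]
        exact hA1 i trivial j trivial
    rw [himg]
    refine (isCompact_univ_pi fun _ => isCompact_univ_pi fun _ =>
      IsNonarchimedeanLocalField.isCompact_closedBall F 1).inter_right ?_
    have hσ := hR.continuous
    have : T2Space (Matrix (Fin (Module.finrank F V)) (Fin (Module.finrank F V)) F) :=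
      inferInstanceAs (T2Space (_ → _ → F))
    exact isClosed_eq (((Continuous.matrix_map continuous_id hσ).matrix_transpose.matrix_mul
      continuous_const).matrix_mul continuous_id) continuous_const
  refine hK.of_isClosed_subset (hR.isClosed_stab hs hnd hL) fun g hg i j => ?_
  exact ((hR.mem_stab_iff_repr hs hnd hL b b' hb hb').1 hg).1 j i

/-- The group is covered by the cosets of the compact stabilizer of `L`, one for each of the
countably many images of `L`. -/
theorem IsRamified.sigmaFinite (hR : IsRamified σ π) (hs : h.IsSymm) (hnd : h.Nondegenerate)
    {L : Submodule 𝒪[F] V} (hL : L.IsLattice F) (μ : Measure (unitaryGroup h))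
    [IsFiniteMeasureOnCompacts μ] : SigmaFinite μ := by
  refine Measure.sigmaFinite_of_countable
    (S := (fun X => {g : unitaryGroup h | mapLattice (g : V ≃ₗ[F] V) L = X}) ''
      {X | ∃ g : unitaryGroup h, mapLattice (g : V ≃ₗ[F] V) L = X})
    ((hR.countable_images hs hnd hL).image _) ?_ ?_
  · rintro _ ⟨_, ⟨g, rfl⟩, rfl⟩
    have : {g' : unitaryGroup h | mapLattice (g' : V ≃ₗ[F] V) L = mapLattice (g : V ≃ₗ[F] V) L} =
        (fun x => g * x) '' (stab h L : Set (unitaryGroup h)) := by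
      ext g'
      constructor
      · intro hg'
        exact ⟨g⁻¹ * g', inv_mul_mem_stab_iff.2 hg', mul_inv_cancel_left _ _⟩
      · rintro ⟨x, hx, rfl⟩
        change mapLattice ((g * x : unitaryGroup h) : V ≃ₗ[F] V) L = _
        rw [mapLattice_mul, mem_stab_iff.1 hx]
    change μ {g' : unitaryGroup h | mapLattice (g' : V ≃ₗ[F] V) L = mapLattice (g : V ≃ₗ[F] V) L} < ⊤
    rw [this]
    exact ((hR.isCompact_stab hs hnd hL).image (continuous_unitary_mul_left g)).measure_lt_top
  · rw [Set.eq_univ_iff_forall]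
    exact fun g => ⟨_, ⟨_, ⟨g, rfl⟩, rfl⟩, rfl⟩

end UnitaryTopology

/-! ### Hecke functions as finite sums of translates -/

section HeckeSums

variable {G : Type*} [Group G]

omit [Group G] in
theorem ind_apply_of_mem {S : Set G} {x : G} (hx : x ∈ S) : ind S x = 1 :=
  Set.indicator_of_mem hx _

omit [Group G] in
theorem ind_apply_of_notMem {S : Set G} {x : G} (hx : x ∉ S) : ind S x = 0 :=
  Set.indicator_of_notMem hx _

omit [Group G] in
theorem ind_congr {G' : Type*} {S : Set G} {S' : Set G'} {x : G} {y : G'} (hxy : x ∈ S ↔ y ∈ S') : ind S x = ind S' y := by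
  by_cases hx : x ∈ S
  · rw [ind_apply_of_mem hx, ind_apply_of_mem (hxy.1 hx)]
  · rw [ind_apply_of_notMem hx, ind_apply_of_notMem (mt hxy.2 hx)]

/-- `T` is a set of representatives of the left cosets of `D` in `S`. -/
def IsReps (T : Finset G) (S : Set G) (D : Subgroup G) : Prop :=
  ∀ y, ind S y = ∑ t ∈ T, ind (D : Set G) (t⁻¹ * y)

/-- Representatives of `A / (A ∩ B)` also represent the left cosets of `B` in `A B`. -/
theorem exists_isReps (A B : Subgroup G) [hfin : Finite (A ⧸ B.subgroupOf A)] :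
    ∃ T : Finset G, (∀ t ∈ T, t ∈ A) ∧ IsReps T ((A : Set G) * (B : Set G)) B := by
  classical
  have := Fintype.ofFinite (A ⧸ B.subgroupOf A)
  have hinj : Function.Injective fun q : A ⧸ B.subgroupOf A => (q.out : G) := fun q q' hqq => by
    rw [← q.out_eq', ← q'.out_eq']
    exact congrArg _ (Subtype.ext hqq)
  refine ⟨Finset.univ.map ⟨_, hinj⟩, fun t ht => ?_, fun y => ?_⟩
  · obtain ⟨q, -, rfl⟩ := Finset.mem_map.1 ht
    exact q.out.2
  · rw [Finset.sum_map]
    by_cases hy : y ∈ (A : Set G) * (B : Set G)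
    · obtain ⟨a, ha, b, hb, rfl⟩ := hy
      rw [ind_apply_of_mem (Set.mul_mem_mul ha hb),
        Finset.sum_eq_single (QuotientGroup.mk (⟨a, ha⟩ : A)), ind_apply_of_mem]
      · have h1 : (QuotientGroup.mk (QuotientGroup.mk (⟨a, ha⟩ : A) : A ⧸ B.subgroupOf A).out :
            A ⧸ B.subgroupOf A) = QuotientGroup.mk (⟨a, ha⟩ : A) := Quotient.out_eq' _
        have h2 := QuotientGroup.eq.1 h1
        have h3 : ((QuotientGroup.mk (⟨a, ha⟩ : A) : A ⧸ B.subgroupOf A).out : G)⁻¹ * a ∈ B := h2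
        change _ * (a * b) ∈ B
        rw [← mul_assoc]
        exact mul_mem h3 hb
      · intro q _ hq
        refine ind_apply_of_notMem fun hmem => hq ?_
        rw [← q.out_eq']
        refine QuotientGroup.eq.2 ?_
        change (q.out : G)⁻¹ * a ∈ B
        have h3 := mul_mem (show (q.out : G)⁻¹ * (a * b) ∈ B from hmem) (inv_mem hb)
        rwa [mul_assoc, mul_inv_cancel_right] at h3
      · simp
    · rw [ind_apply_of_notMem hy, eq_comm]
      refine Finset.sum_eq_zero fun q _ => ind_apply_of_notMem fun hmem => hy ?_
      exact ⟨q.out, q.out.2, _, hmem, mul_inv_cancel_left _ _⟩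

theorem exists_isReps_of_le {A D : Subgroup G} (hDA : D ≤ A) [Finite (A ⧸ D.subgroupOf A)] :
    ∃ T : Finset G, (∀ t ∈ T, t ∈ A) ∧ IsReps T (A : Set G) D := by
  obtain ⟨T, hT, hTr⟩ := exists_isReps A D
  refine ⟨T, hT, ?_⟩
  have : (A : Set G) * (D : Set G) = A := by
    refine Set.Subset.antisymm ?_ fun a ha => ⟨a, ha, 1, one_mem _, mul_one _⟩
    rintro _ ⟨a, ha, d, hd, rfl⟩
    exact mul_mem ha (hDA hd)
  rwa [this] at hTr

theorem IsReps.right {A B : Subgroup G} {T : Finset G}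
    (hT : IsReps T ((A : Set G) * (B : Set G)) B) (y : G) :
    ind ((B : Set G) * (A : Set G)) y = ∑ t ∈ T, ind (B : Set G) (y * t) := by
  have h1 : ind ((B : Set G) * (A : Set G)) y = ind ((A : Set G) * (B : Set G)) y⁻¹ := by
    refine ind_congr ⟨?_, ?_⟩
    · rintro ⟨b, hb, a, ha, rfl⟩
      exact ⟨a⁻¹, inv_mem ha, b⁻¹, inv_mem hb, (mul_inv_rev b a).symm⟩
    · rintro ⟨a, ha, b, hb, hab⟩
      refine ⟨b⁻¹, inv_mem hb, a⁻¹, inv_mem ha, ?_⟩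
      change b⁻¹ * a⁻¹ = y
      rw [← mul_inv_rev, show a * b = y⁻¹ from hab, inv_inv]
  rw [h1, hT]
  refine Finset.sum_congr rfl fun t _ => ind_congr ?_
  rw [← mul_inv_rev]
  exact inv_mem_iff

variable [MeasurableSpace G] {μ : Measure G}

/-- `K` is a subgroup of finite nonzero volume, all of whose cosets have the same volume. -/
structure IsGood (μ : Measure G) (K : Subgroup G) : Prop where
  meas : ∀ g : G, MeasurableSet {x | g⁻¹ * x ∈ K}
  vol_eq : ∀ g : G, μ {x | g⁻¹ * x ∈ K} = μ K
  pos : μ K ≠ 0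
  lt_top : μ K ≠ ⊤

theorem IsGood.vol_ne_zero {K : Subgroup G} (hK : IsGood μ K) : vol μ K ≠ 0 := by
  rw [vol, Measure.real]
  exact Complex.ofReal_ne_zero.2 (ENNReal.toReal_ne_zero.2 ⟨hK.pos, hK.lt_top⟩)

omit [MeasurableSpace G] in
theorem ind_coset_eq (K : Subgroup G) (g : G) :
    (fun x => ind (K : Set G) (g⁻¹ * x)) = {x | g⁻¹ * x ∈ K}.indicator 1 := by
  ext x
  exact ind_congr (S' := {x | g⁻¹ * x ∈ K}) Iff.rfl

theorem IsGood.integrable_ind {K : Subgroup G} (hK : IsGood μ K) (g : G) :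
    Integrable (fun x => ind (K : Set G) (g⁻¹ * x)) μ := by
  rw [ind_coset_eq]
  refine (integrable_indicator_iff (hK.meas g)).2 ?_
  refine integrableOn_const ?_
  rw [hK.vol_eq]
  exact hK.lt_top

theorem IsGood.integral_ind {K : Subgroup G} (hK : IsGood μ K) (g : G) :
    ∫ x, ind (K : Set G) (g⁻¹ * x) ∂μ = vol μ K := by
  rw [ind_coset_eq, integral_indicator (hK.meas g)]
  simp [vol, Measure.real, hK.vol_eq]

/-- The cosets of `D` in `A` are disjoint and of equal positive volume, and `A` has finite volume.
-/
theorem IsGood.finite_quotient {A D : Subgroup G} (hA : IsGood μ A) (hD : IsGood μ D)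
    (hDA : D ≤ A) : Finite (A ⧸ D.subgroupOf A) := by
  by_contra hinf
  rw [not_finite_iff_infinite] at hinf
  have hle : ∀ n : ℕ, n * μ D ≤ μ A := by
    intro n
    obtain ⟨s, hs⟩ := Infinite.exists_subset_card_eq (A ⧸ D.subgroupOf A) n
    have h1 : ∑ q ∈ s, μ {x | (q.out : G)⁻¹ * x ∈ D} = n * μ D := by
      rw [Finset.sum_congr rfl fun q _ => hD.vol_eq _, Finset.sum_const, hs, nsmul_eq_mul]
    rw [← h1, ← measure_biUnion_finset]
    · refine measure_mono ?_
      refine Set.iUnion₂_subset fun q _ x hx => ?_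
      have := mul_mem q.out.2 (hDA hx)
      rwa [mul_inv_cancel_left] at this
    · intro q _ q' _ hqq
      refine Set.disjoint_left.2 fun x hx hx' => hqq ?_
      rw [← q.out_eq', ← q'.out_eq']
      refine QuotientGroup.eq.2 ?_
      change (q.out : G)⁻¹ * q'.out ∈ D
      have := mul_mem (show (q.out : G)⁻¹ * x ∈ D from hx)
        (inv_mem (show (q'.out : G)⁻¹ * x ∈ D from hx'))
      rwa [mul_inv_rev, inv_inv, mul_assoc, mul_inv_cancel_left] at this
    · exact fun q _ => hD.meas _
  obtain ⟨n, hn⟩ := ENNReal.exists_nat_mul_gt hD.pos hA.lt_top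
  exact absurd (hle n) (not_le.2 hn)

/-- Write `1_{AB}` as a sum of indicators of cosets `tB`; on each of them the invariance of `φ`
makes the integrand constant. -/
theorem conv_ind_left {A B : Subgroup G} (hB : IsGood μ B) {T : Finset G}
    (hT : IsReps T ((A : Set G) * (B : Set G)) B) {φ : G → ℂ} (hφ : ∀ b ∈ B, ∀ x, φ (b * x) = φ x)
    (x : G) : conv μ (ind ((A : Set G) * (B : Set G))) φ x = vol μ B * ∑ t ∈ T, φ (t⁻¹ * x) := by
  have h1 : ∀ y, ind ((A : Set G) * (B : Set G)) y * φ (y⁻¹ * x) =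
      ∑ t ∈ T, ind (B : Set G) (t⁻¹ * y) * φ (t⁻¹ * x) := by
    intro y
    rw [hT, Finset.sum_mul]
    refine Finset.sum_congr rfl fun t _ => ?_
    by_cases hy : t⁻¹ * y ∈ B
    · congr 1
      rw [← hφ _ hy]
      group
    · rw [ind_apply_of_notMem hy, zero_mul, zero_mul]
  rw [conv, integral_congr_ae (Filter.Eventually.of_forall h1), integral_finsetSum, Finset.mul_sum]
  · refine Finset.sum_congr rfl fun t _ => ?_
    rw [integral_mul_const, hB.integral_ind]
  · exact fun t _ => (hB.integrable_ind t).mul_const _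

theorem conv_ind_right {A B : Subgroup G} (hB : IsGood μ B) {T : Finset G}
    (hT : IsReps T ((A : Set G) * (B : Set G)) B) {φ : G → ℂ} (hφ : ∀ b ∈ B, ∀ x, φ (x * b) = φ x)
    (x : G) : conv μ φ (ind ((B : Set G) * (A : Set G))) x = vol μ B * ∑ t ∈ T, φ (x * t) := by
  have h1 : ∀ y, φ y * ind ((B : Set G) * (A : Set G)) (y⁻¹ * x) =
      ∑ t ∈ T, φ (x * t) * ind (B : Set G) ((x * t)⁻¹ * y) := by
    intro y
    rw [hT.right, Finset.mul_sum]
    refine Finset.sum_congr rfl fun t _ => ?_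
    have h2 : y⁻¹ * x * t = ((x * t)⁻¹ * y)⁻¹ := by group
    have h3 : ind (B : Set G) (y⁻¹ * x * t) = ind (B : Set G) ((x * t)⁻¹ * y) := by
      rw [h2]
      exact ind_congr inv_mem_iff
    rw [h3]
    by_cases hy : (x * t)⁻¹ * y ∈ B
    · congr 1
      rw [← hφ _ hy (x * t), mul_inv_cancel_left]
    · rw [ind_apply_of_notMem hy, mul_zero, mul_zero]
  rw [conv, integral_congr_ae (Filter.Eventually.of_forall h1), integral_finsetSum, Finset.mul_sum]
  · refine Finset.sum_congr rfl fun t _ => ?_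
    rw [integral_const_mul, hB.integral_ind, mul_comm]
  · exact fun t _ => (hB.integrable_ind _).const_mul _

omit [MeasurableSpace G] in
theorem ind_mul_left {A B : Subgroup G} {b : G} (hb : b ∈ B) (x : G) :
    ind ((B : Set G) * (A : Set G)) (b * x) = ind ((B : Set G) * (A : Set G)) x := by
  refine ind_congr ⟨?_, ?_⟩
  · rintro ⟨b', hb', a, ha, hab⟩
    refine ⟨b⁻¹ * b', mul_mem (inv_mem hb) hb', a, ha, ?_⟩
    change b⁻¹ * b' * a = x
    rw [mul_assoc, show b' * a = b * x from hab, inv_mul_cancel_left]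
  · rintro ⟨b', hb', a, ha, rfl⟩
    exact ⟨b * b', mul_mem hb hb', a, ha, mul_assoc _ _ _⟩

omit [MeasurableSpace G] in
theorem ind_mul_right {A B : Subgroup G} {b : G} (hb : b ∈ B) (x : G) :
    ind ((A : Set G) * (B : Set G)) (x * b) = ind ((A : Set G) * (B : Set G)) x := by
  refine ind_congr ⟨?_, ?_⟩
  · rintro ⟨a, ha, b', hb', hab⟩
    refine ⟨a, ha, b' * b⁻¹, mul_mem hb' (inv_mem hb), ?_⟩
    change a * (b' * b⁻¹) = x
    rw [← mul_assoc, show a * b' = x * b from hab, mul_inv_cancel_right]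
  · rintro ⟨a, ha, b', hb', rfl⟩
    exact ⟨a, ha, b' * b, mul_mem hb' hb, (mul_assoc _ _ _).symm⟩

/-- The normalizing volume disappears, and the Hecke function becomes a finite sum of two-sided
translates of `1_B`, a form to which the translation principle applies. -/
theorem hecke_apply {A B : Subgroup G} (hB : IsGood μ B) {T : Finset G}
    (hT : IsReps T ((A : Set G) * (B : Set G)) B) (x : G) :
    hecke μ A B x = ∑ s ∈ T, ∑ t ∈ T, ind (B : Set G) (s⁻¹ * x * t) := by
  rw [hecke, Pi.smul_apply, smul_eq_mul, conv_ind_left hB hT (fun b hb x => ind_mul_left hb x),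
    inv_mul_cancel_left₀ hB.vol_ne_zero]
  exact Finset.sum_congr rfl fun s _ => hT.right _

/-- The inner pair of convolutions is `vol(C)` times the Hecke function of `B` and `C`, and each
outer convolution gives a factor `vol(B)`. This explains the normalization. -/
theorem hecke₃_apply {A B C : Subgroup G} (hB : IsGood μ B) (hC : IsGood μ C) {T S : Finset G}
    (hT : IsReps T ((A : Set G) * (B : Set G)) B) (hS : IsReps S ((B : Set G) * (C : Set G)) C)
    (x : G) : hecke₃ μ A B C x = ∑ s ∈ T, ∑ t ∈ T, hecke μ B C (s⁻¹ * x * t) := by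
  have h1 : conv μ (ind ((A : Set G) * (B : Set G))) (ind ((B : Set G) * (C : Set G))) = fun y =>
      vol μ B * ∑ t ∈ T, ind ((B : Set G) * (C : Set G)) (t⁻¹ * y) := funext fun y =>
    conv_ind_left hB hT (fun b hb x => ind_mul_left hb x) y
  have h2 : conv μ (conv μ (ind ((A : Set G) * (B : Set G))) (ind ((B : Set G) * (C : Set G))))
      (ind ((C : Set G) * (B : Set G))) = fun y =>
      vol μ C * vol μ B * ∑ s ∈ T, ∑ r ∈ S, ind ((B : Set G) * (C : Set G)) (s⁻¹ * y * r) := by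
    ext y
    rw [h1, conv_ind_right hC hS]
    · rw [← Finset.mul_sum, mul_assoc, Finset.sum_comm]
      simp only [mul_assoc]
    · intro c hc y
      simp only [← mul_assoc, ind_mul_right hc]
  have h3 : ∀ y, hecke μ B C y = ∑ r ∈ S, ind ((B : Set G) * (C : Set G)) (y * r) := by
    intro y
    rw [hecke_apply hC hS, Finset.sum_comm]
    refine Finset.sum_congr rfl fun r _ => ?_
    rw [hS]
    simp only [mul_assoc]
  have h4 : ∀ b ∈ B, ∀ y, hecke μ B C (y * b) = hecke μ B C y := by
    intro b hb y
    rw [hecke_apply hC hS, hecke_apply hC hS]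
    refine Finset.sum_congr rfl fun s _ => ?_
    rw [← hS.right, ← mul_assoc, ind_mul_right hb, hS.right]
  rw [hecke₃, Pi.smul_apply, smul_eq_mul, h2, conv_ind_right hB hT]
  · simp only [h3]
    rw [Finset.sum_comm, ← Finset.mul_sum]
    have := hB.vol_ne_zero
    have := hC.vol_ne_zero
    field_simp
    simp only [mul_assoc]
  · intro b hb y
    congr 1
    refine Finset.sum_congr rfl fun s _ => ?_
    rw [← mul_assoc, ← h3, ← h3, h4 b hb]

/-- Hecke functions are bi-invariant. -/
theorem hecke_mul_right {A B : Subgroup G} (hB : IsGood μ B) [Finite (A ⧸ B.subgroupOf A)]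
    {a : G} (ha : a ∈ A) (x : G) : hecke μ A B (x * a) = hecke μ A B x := by
  obtain ⟨T, -, hT⟩ := exists_isReps A B
  rw [hecke_apply hB hT, hecke_apply hB hT]
  refine Finset.sum_congr rfl fun s _ => ?_
  rw [← hT.right, ← mul_assoc, ind_mul_right ha, hT.right]

theorem hecke_mul_left {A B : Subgroup G} (hB : IsGood μ B) [Finite (A ⧸ B.subgroupOf A)]
    {a : G} (ha : a ∈ A) (x : G) : hecke μ A B (a * x) = hecke μ A B x := by
  obtain ⟨T, -, hT⟩ := exists_isReps A B
  have h1 : ∀ y, hecke μ A B y = ∑ t ∈ T, ind ((A : Set G) * (B : Set G)) (y * t) := by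
    intro y
    rw [hecke_apply hB hT, Finset.sum_comm]
    refine Finset.sum_congr rfl fun r _ => ?_
    rw [hT]
    simp only [mul_assoc]
  rw [h1, h1]
  refine Finset.sum_congr rfl fun s _ => ?_
  rw [mul_assoc, ind_mul_left ha]

omit [MeasurableSpace G] in
/-- A right invariant function with finite support modulo `D` is a finite combination of
characteristic functions of cosets. -/
theorem exists_sum_ind {D : Subgroup G} {Φ : G → ℂ} (hΦ : ∀ d ∈ D, ∀ x, Φ (x * d) = Φ x)
    (hfin : (QuotientGroup.mk (s := D) '' Function.support Φ).Finite) :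
    ∃ (X : Finset G), Φ = fun y => ∑ x ∈ X, Φ x * ind (D : Set G) (x⁻¹ * y) := by
  classical
  refine ⟨hfin.toFinset.image Quotient.out, funext fun y => ?_⟩
  have hinj : Function.Injective (Quotient.out : G ⧸ D → G) := Quotient.out_injective
  rw [Finset.sum_image fun q _ q' _ h => hinj h]
  have hout : ∀ y : G, (Quotient.out (QuotientGroup.mk y : G ⧸ D))⁻¹ * y ∈ D := fun y =>
    QuotientGroup.eq.1 (Quotient.out_eq' (QuotientGroup.mk y : G ⧸ D))
  have hval : Φ (Quotient.out (QuotientGroup.mk y : G ⧸ D)) = Φ y := by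
    rw [← hΦ _ (hout y), mul_inv_cancel_left]
  have hother : ∀ q : G ⧸ D, q ≠ QuotientGroup.mk y → ind (D : Set G) (q.out⁻¹ * y) = 0 := by
    intro q hq
    refine ind_apply_of_notMem fun hmem => hq ?_
    rw [← Quotient.out_eq' q]
    exact QuotientGroup.eq.2 hmem
  by_cases hy : (QuotientGroup.mk y : G ⧸ D) ∈ hfin.toFinset
  · refine ((Finset.sum_eq_single_of_mem (QuotientGroup.mk y) hy fun q _ hq => ?_).trans ?_).symm
    · exact (congrArg _ (hother q hq)).trans (mul_zero _)
    · exact (congrArg₂ (· * ·) hval (ind_apply_of_mem (hout y))).trans (mul_one _)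
  · refine Eq.trans ?_ (Finset.sum_eq_zero fun q hq =>
      (congrArg _ (hother q fun h => hy (h ▸ hq))).trans (mul_zero _)).symm
    by_contra h0
    exact hy (hfin.mem_toFinset.2 ⟨y, h0, rfl⟩)

/-- Averaging over `A / D` a right `D`-invariant function with finite support modulo `D`. -/
theorem integral_sum_translates {A D : Subgroup G} (hA : IsGood μ A) (hD : IsGood μ D)
    {T : Finset G} (hTr : IsReps T (A : Set G) D) {Φ : G → ℂ}
    (hΦ : ∀ d ∈ D, ∀ x, Φ (x * d) = Φ x)
    (hfin : (QuotientGroup.mk (s := D) '' Function.support Φ).Finite) :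
    Integrable Φ μ ∧ Integrable (fun x => ∑ t ∈ T, Φ (x * t)) μ ∧
      (vol μ D)⁻¹ * ∫ x, Φ x ∂μ = (vol μ A)⁻¹ * ∫ x, ∑ t ∈ T, Φ (x * t) ∂μ := by
  obtain ⟨X, hX⟩ := exists_sum_ind hΦ hfin
  -- Summing translates turns the indicator of each coset `xD` into that of `xA` and keeps the
  -- coefficient `Φ x`. Divided by the corresponding volume, both integrals equal the sum of the
  -- coefficients.
  have h1 : (fun y => ∑ t ∈ T, Φ (y * t)) = fun y => ∑ x ∈ X, Φ x * ind (A : Set G) (x⁻¹ * y) := by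
    ext y
    have h2 : ∀ t, Φ (y * t) = ∑ x ∈ X, Φ x * ind (D : Set G) (x⁻¹ * (y * t)) := fun t =>
      congrFun hX (y * t)
    rw [Finset.sum_congr rfl fun t _ => h2 t, Finset.sum_comm]
    refine Finset.sum_congr rfl fun x _ => ?_
    rw [← Finset.mul_sum]
    congr 1
    have h3 : ind (A : Set G) (x⁻¹ * y) = ind (A : Set G) (y⁻¹ * x) := by
      refine ind_congr ?_
      rw [SetLike.mem_coe, ← inv_mem_iff, mul_inv_rev, inv_inv]
      rfl
    rw [h3, hTr]
    refine Finset.sum_congr rfl fun t _ => ind_congr ?_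
    rw [SetLike.mem_coe, ← inv_mem_iff, SetLike.mem_coe]
    group
  have hint : ∀ K : Subgroup G, IsGood μ K →
      Integrable (fun y => ∑ x ∈ X, Φ x * ind (K : Set G) (x⁻¹ * y)) μ ∧
      (vol μ K)⁻¹ * ∫ y, ∑ x ∈ X, Φ x * ind (K : Set G) (x⁻¹ * y) ∂μ = ∑ x ∈ X, Φ x := by
    intro K hK
    refine ⟨integrable_finsetSum _ fun x _ => (hK.integrable_ind x).const_mul _, ?_⟩
    rw [integral_finsetSum _ fun x _ => (hK.integrable_ind x).const_mul _, Finset.mul_sum]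
    refine Finset.sum_congr rfl fun x _ => ?_
    rw [integral_const_mul, hK.integral_ind, mul_comm (Φ x), inv_mul_cancel_left₀ hK.vol_ne_zero]
  have hΦX := hint D hD
  rw [← hX] at hΦX
  have hAX := hint A hA
  rw [← h1] at hAX
  refine ⟨hΦX.1, hAX.1, hΦX.2.trans ?_⟩
  rw [← hAX.2]

theorem IsGood.prod {H : Type*} [Group H] [MeasurableSpace H] {ν : Measure H} [SFinite μ] [SFinite ν]
    {K : Subgroup G} {K' : Subgroup H} (hK : IsGood μ K) (hK' : IsGood ν K') :
    IsGood (μ.prod ν) (K.prod K') := by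
  have hset : ∀ g : G × H, {x | g⁻¹ * x ∈ K.prod K'} = {x | g.1⁻¹ * x ∈ K} ×ˢ {x | g.2⁻¹ * x ∈ K'} :=
    fun g => rfl
  have hset' : ((K.prod K' : Subgroup (G × H)) : Set (G × H)) = (K : Set G) ×ˢ (K' : Set H) := rfl
  refine ⟨fun g => ?_, fun g => ?_, ?_, ?_⟩
  · rw [hset]
    exact (hK.meas _).prod (hK'.meas _)
  · rw [hset, hset', Measure.prod_prod, Measure.prod_prod, hK.vol_eq, hK'.vol_eq]
  · rw [hset', Measure.prod_prod]
    exact mul_ne_zero hK.pos hK'.pos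
  · rw [hset', Measure.prod_prod]
    exact ENNReal.mul_ne_top hK.lt_top hK'.lt_top

theorem vol_prod {H : Type*} [Group H] [MeasurableSpace H] {ν : Measure H} [SFinite μ] [SFinite ν]
    (K : Subgroup G) (K' : Subgroup H) : vol (μ.prod ν) (K.prod K') = vol μ K * vol ν K' := by
  rw [vol, vol, vol, ← Complex.ofReal_mul, ← measureReal_prod_prod]
  rfl

omit [MeasurableSpace G] in
theorem IsReps.prod {H : Type*} [Group H] {T : Finset G} {T' : Finset H} {A D : Subgroup G}
    {A' D' : Subgroup H} (hT : IsReps T (A : Set G) D) (hT' : IsReps T' (A' : Set H) D') :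
    IsReps (T ×ˢ T') ((A.prod A' : Subgroup (G × H)) : Set (G × H)) (D.prod D') := by
  have key : ∀ (K : Subgroup G) (K' : Subgroup H) (y : G × H),
      ind ((K.prod K' : Subgroup (G × H)) : Set (G × H)) y = ind (K : Set G) y.1 * ind (K' : Set H) y.2 := by
    intro K K' y
    by_cases h1 : y.1 ∈ K
    · by_cases h2 : y.2 ∈ K'
      · rw [ind_apply_of_mem h1, ind_apply_of_mem h2, ind_apply_of_mem (show y ∈ (K.prod K' : Set (G × H)) from ⟨h1, h2⟩),
          one_mul]
      · rw [ind_apply_of_notMem h2, ind_apply_of_notMem (fun h => h2 h.2), mul_zero]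
    · rw [ind_apply_of_notMem h1, ind_apply_of_notMem (fun h => h1 h.1), zero_mul]
  intro y
  rw [key, hT, hT', Finset.sum_mul_sum, Finset.sum_product]
  refine Finset.sum_congr rfl fun t _ => Finset.sum_congr rfl fun t' _ => (key D D' (t⁻¹ * y.1, t'⁻¹ * y.2)).symm

end HeckeSums

/-! ### Bounded sets and finiteness of supports -/

section Bounded

variable {F : Type*} [Field F] [ValuativeRel F] [TopologicalSpace F] [IsNonarchimedeanLocalField F]
  {σ : F →+* F} {π : F}
  {V : Type*} [AddCommGroup V] [Module F V] {h : V →ₛₗ[σ] V →ₗ[F] F} {c : F}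

/-- The translates of a lattice by elements of a bounded set lie in a lattice. -/
def IsBoundedSet (Ω : Set (unitaryGroup h)) : Prop :=
  ∀ M : Submodule 𝒪[F] V, M.IsLattice F → ∃ M' : Submodule 𝒪[F] V, M'.IsLattice F ∧
    ∀ g ∈ Ω, mapLattice (g : V ≃ₗ[F] V) M ≤ M'

theorem isBoundedSet_stab {L : Submodule 𝒪[F] V} (hL : L.IsLattice F) :
    IsBoundedSet (stab h L : Set (unitaryGroup h)) := by
  intro M hM
  obtain ⟨ϖ, hϖ⟩ := IsDiscreteValuationRing.exists_irreducible 𝒪[F]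
  obtain ⟨k, hk⟩ := exists_pow_smul_mem hϖ hM.fg hL
  obtain ⟨B, hB, hBe⟩ := smul_pow_isLattice hϖ k hL
  refine ⟨B, hB, fun g hg x hx => (hBe x).2 ?_⟩
  rw [mem_mapLattice] at hx
  have h1 := (hg _).2 (hk _ hx)
  have e : (g : V ≃ₗ[F] V) (ϖ ^ k • (g : V ≃ₗ[F] V).symm x) = ϖ ^ k • x := by
    refine (map_smul (g : V ≃ₗ[F] V) ((ϖ : F) ^ k) _).trans ?_
    rw [LinearEquiv.apply_symm_apply]
    rfl
  rwa [e] at h1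

omit [TopologicalSpace F] [IsNonarchimedeanLocalField F] in
theorem IsBoundedSet.mono {Ω Ω' : Set (unitaryGroup h)} (hΩ : IsBoundedSet Ω) (hle : Ω' ⊆ Ω) :
    IsBoundedSet Ω' := fun M hM =>
  let ⟨M', hM', H⟩ := hΩ M hM
  ⟨M', hM', fun g hg => H g (hle hg)⟩

omit [TopologicalSpace F] [IsNonarchimedeanLocalField F] in
theorem isBoundedSet_singleton (a : unitaryGroup h) : IsBoundedSet {a} := fun _ hM =>
  ⟨_, mapLattice_isLattice (a : V ≃ₗ[F] V) hM, fun _ hg => by rw [hg]⟩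

omit [TopologicalSpace F] [IsNonarchimedeanLocalField F] in
theorem IsBoundedSet.mul {Ω Ω' : Set (unitaryGroup h)} (hΩ : IsBoundedSet Ω)
    (hΩ' : IsBoundedSet Ω') : IsBoundedSet (Ω * Ω') := by
  intro M hM
  obtain ⟨M', hM', H'⟩ := hΩ' M hM
  obtain ⟨M'', hM'', H⟩ := hΩ M' hM'
  refine ⟨M'', hM'', ?_⟩
  rintro _ ⟨a, ha, b, hb, rfl⟩
  change mapLattice ((a * b : unitaryGroup h) : V ≃ₗ[F] V) M ≤ _
  rw [mapLattice_mul]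
  exact (mapLattice_mono (H' b hb)).trans (H a ha)

omit [TopologicalSpace F] [IsNonarchimedeanLocalField F] in
theorem isBoundedSet_biUnion [FiniteDimensional F V] {ι : Type*} {T : Finset ι} (hT : T.Nonempty)
    {Ω : ι → Set (unitaryGroup h)} (hΩ : ∀ i ∈ T, IsBoundedSet (Ω i)) :
    IsBoundedSet (⋃ i ∈ T, Ω i) := by
  intro M hM
  have : ∃ M' : Submodule 𝒪[F] V, M'.IsLattice F ∧ ∀ i ∈ T, ∀ g ∈ Ω i,
      mapLattice (g : V ≃ₗ[F] V) M ≤ M' := by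
    induction hT using Finset.Nonempty.cons_induction with
    | singleton i =>
      obtain ⟨M', hM', H⟩ := hΩ i (by simp) M hM
      exact ⟨M', hM', fun j hj g hg => H g (by rwa [Finset.mem_singleton.1 hj] at hg)⟩
    | cons i T hi hT ih =>
      obtain ⟨M₁, hM₁, H₁⟩ := ih fun j hj => hΩ j (Finset.mem_cons_of_mem hj)
      obtain ⟨M₂, hM₂, H₂⟩ := hΩ i (Finset.mem_cons_self _ _) M hM
      refine ⟨M₁ ⊔ M₂, inferInstance, fun j hj g hg => ?_⟩
      rcases Finset.mem_cons.1 hj with rfl | hj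
      · exact (H₂ g hg).trans le_sup_right
      · exact (H₁ j hj g hg).trans le_sup_left
  obtain ⟨M', hM', H⟩ := this
  refine ⟨M', hM', fun g hg => ?_⟩
  obtain ⟨i, hi, hg⟩ := Set.mem_iUnion₂.1 hg
  exact H i hi g hg

theorem isBoundedSet_support_hecke [FiniteDimensional F V] {μ : Measure (unitaryGroup h)}
    {A B : Subgroup (unitaryGroup h)} (hB : IsGood μ B) [Finite (A ⧸ B.subgroupOf A)]
    {L : Submodule 𝒪[F] V} (hL : L.IsLattice F) (hBL : B ≤ stab h L) :
    IsBoundedSet (Function.support (hecke μ A B)) := by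
  classical
  obtain ⟨T, -, hT⟩ := exists_isReps A B
  -- The pair `(1, 1)` is inserted only to have a nonempty index set for `isBoundedSet_biUnion`.
  have hsub : Function.support (hecke μ A B) ⊆
      ⋃ p ∈ insert (1, 1) (T ×ˢ T), {p.1} * (stab h L : Set (unitaryGroup h)) * {p.2⁻¹} := by
    intro x hx
    rw [Function.mem_support, hecke_apply hB hT] at hx
    obtain ⟨s, hs, hs0⟩ := Finset.exists_ne_zero_of_sum_ne_zero hx
    obtain ⟨t, ht, ht0⟩ := Finset.exists_ne_zero_of_sum_ne_zero hs0
    refine Set.mem_iUnion₂.2 ⟨(s, t), Finset.mem_insert_of_mem (Finset.mk_mem_product hs ht), ?_⟩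
    have h1 : s⁻¹ * x * t ∈ B := by
      by_contra h1
      exact ht0 (ind_apply_of_notMem h1)
    refine Set.mem_mul.2 ⟨s * (s⁻¹ * x * t), Set.mul_mem_mul rfl (hBL h1), t⁻¹, rfl, ?_⟩
    group
  exact (isBoundedSet_biUnion (by simp) fun p _ =>
    ((isBoundedSet_singleton _).mul (isBoundedSet_stab hL)).mul (isBoundedSet_singleton _)).mono hsub

variable [FiniteDimensional F V]

omit [FiniteDimensional F V] [ValuativeRel F] [TopologicalSpace F] [IsNonarchimedeanLocalField F] in
theorem conj_pow_specialVec (a : unitaryGroup h) (γ : unitaryGroup (extForm h c)) (i : ℕ) :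
    ((((embed h c a)⁻¹ * γ * embed h c a) ^ i : unitaryGroup (extForm h c)) :
      (V × F) ≃ₗ[F] (V × F)) (specialVec F V) =
    (((embed h c a)⁻¹ : unitaryGroup (extForm h c)) : (V × F) ≃ₗ[F] (V × F))
      (((γ ^ i : unitaryGroup (extForm h c)) : (V × F) ≃ₗ[F] (V × F)) (specialVec F V)) := by
  have h1 : ((embed h c a)⁻¹ * γ * embed h c a) ^ i = (embed h c a)⁻¹ * (γ ^ i * embed h c a) := by
    rw [← mul_assoc]
    simpa using conj_pow (a := (embed h c a)⁻¹) (b := γ) (i := i)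
  rw [h1, unitary_mul_apply, unitary_mul_apply, embed_specialVec]

/-- The integrand of a regular semisimple orbital integral has finite support modulo a compact
open subgroup. -/
theorem IsRamified.finite_support (hR : IsRamified σ π) (hs : h.IsSymm) (hnd : h.Nondegenerate)
    (hσc : σ c = c) (hc0 : c ≠ 0) {L : Submodule 𝒪[F] V} (hL : L.IsLattice F)
    {φ : unitaryGroup (extForm h c) → ℂ} (hφ : IsBoundedSet (Function.support φ))
    {g : unitaryGroup h × unitaryGroup (extForm h c)} (hg : IsRegularSemisimple h c g) :
    (QuotientGroup.mk (s := (stab h L).prod (stab h L)) '' Function.support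
      (orbIntegrand h c g (tensor (ind (stab h L : Set (unitaryGroup h))) φ))).Finite := by
  have hse := extForm_isSymm hs hR.invol hσc
  have hnde := extForm_nondegenerate hs hnd hR.invol hσc hc0
  have hE := addLine_isLattice_iff.2 hL
  set γ := (embed h c g.1)⁻¹ * g.2 with hγ
  set u : ℕ → V × F := fun i => ((γ ^ i : unitaryGroup (extForm h c)) :
    (V × F) ≃ₗ[F] (V × F)) (specialVec F V) with hu
  -- If `(p, q)` is in the support of the integrand, the conjugate of `γ` by `q` lies in this
  -- bounded set.
  set Ω : Set (unitaryGroup (extForm h c)) :=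
    (stab (extForm h c) (addLine L) : Set (unitaryGroup (extForm h c))) * Function.support φ
  have hΩ : IsBoundedSet Ω := (isBoundedSet_stab hE).mul hφ
  choose! next hnext1 hnext2 using hΩ
  -- Iterating the bound for `Ω` gives lattices `M i` that contain `δ^i u` for every `δ` in `Ω`.
  let M : ℕ → Submodule 𝒪[F] (V × F) := fun i => next^[i] (addLine L)
  have hM : ∀ i, (M i).IsLattice F := by
    intro i
    induction i with
    | zero => exact hE
    | succ i ih =>
      change (next^[i + 1] (addLine L)).IsLattice F
      rw [Function.iterate_succ_apply']
      exact hnext1 _ ih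
  have hδ : ∀ δ ∈ Ω, ∀ i : ℕ, ((δ ^ i : unitaryGroup (extForm h c)) :
      (V × F) ≃ₗ[F] (V × F)) (specialVec F V) ∈ M i := by
    intro δ hδ i
    induction i with
    | zero => exact specialVec_mem_addLine L
    | succ i ih =>
      rw [pow_succ', unitary_mul_apply]
      change _ ∈ next^[i + 1] (addLine L)
      rw [Function.iterate_succ_apply']
      exact hnext2 _ (hM i) δ hδ (apply_mem_mapLattice.2 ih)
  obtain ⟨ϖ, hϖ⟩ := IsDiscreteValuationRing.exists_irreducible 𝒪[F]
  choose k hk using fun i => exists_pow_smul_mem hϖ (hM i).fg hE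
  set n := Module.finrank F V with hn
  set K := ∑ i ∈ Finset.range (n + 1), k i with hK
  have hKM : ∀ i ∈ Finset.range (n + 1), ∀ x ∈ M i, ϖ ^ K • x ∈ addLine L := by
    intro i hi x hx
    obtain ⟨m, hm⟩ := Nat.exists_eq_add_of_le (Finset.single_le_sum (fun i _ => Nat.zero_le (k i)) hi)
    rw [hK, hm, add_comm, pow_add, mul_smul]
    exact (addLine L).smul_mem _ (hk i x hx)
  have hfin : Finite (Fin (n + 1)) := inferInstance
  -- By regular semisimplicity the vectors `γ^i u` span the space, so `N` is a lattice. The exponent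
  -- `K` is large enough to carry every `M i` with `i ≤ n` into `L ⊕ ⟨u⟩`, hence `N` into each
  -- contributing image `q L ⊕ ⟨u⟩`.
  set N : Submodule 𝒪[F] (V × F) :=
    Submodule.span 𝒪[F] (Set.range fun i : Fin (n + 1) => ϖ ^ K • u i) with hN
  have hϖ0 : (ϖ : F) ^ K ≠ 0 := pow_ne_zero _ fun h0 => hϖ.ne_zero (Subtype.ext h0)
  have hNL : N.IsLattice F := by
    refine ⟨Submodule.fg_span (Set.finite_range _), ?_⟩
    have h1 : Submodule.span F (Set.range fun i : Fin (n + 1) => u i) = ⊤ :=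
      LinearIndependent.span_eq_top_of_card_eq_finrank' hg (by
        rw [Fintype.card_fin, Module.finrank_prod, Module.finrank_self])
    rw [eq_top_iff, ← h1, Submodule.span_le]
    rintro _ ⟨i, rfl⟩
    have h2 : ϖ ^ K • u i ∈ Submodule.span F (N : Set (V × F)) :=
      Submodule.subset_span (Submodule.subset_span ⟨i, rfl⟩)
    have h3 := Submodule.smul_mem _ ((ϖ : F) ^ K)⁻¹ h2
    have e : ((ϖ : F) ^ K)⁻¹ • ϖ ^ K • u i = u i := inv_smul_smul₀ hϖ0 (u i)
    rwa [e] at h3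
  have hfinX := hR.finite_images hse hnde hNL hE
  have key : ∀ p ∈ Function.support
      (orbIntegrand h c g (tensor (ind (stab h L : Set (unitaryGroup h))) φ)),
      mapLattice (p.1 : V ≃ₗ[F] V) L =
        mapLattice (g.1 : V ≃ₗ[F] V) (mapLattice (p.2 : V ≃ₗ[F] V) L) ∧
      addLine (mapLattice (p.2 : V ≃ₗ[F] V) L) ∈ {X : Submodule 𝒪[F] (V × F) | N ≤ X ∧
        ∃ g : unitaryGroup (extForm h c), mapLattice (g : (V × F) ≃ₗ[F] (V × F)) (addLine L) = X} := by
    rintro ⟨p, q⟩ hpq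
    have h1 : p⁻¹ * g.1 * q ∈ stab h L := by
      by_contra h1
      refine hpq ?_
      change ind _ _ * _ = 0
      rw [ind_apply_of_notMem h1, zero_mul]
    have h2 : (embed h c p)⁻¹ * g.2 * embed h c q ∈ Function.support φ := by
      intro h2
      refine hpq ?_
      change _ * φ _ = 0
      rw [h2, mul_zero]
    refine ⟨?_, ?_, embed h c q, mapLattice_embed_addLine q L⟩
    · rw [mul_assoc, inv_mul_mem_stab_iff, mapLattice_mul] at h1
      exact h1.symm
    · have h3 : (embed h c q)⁻¹ * γ * embed h c q ∈ Ω := by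
        refine Set.mem_mul.2 ⟨(embed h c (p⁻¹ * g.1 * q))⁻¹,
          inv_mem (embed_mem_stab_addLine.2 h1), _, h2, ?_⟩
        rw [hγ, map_mul, map_mul, map_inv]
        group
      rw [← mapLattice_embed_addLine (c := c), hN, Submodule.span_le]
      rintro _ ⟨i, rfl⟩
      have h4 := hδ _ h3 i
      rw [conj_pow_specialVec] at h4
      have h5 := hKM i (Finset.mem_range.2 i.2) _ h4
      rw [SetLike.mem_coe, mem_mapLattice]
      have e : (((embed h c q : unitaryGroup (extForm h c)) : (V × F) ≃ₗ[F] (V × F))).symm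
          (ϖ ^ K • u i) = ϖ ^ K • (((embed h c q)⁻¹ : unitaryGroup (extForm h c)) :
          (V × F) ≃ₗ[F] (V × F)) (u i) :=
        map_smul ((embed h c q : unitaryGroup (extForm h c)) : (V × F) ≃ₗ[F] (V × F)).symm
          ((ϖ : F) ^ K) (u i)
      rw [e]
      exact h5
  have hfinV : {X : Submodule 𝒪[F] V | addLine X ∈ {X : Submodule 𝒪[F] (V × F) | N ≤ X ∧
      ∃ g : unitaryGroup (extForm h c), mapLattice (g : (V × F) ≃ₗ[F] (V × F)) (addLine L) = X}}.Finite :=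
    hfinX.preimage addLine_injective.injOn
  -- A coset is determined by the pair of lattices `(p L, q L)`. On the support `p L = g₁ q L`, and
  -- `q L ⊕ ⟨u⟩` is one of the finitely many images containing `N`.
  refine Set.Finite.of_finite_image (f := fun q : (unitaryGroup h × unitaryGroup h) ⧸ (stab h L).prod (stab h L) => (mapLattice ((Quotient.out q).1 : V ≃ₗ[F] V) L,
    mapLattice ((Quotient.out q).2 : V ≃ₗ[F] V) L)) ?_ ?_
  · refine ((hfinV.image (mapLattice (g.1 : V ≃ₗ[F] V))).prod hfinV).subset ?_
    rintro _ ⟨_, ⟨p, hp, rfl⟩, rfl⟩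
    have h1 := QuotientGroup.eq.1 (Quotient.out_eq'
      (QuotientGroup.mk p : _ ⧸ (stab h L).prod (stab h L)))
    have h2 := inv_mul_mem_stab_iff.1 h1.1
    have h3 := inv_mul_mem_stab_iff.1 h1.2
    obtain ⟨k1, k2⟩ := key p hp
    refine ⟨⟨_, k2, ?_⟩, ?_⟩
    · exact k1.symm.trans h2
    · rw [h3] at k2
      exact k2
  · intro q _ q' _ hqq
    rw [← Quotient.out_eq' q, ← Quotient.out_eq' q']
    exact QuotientGroup.eq.2 ⟨inv_mul_mem_stab_iff.2 (congrArg Prod.fst hqq).symm,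
      inv_mul_mem_stab_iff.2 (congrArg Prod.snd hqq).symm⟩

end Bounded

/-! ### Comparison of orbital integrals -/

section Cosets

variable {G H : Type*} [Group G] [Group H]

/-- Lets representatives from a subgroup of `U(V)` serve for cosets in `U(V ⊕ F u)`. -/
theorem IsReps.map {A : Subgroup G} {B : Subgroup H} {T : Finset G} (e : G →* H)
    (he : Function.Injective e) (hTA : ∀ t ∈ T, t ∈ A)
    (hT : IsReps T (A : Set G) (A ⊓ B.comap e)) :
    IsReps (T.map ⟨e, he⟩) ((A.map e : Set H) * (B : Set H)) B := by
  intro y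
  rw [Finset.sum_map]
  by_cases hy : y ∈ (A.map e : Set H) * (B : Set H)
  · rw [ind_apply_of_mem hy]
    obtain ⟨_, ⟨a, ha, rfl⟩, b, hb, rfl⟩ := hy
    rw [← ind_apply_of_mem (S := (A : Set G)) ha, hT]
    refine Finset.sum_congr rfl fun t ht => ind_congr ?_
    change t⁻¹ * a ∈ A ∧ e (t⁻¹ * a) ∈ B ↔ (e t)⁻¹ * (e a * b) ∈ B
    rw [and_iff_right (mul_mem (inv_mem (hTA t ht)) ha), ← mul_assoc, B.mul_mem_cancel_right hb,
      map_mul, map_inv]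
  · rw [ind_apply_of_notMem hy, eq_comm]
    refine Finset.sum_eq_zero fun t ht => ind_apply_of_notMem fun hmem => hy ?_
    exact ⟨e t, ⟨t, hTA t ht, rfl⟩, _, hmem, mul_inv_cancel_left _ _⟩

theorem finite_image_mk_of_le {D K : Subgroup G} [Finite (K ⧸ D.subgroupOf K)]
    {S : Set G} (hS : (QuotientGroup.mk (s := K) '' S).Finite) :
    (QuotientGroup.mk (s := D) '' S).Finite := by
  refine (hS.biUnion fun q _ => Set.finite_range fun r : K ⧸ D.subgroupOf K =>
    (QuotientGroup.mk (Quotient.out q * (r.out : G)) : G ⧸ D)).subset ?_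
  rintro _ ⟨x, hx, rfl⟩
  have h1 : (Quotient.out (QuotientGroup.mk x : G ⧸ K))⁻¹ * x ∈ K :=
    QuotientGroup.eq.1 (Quotient.out_eq' (QuotientGroup.mk x : G ⧸ K))
  let k : K := ⟨_, h1⟩
  have h2 := QuotientGroup.eq.1 (Quotient.out_eq' (QuotientGroup.mk k : K ⧸ D.subgroupOf K))
  have h3 : ((Quotient.out (QuotientGroup.mk k : K ⧸ D.subgroupOf K) : K) : G)⁻¹ * (k : G) ∈ D := h2
  refine Set.mem_iUnion₂.2 ⟨QuotientGroup.mk x, ⟨x, hx, rfl⟩, QuotientGroup.mk k,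
    QuotientGroup.eq.2 ?_⟩
  rw [mul_inv_rev, mul_assoc]
  exact h3

end Cosets

/-! ### The translation principle for orbital integrals -/

section Comparison

variable {F : Type*} [Field F] [TopologicalSpace F] {σ : F →+* F} {π : F}
  {V : Type*} [AddCommGroup V] [Module F V] {h : V →ₛₗ[σ] V →ₗ[F] F} {c : F}

theorem sameOrb_symm {μ : Measure (unitaryGroup h)}
    {f f' : unitaryGroup h × unitaryGroup (extForm h c) → ℂ} (H : SameOrb h c μ f f') :
    SameOrb h c μ f' f := fun g hg =>
  ⟨(H g hg).2.1, (H g hg).1, (H g hg).2.2.symm⟩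

theorem sameOrb_trans {μ : Measure (unitaryGroup h)}
    {f f' f'' : unitaryGroup h × unitaryGroup (extForm h c) → ℂ} (H : SameOrb h c μ f f')
    (H' : SameOrb h c μ f' f'') : SameOrb h c μ f f'' := fun g hg =>
  ⟨(H g hg).1, (H' g hg).2.1, (H g hg).2.2.trans (H' g hg).2.2⟩

theorem continuous_embed [IsTopologicalRing F] : Continuous (embed h c) := by
  refine continuous_induced_rng.2 (continuous_pi fun p => ?_)
  have h1 : Continuous fun g : unitaryGroup h =>
      p.2 ((g : V ≃ₗ[F] V) p.1.1, 0) := continuous_coeff p.1.1 (p.2 ∘ₗ LinearMap.inl F V F)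
  refine (h1.add (continuous_const (y := p.2 (0, p.1.2)))).congr fun g => ?_
  change p.2 _ + p.2 _ = _
  rw [← map_add, Prod.mk_add_mk, add_zero, zero_add]
  rfl

variable [ValuativeRel F] [IsNonarchimedeanLocalField F] [FiniteDimensional F V]

theorem IsRamified.isGood_of_isOpen (hR : IsRamified σ π) (hs : h.IsSymm) (hnd : h.Nondegenerate)
    {L : Submodule 𝒪[F] V} (hL : L.IsLattice F) {K : Subgroup (unitaryGroup h)}
    (hK : IsOpen (K : Set (unitaryGroup h))) (hKL : K ≤ stab h L) (μ : Measure (unitaryGroup h))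
    [μ.IsHaarMeasure] : IsGood μ K := by
  have hopen : ∀ g : unitaryGroup h, IsOpen {x : unitaryGroup h | g⁻¹ * x ∈ K} := fun g =>
    hK.preimage (continuous_unitary_mul_left g⁻¹)
  refine ⟨fun g => (hopen g).measurableSet, fun g => ?_, hK.measure_ne_zero μ ⟨1, K.one_mem⟩,
    ((measure_mono hKL).trans_lt (hR.isCompact_stab hs hnd hL).measure_lt_top).ne⟩
  conv_rhs => rw [← Measure.IsMulLeftInvariant.map_mul_left_eq_self (μ := μ) g⁻¹]
  rw [Measure.map_apply (continuous_unitary_mul_left g⁻¹).measurable hK.measurableSet]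
  rfl

/-- The translation principle: if `f'` is the sum of the translates of `1_K ⊗ φ` over `A / D`,
then the two functions have proportional orbital integrals. -/
theorem IsRamified.sameOrb_of_translates (hR : IsRamified σ π) (hs : h.IsSymm)
    (hnd : h.Nondegenerate) (hσc : σ c = c) (hc0 : c ≠ 0) {L : Submodule 𝒪[F] V}
    (hL : L.IsLattice F) {μ : Measure (unitaryGroup h)} [μ.IsHaarMeasure]
    {A D : Subgroup (unitaryGroup h)} (hA : IsGood μ A) (hD : IsGood μ D) (hDL : D ≤ stab h L)
    {T : Finset (unitaryGroup h)} (hT : IsReps T (A : Set (unitaryGroup h)) D)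
    {φ : unitaryGroup (extForm h c) → ℂ} (hφ : IsBoundedSet (Function.support φ))
    (hφl : ∀ d ∈ D, ∀ y, φ (embed h c d * y) = φ y) (hφr : ∀ d ∈ D, ∀ y, φ (y * embed h c d) = φ y)
    {f : unitaryGroup h × unitaryGroup (extForm h c) → ℂ}
    (hf : ∀ x y, f (x, y) = ∑ s ∈ T, ∑ t ∈ T,
      ind (stab h L : Set (unitaryGroup h)) (s⁻¹ * x * t) * φ ((embed h c s)⁻¹ * y * embed h c t)) :
    SameOrb h c μ
      ((vol μ D ^ 2)⁻¹ • tensor (ind (stab h L : Set (unitaryGroup h))) φ)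
      ((vol μ A ^ 2)⁻¹ • f) := by
  intro g hg
  have := hR.sigmaFinite hs hnd hL μ
  have hfin0 := hR.finite_support hs hnd hσc hc0 hL hφ hg
  have hLg := hR.isGood_of_isOpen hs hnd hL (hR.isOpen_stab hs hnd hL) le_rfl μ
  have hle : D.prod D ≤ (stab h L).prod (stab h L) := Subgroup.prod_mono hDL hDL
  have := (hLg.prod hLg).finite_quotient (hD.prod hD) hle
  have hfin := finite_image_mk_of_le (D := D.prod D) hfin0
  have hinv : ∀ d ∈ D.prod D, ∀ x,
      orbIntegrand h c g (tensor (ind (stab h L : Set (unitaryGroup h))) φ) (x * d) =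
        orbIntegrand h c g (tensor (ind (stab h L : Set (unitaryGroup h))) φ) x := by
    rintro ⟨d, d'⟩ ⟨hd, hd'⟩ ⟨x, y⟩
    change ind _ ((x * d)⁻¹ * g.1 * (y * d')) *
        φ ((embed h c (x * d))⁻¹ * g.2 * embed h c (y * d')) =
      ind _ (x⁻¹ * g.1 * y) * φ ((embed h c x)⁻¹ * g.2 * embed h c y)
    congr 1
    · refine ind_congr ?_
      have e : (x * d)⁻¹ * g.1 * (y * d') = d⁻¹ * (x⁻¹ * g.1 * y) * d' := by group
      rw [e, SetLike.mem_coe, (stab h L).mul_mem_cancel_right (hDL hd'),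
        (stab h L).mul_mem_cancel_left (inv_mem (hDL hd))]
      rfl
    · have e : (embed h c (x * d))⁻¹ * g.2 * embed h c (y * d') =
          embed h c d⁻¹ * ((embed h c x)⁻¹ * g.2 * embed h c y) * embed h c d' := by
        rw [map_mul, map_mul, map_inv]
        group
      rw [e, hφr _ hd', hφl _ (inv_mem hd)]
  obtain ⟨h1, h2, h3⟩ := integral_sum_translates (hA.prod hA) (hD.prod hD) (hT.prod hT) hinv hfin
  -- Right translation of the two integration variables is a two-sided translation of the function,
  -- so the sum over `T × T` is the integrand of `f`.
  have h4 : (fun x => ∑ t ∈ T ×ˢ T,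
      orbIntegrand h c g (tensor (ind (stab h L : Set (unitaryGroup h))) φ) (x * t)) =
      orbIntegrand h c g f := by
    ext ⟨x, y⟩
    change _ = f (_, _)
    rw [hf, Finset.sum_product]
    refine Finset.sum_congr rfl fun s _ => Finset.sum_congr rfl fun t _ => ?_
    change ind _ ((x * s)⁻¹ * g.1 * (y * t)) *
      φ ((embed h c (x * s))⁻¹ * g.2 * embed h c (y * t)) = _
    rw [map_mul, map_mul]
    congr 2
  rw [h4] at h2
  simp only [funext_iff] at h4
  simp only [h4] at h3
  rw [vol_prod, vol_prod, ← sq, ← sq] at h3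
  refine ⟨h1.smul _, h2.smul _, ?_⟩
  change ∫ p, (vol μ D ^ 2)⁻¹ • orbIntegrand h c g _ p ∂(μ.prod μ) =
    ∫ p, (vol μ A ^ 2)⁻¹ • orbIntegrand h c g f p ∂(μ.prod μ)
  rw [integral_smul, integral_smul]
  exact h3

/-- Moving the averaging over `A'` into the first factor. -/
theorem IsRamified.sameOrb_hecke_left (hR : IsRamified σ π) (hs : h.IsSymm)
    (hnd : h.Nondegenerate) (hσc : σ c = c) (hc0 : c ≠ 0) {L L' : Submodule 𝒪[F] V}
    (hL : L.IsLattice F) (hL' : L'.IsLattice F) {μ : Measure (unitaryGroup h)} [μ.IsHaarMeasure]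
    {φ : unitaryGroup (extForm h c) → ℂ} (hφ : IsBoundedSet (Function.support φ))
    (hφl : ∀ d ∈ stab h L', ∀ y, φ (embed h c d * y) = φ y)
    (hφr : ∀ d ∈ stab h L', ∀ y, φ (y * embed h c d) = φ y) :
    SameOrb h c μ
      ((vol μ (stab h L ⊓ stab h L') ^ 2)⁻¹ • tensor (ind (stab h L : Set (unitaryGroup h))) φ)
      ((vol μ (stab h L') ^ 2)⁻¹ • tensor (hecke μ (stab h L') (stab h L)) φ) := by
  have hA := hR.isGood_of_isOpen hs hnd hL (hR.isOpen_stab hs hnd hL) le_rfl μ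
  have hA' := hR.isGood_of_isOpen hs hnd hL' (hR.isOpen_stab hs hnd hL') le_rfl μ
  have hD := hR.isGood_of_isOpen hs hnd hL (K := stab h L ⊓ stab h L')
    ((hR.isOpen_stab hs hnd hL).inter (hR.isOpen_stab hs hnd hL')) inf_le_left μ
  have := hA'.finite_quotient hD inf_le_right
  obtain ⟨T, hTA, hT⟩ := exists_isReps_of_le (inf_le_right : stab h L ⊓ stab h L' ≤ stab h L')
  refine hR.sameOrb_of_translates hs hnd hσc hc0 hL hA' hD inf_le_left hT hφ
    (fun d hd => hφl d hd.2) (fun d hd => hφr d hd.2) fun x y => ?_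
  -- The representatives of `stab L'` modulo the intersection also represent `stab L' * stab L`
  -- modulo `stab L`, so the translates add up to the Hecke function in the first variable.
  -- Invariance of `φ` absorbs them in the second one.
  have hT' : IsReps (T.map ⟨MonoidHom.id _, Function.injective_id⟩)
      ((stab h L' : Set (unitaryGroup h)) * (stab h L : Set (unitaryGroup h))) (stab h L) := by
    have := IsReps.map (B := stab h L) (MonoidHom.id _) Function.injective_id hTA
      (by rwa [Subgroup.comap_id, inf_comm])
    rwa [Subgroup.map_id] at this
  change hecke μ _ _ x * φ y = _
  rw [hecke_apply hA hT', Finset.sum_map, Finset.sum_mul]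
  refine Finset.sum_congr rfl fun s hs' => ?_
  rw [Finset.sum_map, Finset.sum_mul]
  refine Finset.sum_congr rfl fun t ht => ?_
  rw [hφr _ (hTA t ht), ← map_inv (embed h c), hφl _ (inv_mem (hTA s hs'))]
  rfl

/-- Moving the averaging over `A` into the second factor. -/
theorem IsRamified.sameOrb_of_isReps (hR : IsRamified σ π) (hs : h.IsSymm)
    (hnd : h.Nondegenerate) (hσc : σ c = c) (hc0 : c ≠ 0) {L : Submodule 𝒪[F] V}
    (hL : L.IsLattice F) {μ : Measure (unitaryGroup h)} [μ.IsHaarMeasure]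
    {A : Subgroup (unitaryGroup h)} (hA : IsOpen (A : Set (unitaryGroup h))) (hAL : A ≤ stab h L)
    {A' B : Subgroup (unitaryGroup (extForm h c))}
    (hB : IsOpen (B : Set (unitaryGroup (extForm h c))))
    (hAB : (A' : Set (unitaryGroup (extForm h c))) * (B : Set (unitaryGroup (extForm h c))) =
      (A.map (embed h c) : Set (unitaryGroup (extForm h c))) *
        (B : Set (unitaryGroup (extForm h c))))
    {φ ψ : unitaryGroup (extForm h c) → ℂ} (hφ : IsBoundedSet (Function.support φ))
    (hφl : ∀ b ∈ B, ∀ y, φ (b * y) = φ y) (hφr : ∀ b ∈ B, ∀ y, φ (y * b) = φ y)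
    (hψ : ∀ T, IsReps T ((A' : Set (unitaryGroup (extForm h c))) *
      (B : Set (unitaryGroup (extForm h c)))) B → ∀ y, ψ y = ∑ s ∈ T, ∑ t ∈ T, φ (s⁻¹ * y * t)) :
    SameOrb h c μ
      ((vol μ (A ⊓ B.comap (embed h c)) ^ 2)⁻¹ •
        tensor (ind (stab h L : Set (unitaryGroup h))) φ)
      ((vol μ A ^ 2)⁻¹ • tensor (ind (stab h L : Set (unitaryGroup h))) ψ) := by
  have hAg := hR.isGood_of_isOpen hs hnd hL hA hAL μ
  have hD := hR.isGood_of_isOpen hs hnd hL (K := A ⊓ B.comap (embed h c))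
    (hA.inter (hB.preimage continuous_embed)) (inf_le_left.trans hAL) μ
  have := hAg.finite_quotient hD inf_le_left
  obtain ⟨T, hTA, hT⟩ := exists_isReps_of_le (inf_le_left : A ⊓ B.comap (embed h c) ≤ A)
  refine hR.sameOrb_of_translates hs hnd hσc hc0 hL hAg hD (inf_le_left.trans hAL) hT hφ
    (fun d hd => hφl _ hd.2) (fun d hd => hφr _ hd.2) fun x y => ?_
  -- The factorization `hAB` allows representatives coming from `A`. They lie in `stab L`, so they
  -- do not affect the first factor.
  have hT' := IsReps.map (embed h c) embed_injective hTA hT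
  rw [← hAB] at hT'
  change ind _ x * ψ y = _
  rw [hψ _ hT', Finset.sum_map, Finset.mul_sum]
  refine Finset.sum_congr rfl fun s hs' => ?_
  rw [Finset.sum_map, Finset.mul_sum]
  refine Finset.sum_congr rfl fun t ht => ?_
  congr 1
  refine ind_congr ?_
  rw [SetLike.mem_coe, SetLike.mem_coe, (stab h L).mul_mem_cancel_right (hAL (hTA t ht)),
    (stab h L).mul_mem_cancel_left (inv_mem (hAL (hTA s hs')))]

end Comparison

/-! ### Counting double cosets -/

section DoubleCosets

variable {G : Type*} [Group G]

theorem doubleCoset_mk_eq_iff {A B K : Subgroup G} (hA : A ≤ B) (g g' : B) :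
    (DoubleCoset.mk (A.subgroupOf B) ((B ⊓ K).subgroupOf B) g =
      DoubleCoset.mk (A.subgroupOf B) ((B ⊓ K).subgroupOf B) g') ↔
      ∃ a ∈ A, (a * g : G)⁻¹ * g' ∈ K := by
  rw [DoubleCoset.eq]
  constructor
  · rintro ⟨a, ha, k, hk, rfl⟩
    refine ⟨a, ha, ?_⟩
    have : ((k : B) : G) ∈ B ⊓ K := hk
    have e : ((a : G) * g)⁻¹ * ((a * g * k : B) : G) = k := by
      rw [Subgroup.coe_mul, Subgroup.coe_mul]
      group
    rw [e]
    exact this.2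
  · rintro ⟨a, ha, hk⟩
    refine ⟨⟨a, hA ha⟩, ha, ((⟨a, hA ha⟩ : B) * g)⁻¹ * g', ⟨((⟨a, hA ha⟩ * g)⁻¹ * g' : B).2, hk⟩, ?_⟩
    group

theorem numDoubleCosets_eq_one {A B K : Subgroup G} (hA : A ≤ B)
    (H : ∀ g ∈ B, ∃ a ∈ A, a⁻¹ * g ∈ K) : numDoubleCosets A B (B ⊓ K) = 1 := by
  refine Nat.card_eq_one_iff_unique.2 ⟨⟨fun q q' => ?_⟩, ⟨DoubleCoset.mk _ _ 1⟩⟩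
  have key : ∀ q : DoubleCoset.Quotient (A.subgroupOf B : Set B) ((B ⊓ K).subgroupOf B : Set B),
      DoubleCoset.mk _ _ 1 = q := by
    intro q
    induction q using Quotient.inductionOn' with | h g => ?_
    refine (doubleCoset_mk_eq_iff hA 1 g).2 ?_
    simpa using H g g.2
  rw [← key q, ← key q']

/-- The predicate `P` is a complete invariant of the double coset that takes both truth values. -/
theorem numDoubleCosets_eq_two {A B K : Subgroup G} (hA : A ≤ B) (P : G → Prop)
    (hP : ∀ g ∈ B, ∀ g' ∈ B, (P g ↔ P g') ↔ ∃ a ∈ A, (a * g)⁻¹ * g' ∈ K)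
    (h1 : ∃ g ∈ B, P g) (h2 : ∃ g ∈ B, ¬ P g) : numDoubleCosets A B (B ⊓ K) = 2 := by
  obtain ⟨g₁, hg₁, hP₁⟩ := h1
  obtain ⟨g₂, hg₂, hP₂⟩ := h2
  refine Nat.card_eq_two_iff.2 ⟨DoubleCoset.mk _ _ ⟨g₁, hg₁⟩, DoubleCoset.mk _ _ ⟨g₂, hg₂⟩, ?_, ?_⟩
  · intro heq
    have := (hP _ hg₁ _ hg₂).2 ((doubleCoset_mk_eq_iff hA _ _).1 heq)
    exact hP₂ (this.1 hP₁)
  · refine Set.eq_univ_of_forall fun q => ?_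
    induction q using Quotient.inductionOn' with | h g => ?_
    by_cases hg : P g
    · exact Or.inl ((doubleCoset_mk_eq_iff hA g ⟨g₁, hg₁⟩).2
        ((hP _ g.2 _ hg₁).1 (iff_of_true hg hP₁)))
    · exact Or.inr ((doubleCoset_mk_eq_iff hA g ⟨g₂, hg₂⟩).2
        ((hP _ g.2 _ hg₂).1 (iff_of_false hg hP₂)))

/-- A subgroup of index two is the kernel of a quadratic character. -/
theorem exists_quadratic_character {k : Type*} [Field k] (hk : (2 : k) ≠ 0) {K : Subgroup G}
    (hK : ∀ g g', g ∉ K → g' ∉ K → g⁻¹ * g' ∈ K) :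
    ∃ χ : G →* rootsOfUnity 2 k, χ.ker = K ∧
      ∀ {H : Type _} [Group H] (φ : H →* G), (∃ x, φ x ∉ K) → Function.Surjective (χ.comp φ) := by
  classical
  let ε : rootsOfUnity 2 k := ⟨-1, by rw [mem_rootsOfUnity]; simp⟩
  have hε : ε * ε = 1 := Subtype.ext (by simp [ε])
  have hε1 : ε ≠ 1 := fun h => hk <| by
    have h1 := congrArg (fun x : rootsOfUnity 2 k => ((x : kˣ) : k)) h
    have h2 : (-1 : k) = 1 := h1
    linear_combination -h2
  have hval : ∀ z : rootsOfUnity 2 k, z = 1 ∨ z = ε := by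
    intro z
    have h1 : ((z : kˣ) : k) ^ 2 = 1 := by
      rw [← Units.val_pow_eq_pow_val, (mem_rootsOfUnity 2 (z : kˣ)).1 z.2, Units.val_one]
    rcases sq_eq_one_iff.1 h1 with h | h
    · exact Or.inl (Subtype.ext (Units.ext h))
    · exact Or.inr (Subtype.ext (Units.ext h))
  let χ : G →* rootsOfUnity 2 k :=
    { toFun := fun g => if g ∈ K then 1 else ε
      map_one' := if_pos K.one_mem
      map_mul' := fun a b => by
        by_cases ha : a ∈ K
        · simp [ha, K.mul_mem_cancel_left ha]
        · by_cases hb : b ∈ K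
          · simp [ha, hb, K.mul_mem_cancel_right hb]
          · have : a * b ∈ K := by
              have := hK a⁻¹ b (fun h => ha (inv_mem_iff.1 h)) hb
              rwa [inv_inv] at this
            simp [ha, hb, this, hε] }
  have hker : χ.ker = K := by
    ext g
    rw [MonoidHom.mem_ker]
    change (if g ∈ K then 1 else ε) = 1 ↔ _
    by_cases hg : g ∈ K <;> simp [hg, hε1]
  refine ⟨χ, hker, fun φ ⟨x, hx⟩ z => ?_⟩
  rcases hval z with rfl | rfl
  · exact ⟨1, map_one _⟩
  · exact ⟨x, if_neg hx⟩

end DoubleCosets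

/-! ### Determinants of unitary transformations -/

section DetUnitary

variable {F : Type*} [Field F] {σ : F →+* F} {V : Type*} [AddCommGroup V] [Module F V]
  {h : V →ₛₗ[σ] V →ₗ[F] F} {c : F} [FiniteDimensional F V]

theorem det_embed (a : unitaryGroup h) :
    LinearEquiv.det ((embed h c a : unitaryGroup (extForm h c)) : (V × F) ≃ₗ[F] (V × F)) =
      LinearEquiv.det (a : V ≃ₗ[F] V) := by
  refine Units.ext ?_
  rw [LinearEquiv.coe_det, LinearEquiv.coe_det]
  refine Eq.trans ?_ ((LinearMap.det_prodMap ((a : V ≃ₗ[F] V) : V →ₗ[F] V)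
    (LinearMap.id : F →ₗ[F] F)).trans ?_)
  · rfl
  · rw [LinearMap.det_id, mul_one]

omit [FiniteDimensional F V] in
theorem det_gram_ne_zero (hnd : h.Nondegenerate) {ι : Type*} [Fintype ι] [DecidableEq ι]
    (b : Module.Basis ι F V) : (gram h b).det ≠ 0 := by
  intro h0
  obtain ⟨v, hv, hv0⟩ := Matrix.exists_mulVec_eq_zero_iff.2 h0
  refine hv ?_
  have h1 : ∑ j, v j • b j = 0 := by
    refine hnd.2 _ fun x => ?_
    have h2 : ∀ i, h (b i) (∑ j, v j • b j) = 0 := fun i => by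
      rw [map_sum]
      refine Eq.trans ?_ (congrFun hv0 i)
      refine Finset.sum_congr rfl fun j _ => ?_
      rw [map_smul, smul_eq_mul, mul_comm]
      rfl
    generalize ∑ j, v j • b j = w at h2
    rw [← b.sum_repr x, map_sum, LinearMap.sum_apply]
    refine Finset.sum_eq_zero fun i _ => ?_
    rw [LinearMap.map_smulₛₗ, LinearMap.smul_apply, h2, smul_zero]
  exact funext fun i => Fintype.linearIndependent_iff.1 b.linearIndependent v h1 i

theorem det_mul_map_det (hnd : h.Nondegenerate) (a : unitaryGroup h) :
    (LinearEquiv.det (a : V ≃ₗ[F] V) : F) * σ (LinearEquiv.det (a : V ≃ₗ[F] V) : F) = 1 := by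
  have b := Module.finBasis F V
  have h1 := gram_map (h' := h) a.2 b
  rw [gram_eq_mul b (b.map (a : V ≃ₗ[F] V))] at h1
  have h2 := congrArg Matrix.det h1
  have h3 : b.toMatrix (b.map (a : V ≃ₗ[F] V)) =
      LinearMap.toMatrix b b ((a : V ≃ₗ[F] V) : V →ₗ[F] V) := by
    ext i j
    rw [LinearMap.toMatrix_apply]
    rfl
  have h4 : (((b.toMatrix (b.map (a : V ≃ₗ[F] V))).map σ)).det =
      σ (b.toMatrix (b.map (a : V ≃ₗ[F] V))).det := (RingHom.map_det σ _).symm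
  rw [Matrix.det_mul, Matrix.det_mul, Matrix.det_transpose, h4, h3, LinearMap.det_toMatrix] at h2
  have h5 := det_gram_ne_zero hnd b
  rw [LinearEquiv.coe_det]
  refine mul_right_cancel₀ h5 ?_
  linear_combination h2

end DetUnitary

/-! ### Vertex lattices in `V ⊕ F u` and their stabilizers -/

section Stabilizers

variable {F : Type*} [Field F] [ValuativeRel F] {σ : F →+* F} {π : F}
  {V : Type*} [AddCommGroup V] [Module F V] {h : V →ₛₗ[σ] V →ₗ[F] F} {c : F}

theorem map_embed_le_stab_addLine {A : Subgroup (unitaryGroup h)} {L : Submodule 𝒪[F] V}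
    (hA : A ≤ stab h L) : A.map (embed h c) ≤ stab (extForm h c) (addLine L) := by
  rintro _ ⟨a, ha, rfl⟩
  exact embed_mem_stab_addLine.2 (hA ha)

theorem comap_embed_stab_addLine (L : Submodule 𝒪[F] V) :
    (stab (extForm h c) (addLine L)).comap (embed h c) = stab h L := by
  ext a
  exact embed_mem_stab_addLine

/-- Reduces a factorization of stabilizers to transitivity: every translate of `Λ` under the
stabilizer of `L ⊕ ⟨u⟩` must already be a translate under `A`. -/
theorem stab_mul_stab_eq {A : Subgroup (unitaryGroup h)} {L : Submodule 𝒪[F] V}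
    (hA : A ≤ stab h L) {Λ : Submodule 𝒪[F] (V × F)}
    (H : ∀ g ∈ stab (extForm h c) (addLine L), ∃ a ∈ A,
      mapLattice ((embed h c a : unitaryGroup (extForm h c)) : (V × F) ≃ₗ[F] (V × F)) Λ =
        mapLattice (g : (V × F) ≃ₗ[F] (V × F)) Λ) :
    (stab (extForm h c) (addLine L) : Set (unitaryGroup (extForm h c))) *
        (stab (extForm h c) Λ : Set (unitaryGroup (extForm h c))) =
      (A.map (embed h c) : Set (unitaryGroup (extForm h c))) *
        (stab (extForm h c) Λ : Set (unitaryGroup (extForm h c))) := by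
  refine Set.Subset.antisymm ?_ (Set.mul_subset_mul_right (map_embed_le_stab_addLine hA))
  rintro _ ⟨g, hg, b, hb, rfl⟩
  obtain ⟨a, ha, hag⟩ := H g hg
  refine ⟨embed h c a, ⟨a, ha, rfl⟩, (embed h c a)⁻¹ * g * b,
    mul_mem (inv_mul_mem_stab_iff.2 hag.symm) hb, ?_⟩
  change embed h c a * ((embed h c a)⁻¹ * g * b) = g * b
  group

theorem specialVec_mem_of_addLine_le {L : Submodule 𝒪[F] V} {Λ : Submodule 𝒪[F] (V × F)}
    (hle : addLine L ≤ Λ) : specialVec F V ∈ Λ := hle (specialVec_mem_addLine L)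

variable [FiniteDimensional F V] [TopologicalSpace F] [IsNonarchimedeanLocalField F]

omit [TopologicalSpace F] [IsNonarchimedeanLocalField F] in
-- Both `u` and `g⁻¹ u` are vectors of unit length `c` in `Λ₀ ⊕ ⟨u⟩`. An isometry `s` taking `u` to
-- `g⁻¹ u` can be chosen to stabilize every lattice between `Λ₀ ⊕ ⟨u⟩` and its dual, in particular
-- `Λ`. Then `g s` fixes `u` and comes from `U(V)`.
theorem IsRamified.stab_mul_stab_eq_of_addLine_le (hR : IsRamified σ π) (hs : h.IsSymm)
    (hσc : σ c = c) (hc : valuation F c = 1) {r t : ℕ} {Λ₀ : Submodule 𝒪[F] V}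
    (h0 : Λ₀ ∈ Vert h r) {Λ : Submodule 𝒪[F] (V × F)} (hΛ : Λ ∈ Vert (extForm h c) t)
    (hle : addLine Λ₀ ≤ Λ) :
    (stab (extForm h c) (addLine Λ₀) : Set (unitaryGroup (extForm h c))) *
        (stab (extForm h c) Λ : Set (unitaryGroup (extForm h c))) =
      ((stab h Λ₀).map (embed h c) : Set (unitaryGroup (extForm h c))) *
        (stab (extForm h c) Λ : Set (unitaryGroup (extForm h c))) := by
  have hse := extForm_isSymm hs hR.invol hσc
  have hc0 : c ≠ 0 := fun h0 => by simp [h0] at hc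
  refine stab_mul_stab_eq le_rfl fun g hg => ?_
  have huu : extForm h c (specialVec F V) (specialVec F V) = c := by
    simp [extForm_apply, specialVec]
  have hE : addLine Λ₀ ≤ dualLattice (extForm h c) (addLine Λ₀) := by
    rw [hR.dual_addLine hc]
    exact addLine_mono h0.le_dual
  obtain ⟨s, hsu, hsM⟩ := hR.exists_map_eq hse hE (specialVec_mem_addLine Λ₀)
    (y := (g⁻¹ : unitaryGroup (extForm h c)).1 (specialVec F V))
    (((inv_mem hg : g⁻¹ ∈ stab (extForm h c) (addLine Λ₀)) _).2 (specialVec_mem_addLine Λ₀))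
    ((unitary_isIsometry _ _ _).symm) (by rw [unitary_isIsometry, huu, hc])
  obtain ⟨a, ha⟩ := exists_embed_eq hc0 (g := g * s) (by
    rw [unitary_mul_apply, hsu]
    exact LinearEquiv.apply_symm_apply _ _)
  refine ⟨a, ?_, ?_⟩
  · rw [← embed_mem_stab_addLine (c := c), ha]
    exact mul_mem hg (hsM _ le_rfl hE)
  · rw [ha, mapLattice_mul, mem_stab_iff.1 (hsM Λ hle (hΛ.le_dual.trans (dual_anti hle)))]

/-- If `u` were in `Λ`, the lattice `Λ ∩ V` would have type greater than the dimension of `V`. -/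
theorem IsRamified.specialVec_notMem (hR : IsRamified σ π) (hs : h.IsSymm) (hnd : h.Nondegenerate)
    (hc : valuation F c = 1) {Λ : Submodule 𝒪[F] (V × F)}
    (hΛ : Λ ∈ Vert (extForm h c) (Module.finrank F V + 1)) : specialVec F V ∉ Λ := by
  intro hu
  have := hR.le_finrank hs hnd (hR.flatPart_mem_vert hc hΛ hu)
  omega

theorem IsRamified.sup_specialLine_eq (hR : IsRamified σ π) (hs : h.IsSymm)
    (hnd : h.Nondegenerate) (hσc : σ c = c) (hc : valuation F c = 1) {t : ℕ}
    {Λ₁ : Submodule 𝒪[F] V} (h1 : Λ₁ ∈ Vert h t) {Λ : Submodule 𝒪[F] (V × F)}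
    (hΛ : Λ ∈ Vert (extForm h c) (t + 2)) (hle : Λ ≤ addLine Λ₁) (hu : specialVec F V ∉ Λ) :
    Λ ⊔ specialLine F V = addLine Λ₁ := by
  obtain ⟨t', ht', N, hN, hNM, he⟩ := hR.exists_addLine_eq_sup hs hnd hσc hc h1 hΛ hle hu
  obtain rfl : t' = t := by omega
  rw [he, vert_eq_of_le hN h1 hNM]

theorem IsRamified.exists_embed_map_eq_map (hR : IsRamified σ π) (hs : h.IsSymm)
    (hnd : h.Nondegenerate) (hσc : σ c = c) (hc : valuation F c = 1) {s t : ℕ}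
    {Λ' : Submodule 𝒪[F] V} (h' : Λ' ∈ Vert h t) {Λ : Submodule 𝒪[F] (V × F)}
    (hΛ : Λ ∈ Vert (extForm h c) s) (hle : Λ ≤ addLine Λ') {g g' : unitaryGroup (extForm h c)}
    (hg : g ∈ stab (extForm h c) (addLine Λ')) (hg' : g' ∈ stab (extForm h c) (addLine Λ'))
    (hu : specialVec F V ∉ mapLattice (g : (V × F) ≃ₗ[F] (V × F)) Λ)
    (hu' : specialVec F V ∉ mapLattice (g' : (V × F) ≃ₗ[F] (V × F)) Λ) :
    ∃ a ∈ stab h Λ',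
      mapLattice ((embed h c a * g : unitaryGroup (extForm h c)) : (V × F) ≃ₗ[F] (V × F)) Λ =
        mapLattice (g' : (V × F) ≃ₗ[F] (V × F)) Λ := by
  obtain ⟨a, ha, H⟩ := hR.exists_embed_map_eq hs hnd hσc hc h' (hR.mapLattice_mem_vert hΛ g)
    (hR.mapLattice_mem_vert hΛ g') (mapLattice_le_of_mem_stab hg hle)
    (mapLattice_le_of_mem_stab hg' hle) hu hu'
  exact ⟨a, ha, by rw [mapLattice_mul, H]⟩

/-! #### Maximal type in the odd-dimensional case -/

/-- Splitness of `V ⊕ F u` makes the reduction of `Λ₁ ⊕ ⟨u⟩` a hyperbolic plane, which has two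
isotropic lines. -/
theorem IsRamified.exists_eq_pair_addLine (hR : IsRamified σ π) (hs : h.IsSymm)
    (hnd : h.Nondegenerate) (hσc : σ c = c) (hc : valuation F c = 1)
    (hh : hasse (extForm h c) = 1) {r : ℕ} (heven : Even r) (hr : r + 1 = Module.finrank F V)
    {Λ₁ : Submodule 𝒪[F] V} (h1 : Λ₁ ∈ Vert h r) :
    ∃ N₁ N₂, N₁ ≠ N₂ ∧
      {N | N ∈ Vert (extForm h c) (Module.finrank F V + 1) ∧ N ≤ addLine Λ₁} = {N₁, N₂} := by
  have hc0 : c ≠ 0 := fun h0 => by simp [h0] at hc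
  have hse := extForm_isSymm hs hR.invol hσc
  have hnde := extForm_nondegenerate hs hnd hR.invol hσc hc0
  have hdim : r + 2 = Module.finrank F (V × F) := by
    rw [Module.finrank_prod, Module.finrank_self]
    omega
  have hL := (hR.addLine_mem_vert_iff hc).2 h1
  obtain ⟨i, hi, hi', hii⟩ := hR.exists_isotropic hse hnde hL hdim heven hh
  have := hR.exists_eq_pair hse hnde hL hdim hi hi' hii
  rwa [← hr]

/-- Reflections of determinant `-1`. -/
theorem IsRamified.exists_stab_det_eq_neg_one (hR : IsRamified σ π) (hs : h.IsSymm)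
    (hnd : h.Nondegenerate) {t : ℕ} {Λ₁ : Submodule 𝒪[F] V} (h1 : Λ₁ ∈ Vert h t)
    (ht : t < Module.finrank F V) :
    ∃ a : unitaryGroup h, (LinearEquiv.det (a : V ≃ₗ[F] V) : F) = -1 ∧
      ∀ L, Λ₁ ≤ L → L ≤ dualLattice h Λ₁ → a ∈ stab h L := by
  obtain ⟨e, he, hee⟩ := hR.exists_unit_vector hs hnd h1 ht
  obtain ⟨a, ha, haL, -⟩ := hR.exists_reflection hs hee
  exact ⟨a, ha, fun L h1L hL => haL L (h1L he) fun z hz => hL hz e he⟩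

theorem IsRamified.det_sub_one_lt_of_embed (hR : IsRamified σ π) (hs : h.IsSymm)
    (hnd : h.Nondegenerate) (hσc : σ c = c) (hc : valuation F c = 1)
    {Λ : Submodule 𝒪[F] (V × F)} (hΛ : Λ ∈ Vert (extForm h c) (Module.finrank F V + 1))
    {g : unitaryGroup (extForm h c)} (hg : g ∈ stab (extForm h c) Λ) :
    valuation F ((LinearEquiv.det (g : (V × F) ≃ₗ[F] (V × F)) : F) - 1) < 1 := by
  have hc0 : c ≠ 0 := fun h0 => by simp [h0] at hc
  refine hR.det_sub_one_lt (extForm_isSymm hs hR.invol hσc)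
    (extForm_nondegenerate hs hnd hR.invol hσc hc0) (Λ := Λ) ?_ hg
  rwa [Module.finrank_prod, Module.finrank_self]

omit [TopologicalSpace F] [IsNonarchimedeanLocalField F] in
theorem IsRamified.valuation_neg_one_sub_one (hR : IsRamified σ π) :
    ¬ valuation F ((-1 : F) - 1) < 1 := by
  have e : (-1 : F) - 1 = -2 := by ring
  rw [e, Valuation.map_neg, hR.val_two]
  exact lt_irrefl _

theorem IsRamified.map_ne_of_det_eq_neg_one (hR : IsRamified σ π) (hs : h.IsSymm)
    (hnd : h.Nondegenerate) (hσc : σ c = c) (hc : valuation F c = 1)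
    {Λ : Submodule 𝒪[F] (V × F)} (hΛ : Λ ∈ Vert (extForm h c) (Module.finrank F V + 1))
    {a : unitaryGroup h} (ha : (LinearEquiv.det (a : V ≃ₗ[F] V) : F) = -1) :
    embed h c a ∉ stab (extForm h c) Λ := by
  intro hmem
  have := hR.det_sub_one_lt_of_embed hs hnd hσc hc hΛ hmem
  rw [det_embed, ha] at this
  exact hR.valuation_neg_one_sub_one this

/-- The stabilizer of `Λ₁ ⊕ ⟨u⟩` permutes a set of two lattices, so any two elements that move `Λ`
send it to the same place. -/
theorem IsRamified.inv_mul_mem_stab (hR : IsRamified σ π) (hs : h.IsSymm)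
    (hnd : h.Nondegenerate) (hσc : σ c = c) (hc : valuation F c = 1)
    (hh : hasse (extForm h c) = 1) {r : ℕ} (heven : Even r) (hr : r + 1 = Module.finrank F V)
    {Λ₁ : Submodule 𝒪[F] V} (h1 : Λ₁ ∈ Vert h r) {Λ : Submodule 𝒪[F] (V × F)}
    (hΛ : Λ ∈ Vert (extForm h c) (Module.finrank F V + 1)) (hle : Λ ≤ addLine Λ₁)
    {g g' : unitaryGroup (extForm h c)} (hg : g ∈ stab (extForm h c) (addLine Λ₁))
    (hg' : g' ∈ stab (extForm h c) (addLine Λ₁)) (hgΛ : g ∉ stab (extForm h c) Λ)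
    (hgΛ' : g' ∉ stab (extForm h c) Λ) : g⁻¹ * g' ∈ stab (extForm h c) Λ := by
  obtain ⟨N₁, N₂, hN, hset⟩ := hR.exists_eq_pair_addLine hs hnd hσc hc hh heven hr h1
  have hmem : ∀ x ∈ stab (extForm h c) (addLine Λ₁),
      mapLattice (x : (V × F) ≃ₗ[F] (V × F)) Λ ∈ ({N₁, N₂} : Set _) := fun x hx => by
    rw [← hset]
    exact ⟨hR.mapLattice_mem_vert hΛ x, mapLattice_le_of_mem_stab hx hle⟩
  have h0 : Λ ∈ ({N₁, N₂} : Set _) := by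
    rw [← hset]
    exact ⟨hΛ, hle⟩
  have h2 := hmem g hg
  have h3 := hmem g' hg'
  rw [mem_stab_iff] at hgΛ hgΛ'
  rw [inv_mul_mem_stab_iff]
  rcases h0 with h0 | h0 <;> rcases h2 with h2 | h2 <;> rcases h3 with h3 | h3 <;> simp_all

/-- The stabilizer in `U(V)` of a lattice of maximal type in `V ⊕ F u`. -/
theorem IsRamified.comap_embed_stab (hR : IsRamified σ π) (hs : h.IsSymm)
    (hnd : h.Nondegenerate) (hσc : σ c = c) (hc : valuation F c = 1)
    (hh : hasse (extForm h c) = 1) {r : ℕ} (heven : Even r) (hr : r + 1 = Module.finrank F V)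
    {Λ₁ : Submodule 𝒪[F] V} (h1 : Λ₁ ∈ Vert h r) {Λ : Submodule 𝒪[F] (V × F)}
    (hΛ : Λ ∈ Vert (extForm h c) (Module.finrank F V + 1)) (hle : Λ ≤ addLine Λ₁) :
    (stab (extForm h c) Λ).comap (embed h c) = stabDet h Λ₁ := by
  have hu := hR.specialVec_notMem hs hnd hc hΛ
  have hsup := hR.sup_specialLine_eq hs hnd hσc hc h1 (hr.symm ▸ hΛ : Λ ∈ Vert (extForm h c) (r + 1 + 1)) hle hu
  ext a
  constructor
  · intro ha
    have ha' : embed h c a ∈ stab (extForm h c) Λ := ha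
    refine ⟨?_, ?_⟩
    -- An element of `U(V)` fixes `u`, so if it preserves `Λ`, it preserves `Λ + ⟨u⟩ = Λ₁ ⊕ ⟨u⟩`.
    · rw [← embed_mem_stab_addLine (c := c), mem_stab_iff]
      refine vert_eq_of_le (hR.mapLattice_mem_vert ((hR.addLine_mem_vert_iff hc).2 h1) _)
        ((hR.addLine_mem_vert_iff hc).2 h1) ?_
      intro x hx
      rw [mem_mapLattice, ← hsup] at hx
      obtain ⟨y, hy, z, hz, hyz⟩ := Submodule.mem_sup.1 hx
      obtain ⟨b, rfl⟩ := Submodule.mem_span_singleton.1 hz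
      have hx2 := congrArg ((embed h c a : unitaryGroup (extForm h c)) : (V × F) ≃ₗ[F] (V × F)) hyz
      rw [LinearEquiv.apply_symm_apply, map_add] at hx2
      rw [← hx2]
      refine add_mem (hle ((ha' y).2 hy)) ?_
      have e : ((embed h c a : unitaryGroup (extForm h c)) : (V × F) ≃ₗ[F] (V × F))
          (b • specialVec F V) = b • specialVec F V := by
        refine (map_smul ((embed h c a : unitaryGroup (extForm h c)) : (V × F) ≃ₗ[F] (V × F))
          (b : F) _).trans ?_
        rw [embed_specialVec]
        rfl
      rw [e]
      exact Submodule.smul_mem _ _ (specialVec_mem_addLine Λ₁)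
    · rw [← det_embed (c := c)]
      exact hR.det_sub_one_lt_of_embed hs hnd hσc hc hΛ ha'
  · rintro ⟨ha, hdet⟩
    -- A reflection `s` moves `Λ`. If `a` moved it as well, `s⁻¹ a` would stabilize `Λ` and have
    -- determinant `1` modulo `π`, contradicting `det a = 1` modulo `π` and `det s = -1`.
    obtain ⟨s, hsdet, hsL⟩ := hR.exists_stab_det_eq_neg_one hs hnd h1 (by omega)
    by_contra haΛ
    have h3 := hR.inv_mul_mem_stab hs hnd hσc hc hh heven hr h1 hΛ hle
      (embed_mem_stab_addLine.2 (hsL Λ₁ le_rfl h1.le_dual)) (embed_mem_stab_addLine.2 ha)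
      (hR.map_ne_of_det_eq_neg_one hs hnd hσc hc hΛ hsdet) haΛ
    rw [← map_inv, ← map_mul] at h3
    have h4 := hR.det_sub_one_lt_of_embed hs hnd hσc hc hΛ h3
    rw [det_embed, Subgroup.coe_mul, Subgroup.coe_inv, map_mul, map_inv, Units.val_mul,
      Units.val_inv_eq_inv_val, hsdet] at h4
    refine hR.valuation_neg_one_sub_one ?_
    have e : (-1 : F) - 1 = ((-1)⁻¹ * (LinearEquiv.det (a : V ≃ₗ[F] V) : F) - 1) +
        ((LinearEquiv.det (a : V ≃ₗ[F] V) : F) - 1) := by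
      rw [inv_neg_one]
      ring
    rw [e]
    exact (valuation F).map_add_lt h4 hdet

/-- The character records whether the two lattices of maximal type below `Λ₀ ⊕ ⟨u⟩` are swapped. A
reflection from `U(V)` swaps them, whence surjectivity after restriction. -/
theorem IsRamified.exists_character (hR : IsRamified σ π) (hs : h.IsSymm)
    (hnd : h.Nondegenerate) (hσc : σ c = c) (hc : valuation F c = 1)
    (hh : hasse (extForm h c) = 1) {r : ℕ} (heven : Even r) (hr : r + 1 = Module.finrank F V)
    {Λ₀ : Submodule 𝒪[F] V} (h0 : Λ₀ ∈ Vert h r) {Λ : Submodule 𝒪[F] (V × F)}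
    (hΛ : Λ ∈ Vert (extForm h c) (Module.finrank F V + 1)) (hle : Λ ≤ addLine Λ₀) :
    ∃ χ : stab (extForm h c) (addLine Λ₀) →* rootsOfUnity 2 𝓀[F],
      Function.Surjective χ ∧
      χ.ker = (stab (extForm h c) Λ).subgroupOf (stab (extForm h c) (addLine Λ₀)) ∧
      Function.Surjective (χ.comp (stabEmbed h c Λ₀)) ∧
      (χ.comp (stabEmbed h c Λ₀)).ker = (stabDet h Λ₀).subgroupOf (stab h Λ₀) := by
  obtain ⟨s, hsdet, hsL⟩ := hR.exists_stab_det_eq_neg_one hs hnd h0 (by omega)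
  obtain ⟨χ, hχ, hχs⟩ := exists_quadratic_character hR.two_ne_zero
    (K := (stab (extForm h c) Λ).subgroupOf (stab (extForm h c) (addLine Λ₀)))
    fun g g' hg hg' => hR.inv_mul_mem_stab hs hnd hσc hc hh heven hr h0 hΛ hle g.2 g'.2 hg hg'
  have hsurj : Function.Surjective (χ.comp (stabEmbed h c Λ₀)) :=
    hχs _ ⟨⟨s, hsL _ le_rfl h0.le_dual⟩, hR.map_ne_of_det_eq_neg_one hs hnd hσc hc hΛ hsdet⟩
  refine ⟨χ, (show Function.Surjective (χ ∘ stabEmbed h c Λ₀) from hsurj).of_comp, hχ, hsurj, ?_⟩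
  ext a
  rw [← MonoidHom.comap_ker, hχ, ← hR.comap_embed_stab hs hnd hσc hc hh heven hr h0 hΛ hle]
  rfl

theorem IsRamified.stab_mul_stab_eq_of_notMem (hR : IsRamified σ π) (hs : h.IsSymm)
    (hnd : h.Nondegenerate) (hσc : σ c = c) (hc : valuation F c = 1) {s t : ℕ}
    {Λ' : Submodule 𝒪[F] V} (h' : Λ' ∈ Vert h t) {Λ : Submodule 𝒪[F] (V × F)}
    (hΛ : Λ ∈ Vert (extForm h c) s) (hle : Λ ≤ addLine Λ')
    (hu : ∀ N ∈ Vert (extForm h c) s, specialVec F V ∉ N) :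
    (stab (extForm h c) (addLine Λ') : Set (unitaryGroup (extForm h c))) *
        (stab (extForm h c) Λ : Set (unitaryGroup (extForm h c))) =
      ((stab h Λ').map (embed h c) : Set (unitaryGroup (extForm h c))) *
        (stab (extForm h c) Λ : Set (unitaryGroup (extForm h c))) := by
  refine stab_mul_stab_eq le_rfl fun g hg => ?_
  obtain ⟨a, ha, H⟩ := hR.exists_embed_map_eq_map hs hnd hσc hc h' hΛ hle (one_mem _) hg
    (hu _ (hR.mapLattice_mem_vert hΛ _)) (hu _ (hR.mapLattice_mem_vert hΛ _))
  rw [mul_one] at H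
  exact ⟨a, ha, H⟩

/-- The nontrivial coset is represented by a reflection in a unit vector of `Λ₁`. It also stabilizes
`Λ'`, because `Λ₁ ≤ Λ' ≤ Λ₁^∨`. -/
theorem IsRamified.stab_mul_stab_eq_of_inf (hR : IsRamified σ π) (hs : h.IsSymm)
    (hnd : h.Nondegenerate) (hσc : σ c = c) (hc : valuation F c = 1)
    (hh : hasse (extForm h c) = 1) {r t : ℕ} (heven : Even r) (hr : r + 1 = Module.finrank F V)
    {Λ₁ Λ' : Submodule 𝒪[F] V} (h1 : Λ₁ ∈ Vert h r) (h' : Λ' ∈ Vert h t) (hle' : Λ₁ ≤ Λ')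
    {Λ : Submodule 𝒪[F] (V × F)}
    (hΛ : Λ ∈ Vert (extForm h c) (Module.finrank F V + 1)) (hle : Λ ≤ addLine Λ₁) :
    (stab (extForm h c) (addLine Λ₁) : Set (unitaryGroup (extForm h c))) *
        (stab (extForm h c) Λ : Set (unitaryGroup (extForm h c))) =
      ((stab h Λ' ⊓ stab h Λ₁).map (embed h c) : Set (unitaryGroup (extForm h c))) *
        (stab (extForm h c) Λ : Set (unitaryGroup (extForm h c))) := by
  refine stab_mul_stab_eq inf_le_right fun g hg => ?_
  by_cases hgΛ : g ∈ stab (extForm h c) Λ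
  · exact ⟨1, one_mem _, by rw [map_one, mapLattice_one, mem_stab_iff.1 hgΛ]⟩
  · obtain ⟨s, hsdet, hsL⟩ := hR.exists_stab_det_eq_neg_one hs hnd h1 (by omega)
    refine ⟨s, ⟨hsL _ hle' (h'.le_dual.trans (dual_anti hle')), hsL _ le_rfl h1.le_dual⟩, ?_⟩
    exact inv_mul_mem_stab_iff.1 (hR.inv_mul_mem_stab hs hnd hσc hc hh heven hr h1 hΛ hle hg
      (embed_mem_stab_addLine.2 (hsL Λ₁ le_rfl h1.le_dual)) hgΛ
      (hR.map_ne_of_det_eq_neg_one hs hnd hσc hc hΛ hsdet))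

omit [TopologicalSpace F] [IsNonarchimedeanLocalField F] in
-- The determinant has norm one, and `σ` is trivial on residues, so its residue squares to one.
theorem IsRamified.det_cases (hR : IsRamified σ π) (hnd : h.Nondegenerate) (a : unitaryGroup h) :
    valuation F ((LinearEquiv.det (a : V ≃ₗ[F] V) : F) - 1) < 1 ∨
      valuation F ((LinearEquiv.det (a : V ≃ₗ[F] V) : F) + 1) < 1 := by
  have h1 := det_mul_map_det hnd a
  set x := (LinearEquiv.det (a : V ≃ₗ[F] V) : F)
  have hx : valuation F x = 1 := by
    have h2 := congrArg (valuation F) h1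
    rw [map_mul, hR.val_map, map_one, ← sq] at h2
    exact (pow_eq_one_iff_of_nonneg zero_le _root_.two_ne_zero).1 h2
  have h3 : resid x * resid x = 1 := by
    rw [← resid_one, ← h1, resid_mul hx.le (by rw [hR.val_map, hx]), hR.resid_map]
  rcases mul_self_eq_one_iff.1 h3 with h4 | h4
  · left
    rwa [← resid_sub_eq_zero_iff hx.le (by simp), resid_one]
  · right
    rw [← sub_neg_eq_add, ← resid_sub_eq_zero_iff hx.le (by simp), resid_neg (by simp), resid_one, h4]

theorem IsRamified.numDoubleCosets_eq_one (hR : IsRamified σ π) (hs : h.IsSymm)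
    (hnd : h.Nondegenerate) (hσc : σ c = c) (hc : valuation F c = 1) {s t : ℕ}
    {Λ' : Submodule 𝒪[F] V} (h' : Λ' ∈ Vert h t) {Λ : Submodule 𝒪[F] (V × F)}
    (hΛ : Λ ∈ Vert (extForm h c) s) (hle : Λ ≤ addLine Λ')
    (hu : ∀ N ∈ Vert (extForm h c) s, specialVec F V ∉ N) :
    numDoubleCosets ((stab h Λ').map (embed h c)) (stab (extForm h c) (addLine Λ'))
      (stab (extForm h c) (addLine Λ') ⊓ stab (extForm h c) Λ) = 1 := by
  refine _root_.numDoubleCosets_eq_one (map_embed_le_stab_addLine le_rfl) fun g hg => ?_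
  obtain ⟨a, ha, H⟩ := hR.exists_embed_map_eq_map hs hnd hσc hc h' hΛ hle (one_mem _) hg
    (hu _ (hR.mapLattice_mem_vert hΛ _)) (hu _ (hR.mapLattice_mem_vert hΛ _))
  rw [mul_one] at H
  exact ⟨_, ⟨a, ha, rfl⟩, inv_mul_mem_stab_iff.2 H.symm⟩

/-- The invariant is the determinant modulo `π`, constant on double cosets because the stabilizer of
`Λ` has determinant `1` modulo `π`. Transitivity under the full stabilizer shows that it is
complete, and a reflection realizes the value `-1`. -/
theorem IsRamified.numDoubleCosets_stabDet (hR : IsRamified σ π) (hs : h.IsSymm)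
    (hnd : h.Nondegenerate) (hσc : σ c = c) (hc : valuation F c = 1) {t : ℕ}
    (ht : t < Module.finrank F V)
    {Λ' : Submodule 𝒪[F] V} (h' : Λ' ∈ Vert h t) {Λ : Submodule 𝒪[F] (V × F)}
    (hΛ : Λ ∈ Vert (extForm h c) (Module.finrank F V + 1)) (hle : Λ ≤ addLine Λ') :
    numDoubleCosets ((stabDet h Λ').map (embed h c)) (stab (extForm h c) (addLine Λ'))
      (stab (extForm h c) (addLine Λ') ⊓ stab (extForm h c) Λ) = 2 := by
  have hc0 : c ≠ 0 := fun h0 => by simp [h0] at hc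
  have hnde := extForm_nondegenerate hs hnd hR.invol hσc hc0
  have hsd : stabDet h Λ' ≤ stab h Λ' := fun a ha => ha.1
  have hu : ∀ N ∈ Vert (extForm h c) (Module.finrank F V + 1), specialVec F V ∉ N :=
    fun N hN => hR.specialVec_notMem hs hnd hc hN
  obtain ⟨s, hsdet, hsL⟩ := hR.exists_stab_det_eq_neg_one hs hnd h' ht
  have hval : ∀ g : unitaryGroup (extForm h c),
      valuation F (LinearEquiv.det (g : (V × F) ≃ₗ[F] (V × F)) : F) = 1 := by
    intro g
    have h2 := congrArg (valuation F) (det_mul_map_det hnde g)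
    rw [map_mul, hR.val_map, map_one, ← sq] at h2
    exact (pow_eq_one_iff_of_nonneg zero_le _root_.two_ne_zero).1 h2
  let d : unitaryGroup (extForm h c) → 𝓀[F] := fun g =>
    resid (LinearEquiv.det (g : (V × F) ≃ₗ[F] (V × F)) : F)
  have hdm : ∀ g g', d (g * g') = d g * d g' := fun g g' => by
    change resid _ = resid _ * resid _
    rw [← resid_mul (hval g).le (hval g').le, Subgroup.coe_mul, map_mul, Units.val_mul]
  have hd1 : ∀ g, d g = 1 ↔
      valuation F ((LinearEquiv.det (g : (V × F) ≃ₗ[F] (V × F)) : F) - 1) < 1 := fun g => by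
    rw [← resid_sub_eq_zero_iff (hval g).le (by simp), resid_one]
  have hd : ∀ g, d g = 1 ∨ d g = -1 := fun g => by
    rcases hR.det_cases hnde g with h1 | h1
    · exact Or.inl ((hd1 g).2 h1)
    · right
      rw [← sub_neg_eq_add, ← resid_sub_eq_zero_iff (hval g).le (by simp), resid_neg (by simp),
        resid_one] at h1
      exact h1
  have h11 : (-1 : 𝓀[F]) ≠ 1 := fun h1 => hR.two_ne_zero (by linear_combination -h1)
  refine numDoubleCosets_eq_two (map_embed_le_stab_addLine hsd) (fun g => d g = 1)
    (fun g hg g' hg' => ?_) ⟨1, one_mem _, ?_⟩ ⟨embed h c s, ?_, ?_⟩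
  · constructor
    · intro hgg
      obtain ⟨a, ha, H⟩ := hR.exists_embed_map_eq_map hs hnd hσc hc h' hΛ hle hg hg'
        (hu _ (hR.mapLattice_mem_vert hΛ _)) (hu _ (hR.mapLattice_mem_vert hΛ _))
      have hk := inv_mul_mem_stab_iff.2 H.symm
      refine ⟨_, ⟨a, ⟨ha, ?_⟩, rfl⟩, hk⟩
      have hk1 := (hd1 _).2 (hR.det_sub_one_lt_of_embed hs hnd hσc hc hΛ hk)
      have hk2 : d g' = d (embed h c a) * d g * d ((embed h c a * g)⁻¹ * g') := by
        rw [← hdm, ← hdm, mul_inv_cancel_left]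
      rw [hk1, mul_one] at hk2
      have hgg' : d g' = d g := by
        rcases hd g with e | e <;> rcases hd g' with e' | e' <;> simp_all
      have hg0 : d g ≠ 0 := by rcases hd g with e | e <;> simp [e]
      have hk3 : d (embed h c a) = 1 := by
        rw [hgg'] at hk2
        exact (mul_right_cancel₀ hg0 (by rw [one_mul]; exact hk2)).symm
      have := (hd1 _).1 hk3
      rwa [det_embed] at this
    · rintro ⟨_, ⟨a, ⟨-, ha⟩, rfl⟩, hk⟩
      have hk1 := (hd1 _).2 (hR.det_sub_one_lt_of_embed hs hnd hσc hc hΛ hk)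
      have hk2 : d g' = d (embed h c a) * d g * d ((embed h c a * g)⁻¹ * g') := by
        rw [← hdm, ← hdm, mul_inv_cancel_left]
      have hk3 : d (embed h c a) = 1 := by
        rw [hd1, det_embed]
        exact ha
      rw [hk2, hk1, hk3, one_mul, mul_one]
  · rw [hd1]
    simp
  · exact embed_mem_stab_addLine.2 (hsL _ le_rfl h'.le_dual)
  · change ¬ resid _ = 1
    rw [det_embed, hsdet, resid_neg (by simp), resid_one]
    exact h11

end Stabilizers

/-! ### Double cosets in the even-dimensional case -/

section EvenCase

variable {F : Type*} [Field F] [ValuativeRel F] {σ : F →+* F} {π : F}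
  {V : Type*} [AddCommGroup V] [Module F V] {h : V →ₛₗ[σ] V →ₗ[F] F} {c : F}
  [FiniteDimensional F V] [TopologicalSpace F] [IsNonarchimedeanLocalField F]

/-- If `u` were in `Λ`, then `Λ ∩ V` would be of maximal type, which forces `V` to be split. -/
theorem IsRamified.specialVec_notMem_of_hasse (hR : IsRamified σ π) (hs : h.IsSymm)
    (hnd : h.Nondegenerate) (hc : valuation F c = 1) (heven : Even (Module.finrank F V))
    (hh : hasse h = -1) {Λ : Submodule 𝒪[F] (V × F)}
    (hΛ : Λ ∈ Vert (extForm h c) (Module.finrank F V)) : specialVec F V ∉ Λ := by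
  intro hu
  have := hR.hasse_eq_one_of_vert hs hnd (hR.flatPart_mem_vert hc hΛ hu) heven
  omega

omit [ValuativeRel F] [FiniteDimensional F V] [TopologicalSpace F]
  [IsNonarchimedeanLocalField F] in
theorem hasse_eq_one_or : hasse h = 1 ∨ hasse h = -1 := by
  unfold hasse
  split_ifs
  · exact Or.inl rfl
  · exact Or.inr rfl

/-- A lattice of maximal type in `V` contained in a given one, for split `V`. -/
theorem IsRamified.exists_vert_specialVec_mem (hR : IsRamified σ π) (hs : h.IsSymm)
    (hnd : h.Nondegenerate) (hσc : σ c = c) (hc : valuation F c = 1)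
    (heven : Even (Module.finrank F V)) (hh : hasse h = 1) {t : ℕ} {Λ' : Submodule 𝒪[F] V}
    (h' : Λ' ∈ Vert h t) {Λ : Submodule 𝒪[F] (V × F)}
    (hΛ : Λ ∈ Vert (extForm h c) (Module.finrank F V)) (hle : Λ ≤ addLine Λ') :
    ∃ N ∈ Vert h (Module.finrank F V), N ≤ Λ' := by
  by_cases hu : specialVec F V ∈ Λ
  · refine ⟨flatPart Λ, hR.flatPart_mem_vert hc hΛ hu, ?_⟩
    rw [← addLine_le_iff, addLine_flatPart hc hΛ.le_dual hu]
    exact hle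
  · obtain ⟨t', ht', N, hN, hNM, -⟩ := hR.exists_addLine_eq_sup hs hnd hσc hc h' hΛ hle hu
    -- The lattice `N` has type `n - 2` in a split space, so an isotropic line of its reduction
    -- yields a sublattice of type `n`.
    obtain ⟨i, hi, hi', hii⟩ := hR.exists_isotropic hs hnd hN ht'
      (by rw [← ht', Nat.even_add] at heven; exact heven.2 even_two) hh
    refine ⟨pairingKernel h i N, ht' ▸ hR.vert_pairingKernel hs hN hi hi' hii, ?_⟩
    exact fun x hx => hNM (hR.mem_pairingKernel.1 hx).1

/-- The reflection in `(v, 1)` with `v` in `Λ'` but not in `Λ₁` sends `u` to `u - a (v, 1)` with a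
unit `a`, and the component `-a v` in `V` is not in `Λ₁`. -/
theorem IsRamified.exists_stab_specialVec_notMem (hR : IsRamified σ π) (hs : h.IsSymm)
    (hnd : h.Nondegenerate) (hσc : σ c = c) (hc : valuation F c = 1) {t : ℕ}
    (ht : t < Module.finrank F V) {Λ' Λ₁ : Submodule 𝒪[F] V} (h' : Λ' ∈ Vert h t)
    (h1 : Λ₁ ∈ Vert h (Module.finrank F V)) (hle : Λ₁ ≤ Λ') :
    ∃ g ∈ stab (extForm h c) (addLine Λ'),
      (g : (V × F) ≃ₗ[F] (V × F)) (specialVec F V) ∉ addLine Λ₁ := by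
  have hse := extForm_isSymm hs hR.invol hσc
  have hE : addLine Λ' ≤ dualLattice (extForm h c) (addLine Λ') := by
    rw [hR.dual_addLine hc]
    exact addLine_mono h'.le_dual
  have hsub := hR.subDual_eq hs hnd h1
  have hc2 : resid c ≠ 0 := resid_ne_zero hc
  -- a vector `v` of `Λ'` outside `Λ₁` such that `v + u` has unit length
  obtain ⟨v, hv, hv1, hvc⟩ : ∃ v ∈ Λ', v ∉ Λ₁ ∧ resForm h v v + resid c ≠ 0 := by
    obtain ⟨v, hv, hv1⟩ : ∃ v ∈ Λ', v ∉ Λ₁ := by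
      by_contra! hcon
      have heq : Λ' = Λ₁ := le_antisymm hcon hle
      have h2 := h'.relLength_eq
      rw [heq, h1.relLength_eq] at h2
      have h3 : Module.finrank F V = t := by exact_mod_cast h2
      omega
    -- If `(v, 1)` is isotropic modulo `π`, add to `v` some `f` in `Λ₁ = π Λ₁^∨` that pairs with `v`
    -- to a unit. As `f` is isotropic modulo `π`, the length changes by `2 h(f, v)`, which is a
    -- unit.
    by_cases hvc : resForm h v v + resid c = 0
    · have hvs : v ∉ subDual h Λ₁ := by rwa [hsub]
      rw [mem_subDual] at hvs
      push Not at hvs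
      obtain ⟨f, hf, hfv⟩ := hvs
      have hff : resForm h f f = 0 :=
        resid_eq_zero (mem_subDual.1 (hsub.symm ▸ hf : f ∈ subDual h Λ₁) f hf)
      have hfv' : resForm h f v ≠ 0 := by
        rw [resForm_ne_zero_iff h'.le_dual (hle hf) hv]
        exact le_antisymm (h'.le_dual hv f (hle hf)) hfv
      refine ⟨v + f, add_mem hv (hle hf), fun hvf => hv1 ?_, fun h0 => hfv' ?_⟩
      · simpa using sub_mem hvf hf
      · rw [resForm_add_left h'.le_dual hv (hle hf) (add_mem hv (hle hf)),
          resForm_add_right h'.le_dual hv (hle hf) hv,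
          resForm_add_right h'.le_dual hv (hle hf) (hle hf), hff, hR.resForm_comm hs v f] at h0
        have h2 : 2 * resForm h f v = 0 := by linear_combination h0 - hvc
        exact (mul_eq_zero.1 h2).resolve_left hR.two_ne_zero
    · exact ⟨v, hv, hv1, hvc⟩
  have hy : ((v, 1) : V × F) ∈ addLine Λ' := mem_addLine.2 ⟨hv, by simp⟩
  have hyy : resForm (extForm h c) (v, 1) (v, 1) = resForm h v v + resid c := by
    change resid _ = resid _ + _
    rw [← resid_add (h'.le_dual hv v hv) hc.le, extForm_apply]
    simp
  have hyu : resForm (extForm h c) (v, 1) (specialVec F V) = resid c := by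
    change resid _ = _
    rw [extForm_apply]
    simp [specialVec]
  obtain ⟨s, -, hsL, hsv, -⟩ := hR.exists_reflection_sub hse hE hy (by rwa [hyy])
  refine ⟨s, hsL _ le_rfl hE, fun hmem => hv1 ?_⟩
  obtain ⟨a, ha, hsa, hae⟩ := hsv _ (specialVec_mem_addLine Λ')
  rw [hsa, mem_addLine] at hmem
  have ha1 : valuation F a = 1 := by
    rw [← resid_ne_zero_iff ha]
    intro h0
    rw [h0, zero_mul, hyu] at hae
    exact mul_ne_zero hR.two_ne_zero hc2 hae.symm
  have hav : a • v ∈ Λ₁ := by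
    have := neg_mem hmem.1
    simpa [specialVec] using this
  have ha0 : a ≠ 0 := fun h0 => by simp [h0] at ha1
  have := int_smul_mem (a := a⁻¹) (by rw [map_inv₀, ha1, inv_one]) hav
  rwa [inv_smul_smul₀ ha0] at this

/-- The invariant of the coset of `g` is whether `u` lies in `gΛ`. Lattices containing `u` are
conjugate by Witt's theorem in `V`, those not containing it by `IsRamified.exists_embed_map_eq`.
Both kinds occur when `V` is split, only the second one otherwise. -/
theorem IsRamified.numDoubleCosets_of_even (hR : IsRamified σ π) (hs : h.IsSymm)
    (hnd : h.Nondegenerate) (hσc : σ c = c) (hc : valuation F c = 1)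
    (heven : Even (Module.finrank F V)) {t : ℕ} (ht : t < Module.finrank F V)
    {Λ' : Submodule 𝒪[F] V} (h' : Λ' ∈ Vert h t) {Λ : Submodule 𝒪[F] (V × F)}
    (hΛ : Λ ∈ Vert (extForm h c) (Module.finrank F V)) (hle : Λ ≤ addLine Λ') :
    numDoubleCosets ((stab h Λ').map (embed h c)) (stab (extForm h c) (addLine Λ'))
      (stab (extForm h c) (addLine Λ') ⊓ stab (extForm h c) Λ) =
        if hasse h = 1 then 2 else 1 := by
  split_ifs with hh
  · have hc0 : c ≠ 0 := fun h0 => by simp [h0] at hc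
    have hse := extForm_isSymm hs hR.invol hσc
    have hnde := extForm_nondegenerate hs hnd hR.invol hσc hc0
    have hL := (hR.addLine_mem_vert_iff hc).2 h'
    obtain ⟨N, hN, hNM⟩ := hR.exists_vert_specialVec_mem hs hnd hσc hc heven hh h' hΛ hle
    obtain ⟨b, hb, hbN⟩ := hR.exists_stab_map_eq hse hnde hL.isLattice.fg hL.le_dual hΛ
      ((hR.addLine_mem_vert_iff hc).2 hN) hle (addLine_mono hNM)
    have hbL := hb _ le_rfl hL.le_dual
    obtain ⟨g, hg, hgu⟩ := hR.exists_stab_specialVec_notMem hs hnd hσc hc ht h' hN hNM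
    refine numDoubleCosets_eq_two (map_embed_le_stab_addLine le_rfl)
      (fun g => specialVec F V ∈ mapLattice (g : (V × F) ≃ₗ[F] (V × F)) Λ)
      (fun g hg g' hg' => ?_) ⟨b, hbL, ?_⟩ ⟨g⁻¹ * b, mul_mem (inv_mem hg) hbL, ?_⟩
    · have hgΛ := hR.mapLattice_mem_vert hΛ g
      have hgΛ' := hR.mapLattice_mem_vert hΛ g'
      have hgle := mapLattice_le_of_mem_stab hg hle
      have hgle' := mapLattice_le_of_mem_stab hg' hle
      constructor
      · intro hgg
        by_cases hu : specialVec F V ∈ mapLattice (g : (V × F) ≃ₗ[F] (V × F)) Λ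
        · have hu' := hgg.1 hu
          have e := addLine_flatPart hc hgΛ.le_dual hu
          have e' := addLine_flatPart hc hgΛ'.le_dual hu'
          rw [← e, addLine_le_iff] at hgle
          rw [← e', addLine_le_iff] at hgle'
          obtain ⟨a, ha, H⟩ := hR.exists_stab_map_eq hs hnd h'.isLattice.fg h'.le_dual
            (hR.flatPart_mem_vert hc hgΛ hu) (hR.flatPart_mem_vert hc hgΛ' hu') hgle hgle'
          refine ⟨_, ⟨a, ha _ le_rfl h'.le_dual, rfl⟩, inv_mul_mem_stab_iff.2 ?_⟩
          rw [mapLattice_mul, ← e, mapLattice_embed_addLine, H, e']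
        · obtain ⟨a, ha, H⟩ := hR.exists_embed_map_eq_map hs hnd hσc hc h' hΛ hle hg hg' hu
            (fun hu' => hu (hgg.2 hu'))
          exact ⟨_, ⟨a, ha, rfl⟩, inv_mul_mem_stab_iff.2 H.symm⟩
      · rintro ⟨_, ⟨a, ha, rfl⟩, hk⟩
        rw [inv_mul_mem_stab_iff, mapLattice_mul] at hk
        rw [hk, mem_mapLattice (φ := ((embed h c a : unitaryGroup (extForm h c)) :
          (V × F) ≃ₗ[F] (V × F))), ← unitary_inv_apply, ← map_inv, embed_specialVec]
    · rw [hbN]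
      exact specialVec_mem_addLine N
    · rw [mapLattice_mul, hbN, mem_mapLattice]
      exact hgu
  · exact hR.numDoubleCosets_eq_one hs hnd hσc hc h' hΛ hle fun N hN =>
      hR.specialVec_notMem_of_hasse hs hnd hc heven (hasse_eq_one_or.resolve_left hh) hN

end EvenCase

/-! ### Lattice models of the correspondences -/

section Correspondences

variable {F : Type*} [Field F] [ValuativeRel F] {σ : F →+* F} {π : F}
  {V : Type*} [AddCommGroup V] [Module F V] {h : V →ₛₗ[σ] V →ₗ[F] F} {c : F}

theorem injOn_hatN {r t : ℕ} : Set.InjOn (fun x => (x.1, x.2.2)) (hatN h c r t) := by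
  rintro ⟨x, y, z⟩ hx ⟨x', y', z'⟩ hx' heq
  have h1 : x = x' := congrArg Prod.fst heq
  have h2 : z = z' := congrArg Prod.snd heq
  have h3 : addLine x = y := hx.2.2
  have h4 : addLine x' = y' := hx'.2.2
  rw [← h3, ← h4, h1, h2]

theorem injOn_vertPair {r t : ℕ} :
    Set.InjOn (fun p : Submodule 𝒪[F] V × Submodule 𝒪[F] V => (p.1, addLine p.2))
      (VertPair h r t) := by
  rintro ⟨x, y⟩ - ⟨x', y'⟩ - heq
  obtain ⟨h1, h2⟩ := Prod.ext_iff.1 heq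
  exact Prod.ext h1 (addLine_injective h2)

/-- A lattice above `Λ♭ ⊕ ⟨u⟩` contains `u` and therefore splits off `⟨u⟩`. -/
theorem IsRamified.image_hatN (hR : IsRamified σ π) (hc : valuation F c = 1) {r t : ℕ} :
    (fun x => (x.1, x.2.2)) '' hatN h c r t = (fun p => (p.1, addLine p.2)) '' VertPair h r t := by
  refine Set.Subset.antisymm ?_ ?_
  · rintro _ ⟨⟨x, y, z⟩, ⟨hx, ⟨hy, hz, hyz⟩, hxy⟩, rfl⟩
    have hxy' : addLine x = y := hxy
    have hxz : addLine x ≤ z := hxy' ▸ hyz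
    have hu := specialVec_mem_of_addLine_le hxz
    have e : addLine (flatPart z) = z := addLine_flatPart hc hz.le_dual hu
    refine ⟨(x, flatPart z), ⟨hx, hR.flatPart_mem_vert hc hz hu, ?_⟩, Prod.ext rfl e⟩
    rw [← e, addLine_le_iff] at hxz
    exact hxz
  · rintro _ ⟨⟨x, y⟩, ⟨hx, hy, hxy⟩, rfl⟩
    exact ⟨(x, addLine x, addLine y), ⟨hx, ⟨(hR.addLine_mem_vert_iff hc).2 hx,
      (hR.addLine_mem_vert_iff hc).2 hy, addLine_mono hxy⟩, rfl⟩, rfl⟩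

variable [FiniteDimensional F V] [TopologicalSpace F] [IsNonarchimedeanLocalField F]

/-- The inverse recovers the intermediate lattice from `Λ + ⟨u⟩ = Λ₁♭ ⊕ ⟨u⟩`; since `u` is not in
`Λ`, adjoining it lowers the type `n + 1` by two. -/
theorem IsRamified.bijOn_circN (hR : IsRamified σ π) (hs : h.IsSymm) (hnd : h.Nondegenerate)
    (hσc : σ c = c) (hc : valuation F c = 1) {r t : ℕ} (hr : r + 1 = Module.finrank F V) :
    Set.BijOn (fun x => (x.1.2, x.2)) (circN h c r t (Module.finrank F V + 1))
      (bigN h c t (Module.finrank F V + 1)) := by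
  refine ⟨?_, ?_, ?_⟩
  · rintro ⟨⟨x, y⟩, z⟩ ⟨⟨-, hy, hxy⟩, hz, hzx⟩
    exact ⟨hy, hz, hzx.trans (addLine_mono hxy)⟩
  · rintro ⟨⟨x, y⟩, z⟩ ⟨⟨hx, -, -⟩, hz, hzx⟩ ⟨⟨x', y'⟩, z'⟩ ⟨⟨hx', -, -⟩, hz', hzx'⟩ heq
    obtain rfl : y = y' := congrArg Prod.fst heq
    obtain rfl : z = z' := congrArg Prod.snd heq
    have hu := hR.specialVec_notMem hs hnd hc hz
    have hz2 : z ∈ Vert (extForm h c) (r + 1 + 1) := hr.symm ▸ hz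
    obtain rfl : x = x' := addLine_injective
      ((hR.sup_specialLine_eq hs hnd hσc hc hx hz2 hzx hu).symm.trans
        (hR.sup_specialLine_eq hs hnd hσc hc hx' hz2 hzx' hu))
    rfl
  · rintro ⟨y, z⟩ ⟨hy, hz, hzy⟩
    obtain ⟨t', ht', N, hN, hNM, he⟩ := hR.exists_addLine_eq_sup hs hnd hσc hc hy hz hzy
      (hR.specialVec_notMem hs hnd hc hz)
    obtain rfl : t' = r := by omega
    exact ⟨((N, y), z), ⟨⟨hN, hy, hNM⟩, hz, he ▸ le_sup_left⟩, rfl⟩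

theorem IsRamified.ncard_vert_addLine (hR : IsRamified σ π) (hs : h.IsSymm) (hnd : h.Nondegenerate)
    (hσc : σ c = c) (hc : valuation F c = 1) (hh : hasse (extForm h c) = 1) {r : ℕ}
    (heven : Even r) (hr : r + 1 = Module.finrank F V) {Λ₁ : Submodule 𝒪[F] V}
    (h1 : Λ₁ ∈ Vert h r) :
    {N | N ∈ Vert (extForm h c) (Module.finrank F V + 1) ∧ N ≤ addLine Λ₁}.ncard = 2 := by
  obtain ⟨N₁, N₂, hN, he⟩ := hR.exists_eq_pair_addLine hs hnd hσc hc hh heven hr h1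
  rw [he, Set.ncard_pair hN]

theorem IsRamified.ncard_circN (hR : IsRamified σ π) (hs : h.IsSymm) (hnd : h.Nondegenerate)
    (hσc : σ c = c) (hc : valuation F c = 1) (hh : hasse (extForm h c) = 1) {r t : ℕ}
    (heven : Even r) (hr : r + 1 = Module.finrank F V)
    {p : Submodule 𝒪[F] V × Submodule 𝒪[F] V} (hp : p ∈ VertPair h r t) :
    {x ∈ circN h c r t (Module.finrank F V + 1) | x.1 = p}.ncard = 2 := by
  refine Eq.trans (congrArg Set.ncard (Set.ext ?_))
    ((Set.ncard_image_of_injective _ (Prod.mk_right_injective p)).trans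
      (hR.ncard_vert_addLine hs hnd hσc hc hh heven hr hp.1))
  rintro ⟨q, N⟩
  constructor
  · rintro ⟨⟨-, hN, hNp⟩, rfl⟩
    exact ⟨N, ⟨hN, hNp⟩, rfl⟩
  · rintro ⟨N', ⟨hN, hNp⟩, heq⟩
    obtain ⟨rfl, rfl⟩ := Prod.ext_iff.1 heq
    exact ⟨⟨hp, hN, hNp⟩, rfl⟩

theorem IsRamified.ncard_bigN (hR : IsRamified σ π) (hs : h.IsSymm) (hnd : h.Nondegenerate)
    (hσc : σ c = c) (hc : valuation F c = 1) (hh : hasse (extForm h c) = 1) {r t : ℕ}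
    (heven : Even r) (hr : r + 1 = Module.finrank F V)
    {p : Submodule 𝒪[F] V × Submodule 𝒪[F] V} (hp : p ∈ VertPair h r t) :
    {x ∈ bigN h c t (Module.finrank F V + 1) |
      x.1 = p.2 ∧ x.2 ⊔ specialLine F V = addLine p.1}.ncard = 2 := by
  refine Eq.trans (congrArg Set.ncard (Set.ext ?_))
    ((Set.ncard_image_of_injective _ (Prod.mk_right_injective p.2)).trans
      (hR.ncard_vert_addLine hs hnd hσc hc hh heven hr hp.1))
  rintro ⟨q, N⟩
  constructor
  · rintro ⟨⟨-, hN, -⟩, hq, hNp⟩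
    exact ⟨N, ⟨hN, le_sup_left.trans hNp.le⟩, Prod.ext hq.symm rfl⟩
  · rintro ⟨N', ⟨hN, hNp⟩, heq⟩
    obtain ⟨rfl, rfl⟩ := Prod.ext_iff.1 heq
    exact ⟨⟨hp.2.1, hN, hNp.trans (addLine_mono hp.2.2)⟩, rfl,
      hR.sup_specialLine_eq hs hnd hσc hc hp.1 (hr.symm ▸ hN : N' ∈ Vert (extForm h c) (r + 1 + 1))
        hNp (hR.specialVec_notMem hs hnd hc hN)⟩

end Correspondences

/-! ### Orbital integrals of Hecke functions -/

section HeckeComparison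

variable {F : Type*} [Field F] [ValuativeRel F] [TopologicalSpace F] [IsNonarchimedeanLocalField F]
  {σ : F →+* F} {π : F}
  {V : Type*} [AddCommGroup V] [Module F V] {h : V →ₛₗ[σ] V →ₗ[F] F} {c : F}

theorem isBoundedSet_support_ind {L : Submodule 𝒪[F] V} (hL : L.IsLattice F) :
    IsBoundedSet (Function.support (ind (stab h L : Set (unitaryGroup h)))) :=
  (isBoundedSet_stab hL).mono fun _ hx => by
    by_contra hx'
    exact hx (ind_apply_of_notMem hx')

theorem ind_subgroup_mul_left {G : Type*} [Group G] {K : Subgroup G} {a : G} (ha : a ∈ K) (x : G) :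
    ind (K : Set G) (a * x) = ind (K : Set G) x :=
  ind_congr (K.mul_mem_cancel_left ha)

theorem ind_subgroup_mul_right {G : Type*} [Group G] {K : Subgroup G} {a : G} (ha : a ∈ K) (x : G) :
    ind (K : Set G) (x * a) = ind (K : Set G) x :=
  ind_congr (K.mul_mem_cancel_right ha)

variable [FiniteDimensional F V]

theorem IsRamified.isGood_stab (hR : IsRamified σ π) (hs : h.IsSymm) (hnd : h.Nondegenerate)
    {L : Submodule 𝒪[F] V} (hL : L.IsLattice F) (μ : Measure (unitaryGroup h)) [μ.IsHaarMeasure] :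
    IsGood μ (stab h L) :=
  hR.isGood_of_isOpen hs hnd hL (hR.isOpen_stab hs hnd hL) le_rfl μ

theorem IsRamified.finite_quotient_stab (hR : IsRamified σ π) (hs : h.IsSymm)
    (hnd : h.Nondegenerate) {L L' : Submodule 𝒪[F] V} (hL : L.IsLattice F) (hL' : L'.IsLattice F)
    (μ : Measure (unitaryGroup h)) [μ.IsHaarMeasure] :
    Finite (stab h L ⧸ (stab h L').subgroupOf (stab h L)) := by
  have hD := hR.isGood_of_isOpen hs hnd hL (K := stab h L ⊓ stab h L')
    ((hR.isOpen_stab hs hnd hL).inter (hR.isOpen_stab hs hnd hL')) inf_le_left μ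
  have := (hR.isGood_stab hs hnd hL μ).finite_quotient hD inf_le_left
  rwa [Subgroup.inf_subgroupOf_left] at this

variable {μ : Measure (unitaryGroup h)} [μ.IsHaarMeasure] {ν : Measure (unitaryGroup (extForm h c))}
  [ν.IsHaarMeasure]

/-- Moving the averaging over `A` into the second factor, which is a characteristic function. -/
theorem IsRamified.sameOrb_hecke_right (hR : IsRamified σ π) (hs : h.IsSymm)
    (hnd : h.Nondegenerate) (hσc : σ c = c) (hc0 : c ≠ 0) {L : Submodule 𝒪[F] V}
    (hL : L.IsLattice F) {A : Subgroup (unitaryGroup h)} (hA : IsOpen (A : Set (unitaryGroup h)))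
    (hAL : A ≤ stab h L) {A' : Subgroup (unitaryGroup (extForm h c))}
    {Λ : Submodule 𝒪[F] (V × F)} (hΛ : Λ.IsLattice F)
    (hAB : (A' : Set (unitaryGroup (extForm h c))) *
        (stab (extForm h c) Λ : Set (unitaryGroup (extForm h c))) =
      (A.map (embed h c) : Set (unitaryGroup (extForm h c))) *
        (stab (extForm h c) Λ : Set (unitaryGroup (extForm h c)))) :
    SameOrb h c μ
      ((vol μ (A ⊓ (stab (extForm h c) Λ).comap (embed h c)) ^ 2)⁻¹ •
        tensor (ind (stab h L : Set (unitaryGroup h)))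
          (ind (stab (extForm h c) Λ : Set (unitaryGroup (extForm h c)))))
      ((vol μ A ^ 2)⁻¹ • tensor (ind (stab h L : Set (unitaryGroup h)))
        (hecke ν A' (stab (extForm h c) Λ))) := by
  have hse := extForm_isSymm hs hR.invol hσc
  have hnde := extForm_nondegenerate hs hnd hR.invol hσc hc0
  exact hR.sameOrb_of_isReps hs hnd hσc hc0 hL hA hAL (hR.isOpen_stab hse hnde hΛ) hAB
    (isBoundedSet_support_ind hΛ) (fun b hb y => ind_subgroup_mul_left hb y)
    (fun b hb y => ind_subgroup_mul_right hb y)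
    (fun T hT y => hecke_apply (hR.isGood_stab hse hnde hΛ ν) hT y)

/-- Moving the averaging over `A` into the second factor, which is a Hecke function. -/
theorem IsRamified.sameOrb_hecke₃ (hR : IsRamified σ π) (hs : h.IsSymm)
    (hnd : h.Nondegenerate) (hσc : σ c = c) (hc0 : c ≠ 0) {L : Submodule 𝒪[F] V}
    (hL : L.IsLattice F) {A' : Subgroup (unitaryGroup (extForm h c))}
    {Λ Λt : Submodule 𝒪[F] (V × F)} (hΛ : Λ.IsLattice F) (hΛt : Λt.IsLattice F)
    (hAB : (A' : Set (unitaryGroup (extForm h c))) *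
        (stab (extForm h c) Λ : Set (unitaryGroup (extForm h c))) =
      ((stab h L).map (embed h c) : Set (unitaryGroup (extForm h c))) *
        (stab (extForm h c) Λ : Set (unitaryGroup (extForm h c)))) :
    SameOrb h c μ
      ((vol μ (stab h L ⊓ (stab (extForm h c) Λ).comap (embed h c)) ^ 2)⁻¹ •
        tensor (ind (stab h L : Set (unitaryGroup h)))
          (hecke ν (stab (extForm h c) Λ) (stab (extForm h c) Λt)))
      ((vol μ (stab h L) ^ 2)⁻¹ • tensor (ind (stab h L : Set (unitaryGroup h)))
        (hecke₃ ν A' (stab (extForm h c) Λ) (stab (extForm h c) Λt))) := by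
  have hse := extForm_isSymm hs hR.invol hσc
  have hnde := extForm_nondegenerate hs hnd hR.invol hσc hc0
  have hB := hR.isGood_stab hse hnde hΛ ν
  have hC := hR.isGood_stab hse hnde hΛt ν
  have := hR.finite_quotient_stab hse hnde hΛ hΛt ν
  obtain ⟨S, -, hS⟩ := exists_isReps (stab (extForm h c) Λ) (stab (extForm h c) Λt)
  exact hR.sameOrb_of_isReps hs hnd hσc hc0 hL (hR.isOpen_stab hs hnd hL) le_rfl
    (hR.isOpen_stab hse hnde hΛ) hAB (isBoundedSet_support_hecke hC hΛt le_rfl)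
    (fun b hb y => hecke_mul_left hC hb y) (fun b hb y => hecke_mul_right hC hb y)
    (fun T hT y => hecke₃_apply hB hC hT hS y)

/-- Moving the averaging into the first factor, the second one being a characteristic function. -/
theorem IsRamified.sameOrb_hecke_left_ind (hR : IsRamified σ π) (hs : h.IsSymm)
    (hnd : h.Nondegenerate) (hσc : σ c = c) (hc0 : c ≠ 0) {L L' : Submodule 𝒪[F] V}
    (hL : L.IsLattice F) (hL' : L'.IsLattice F) :
    SameOrb h c μ
      ((vol μ (stab h L ⊓ stab h L') ^ 2)⁻¹ • tensor (ind (stab h L : Set (unitaryGroup h)))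
        (ind (stab (extForm h c) (addLine L') : Set (unitaryGroup (extForm h c)))))
      ((vol μ (stab h L') ^ 2)⁻¹ • tensor (hecke μ (stab h L') (stab h L))
        (ind (stab (extForm h c) (addLine L') : Set (unitaryGroup (extForm h c))))) :=
  hR.sameOrb_hecke_left hs hnd hσc hc0 hL hL'
    (isBoundedSet_support_ind (addLine_isLattice_iff.2 hL'))
    (fun _ hd y => ind_subgroup_mul_left (embed_mem_stab_addLine.2 hd) y)
    (fun _ hd y => ind_subgroup_mul_right (embed_mem_stab_addLine.2 hd) y)

/-- Moving the averaging into the first factor, the second one being a Hecke function. -/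
theorem IsRamified.sameOrb_hecke_left_hecke (hR : IsRamified σ π) (hs : h.IsSymm)
    (hnd : h.Nondegenerate) (hσc : σ c = c) (hc0 : c ≠ 0) {L L' : Submodule 𝒪[F] V}
    (hL : L.IsLattice F) (hL' : L'.IsLattice F) {Λ : Submodule 𝒪[F] (V × F)} (hΛ : Λ.IsLattice F) :
    SameOrb h c μ
      ((vol μ (stab h L ⊓ stab h L') ^ 2)⁻¹ • tensor (ind (stab h L : Set (unitaryGroup h)))
        (hecke ν (stab (extForm h c) (addLine L')) (stab (extForm h c) Λ)))
      ((vol μ (stab h L') ^ 2)⁻¹ • tensor (hecke μ (stab h L') (stab h L))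
        (hecke ν (stab (extForm h c) (addLine L')) (stab (extForm h c) Λ))) := by
  have hse := extForm_isSymm hs hR.invol hσc
  have hnde := extForm_nondegenerate hs hnd hR.invol hσc hc0
  have hC := hR.isGood_stab hse hnde hΛ ν
  have := hR.finite_quotient_stab hse hnde (addLine_isLattice_iff.2 hL') hΛ ν
  exact hR.sameOrb_hecke_left hs hnd hσc hc0 hL hL' (isBoundedSet_support_hecke hC hΛ le_rfl)
    (fun _ hd y => hecke_mul_left hC (embed_mem_stab_addLine.2 hd) y)
    (fun _ hd y => hecke_mul_right hC (embed_mem_stab_addLine.2 hd) y)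

end HeckeComparison

/-! ### The four families of types -/

theorem mainTheorem12
    {F₀ F : Type*}
    [Field F₀] [ValuativeRel F₀] [TopologicalSpace F₀] [IsNonarchimedeanLocalField F₀] [CharZero F₀]
    [Field F] [ValuativeRel F] [TopologicalSpace F] [IsNonarchimedeanLocalField F]
    (h2 : (2 : 𝓀[F₀]) ≠ 0)
    -- `F / F₀` is a ramified quadratic extension with uniformizers `π ^ 2 = π₀`
    [Algebra F₀ F] [ValuativeExtension F₀ F] (hquad : Module.finrank F₀ F = 2)
    (π₀ : 𝒪[F₀]) (hπ₀ : Irreducible π₀) (π : 𝒪[F]) (hπ : Irreducible π)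
    (hππ₀ : (π : F) ^ 2 = algebraMap F₀ F (π₀ : F₀))
    (σ : F ≃ₐ[F₀] F) (hσ : σ ≠ AlgEquiv.refl)
    -- `V` is the hermitian space of dimension `n`
    {V : Type*} [AddCommGroup V] [Module F V] [FiniteDimensional F V]
    (n : ℕ) (hn : 1 ≤ n) (hV : Module.finrank F V = n)
    (h : V →ₛₗ[(σ : F →+* F)] V →ₗ[F] F) (hsymm : h.IsSymm) (hnd : h.Nondegenerate)
    -- `c = h(u, u)` is a unit
    (ζ : 𝒪[F₀]ˣ) (c : F) (hc : c = algebraMap F₀ F ((ζ : 𝒪[F₀]) : F₀))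
    (μ : Measure (unitaryGroup h)) [μ.IsHaarMeasure]
    (ν : Measure (unitaryGroup (extForm h c))) [ν.IsHaarMeasure] :
    -- types `(r, t)` with `r = n` for even `n`, and `r = n - 1` for odd `n`
    (∀ r t : ℕ, Even r → (r = n ∨ r + 1 = n) → Even t → t ≤ r →
      (Set.InjOn (fun x => (x.1, x.2.2)) (hatN h c r t) ∧
        Set.InjOn (fun p => (p.1, addLine p.2)) (VertPair h r t) ∧
        (fun x => (x.1, x.2.2)) '' hatN h c r t =
          (fun p => (p.1, addLine p.2)) '' VertPair h r t) ∧
      ∀ Λ₀ ∈ Vert h r, ∀ Λ ∈ Vert (extForm h c) t, addLine Λ₀ ≤ Λ →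
        ((stab (extForm h c) (addLine Λ₀) : Set (unitaryGroup (extForm h c))) *
            (stab (extForm h c) Λ : Set (unitaryGroup (extForm h c))) =
          ((stab h Λ₀).map (embed h c) : Set (unitaryGroup (extForm h c))) *
            (stab (extForm h c) Λ : Set (unitaryGroup (extForm h c)))) ∧
        SameOrb h c μ
          ((vol μ (stab h Λ₀ ⊓ stab h (flatPart Λ)) ^ 2)⁻¹ •
            tensor (ind (stab h Λ₀ : Set (unitaryGroup h)))
              (ind (stab (extForm h c) Λ : Set (unitaryGroup (extForm h c)))))
          ((vol μ (stab h (flatPart Λ)) ^ 2)⁻¹ •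
            tensor (hecke μ (stab h (flatPart Λ)) (stab h Λ₀))
              (ind (stab (extForm h c) Λ : Set (unitaryGroup (extForm h c))))) ∧
        SameOrb h c μ
          ((vol μ (stab h (flatPart Λ)) ^ 2)⁻¹ •
            tensor (hecke μ (stab h (flatPart Λ)) (stab h Λ₀))
              (ind (stab (extForm h c) Λ : Set (unitaryGroup (extForm h c)))))
          ((vol μ (stab h Λ₀) ^ 2)⁻¹ •
            tensor (ind (stab h Λ₀ : Set (unitaryGroup h)))
              (hecke ν (stab (extForm h c) (addLine Λ₀)) (stab (extForm h c) Λ)))) ∧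
    -- types `(n - 1, n + 1, t)`, where `n` is odd and `V ⊕ F u` is split
    (∀ r : ℕ, Even r → r + 1 = n → hasse (extForm h c) = 1 →
      ∀ Λ₀ ∈ Vert h r, ∀ Λ ∈ Vert (extForm h c) (n + 1), Λ ≤ addLine Λ₀ →
        (∃ χ : stab (extForm h c) (addLine Λ₀) →* rootsOfUnity 2 𝓀[F],
          Function.Surjective χ ∧
          χ.ker = (stab (extForm h c) Λ).subgroupOf (stab (extForm h c) (addLine Λ₀)) ∧
          Function.Surjective (χ.comp (stabEmbed h c Λ₀)) ∧
          (χ.comp (stabEmbed h c Λ₀)).ker = (stabDet h Λ₀).subgroupOf (stab h Λ₀)) ∧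
        (((stab h Λ₀).map (embed h c) : Set (unitaryGroup (extForm h c))) *
            (stab (extForm h c) Λ : Set (unitaryGroup (extForm h c))) =
          (stab (extForm h c) (addLine Λ₀) : Set (unitaryGroup (extForm h c))) *
            (stab (extForm h c) Λ : Set (unitaryGroup (extForm h c)))) ∧
        ∀ t : ℕ, Even t → t ≤ n + 1 → ∀ Λt ∈ Vert (extForm h c) t, Λ ≤ Λt →
          SameOrb h c μ
            ((vol μ (stabDet h Λ₀) ^ 2)⁻¹ •
              tensor (ind (stab h Λ₀ : Set (unitaryGroup h)))
                (hecke ν (stab (extForm h c) Λ) (stab (extForm h c) Λt)))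
            ((vol μ (stab h Λ₀) ^ 2)⁻¹ •
              tensor (ind (stab h Λ₀ : Set (unitaryGroup h)))
                (hecke₃ ν (stab (extForm h c) (addLine Λ₀)) (stab (extForm h c) Λ)
                  (stab (extForm h c) Λt)))) ∧
    -- types `(t, n)`, where `n` is even
    (∀ t : ℕ, Even n → Even t → t ≤ n →
      ∀ Λ' ∈ Vert h t, ∀ Λ ∈ Vert (extForm h c) n, Λ ≤ addLine Λ' →
        (t + 2 ≤ n →
          numDoubleCosets ((stab h Λ').map (embed h c)) (stab (extForm h c) (addLine Λ'))
            (stab (extForm h c) (addLine Λ') ⊓ stab (extForm h c) Λ) =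
              if hasse h = 1 then 2 else 1) ∧
        (hasse h = 1 → ∀ Λ₁ ∈ Vert h n, Λ₁ ≤ Λ' → Λ = addLine Λ₁ →
          SameOrb h c μ
            ((vol μ (stab h Λ₁) ^ 2)⁻¹ •
              tensor (hecke μ (stab h Λ₁) (stab h Λ'))
                (ind (stab (extForm h c) Λ : Set (unitaryGroup (extForm h c)))))
            ((vol μ (stab h Λ₁ ⊓ stab h Λ') ^ 2)⁻¹ •
              tensor (ind (stab h Λ' : Set (unitaryGroup h)))
                (ind (stab (extForm h c) Λ : Set (unitaryGroup (extForm h c)))))) ∧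
        (hasse h = -1 →
          SameOrb h c μ
            ((vol μ (stab h Λ') ^ 2)⁻¹ •
              tensor (ind (stab h Λ' : Set (unitaryGroup h)))
                (hecke ν (stab (extForm h c) (addLine Λ')) (stab (extForm h c) Λ)))
            ((vol μ (stab h Λ' ⊓ (stab (extForm h c) Λ).comap (embed h c)) ^ 2)⁻¹ •
              tensor (ind (stab h Λ' : Set (unitaryGroup h)))
                (ind (stab (extForm h c) Λ : Set (unitaryGroup (extForm h c))))))) ∧
    -- types `(t, n + 1)`, where `n` is odd and `V ⊕ F u` is split
    (∀ r t : ℕ, Even r → r + 1 = n → hasse (extForm h c) = 1 → Even t → t ≤ r →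
      (Set.BijOn (fun x => (x.1.2, x.2)) (circN h c r t (n + 1)) (bigN h c t (n + 1)) ∧
        (∀ p ∈ VertPair h r t, {x ∈ circN h c r t (n + 1) | x.1 = p}.ncard = 2) ∧
        ∀ p ∈ VertPair h r t,
          {x ∈ bigN h c t (n + 1) |
            x.1 = p.2 ∧ x.2 ⊔ specialLine F V = addLine p.1}.ncard = 2) ∧
      ∀ Λ' ∈ Vert h t, ∀ Λ ∈ Vert (extForm h c) (n + 1), Λ ≤ addLine Λ' →
        (numDoubleCosets ((stab h Λ').map (embed h c)) (stab (extForm h c) (addLine Λ'))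
            (stab (extForm h c) (addLine Λ') ⊓ stab (extForm h c) Λ) = 1 ∧
          numDoubleCosets ((stabDet h Λ').map (embed h c)) (stab (extForm h c) (addLine Λ'))
            (stab (extForm h c) (addLine Λ') ⊓ stab (extForm h c) Λ) = 2) ∧
        ∀ Λ₁ ∈ Vert h r, Λ₁ ≤ Λ' → Λ ≤ addLine Λ₁ →
          SameOrb h c μ
            ((vol μ (stabDet h Λ₁ ⊓ stab h Λ') ^ 2)⁻¹ •
              tensor (ind (stab h Λ' : Set (unitaryGroup h)))
                (ind (stab (extForm h c) Λ : Set (unitaryGroup (extForm h c)))))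
            ((vol μ (stab h Λ') ^ 2)⁻¹ •
              tensor (ind (stab h Λ' : Set (unitaryGroup h)))
                (hecke ν (stab (extForm h c) (addLine Λ')) (stab (extForm h c) Λ))) ∧
          SameOrb h c μ
            ((vol μ (stab h Λ') ^ 2)⁻¹ •
              tensor (ind (stab h Λ' : Set (unitaryGroup h)))
                (hecke ν (stab (extForm h c) (addLine Λ')) (stab (extForm h c) Λ)))
            ((vol μ (stab h Λ₁) ^ 2)⁻¹ •
              tensor (hecke μ (stab h Λ₁) (stab h Λ'))
                (hecke ν (stab (extForm h c) (addLine Λ₁)) (stab (extForm h c) Λ)))) := by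
  subst hV
  have hR := isRamified_of_quadratic h2 hquad hπ₀ hπ hππ₀ hσ
  have hσc : (σ : F →+* F) c = c := by
    rw [hc]
    exact σ.commutes _
  have hcu : valuation F c = 1 := by
    rw [hc, ← map_one (valuation F), ← map_one (algebraMap F₀ F), valuation_algebraMap_eq_iff,
      valuation_unit, map_one]
  have hc0 : c ≠ 0 := fun h0 => by simp [h0] at hcu
  refine ⟨fun r t hr hrn ht htr => ⟨⟨injOn_hatN, injOn_vertPair, hR.image_hatN hcu⟩,
      fun Λ₀ h0 Λ hΛ hle => ?_⟩,
    fun r hr hrn hh Λ₀ h0 Λ hΛ hle => ?_,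
    fun t hn2 ht htn Λ' h' Λ hΛ hle => ⟨fun htn2 => ?_, fun hh Λ₁ h1 hle1 hΛ1 => ?_, fun hh => ?_⟩,
    fun r t hr hrn hh ht htr => ⟨⟨hR.bijOn_circN hsymm hnd hσc hcu hrn,
      fun p hp => hR.ncard_circN hsymm hnd hσc hcu hh hr hrn hp,
      fun p hp => hR.ncard_bigN hsymm hnd hσc hcu hh hr hrn hp⟩,
      fun Λ' h' Λ hΛ hle => ⟨⟨?_, ?_⟩, fun Λ₁ h1 hle1 hle' => ?_⟩⟩⟩
  -- Since `u` is in `Λ`, the lattice splits as `flatPart Λ ⊕ ⟨u⟩`, so the averagings in the left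
  -- and in the right factor start from the same function with the same volume.
  · have hu := specialVec_mem_of_addLine_le hle
    have he := addLine_flatPart hcu hΛ.le_dual hu
    have hf := hR.flatPart_mem_vert hcu hΛ hu
    have hmul := hR.stab_mul_stab_eq_of_addLine_le hsymm hσc hcu h0 hΛ hle
    have H := hR.sameOrb_hecke_left_ind (μ := μ) hsymm hnd hσc hc0 h0.isLattice hf.isLattice
    have H' := hR.sameOrb_hecke_right (μ := μ) (ν := ν) hsymm hnd hσc hc0 h0.isLattice
      (hR.isOpen_stab hsymm hnd h0.isLattice) le_rfl hΛ.isLattice hmul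
    have hcomap : (stab (extForm h c) Λ).comap (embed h c) = stab h (flatPart Λ) := by
      conv_lhs => rw [← he]
      exact comap_embed_stab_addLine _
    rw [he] at H
    rw [hcomap] at H'
    exact ⟨hmul, H, sameOrb_trans (sameOrb_symm H) H'⟩
  · have hmul := hR.stab_mul_stab_eq_of_notMem hsymm hnd hσc hcu h0 hΛ hle fun N hN =>
      hR.specialVec_notMem hsymm hnd hcu hN
    refine ⟨hR.exists_character hsymm hnd hσc hcu hh hr hrn h0 hΛ hle, hmul.symm,
      fun t ht htn Λt hΛt hle' => ?_⟩
    have H := hR.sameOrb_hecke₃ (μ := μ) (ν := ν) hsymm hnd hσc hc0 h0.isLattice hΛ.isLattice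
      hΛt.isLattice hmul
    -- The part of `stab Λ₀` that stabilizes `Λ` is the kernel of `det mod π`, which is why its
    -- volume appears.
    rwa [hR.comap_embed_stab hsymm hnd hσc hcu hh hr hrn h0 hΛ hle,
      inf_eq_right.2 fun a (ha : a ∈ stabDet h Λ₀) => ha.1] at H
  · exact hR.numDoubleCosets_of_even hsymm hnd hσc hcu hn2 (by omega) h' hΛ hle
  · subst hΛ1
    have H := hR.sameOrb_hecke_left_ind (μ := μ) hsymm hnd hσc hc0 h'.isLattice h1.isLattice
    rw [inf_comm] at H
    exact sameOrb_symm H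
  · have hmul := hR.stab_mul_stab_eq_of_notMem hsymm hnd hσc hcu h' hΛ hle fun N hN =>
      hR.specialVec_notMem_of_hasse hsymm hnd hcu hn2 hh hN
    exact sameOrb_symm (hR.sameOrb_hecke_right hsymm hnd hσc hc0 h'.isLattice
      (hR.isOpen_stab hsymm hnd h'.isLattice) le_rfl hΛ.isLattice hmul)
  · exact hR.numDoubleCosets_eq_one hsymm hnd hσc hcu h' hΛ hle fun N hN =>
      hR.specialVec_notMem hsymm hnd hcu hN
  · exact hR.numDoubleCosets_stabDet hsymm hnd hσc hcu (by omega) h' hΛ hle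
  · have hmul := hR.stab_mul_stab_eq_of_notMem hsymm hnd hσc hcu h' hΛ hle fun N hN =>
      hR.specialVec_notMem hsymm hnd hcu hN
    have hcomap := hR.comap_embed_stab hsymm hnd hσc hcu hh hr hrn h1 hΛ hle'
    have H := hR.sameOrb_hecke_right (μ := μ) (ν := ν) hsymm hnd hσc hc0 h'.isLattice
      (hR.isOpen_stab hsymm hnd h'.isLattice) le_rfl hΛ.isLattice hmul
    -- The same initial function is averaged over the smaller group `stab Λ' ⊓ stab Λ₁`, which
    -- produces the Hecke function for `Λ₁` in the second factor. `H''` then averages over `stab Λ₁`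
    -- in the first factor.
    have H' := hR.sameOrb_hecke_right (μ := μ) (ν := ν) hsymm hnd hσc hc0 h'.isLattice
      (A := stab h Λ' ⊓ stab h Λ₁) ((hR.isOpen_stab hsymm hnd h'.isLattice).inter
        (hR.isOpen_stab hsymm hnd h1.isLattice)) inf_le_left hΛ.isLattice
      (hR.stab_mul_stab_eq_of_inf hsymm hnd hσc hcu hh hr hrn h1 h' hle1 hΛ hle')
    have H'' := hR.sameOrb_hecke_left_hecke (μ := μ) (ν := ν) hsymm hnd hσc hc0 h'.isLattice
      h1.isLattice hΛ.isLattice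
    rw [hcomap, inf_comm] at H
    have hdet : stab h Λ₁ ⊓ stabDet h Λ₁ = stabDet h Λ₁ :=
      inf_eq_right.2 fun a (ha : a ∈ stabDet h Λ₁) => ha.1
    rw [hcomap, inf_assoc, hdet, inf_comm] at H'
    exact ⟨H, sameOrb_trans (sameOrb_symm H) (sameOrb_trans H' H'')⟩
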